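/- **Setting.** Let $n\ge 1$, let $A^{(1)},\dots,A^{(m)},C$ be symmetric $n\times n$ real matrices with $A^{(1)},\dots,A^{(m)}$ linearly independent, let $b\in\mathbb R^m$, write $U\bullet V=\operatorname{tr}(UV)$, and consider the pair $$\inf_X\{C\bullet X: A^{(i)}\bullet X=b_i\ (1\le i\le m),\ X\succeq0\},\qquad \sup_{y,S}\{b^\top y:\textstyle\sum_i y_iA^{(i)}+S=C,\ S\succeq0\}.$$ A triple $(X,y,S)$ is *$\varepsilon$-optimal* if it is primal and dual feasible and $\nu(X,S):=X\bullet S/n\le\varepsilon$. For $\gamma\in(0,1)$ let $\mathcal N_F(\gamma)$ be the set of feasible $(X,y,S)$ with $X,S\succ0$ and $\|X^{1/2}SX^{1/2}-\nu I\|_F\le\gamma\nu$, $\nu=\nu(X,S)$. Let $\mathbf{svec}$ stack the lower triangle of a symmetric matrix with off-diagonal entries multiplied by $\sqrt2$, let $\otimes_s$ be the symmetric Kronecker product, let $\mathcal A_s$ have rows $\mathbf{svec}(A^{(i)})^\top$, and let the columns of $Q$ form a basis of the null space of $\mathcal A_s$. For a nonsingular $P$ and $\sigma\in(0,1)$ put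 $H_P(M)=\tfrac12(PMP^{-1}+P^{-\top}M^\top P^\top)$ and $$M_P=\begin{bmatrix}(P\otimes_sP^{-\top}S)\,Q & -(PX\otimes_sP^{-\top})\mathcal A_s^\top\end{bmatrix},\qquad R_P=\mathbf{svec}(\sigma\nu I-H_P(XS)),$$ so that $M_P(\Delta z,\Delta y)=R_P$ is the Newton system in nullspace representation. The Nesterov–Todd (NT) choice is $P=W^{-1/2}$, $W=S^{-1/2}(S^{1/2}XS^{1/2})^{1/2}S^{-1/2}$; write $M_{NT},R_{NT}$ for it. Computations are carried out on a real random access machine: each operation $+,-,\times,/,\sqrt{\ }$, assignment, comparison and loop pass costs one unit. The problem data, a null space basis $Q$, an initial point and the parameters are given in memory; the one-time computation of $Q$ is preprocessing and is not counted. Let $\gamma,\delta,\beta\in(0,1)$ satisfy $$\frac{2\sqrt2\,\gamma}{1-\gamma}\le1,\qquad \beta\le1-\frac{\gamma}{\sqrt n}-\frac{21.7(\gamma^2+\delta^2)}{(2+\sqrt2)(1-\delta/\sqrt n)\gamma(1-\gamma)},$$ and put $\sigma=1-\delta/\sqrt n$. **Statement (semidefinite optimization).** There are one program (the same for all problems and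 parameters), of the form "initialize; while $\nu>\varepsilon$ do one iteration", and a natural number $c$ such that for all constants $\gamma,\delta,\beta\in(0,1)$ and $\nu_{\max}$ there is a constant $B>0$ with the following property. For every problem of size $n$ for which the above conditions on $\gamma,\delta,\beta$ hold, every basis $Q$, every $\varepsilon>0$ and every initial point $(X_0,y_0,S_0)\in\mathcal N_F(\gamma)$ with $\nu(X_0,S_0)\le\nu_{\max}$, the program halts after finitely many iterations and the triples $(X_k,y_k,S_k)$ held in memory before and after the iterations satisfy: 1. every $(X_k,y_k,S_k)$ lies in $\mathcal N_F(\gamma)$, the first one is the initial point, and the last one is $\varepsilon$-optimal; 2. iteration $k$ is an inexact NT step: there is $u=(\Delta z,\Delta y)$ with $\|M_{NT}u-R_{NT}\|_2\le\beta\|R_{NT}\|_2$ at $(X_k,y_k,S_k)$, and $X_{k+1}=X_k+\Delta X$, $y_{k+1}=y_k+\Delta y$, $S_{k+1}=S_k+\Delta S$, where $\mathbf{svec}(\Delta X)=Q\Delta z$ and $\mathbf{svec}(\Delta S)=-\mathcal A_s^\top\Delta y$; 3. the system is solved by a polynomial approximation of the inverse: $u=q_k(M_{P'}^\top M_{P'})M_{P'}^\top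 R_{P'}$ for a real polynomial $q_k$ and a scaling matrix $P'$ with $\|P'WP'^\top-I\|_F\le\beta$ (the NT scaling up to an orthogonal factor and an approximation error); 4. if $\kappa\ge1$ is an upper bound on the condition numbers $\sigma_{\max}/\sigma_{\min}$ of the matrices $M_{NT}$ at all iterates at which an iteration is performed, then the total number of operations is at most $$B\,n^{4.5}\,\kappa\,\bigl(\log(2+\kappa)\log(2+1/\varepsilon)\bigr)^c,$$ that is $O\bigl(n^{4.5}\kappa\,\mathrm{polylog}(\kappa,1/\varepsilon)\bigr)$, and $\deg q_k\le B\,\kappa\,(\log(2+\kappa)\log(2+1/\varepsilon))^c$ for all $k$. **Statement (linear optimization).** The same holds for the pair $\min\{c^\top x:Ax=b,\ x\ge0\}$, $\max\{b^\top y:A^\top y+s=c,\ s\ge0\}$ with $A\in\mathbb R^{m\times n}$ of full row rank, where $\nu=x^\top s/n$, the neighborhood is given by $x,s>0$, feasibility and $\|x\circ s-\nu e\|_2\le\gamma\nu$, $Q$ is a basis of the null space of $A$, the Newton system is $[\operatorname{diag}(s)Q\ \ -\operatorname{diag}(x)A^\top](\Delta z,\Delta y)=\sigma\nu e-x\circ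 s$, the steps are $\Delta x=Q\Delta z$, $\Delta s=-A^\top\Delta y$, item 3 holds with this system itself, $\kappa$ bounds the condition numbers of these matrices, and the total number of operations is at most $B\,n^{2.5}\,\kappa\,(\log(2+\kappa)\log(2+1/\varepsilon))^c$. -/

import Mathlib

open Matrix Polynomial
open scoped MatrixOrder Kronecker

noncomputable section

namespace IFIPM

/-! ### Norms and condition numbers -/

/-- Euclidean norm of a real vector. -/
def vnorm {ι : Type*} [Fintype ι] (v : ι → ℝ) : ℝ := Real.sqrt (∑ i, v i ^ 2)

/-- Frobenius norm of a real matrix. -/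
def frob {ι κ : Type*} [Fintype ι] [Fintype κ] (M : Matrix ι κ ℝ) : ℝ :=
  Real.sqrt (∑ i, ∑ j, M i j ^ 2)

/-- Largest singular value. -/
def sigmaMax {ι κ : Type*} [Fintype ι] [Fintype κ] (M : Matrix ι κ ℝ) : ℝ :=
  sSup {r : ℝ | ∃ u : κ → ℝ, vnorm u = 1 ∧ r = vnorm (M *ᵥ u)}

/-- Smallest singular value (of a matrix with at least as many rows as columns). -/
def sigmaMin {ι κ : Type*} [Fintype ι] [Fintype κ] (M : Matrix ι κ ℝ) : ℝ :=
  sInf {r : ℝ | ∃ u : κ → ℝ, vnorm u = 1 ∧ r = vnorm (M *ᵥ u)}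

/-- Condition number `σ_max / σ_min`. -/
def condNumber {ι κ : Type*} [Fintype ι] [Fintype κ] (M : Matrix ι κ ℝ) : ℝ :=
  sigmaMax M / sigmaMin M

/-- `q(MᵀM) Mᵀ v`: the approximate solution of `M u = v` produced by the polynomial `q`. -/
def polySolve {ι κ : Type*} [Fintype ι] [Fintype κ] [DecidableEq κ]
    (q : ℝ[X]) (M : Matrix ι κ ℝ) (v : ι → ℝ) : κ → ℝ :=
  (aeval (Mᵀ * M) q) *ᵥ (Mᵀ *ᵥ v)

/-! ### Symmetric vectorization and the symmetric Kronecker product -/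

/-- Positions on or below the diagonal; there are `n(n+1)/2` of them. -/
abbrev SIdx (n : ℕ) : Type := {p : Fin n × Fin n // p.2 ≤ p.1}

/-- `svec`: diagonal entries, and strictly lower triangular entries multiplied by `√2`. -/
def svec {n : ℕ} (G : Matrix (Fin n) (Fin n) ℝ) : SIdx n → ℝ := fun p =>
  if p.1.1 = p.1.2 then G p.1.1 p.1.2 else Real.sqrt 2 * G p.1.1 p.1.2

/-- `smat`: the inverse of `svec`, with values in the symmetric matrices. -/
def smat {n : ℕ} (v : SIdx n → ℝ) : Matrix (Fin n) (Fin n) ℝ := Matrix.of fun i j =>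
  if i = j then v ⟨(i, i), le_rfl⟩
  else if h : j ≤ i then v ⟨(i, j), h⟩ / Real.sqrt 2
  else v ⟨(j, i), (not_le.mp h).le⟩ / Real.sqrt 2

/-- The matrix `V` with `V vec(G) = svec(G)` for symmetric `G`, and `V Vᵀ = I`. -/
def symV (n : ℕ) : Matrix (SIdx n) (Fin n × Fin n) ℝ := Matrix.of fun p k =>
  if k = p.1 ∨ k = p.1.swap then (if p.1.1 = p.1.2 then 1 else 1 / Real.sqrt 2) else 0

/-- Symmetric Kronecker product `G ⊗ₛ K = ½ V (G ⊗ K + K ⊗ G) Vᵀ`. -/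
def symKron {n : ℕ} (G K : Matrix (Fin n) (Fin n) ℝ) : Matrix (SIdx n) (SIdx n) ℝ :=
  (1 / 2 : ℝ) • (symV n * (G ⊗ₖ K + K ⊗ₖ G) * (symV n)ᵀ)

/-- `H_P(M) = ½ (P M P⁻¹ + P⁻ᵀ Mᵀ Pᵀ)`. -/
def symmetrize {n : ℕ} (P M : Matrix (Fin n) (Fin n) ℝ) : Matrix (Fin n) (Fin n) ℝ :=
  (1 / 2 : ℝ) • (P * M * P⁻¹ + P⁻¹ᵀ * Mᵀ * Pᵀ)

/-! ### The semidefinite optimization pair -/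

/-- Data of the primal-dual pair
`inf {C • X : Aᵢ • X = bᵢ, X ⪰ 0}` and `sup {bᵀy : ∑ yᵢ Aᵢ + S = C, S ⪰ 0}`. -/
structure SDO (n m : ℕ) where
  A : Fin m → Matrix (Fin n) (Fin n) ℝ
  b : Fin m → ℝ
  C : Matrix (Fin n) (Fin n) ℝ
  A_symm : ∀ i, (A i).IsSymm
  C_symm : C.IsSymm
  A_indep : LinearIndependent ℝ A

/-- Trace inner product `U • V = tr(UV)`. -/
def inn {n : ℕ} (U V : Matrix (Fin n) (Fin n) ℝ) : ℝ := (U * V).trace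

/-- Normalized duality gap `ν = (X • S) / n`. -/
def nu {n : ℕ} (X S : Matrix (Fin n) (Fin n) ℝ) : ℝ := inn X S / n

/-- `(X, y, S)` satisfies the primal and dual equations. -/
def SDO.Equations {n m : ℕ} (D : SDO n m) (X : Matrix (Fin n) (Fin n) ℝ) (y : Fin m → ℝ)
    (S : Matrix (Fin n) (Fin n) ℝ) : Prop :=
  (∀ i, inn (D.A i) X = D.b i) ∧ ∑ i, y i • D.A i + S = D.C

/-- `ε`-optimality: exact primal and dual feasibility, and normalized duality gap at most `ε`. -/
def SDO.EpsOptimal {n m : ℕ} (D : SDO n m) (ε : ℝ) (X : Matrix (Fin n) (Fin n) ℝ)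
    (y : Fin m → ℝ) (S : Matrix (Fin n) (Fin n) ℝ) : Prop :=
  D.Equations X y S ∧ X.PosSemidef ∧ S.PosSemidef ∧ nu X S ≤ ε

/-- The narrow neighborhood `N_F(γ)` of the central path. -/
def SDO.Neighborhood {n m : ℕ} (D : SDO n m) (γ : ℝ) (X : Matrix (Fin n) (Fin n) ℝ)
    (y : Fin m → ℝ) (S : Matrix (Fin n) (Fin n) ℝ) : Prop :=
  D.Equations X y S ∧ X.PosDef ∧ S.PosDef ∧
    frob (CFC.sqrt X * S * CFC.sqrt X - nu X S • (1 : Matrix (Fin n) (Fin n) ℝ)) ≤ γ * nu X S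

/-- `𝒜ₛ`, the matrix whose rows are `svec(Aᵢ)`. -/
def SDO.As {n m : ℕ} (D : SDO n m) : Matrix (Fin m) (SIdx n) ℝ := Matrix.of fun i => svec (D.A i)

/-- The columns of `Q` form a basis of the null space of `B`. -/
def IsNullBasis {ι κ : Type*} {p : ℕ} [Fintype ι] (B : Matrix κ ι ℝ) (Q : Matrix ι (Fin p) ℝ) :
    Prop :=
  LinearIndependent ℝ Qᵀ ∧ ∀ v : ι → ℝ, B *ᵥ v = 0 ↔ ∃ z : Fin p → ℝ, v = Q *ᵥ z

/-- Nesterov-Todd scaling matrix `W = S^{-1/2} (S^{1/2} X S^{1/2})^{1/2} S^{-1/2}`. -/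
def ntW {n : ℕ} (X S : Matrix (Fin n) (Fin n) ℝ) : Matrix (Fin n) (Fin n) ℝ :=
  (CFC.sqrt S)⁻¹ * CFC.sqrt (CFC.sqrt S * X * CFC.sqrt S) * (CFC.sqrt S)⁻¹

/-- Nesterov-Todd choice `P = W^{-1/2}`. -/
def ntP {n : ℕ} (X S : Matrix (Fin n) (Fin n) ℝ) : Matrix (Fin n) (Fin n) ℝ :=
  (CFC.sqrt (ntW X S))⁻¹

/-- Coefficient matrix `[ℰₛ Q, ℱₛ (-𝒜ₛᵀ)]` of the Newton system in nullspace representation,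
where `ℰₛ = P ⊗ₛ P⁻ᵀ S` and `ℱₛ = P X ⊗ₛ P⁻ᵀ`. -/
def SDO.newtonMatrix {n m p : ℕ} (D : SDO n m) (Q : Matrix (SIdx n) (Fin p) ℝ)
    (P X S : Matrix (Fin n) (Fin n) ℝ) : Matrix (SIdx n) (Fin p ⊕ Fin m) ℝ :=
  Matrix.fromCols (symKron P (P⁻¹ᵀ * S) * Q) (symKron (P * X) P⁻¹ᵀ * (-D.Asᵀ))

/-- Right-hand side `svec(σ ν I - H_P(XS))`. -/
def newtonRhs {n : ℕ} (σ : ℝ) (P X S : Matrix (Fin n) (Fin n) ℝ) : SIdx n → ℝ :=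
  svec ((σ * nu X S) • (1 : Matrix (Fin n) (Fin n) ℝ) - symmetrize P (X * S))

/-- Coefficient matrix of the Newton system with the Nesterov-Todd direction. -/
def SDO.ntMatrix {n m p : ℕ} (D : SDO n m) (Q : Matrix (SIdx n) (Fin p) ℝ)
    (X S : Matrix (Fin n) (Fin n) ℝ) : Matrix (SIdx n) (Fin p ⊕ Fin m) ℝ :=
  D.newtonMatrix Q (ntP X S) X S

/-- One iteration of the inexact-feasible method with the Nesterov-Todd direction.
The vector `u = (Δz, Δy)` is obtained by applying the polynomial `q` to the Newton system built
with a numerically computed scaling matrix `P'` (equal to `W^{-1/2}` up to a left orthogonal factor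
and a relative error at most `β`); its residual in the exact Nesterov-Todd Newton system is at most
`β` times the norm of the right-hand side; the iterate is updated by `svec ΔX = Q Δz` and
`svec ΔS = -𝒜ₛᵀ Δy` with a full step. -/
def SDO.InexactStep {n m p : ℕ} (D : SDO n m) (Q : Matrix (SIdx n) (Fin p) ℝ) (σ β : ℝ) (q : ℝ[X])
    (X : Matrix (Fin n) (Fin n) ℝ) (y : Fin m → ℝ) (S : Matrix (Fin n) (Fin n) ℝ)
    (X' : Matrix (Fin n) (Fin n) ℝ) (y' : Fin m → ℝ) (S' : Matrix (Fin n) (Fin n) ℝ) : Prop :=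
  ∃ (P' : Matrix (Fin n) (Fin n) ℝ) (u : Fin p ⊕ Fin m → ℝ),
    frob (P' * ntW X S * P'ᵀ - 1) ≤ β ∧
    u = polySolve q (D.newtonMatrix Q P' X S) (newtonRhs σ P' X S) ∧
    vnorm (D.ntMatrix Q X S *ᵥ u - newtonRhs σ (ntP X S) X S)
      ≤ β * vnorm (newtonRhs σ (ntP X S) X S) ∧
    X' = X + smat (Q *ᵥ (fun i => u (Sum.inl i))) ∧
    y' = y + (fun i => u (Sum.inr i)) ∧
    S' = S - smat (D.Asᵀ *ᵥ (fun i => u (Sum.inr i)))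

/-! ### The linear optimization pair -/

/-- Data of `min {cᵀx : Ax = b, x ≥ 0}` and `max {bᵀy : Aᵀy + s = c, s ≥ 0}`. -/
structure LO (n m : ℕ) where
  A : Matrix (Fin m) (Fin n) ℝ
  b : Fin m → ℝ
  c : Fin n → ℝ
  A_indep : LinearIndependent ℝ A.row

/-- Normalized duality gap `xᵀs / n`. -/
def nuLO {n : ℕ} (x s : Fin n → ℝ) : ℝ := x ⬝ᵥ s / n

def LO.Equations {n m : ℕ} (L : LO n m) (x : Fin n → ℝ) (y : Fin m → ℝ) (s : Fin n → ℝ) : Prop :=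
  L.A *ᵥ x = L.b ∧ L.Aᵀ *ᵥ y + s = L.c

def LO.EpsOptimal {n m : ℕ} (L : LO n m) (ε : ℝ) (x : Fin n → ℝ) (y : Fin m → ℝ)
    (s : Fin n → ℝ) : Prop :=
  L.Equations x y s ∧ (∀ i, 0 ≤ x i) ∧ (∀ i, 0 ≤ s i) ∧ nuLO x s ≤ ε

def LO.Neighborhood {n m : ℕ} (L : LO n m) (γ : ℝ) (x : Fin n → ℝ) (y : Fin m → ℝ)
    (s : Fin n → ℝ) : Prop :=
  L.Equations x y s ∧ (∀ i, 0 < x i) ∧ (∀ i, 0 < s i) ∧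
    vnorm (fun i => x i * s i - nuLO x s) ≤ γ * nuLO x s

/-- Newton matrix `[diag(s) Q, -diag(x) Aᵀ]`. For diagonal matrices every diagonal scaling `P`
leads to this matrix, since then `P S P⁻¹ = S` and `P X P⁻¹ = X`. -/
def LO.newtonMatrix {n m p : ℕ} (L : LO n m) (Q : Matrix (Fin n) (Fin p) ℝ) (x s : Fin n → ℝ) :
    Matrix (Fin n) (Fin p ⊕ Fin m) ℝ :=
  Matrix.fromCols (Matrix.diagonal s * Q) (Matrix.diagonal x * (-L.Aᵀ))

/-- Right-hand side `σ ν e - x ∘ s`. -/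
def newtonRhsLO {n : ℕ} (σ : ℝ) (x s : Fin n → ℝ) : Fin n → ℝ := fun i => σ * nuLO x s - x i * s i

def LO.InexactStep {n m p : ℕ} (L : LO n m) (Q : Matrix (Fin n) (Fin p) ℝ) (σ β : ℝ) (q : ℝ[X])
    (x : Fin n → ℝ) (y : Fin m → ℝ) (s : Fin n → ℝ)
    (x' : Fin n → ℝ) (y' : Fin m → ℝ) (s' : Fin n → ℝ) : Prop :=
  ∃ u : Fin p ⊕ Fin m → ℝ,
    u = polySolve q (L.newtonMatrix Q x s) (newtonRhsLO σ x s) ∧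
    vnorm (L.newtonMatrix Q x s *ᵥ u - newtonRhsLO σ x s) ≤ β * vnorm (newtonRhsLO σ x s) ∧
    x' = x + Q *ᵥ (fun i => u (Sum.inl i)) ∧
    y' = y + (fun i => u (Sum.inr i)) ∧
    s' = s - L.Aᵀ *ᵥ (fun i => u (Sum.inr i))

/-! ### Machine model: a real random access machine programmed in a small imperative language

Memory consists of natural-number index variables and of real cells, organized in arrays with three
indices.  One unit of cost is charged for each arithmetic operation (`+`, `-`, `*`, `/`, `√`) on
real cells, each assignment, each comparison, and each pass through a loop. -/

/-- An index: a literal or the value of an index variable. -/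
inductive Ix : Type
  | lit (k : ℕ)
  | var (v : ℕ)

/-- A real cell: array name and three indices. -/
structure Ref : Type where
  arr : ℕ
  i : Ix
  j : Ix
  k : Ix

/-- Binary arithmetic operations. -/
inductive Op : Type
  | add | sub | mul | div

/-- Programs. -/
inductive Cmd : Type
  /-- do nothing -/
  | skip
  /-- index variable `v := i` -/
  | setVar (v : ℕ) (i : Ix)
  /-- real cell `dst := c` for a rational literal `c` -/
  | const (dst : Ref) (c : ℚ)
  /-- real cell `dst := i` for an index `i` -/
  | ofIx (dst : Ref) (i : Ix)
  /-- real cell `dst := a` -/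
  | copy (dst a : Ref)
  /-- real cell `dst := a op b` -/
  | arith (o : Op) (dst a b : Ref)
  /-- real cell `dst := √a` -/
  | sqrt (dst a : Ref)
  | seq (p q : Cmd)
  /-- branch on the comparison `a < b` of real cells -/
  | ifLt (a b : Ref) (p q : Cmd)
  /-- branch on the comparison `i < j` of indices -/
  | ifIx (i j : Ix) (p q : Cmd)
  /-- `for v = 0, …, N - 1 do p`, where `N` is the value of `bound` on entry -/
  | forLt (v : ℕ) (bound : Ix) (p : Cmd)
  /-- `while a < b do p` for real cells `a`, `b` -/
  | whileLt (a b : Ref) (p : Cmd)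

/-- Machine states. -/
structure State : Type where
  ix : ℕ → ℕ
  mem : ℕ → ℕ → ℕ → ℕ → ℝ

def State.ixVal (s : State) : Ix → ℕ
  | .lit k => k
  | .var v => s.ix v

def State.get (s : State) (r : Ref) : ℝ := s.mem r.arr (s.ixVal r.i) (s.ixVal r.j) (s.ixVal r.k)

def State.setIx (s : State) (v k : ℕ) : State := { s with ix := Function.update s.ix v k }

def State.set (s : State) (r : Ref) (x : ℝ) : State :=
  { s with mem := fun a i j k =>
      if a = r.arr ∧ i = s.ixVal r.i ∧ j = s.ixVal r.j ∧ k = s.ixVal r.k then x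
      else s.mem a i j k }

def Op.eval : Op → ℝ → ℝ → ℝ
  | .add, x, y => x + y
  | .sub, x, y => x - y
  | .mul, x, y => x * y
  | .div, x, y => x / y

/-- `Exec p s t s'`: started in state `s`, program `p` halts in state `s'` at cost `t`.
Division by zero and square roots of negative numbers do not produce a result. -/
inductive Exec : Cmd → State → ℕ → State → Prop
  | skip (s : State) : Exec .skip s 0 s
  | setVar (s : State) (v : ℕ) (i : Ix) : Exec (.setVar v i) s 1 (s.setIx v (s.ixVal i))
  | const (s : State) (d : Ref) (c : ℚ) : Exec (.const d c) s 1 (s.set d (c : ℝ))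
  | ofIx (s : State) (d : Ref) (i : Ix) : Exec (.ofIx d i) s 1 (s.set d (s.ixVal i : ℝ))
  | copy (s : State) (d a : Ref) : Exec (.copy d a) s 1 (s.set d (s.get a))
  | arith (s : State) (o : Op) (d a b : Ref) (h : o = Op.div → s.get b ≠ 0) :
      Exec (.arith o d a b) s 1 (s.set d (o.eval (s.get a) (s.get b)))
  | sqrt (s : State) (d a : Ref) (h : 0 ≤ s.get a) :
      Exec (.sqrt d a) s 1 (s.set d (Real.sqrt (s.get a)))
  | seq {p q : Cmd} {s s' s'' : State} {t t' : ℕ} (h : Exec p s t s') (h' : Exec q s' t' s'') :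
      Exec (.seq p q) s (t + t') s''
  | ifLt_true {a b : Ref} {p q : Cmd} {s s' : State} {t : ℕ} (hc : s.get a < s.get b)
      (h : Exec p s t s') : Exec (.ifLt a b p q) s (t + 1) s'
  | ifLt_false {a b : Ref} {p q : Cmd} {s s' : State} {t : ℕ} (hc : ¬ s.get a < s.get b)
      (h : Exec q s t s') : Exec (.ifLt a b p q) s (t + 1) s'
  | ifIx_true {i j : Ix} {p q : Cmd} {s s' : State} {t : ℕ} (hc : s.ixVal i < s.ixVal j)
      (h : Exec p s t s') : Exec (.ifIx i j p q) s (t + 1) s'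
  | ifIx_false {i j : Ix} {p q : Cmd} {s s' : State} {t : ℕ} (hc : ¬ s.ixVal i < s.ixVal j)
      (h : Exec q s t s') : Exec (.ifIx i j p q) s (t + 1) s'
  | forLt {v : ℕ} {bound : Ix} {p : Cmd} {s : State} (st : ℕ → State) (t : ℕ → ℕ) (h0 : st 0 = s)
      (h : ∀ k, k < s.ixVal bound → Exec p ((st k).setIx v k) (t k) (st (k + 1))) :
      Exec (.forLt v bound p) s (∑ k ∈ Finset.range (s.ixVal bound), (t k + 1) + 1)
        (st (s.ixVal bound))
  | while_true {a b : Ref} {p : Cmd} {s s' s'' : State} {t t' : ℕ} (hc : s.get a < s.get b)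
      (h : Exec p s t s') (h' : Exec (.whileLt a b p) s' t' s'') :
      Exec (.whileLt a b p) s (t + t' + 1) s''
  | while_false {a b : Ref} {p : Cmd} {s : State} (hc : ¬ s.get a < s.get b) :
      Exec (.whileLt a b p) s 1 s

/-! ### Memory layout

Index variables `0, 1, 2` hold `n`, `m`, `p` (`p` is the dimension of the null space).
Array `0` holds the scalars `ε, γ, δ, β` and, in position `4`, the current value of `ν`;
arrays `1, 2, 3` hold the iterate `X, y, S`; arrays `4, 5, 6, 7` hold `A, C, b, Q`. -/

def put1 {a : ℕ} (v : Fin a → ℝ) (i : ℕ) : ℝ := if h : i < a then v ⟨i, h⟩ else 0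

def put2 {a b : ℕ} (M : Matrix (Fin a) (Fin b) ℝ) (i j : ℕ) : ℝ :=
  if h : i < a ∧ j < b then M ⟨i, h.1⟩ ⟨j, h.2⟩ else 0

def scalars (ε γ δ β : ℝ) : ℕ → ℝ
  | 0 => ε
  | 1 => γ
  | 2 => δ
  | 3 => β
  | _ => 0

def sizes (n m p : ℕ) : ℕ → ℕ
  | 0 => n
  | 1 => m
  | 2 => p
  | _ => 0

def State.scalar (s : State) (i : ℕ) : ℝ := s.mem 0 i 0 0
def State.vec (s : State) (arr a : ℕ) : Fin a → ℝ := fun i => s.mem arr i 0 0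
def State.mat (s : State) (arr a b : ℕ) : Matrix (Fin a) (Fin b) ℝ := Matrix.of fun i j =>
  s.mem arr i j 0

/-- The cells holding `ε` and `ν`. -/
def epsRef : Ref := ⟨0, .lit 0, .lit 0, .lit 0⟩
def nuRef : Ref := ⟨0, .lit 4, .lit 0, .lit 0⟩

/-- Input state for a semidefinite optimization problem: problem data, a basis `Q` of the null
space of `𝒜ₛ` (the `l`-th column in positions `(i, j, l)`, `j ≤ i`), and the initial point. -/
def SDO.input {n m p : ℕ} (D : SDO n m) (Q : Matrix (SIdx n) (Fin p) ℝ) (ε γ δ β : ℝ)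
    (X : Matrix (Fin n) (Fin n) ℝ) (y : Fin m → ℝ) (S : Matrix (Fin n) (Fin n) ℝ) : State where
  ix := sizes n m p
  mem := fun arr i j k => match arr with
    | 0 => if j = 0 ∧ k = 0 then scalars ε γ δ β i else 0
    | 1 => if k = 0 then put2 X i j else 0
    | 2 => if j = 0 ∧ k = 0 then put1 y i else 0
    | 3 => if k = 0 then put2 S i j else 0
    | 4 => if h : i < m then put2 (D.A ⟨i, h⟩) j k else 0
    | 5 => if k = 0 then put2 D.C i j else 0
    | 6 => if j = 0 ∧ k = 0 then put1 D.b i else 0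
    | 7 => if h : (i < n ∧ j < n ∧ k < p) ∧ j ≤ i then
        Q ⟨(⟨i, h.1.1⟩, ⟨j, h.1.2.1⟩), h.2⟩ ⟨k, h.1.2.2⟩ else 0
    | _ => 0

/-- Input state for a linear optimization problem. -/
def LO.input {n m p : ℕ} (L : LO n m) (Q : Matrix (Fin n) (Fin p) ℝ) (ε γ δ β : ℝ)
    (x : Fin n → ℝ) (y : Fin m → ℝ) (s : Fin n → ℝ) : State where
  ix := sizes n m p
  mem := fun arr i j k => match arr with
    | 0 => if j = 0 ∧ k = 0 then scalars ε γ δ β i else 0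
    | 1 => if j = 0 ∧ k = 0 then put1 x i else 0
    | 2 => if j = 0 ∧ k = 0 then put1 y i else 0
    | 3 => if j = 0 ∧ k = 0 then put1 s i else 0
    | 4 => if k = 0 then put2 L.A i j else 0
    | 5 => if j = 0 ∧ k = 0 then put1 L.c i else 0
    | 6 => if j = 0 ∧ k = 0 then put1 L.b i else 0
    | 7 => if k = 0 then put2 Q i j else 0
    | _ => 0

/-- The program `init; while ε < ν do body`. -/
def ipm (init body : Cmd) : Cmd := .seq init (.whileLt epsRef nuRef body)

/-- `Run init body s K st`: in the execution of `ipm init body` from state `s`, the loop body is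
executed exactly `K` times, and `st k` is the state after `k` passes. -/
def Run (init body : Cmd) (s : State) (K : ℕ) (st : ℕ → State) : Prop :=
  (∃ t, Exec init s t (st 0)) ∧
    (∀ k < K, (st k).get epsRef < (st k).get nuRef ∧ ∃ t, Exec body (st k) t (st (k + 1))) ∧
    ¬ (st K).get epsRef < (st K).get nuRef

/-! ### Parameters and the complexity bound -/

/-- Conditions on the parameters of the method for problems of size `n`. -/
def Admissible (n : ℕ) (γ δ β : ℝ) : Prop :=
  2 * Real.sqrt 2 * γ / (1 - γ) ≤ 1 ∧
    β ≤ 1 - γ / Real.sqrt n - 21.7 * (γ ^ 2 + δ ^ 2) /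
      ((2 + Real.sqrt 2) * (1 - δ / Real.sqrt n) * γ * (1 - γ))

/-- Centering parameter `σ = 1 - δ / √n`. -/
def centering (n : ℕ) (δ : ℝ) : ℝ := 1 - δ / Real.sqrt n

/-- A polylogarithmic factor in `κ` and `1/ε`, of exponent `c`. -/
def polylog (c : ℕ) (κ ε : ℝ) : ℝ := (Real.log (2 + κ) * Real.log (2 + 1 / ε)) ^ c

end IFIPM

end

/-! The algorithm is a short-step path-following method whose Newton systems are solved by conjugate
gradients on the normal equations. The bound is a product: about `√n log(1/ε)` outer iterations,
about `κ` inner passes per iteration, and `n⁴` operations (`n²` in the linear case) per pass.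

Outer iterations. In the coordinates given by the Nesterov-Todd scaling both `X` and `S` become one
matrix `V` with `‖V² - νI‖ ≤ γν`, and the Newton equation says that the symmetric part of `dx V + V
ds` equals `σνI - V²`. The columns of `Q` lie in the null space, so `dx` and `ds` are orthogonal and
`‖dx‖² + ‖ds‖² = ‖dx + ds‖²` is controlled by the right-hand side. Hence the second-order term `dx
ds` is small enough for a full step, even with a residual of relative size `τ`, a small constant
depending on `γ, δ, β` only. `Frame.step` gives the new neighborhood and the decrease of `ν` by the
factor `1 - δ/(2√n)`. Feasibility is exact for any `u` because the step is parametrized by the null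
space. Linear optimization is the case of diagonal matrices (`LO.step`).

Inner passes. Conjugate gradient iterates have the form `f(MᵀM)MᵀR` (`cg_poly`) and minimal residual
among such vectors (`cg_optimal`). Comparison with a Chebyshev polynomial (`cg_converges`,
`cg_stops`) shows that a constant relative residual is reached after a number of passes proportional
to `κ`. The stopping test uses the residual alone, so `κ` need not be known.

Scaling. The program replaces `W^{-1/2}` by an approximation. Newton's iteration, started at
`ν^{-1/2}I`, gives `Y` close to `(XS)^{-1/2}` (`nearInvSqrt_iter`). Then `SY` is positive definite
and close to `W⁻¹`, and Gram-Schmidt gives a triangular `T` with `T(SY)Tᵀ = I`. The matrix `P' =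
TSY` has inverse `Tᵀ` and nearly satisfies `P'WP'ᵀ = I` (`NearInvSqrt.scaling`). Passing from `P'`
to the exact scaling is conjugation by a nearly orthogonal matrix. It leaves `tr Z²` unchanged and
hardly changes `‖Z‖`, hence hardly changes the norm of the symmetric part
(`abs_frob_symP_conj_sq_sub_le`). Since the skew part of the linearization is dominated by its
symmetric part, condition numbers and residuals carry over (`SDO.stepFacts`).

Cost. Straight-line computations are written as array assignments with sums. Their compilation is
proved correct once (`Tm.comp_tot`, `Fill.comp_tot`), and their cost is bounded by a polynomial in
`n` read off from the syntax (`Blk.cost_le`). `ipm_run`, `iterations_le` and `complexity_bound`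
combine everything; the polylogarithmic exponent is 1. -/

noncomputable section

namespace IFIPM

/-! ### Total correctness with cost bounds -/

/-- Program `c` halts from `s` at cost at most `T`, in a state satisfying `Q`. -/
def Tot (c : Cmd) (s : State) (T : ℕ) (Q : State → Prop) : Prop :=
  ∃ t s', Exec c s t s' ∧ t ≤ T ∧ Q s'

theorem Tot.mono {c : Cmd} {s : State} {T T' : ℕ} {Q Q' : State → Prop} (h : Tot c s T Q)
    (hT : T ≤ T') (hQ : ∀ s', Q s' → Q' s') : Tot c s T' Q' := by
  obtain ⟨t, s', h1, h2, h3⟩ := h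
  exact ⟨t, s', h1, h2.trans hT, hQ _ h3⟩

theorem Tot.seq {c d : Cmd} {s : State} {T T' : ℕ} {P Q : State → Prop} (h : Tot c s T P)
    (h' : ∀ s', P s' → Tot d s' T' Q) : Tot (.seq c d) s (T + T') Q := by
  obtain ⟨t, s', h1, h2, h3⟩ := h
  obtain ⟨t', s'', h4, h5, h6⟩ := h' s' h3
  exact ⟨_, s'', Exec.seq h1 h4, by omega, h6⟩

theorem Tot.skip {s : State} {Q : State → Prop} (h : Q s) : Tot .skip s 0 Q :=
  ⟨0, s, Exec.skip s, le_rfl, h⟩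

/-- An invariant yields one successor state at a time, while `Exec.forLt` needs entire sequences of
states and costs. The sequences are built by extending finite ones with `Function.update`. -/
theorem Tot.forLt {v : ℕ} {b : Ix} {p : Cmd} {s : State} {C : ℕ} (I : ℕ → State → Prop)
    (h0 : I 0 s)
    (h : ∀ k < s.ixVal b, ∀ s', I k s' → Tot p (s'.setIx v k) C (I (k + 1))) :
    Tot (.forLt v b p) s (s.ixVal b * (C + 1) + 1) (I (s.ixVal b)) := by
  have key : ∀ N ≤ s.ixVal b, ∃ (st : ℕ → State) (t : ℕ → ℕ), st 0 = s ∧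
      (∀ k < N, Exec p ((st k).setIx v k) (t k) (st (k + 1))) ∧ (∀ k < N, t k ≤ C) ∧
      I N (st N) := by
    intro N
    induction N with
    | zero => exact fun _ => ⟨fun _ => s, fun _ => 0, rfl, by simp, by simp, h0⟩
    | succ N ih =>
      intro hN
      obtain ⟨st, t, h1, h2, h3, h4⟩ := ih (by omega)
      obtain ⟨t', s', h5, h6, h7⟩ := h N (by omega) _ h4
      refine ⟨Function.update st (N + 1) s', Function.update t N t', ?_, ?_, ?_, ?_⟩
      · simpa using h1
      · intro k hk
        rcases Nat.lt_succ_iff_lt_or_eq.mp hk with hk | rfl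
        · rw [Function.update_of_ne (by omega), Function.update_of_ne (by omega),
            Function.update_of_ne (by omega)]
          exact h2 k hk
        · simpa [Function.update_of_ne] using h5
      · intro k hk
        rcases Nat.lt_succ_iff_lt_or_eq.mp hk with hk | rfl
        · rw [Function.update_of_ne (by omega)]
          exact h3 k hk
        · simpa using h6
      · simpa using h7
  obtain ⟨st, t, h1, h2, h3, h4⟩ := key _ le_rfl
  refine ⟨_, _, Exec.forLt st t h1 h2, ?_, h4⟩
  have : ∑ k ∈ Finset.range (s.ixVal b), (t k + 1) ≤ ∑ k ∈ Finset.range (s.ixVal b), (C + 1) :=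
    Finset.sum_le_sum fun k hk => by have := h3 k (Finset.mem_range.mp hk); omega
  simpa using this

/-- The number `K` of passes is fixed beforehand by the invariant, so the induction runs over the
number of passes still to be made. -/
theorem Tot.whileLt {a b : Ref} {p : Cmd} {C : ℕ} (I : ℕ → State → Prop) (K : ℕ)
    (h : ∀ k < K, ∀ s, I k s → s.get a < s.get b ∧ Tot p s C (I (k + 1)))
    (hK : ∀ s, I K s → ¬ s.get a < s.get b) {s : State} (h0 : I 0 s) :
    Tot (.whileLt a b p) s (K * (C + 1) + 1) (I K) := by
  have key : ∀ j ≤ K, ∀ s, I (K - j) s → Tot (.whileLt a b p) s (j * (C + 1) + 1) (I K) := by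
    intro j
    induction j with
    | zero => exact fun _ s hs => ⟨1, s, Exec.while_false (hK s hs), by simp, hs⟩
    | succ j ih =>
      intro hj s hs
      obtain ⟨hc, t, s', h1, h2, h3⟩ := h (K - (j + 1)) (by omega) s hs
      rw [show K - (j + 1) + 1 = K - j by omega] at h3
      obtain ⟨t', s'', h4, h5, h6⟩ := ih (by omega) s' h3
      exact ⟨_, s'', Exec.while_true hc h1 h4, by rw [Nat.succ_mul]; omega, h6⟩
  exact key K le_rfl s (by simpa using h0)

/-! ### Expressions with sums, and their compilation -/

abbrev Mem : Type := ℕ → ℕ → ℕ → ℕ → ℝ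

def ixv (ι : ℕ → ℕ) : Ix → ℕ
  | .lit k => k
  | .var v => ι v

/-- Real expressions. `sum b e` sums over an index running below `b`; the index variable is the
current level (de Bruijn level). `lt i j` is the indicator of `i < j`. -/
inductive Tm : Type
  | rd (a : ℕ) (i j k : Ix)
  | cst (c : ℚ)
  | lt (i j : Ix)
  | bin (o : Op) (e f : Tm)
  | sqrt (e : Tm)
  | sum (b : Ix) (e : Tm)

def Tm.ev (μ : Mem) : ℕ → (ℕ → ℕ) → Tm → ℝ
  | _, ι, .rd a i j k => μ a (ixv ι i) (ixv ι j) (ixv ι k)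
  | _, _, .cst c => c
  | _, ι, .lt i j => if ixv ι i < ixv ι j then 1 else 0
  | l, ι, .bin o e f => o.eval (e.ev μ l ι) (f.ev μ l ι)
  | l, ι, .sqrt e => Real.sqrt (e.ev μ l ι)
  | l, ι, .sum b e => ∑ k ∈ Finset.range (ixv ι b), e.ev μ (l + 1) (Function.update ι l k)

/-- Divisors are nonzero and radicands nonnegative. -/
def Tm.ok (μ : Mem) : ℕ → (ℕ → ℕ) → Tm → Prop
  | l, ι, .bin o e f => e.ok μ l ι ∧ f.ok μ l ι ∧ (o = Op.div → f.ev μ l ι ≠ 0)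
  | l, ι, .sqrt e => e.ok μ l ι ∧ 0 ≤ e.ev μ l ι
  | l, ι, .sum b e => ∀ k < ixv ι b, e.ok μ (l + 1) (Function.update ι l k)
  | _, _, _ => True

def Ix.below (l : ℕ) : Ix → Bool
  | .lit _ => true
  | .var v => decide (v < l)

/-- Index variables 4 and 5 are the row and column counters of the assignment loops, so this pattern
is the cell currently being written. -/
def isOwn : Ix → Ix → Ix → Bool
  | .var 4, .var 5, .lit 0 => true
  | _, _, _ => false

/-- Well-formedness at level `l`: only index variables below `l` are read, array `8` is not read,
and the target array `a` is read only at the cell being assigned. -/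
def Tm.wf (a : ℕ) : ℕ → Tm → Bool
  | l, .rd b i j k => decide (b ≠ 8) && i.below l && j.below l && k.below l &&
      (decide (b ≠ a) || isOwn i j k)
  | _, .cst _ => true
  | l, .lt i j => i.below l && j.below l
  | l, .bin _ e f => e.wf a l && f.wf a l
  | l, .sqrt e => e.wf a l
  | l, .sum b e => b.below 3 && e.wf a (l + 1)

/-- Array 8 serves as the evaluation stack of compiled expressions, which is why expressions may not
read it. -/
def tmp (d : ℕ) : Ref := ⟨8, .lit d, .lit 0, .lit 0⟩

/-- The first argument is the next free index variable, the second the height of the evaluation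
stack; the result is left in stack cell `d`. -/
def Tm.comp : ℕ → ℕ → Tm → Cmd
  | _, d, .rd a i j k => .copy (tmp d) ⟨a, i, j, k⟩
  | _, d, .cst c => .const (tmp d) c
  | _, d, .lt i j => .ifIx i j (.const (tmp d) 1) (.const (tmp d) 0)
  | l, d, .bin o e f => .seq (e.comp l d) (.seq (f.comp l (d + 1))
      (.arith o (tmp d) (tmp d) (tmp (d + 1))))
  | l, d, .sqrt e => .seq (e.comp l d) (.sqrt (tmp d) (tmp d))
  | l, d, .sum b e => .seq (.const (tmp d) 0) (.forLt l b (.seq (e.comp (l + 1) (d + 1))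
      (.arith .add (tmp d) (tmp d) (tmp (d + 1)))))

def Tm.cost (ι : ℕ → ℕ) : Tm → ℕ
  | .rd .. => 1
  | .cst _ => 1
  | .lt .. => 2
  | .bin _ e f => e.cost ι + (f.cost ι + 1)
  | .sqrt e => e.cost ι + 1
  | .sum b e => 1 + (ixv ι b * (e.cost ι + 1 + 1) + 1)

theorem State.ixVal_eq_ixv {s : State} {ι : ℕ → ℕ} {l : ℕ} (h : ∀ v < l, s.ix v = ι v) {i : Ix}
    (hi : i.below l = true) : s.ixVal i = ixv ι i := by
  cases i with
  | lit k => rfl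
  | var v => exact h v (by simpa [Ix.below] using hi)

theorem State.get_tmp (s : State) (d : ℕ) : s.get (tmp d) = s.mem 8 d 0 0 := rfl

theorem State.set_tmp_mem_ne (s : State) (d : ℕ) (x : ℝ) {b : ℕ} (hb : b ≠ 8) :
    (s.set (tmp d) x).mem b = s.mem b := by
  funext i j k
  simp [State.set, tmp, hb]

theorem State.set_tmp_mem_tmp (s : State) (d d' : ℕ) (x : ℝ) :
    (s.set (tmp d) x).mem 8 d' 0 0 = if d' = d then x else s.mem 8 d' 0 0 := by
  simp [State.set, tmp, State.ixVal]

theorem State.set_ix (s : State) (r : Ref) (x : ℝ) : (s.set r x).ix = s.ix := rfl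

theorem State.setIx_mem (s : State) (v k : ℕ) : (s.setIx v k).mem = s.mem := rfl

/-- The effect of a compiled expression. -/
def Tm.Post (l d : ℕ) (x : ℝ) (s s' : State) : Prop :=
  (∀ v < l, s'.ix v = s.ix v) ∧ (∀ b ≠ 8, s'.mem b = s.mem b) ∧
    (∀ d' < d, s'.mem 8 d' 0 0 = s.mem 8 d' 0 0) ∧ s'.mem 8 d 0 0 = x

theorem Tm.Post.set {l d : ℕ} {s : State} (x : ℝ) : Tm.Post l d x s (s.set (tmp d) x) := by
  refine ⟨fun _ _ => rfl, fun b hb => s.set_tmp_mem_ne d x hb, fun d' hd' => ?_, ?_⟩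
  · rw [State.set_tmp_mem_tmp, if_neg (by omega)]
  · rw [State.set_tmp_mem_tmp, if_pos rfl]

/-- Correctness of the compiler. The induction works because code at height `d` and level `l`
preserves the stack below `d`, the index variables below `l` and every array other than 8, so a
value already computed survives the evaluation of the next operand. -/
theorem Tm.comp_tot {a : ℕ} {μ : Mem} (e : Tm) : ∀ (l d : ℕ) (ι : ℕ → ℕ) (s : State),
    e.wf a l = true → 3 ≤ l → e.ok μ l ι → (∀ v < l, s.ix v = ι v) → (∀ b ≠ 8, s.mem b = μ b) →
    Tot (e.comp l d) s (e.cost ι) (Tm.Post l d (e.ev μ l ι) s) := by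
  induction e with
  | rd b i j k =>
    intro l d ι s hw hl hok hι hμ
    simp only [Tm.wf, Bool.and_eq_true, decide_eq_true_eq] at hw
    refine ⟨1, _, Exec.copy s (tmp d) ⟨b, i, j, k⟩, le_rfl, ?_⟩
    have : s.get ⟨b, i, j, k⟩ = Tm.ev μ l ι (.rd b i j k) := by
      simp only [State.get, Tm.ev, State.ixVal_eq_ixv hι hw.1.1.1.2,
        State.ixVal_eq_ixv hι hw.1.1.2, State.ixVal_eq_ixv hι hw.1.2, hμ b hw.1.1.1.1]
    rw [this]
    exact Tm.Post.set _
  | cst c =>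
    intro l d ι s hw hl hok hι hμ
    exact ⟨1, _, Exec.const s (tmp d) c, le_rfl, Tm.Post.set _⟩
  | lt i j =>
    intro l d ι s hw hl hok hι hμ
    simp only [Tm.wf, Bool.and_eq_true] at hw
    by_cases h : ixv ι i < ixv ι j
    · refine ⟨2, _, Exec.ifIx_true (t := 1) ?_ (Exec.const s (tmp d) 1), le_rfl, ?_⟩
      · rwa [State.ixVal_eq_ixv hι hw.1, State.ixVal_eq_ixv hι hw.2]
      · simp only [Tm.ev, h, if_true]
        simpa using Tm.Post.set (l := l) (d := d) (s := s) 1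
    · refine ⟨2, _, Exec.ifIx_false (t := 1) ?_ (Exec.const s (tmp d) 0), le_rfl, ?_⟩
      · rwa [State.ixVal_eq_ixv hι hw.1, State.ixVal_eq_ixv hι hw.2]
      · simp only [Tm.ev, h, if_false]
        simpa using Tm.Post.set (l := l) (d := d) (s := s) 0
  | bin o e f ihe ihf =>
    intro l d ι s hw hl hok hι hμ
    simp only [Tm.wf, Bool.and_eq_true] at hw
    simp only [Tm.ok] at hok
    refine Tot.seq (ihe l d ι s hw.1 hl hok.1 hι hμ) fun s1 h1 => ?_
    refine Tot.seq (ihf l (d + 1) ι s1 hw.2 hl hok.2.1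
      (fun v hv => (h1.1 v hv).trans (hι v hv)) (fun b hb => (h1.2.1 b hb).trans (hμ b hb)))
      fun s2 h2 => ?_
    have ea : s2.get (tmp d) = e.ev μ l ι := by
      rw [State.get_tmp, h2.2.2.1 d (by omega), h1.2.2.2]
    have eb : s2.get (tmp (d + 1)) = f.ev μ l ι := by rw [State.get_tmp, h2.2.2.2]
    refine ⟨1, _, Exec.arith s2 o (tmp d) (tmp d) (tmp (d + 1)) ?_, le_rfl, ?_⟩
    · rw [eb]; exact hok.2.2
    · have := Tm.Post.set (l := l) (d := d) (s := s2) (o.eval (e.ev μ l ι) (f.ev μ l ι))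
      rw [ea, eb]
      refine ⟨fun v hv => ?_, fun b hb => ?_, fun d' hd => ?_, this.2.2.2⟩
      · rw [this.1 v hv, h2.1 v hv, h1.1 v hv]
      · rw [this.2.1 b hb, h2.2.1 b hb, h1.2.1 b hb]
      · rw [this.2.2.1 d' hd, h2.2.2.1 d' (by omega), h1.2.2.1 d' hd]
  | sqrt e ih =>
    intro l d ι s hw hl hok hι hμ
    simp only [Tm.wf] at hw
    simp only [Tm.ok] at hok
    refine Tot.seq (ih l d ι s hw hl hok.1 hι hμ) fun s1 h1 => ?_
    have ea : s1.get (tmp d) = e.ev μ l ι := by rw [State.get_tmp, h1.2.2.2]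
    refine ⟨1, _, Exec.sqrt s1 (tmp d) (tmp d) (by rw [ea]; exact hok.2), le_rfl, ?_⟩
    have := Tm.Post.set (l := l) (d := d) (s := s1) (Real.sqrt (e.ev μ l ι))
    rw [ea]
    refine ⟨fun v hv => ?_, fun b hb => ?_, fun d' hd => ?_, this.2.2.2⟩
    · rw [this.1 v hv, h1.1 v hv]
    · rw [this.2.1 b hb, h1.2.1 b hb]
    · rw [this.2.2.1 d' hd, h1.2.2.1 d' hd]
  | sum b e ih =>
    intro l d ι s hw hl hok hι hμ
    simp only [Tm.wf, Bool.and_eq_true] at hw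
    simp only [Tm.ok] at hok
    have hs : Tot (.const (tmp d) 0) s 1 (Tm.Post l d 0 s) :=
      ⟨1, _, Exec.const s (tmp d) 0, le_rfl, by simpa using Tm.Post.set (l := l) (s := s) 0⟩
    refine Tot.seq hs fun s1 h1 => ?_
    have hι1 : ∀ v < l, s1.ix v = ι v := fun v hv => (h1.1 v hv).trans (hι v hv)
    have hb : s1.ixVal b = ixv ι b :=
      State.ixVal_eq_ixv (l := 3) (fun v hv => hι1 v (by omega)) hw.1
    have := Tot.forLt (v := l) (b := b) (s := s1) (C := e.cost ι + 1)
      (p := .seq (e.comp (l + 1) (d + 1)) (.arith .add (tmp d) (tmp d) (tmp (d + 1))))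
      (fun N s' => Tm.Post l d
        (∑ k ∈ Finset.range N, e.ev μ (l + 1) (Function.update ι l k)) s s')
      (by simpa using h1) ?_
    · rw [hb] at this
      exact this
    intro k hk s2 h2
    rw [hb] at hk
    have hι2 : ∀ v < l + 1, (s2.setIx l k).ix v = Function.update ι l k v := by
      intro v hv
      rcases Nat.lt_succ_iff_lt_or_eq.mp hv with hv | rfl
      · simp only [State.setIx, Function.update_of_ne (Nat.ne_of_lt hv)]
        exact (h2.1 v hv).trans (hι v hv)
      · simp [State.setIx]
    -- Bounds of sums are literals or the size variables below 3, whereas the summation variable is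
    -- at least 3. All passes of the loop therefore have the same cost.
    have hcost : e.cost (Function.update ι l k) = e.cost ι := by
      have : ∀ (f : Tm) (l' : ℕ), f.wf a l' = true →
          f.cost (Function.update ι l k) = f.cost ι := by
        intro f
        induction f with
        | rd | cst | lt => intro _ _; rfl
        | bin o e f ihe ihf =>
          intro l' h
          simp only [Tm.wf, Bool.and_eq_true] at h
          simp only [Tm.cost, ihe l' h.1, ihf l' h.2]
        | sqrt e ih => intro l' h; simp only [Tm.cost, ih l' h]
        | sum b e ih =>
          intro l' h
          simp only [Tm.wf, Bool.and_eq_true] at h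
          have hb' : ixv (Function.update ι l k) b = ixv ι b := by
            cases b with
            | lit => rfl
            | var v =>
              have : v < 3 := by simpa [Ix.below] using h.1
              exact Function.update_of_ne (by omega) _ _
          simp only [Tm.cost, ih _ h.2, hb']
      exact this e _ hw.2
    have h3 := ih (l + 1) (d + 1) (Function.update ι l k) (s2.setIx l k) hw.2 (by omega)
      (hok k hk) hι2 (fun b hb => by rw [State.setIx_mem, h2.2.1 b hb, hμ b hb])
    rw [hcost] at h3
    refine Tot.seq h3 fun s3 h3 => ?_
    have ea : s3.get (tmp d) = ∑ k ∈ Finset.range k, e.ev μ (l + 1) (Function.update ι l k) := by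
      rw [State.get_tmp, h3.2.2.1 d (by omega), State.setIx_mem, h2.2.2.2]
    have eb : s3.get (tmp (d + 1)) = e.ev μ (l + 1) (Function.update ι l k) := by
      rw [State.get_tmp, h3.2.2.2]
    refine ⟨1, _, Exec.arith s3 .add (tmp d) (tmp d) (tmp (d + 1)) (by simp), le_rfl, ?_⟩
    rw [ea, eb, Op.eval, ← Finset.sum_range_succ
      (fun k => e.ev μ (l + 1) (Function.update ι l k))]
    generalize (∑ k ∈ Finset.range (k + 1), e.ev μ (l + 1) (Function.update ι l k)) = x
    have := Tm.Post.set (l := l) (d := d) (s := s3) x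
    refine ⟨fun v hv => ?_, fun b hb => ?_, fun d' hd => ?_, this.2.2.2⟩
    · rw [this.1 v hv, h3.1 v (by omega)]
      simp only [State.setIx, Function.update_of_ne (Nat.ne_of_lt hv)]
      exact h2.1 v hv
    · rw [this.2.1 b hb, h3.2.1 b hb, State.setIx_mem, h2.2.1 b hb]
    · rw [this.2.2.1 d' hd, h3.2.2.1 d' (by omega), State.setIx_mem, h2.2.2.1 d' hd]

/-- Values do not depend on array `8`, nor on the target array outside of the current cell. -/
theorem Tm.mem_congr {a : ℕ} {μ μ' : Mem} (h : ∀ b, b ≠ 8 → b ≠ a → μ b = μ' b) (e : Tm) :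
    ∀ (l : ℕ) (ι : ℕ → ℕ), 6 ≤ l → e.wf a l = true → μ a (ι 4) (ι 5) 0 = μ' a (ι 4) (ι 5) 0 →
    e.ev μ l ι = e.ev μ' l ι ∧ (e.ok μ l ι → e.ok μ' l ι) := by
  induction e with
  | rd b i j k =>
    intro l ι hl hw ho
    refine ⟨?_, fun _ => trivial⟩
    simp only [Tm.wf, Bool.and_eq_true, decide_eq_true_eq, Bool.or_eq_true] at hw
    by_cases hb : b = a
    · rcases hw.2 with hn | hn
      · exact absurd hb hn
      · subst hb
        unfold isOwn at hn
        split at hn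
        · exact ho
        · exact absurd hn (by simp)
    · simp only [Tm.ev, h b hw.1.1.1.1 hb]
  | cst => exact fun _ _ _ _ _ => ⟨rfl, id⟩
  | lt => exact fun _ _ _ _ _ => ⟨rfl, id⟩
  | bin o e f ihe ihf =>
    intro l ι hl hw ho
    simp only [Tm.wf, Bool.and_eq_true] at hw
    have h1 := ihe l ι hl hw.1 ho
    have h2 := ihf l ι hl hw.2 ho
    refine ⟨by simp only [Tm.ev, h1.1, h2.1], ?_⟩
    simp only [Tm.ok]
    rintro ⟨ha, hb, hc⟩
    exact ⟨h1.2 ha, h2.2 hb, by rwa [← h2.1]⟩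
  | sqrt e ih =>
    intro l ι hl hw ho
    have h1 := ih l ι hl hw ho
    refine ⟨by simp only [Tm.ev, h1.1], ?_⟩
    simp only [Tm.ok]
    rintro ⟨ha, hb⟩
    exact ⟨h1.2 ha, by rwa [← h1.1]⟩
  | sum b e ih =>
    intro l ι hl hw ho
    simp only [Tm.wf, Bool.and_eq_true] at hw
    have h1 : ∀ k, _ := fun k => ih (l + 1) (Function.update ι l k) (by omega) hw.2
      (by rwa [Function.update_of_ne (by omega), Function.update_of_ne (by omega)])
    refine ⟨?_, ?_⟩
    · simp only [Tm.ev]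
      exact Finset.sum_congr rfl fun k _ => (h1 k).1
    · simp only [Tm.ok]
      exact fun hk k hkb => (h1 k).2 (hk k hkb)

/-! ### Array assignments and blocks of them -/

/-- The assignment `a[i][j] := e(i, j)` for all `i < r`, `j < c`. -/
structure Fill : Type where
  a : ℕ
  r : Ix
  c : Ix
  e : Tm

/-- Evaluation starts at level 6 because variables 4 and 5 hold the position of the cell. -/
def Fill.val (f : Fill) (μ : Mem) (ι : ℕ → ℕ) (i j : ℕ) : ℝ :=
  f.e.ev μ 6 (Function.update (Function.update ι 4 i) 5 j)

def Fill.den (f : Fill) (μ : Mem) (ι : ℕ → ℕ) : Mem := Function.update μ f.a fun i j k =>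
  if i < ixv ι f.r ∧ j < ixv ι f.c ∧ k = 0 then f.val μ ι i j else μ f.a i j k

def Fill.ok (f : Fill) (μ : Mem) (ι : ℕ → ℕ) : Prop :=
  ∀ i < ixv ι f.r, ∀ j < ixv ι f.c, f.e.ok μ 6 (Function.update (Function.update ι 4 i) 5 j)

def Fill.wf (f : Fill) : Bool := decide (f.a ≠ 8) && f.r.below 3 && f.c.below 3 && f.e.wf f.a 6

def Fill.comp (f : Fill) : Cmd :=
  .forLt 4 f.r (.forLt 5 f.c (.seq (f.e.comp 6 0) (.copy ⟨f.a, .var 4, .var 5, .lit 0⟩ (tmp 0))))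

def Fill.cost (f : Fill) (ι : ℕ → ℕ) : ℕ :=
  ixv ι f.r * (ixv ι f.c * (f.e.cost ι + 1 + 1) + 1 + 1) + 1

/-- The state holds memory `μ` (except for array `8`) and index variables `ι` (below `4`). -/
def Agree (μ : Mem) (ι : ℕ → ℕ) (s : State) : Prop :=
  (∀ v < 4, s.ix v = ι v) ∧ ∀ b ≠ 8, s.mem b = μ b

theorem Tm.cost_congr {a : ℕ} {ι ι' : ℕ → ℕ} (h : ∀ v < 3, ι v = ι' v) (e : Tm) : ∀ l,
    e.wf a l = true → e.cost ι = e.cost ι' := by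
  induction e with
  | rd | cst | lt => intro _ _; rfl
  | bin o e f ihe ihf =>
    intro l' h
    simp only [Tm.wf, Bool.and_eq_true] at h
    simp only [Tm.cost, ihe l' h.1, ihf l' h.2]
  | sqrt e ih => intro l' h; simp only [Tm.cost, ih l' h]
  | sum b e ih =>
    intro l' h'
    simp only [Tm.wf, Bool.and_eq_true] at h'
    have hb' : ixv ι b = ixv ι' b := by
      cases b with
      | lit => rfl
      | var v => exact h v (by simpa [Ix.below] using h'.1)
    simp only [Tm.cost, ih _ h'.2, hb']

/-- The assignment may refer to its own target, but only at the cell being written. That cell still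
has its old value when it is read, so the sequential loops agree with a simultaneous assignment. -/
theorem Fill.comp_tot (f : Fill) {μ : Mem} {ι : ℕ → ℕ} {s : State} (hw : f.wf = true)
    (hok : f.ok μ ι) (hs : Agree μ ι s) : Tot f.comp s (f.cost ι) (Agree (f.den μ ι) ι) := by
  simp only [Fill.wf, Bool.and_eq_true, decide_eq_true_eq] at hw
  obtain ⟨⟨⟨ha, hr⟩, hc⟩, he⟩ := hw
  -- The memory after the complete rows before `i` and the first `j` cells of row `i`; it is the
  -- invariant of both loops.
  let part : ℕ → ℕ → Mem := fun i j => Function.update μ f.a fun i' j' k' =>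
    if (i' < i ∧ j' < ixv ι f.c ∨ i' = i ∧ j' < j) ∧ k' = 0 then f.val μ ι i' j'
    else μ f.a i' j' k'
  have hrow : s.ixVal f.r = ixv ι f.r :=
    State.ixVal_eq_ixv (l := 3) (fun v hv => hs.1 v (by omega)) hr
  have main := Tot.forLt (v := 4) (b := f.r) (s := s) (C := ixv ι f.c * (f.e.cost ι + 1 + 1) + 1)
    (p := .forLt 5 f.c (.seq (f.e.comp 6 0) (.copy ⟨f.a, .var 4, .var 5, .lit 0⟩ (tmp 0))))
    (fun i s' => Agree (part i 0) ι s') ?_ ?_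
  · rw [hrow] at main
    refine main.mono le_rfl fun s' hs' => ⟨hs'.1, fun b hb => ?_⟩
    rw [hs'.2 b hb]
    by_cases hba : b = f.a
    · subst hba
      simp only [part, Fill.den, Function.update_self]
      funext i j k
      simp [and_assoc]
    · simp only [part, Fill.den, Function.update_of_ne hba]
  · refine ⟨hs.1, fun b hb => ?_⟩
    rw [hs.2 b hb]
    by_cases hba : b = f.a
    · subst hba
      simp [part]
    · simp only [part, Function.update_of_ne hba]
  intro i hi s1 h1
  rw [hrow] at hi
  have hcol : (s1.setIx 4 i).ixVal f.c = ixv ι f.c := by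
    refine State.ixVal_eq_ixv (l := 3) (fun v hv => ?_) hc
    simp only [State.setIx, Function.update_of_ne (show v ≠ 4 by omega)]
    exact h1.1 v (by omega)
  have inner := Tot.forLt (v := 5) (b := f.c) (s := s1.setIx 4 i) (C := f.e.cost ι + 1)
    (p := .seq (f.e.comp 6 0) (.copy ⟨f.a, .var 4, .var 5, .lit 0⟩ (tmp 0)))
    (fun j s' => Agree (part i j) ι s' ∧ s'.ix 4 = i) ?_ ?_
  · rw [hcol] at inner
    refine inner.mono le_rfl fun s' hs' => ⟨hs'.1.1, fun b hb => ?_⟩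
    rw [hs'.1.2 b hb]
    by_cases hba : b = f.a
    · subst hba
      simp only [part, Function.update_self]
      funext i' j' k'
      have : (i' < i ∧ j' < ixv ι f.c ∨ i' = i ∧ j' < ixv ι f.c) ↔
        (i' < i + 1 ∧ j' < ixv ι f.c ∨ i' = i + 1 ∧ j' < 0) := by omega
      simp only [this]
    · simp only [part, Function.update_of_ne hba]
  · refine ⟨⟨fun v hv => ?_, h1.2⟩, by simp [State.setIx]⟩
    simp only [State.setIx, Function.update_of_ne (show v ≠ 4 by omega)]
    exact h1.1 v hv
  intro j hj s2 h2
  rw [hcol] at hj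
  set ι' := Function.update (Function.update ι 4 i) 5 j with hι'
  have hag : ∀ v < 6, (s2.setIx 5 j).ix v = ι' v := by
    intro v hv
    by_cases h5 : v = 5
    · subst h5; simp [State.setIx, hι']
    · simp only [State.setIx, hι', Function.update_of_ne h5]
      by_cases h4 : v = 4
      · subst h4; simpa using h2.2
      · rw [Function.update_of_ne h4]
        exact h2.1.1 v (by omega)
  have hpart : part i j f.a (ι' 4) (ι' 5) 0 = μ f.a (ι' 4) (ι' 5) 0 := by
    simp [part, hι', Function.update_of_ne]
  have hcongr := Tm.mem_congr (a := f.a) (μ := μ) (μ' := part i j)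
    (fun b _ hb => by simp only [part, Function.update_of_ne hb]) f.e 6 ι' le_rfl he hpart.symm
  have hcost : f.e.cost ι' = f.e.cost ι := Tm.cost_congr (fun v hv => by
    rw [hι', Function.update_of_ne (by omega), Function.update_of_ne (by omega)]) f.e 6 he
  have h3 := Tm.comp_tot f.e 6 0 ι' (s2.setIx 5 j) he (by omega)
    (hcongr.2 (hok i hi j hj)) hag h2.1.2
  rw [hcost, ← hcongr.1] at h3
  refine Tot.seq h3 fun s3 h3 => ?_
  refine ⟨1, _, Exec.copy s3 _ _, le_rfl, ⟨fun v hv => ?_, fun b hb => ?_⟩, ?_⟩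
  · rw [State.set_ix, h3.1 v (by omega), State.setIx]
    simp only [Function.update_of_ne (show v ≠ 5 by omega)]
    exact h2.1.1 v hv
  · have i4 : s3.ix 4 = i := by
      rw [h3.1 4 (by omega), hag 4 (by omega)]
      simp [hι', Function.update_of_ne]
    have i5 : s3.ix 5 = j := by
      rw [h3.1 5 (by omega), hag 5 (by omega)]; simp [hι']
    have hm : s3.mem b = part i j b := by
      rw [h3.2.1 b hb, State.setIx_mem, h2.1.2 b hb]
    rw [State.get_tmp, h3.2.2.2]
    funext i' j' k'
    simp only [State.set, State.ixVal, i4, i5, hm]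
    by_cases hba : b = f.a
    · subst hba
      simp only [part, Function.update_self, true_and]
      by_cases hc : i' = i ∧ j' = j ∧ k' = 0
      · obtain ⟨rfl, rfl, rfl⟩ := hc
        simp [Fill.val, hι']
      · rw [if_neg hc]
        have : ((i' < i ∧ j' < ixv ι f.c ∨ i' = i ∧ j' < j) ∧ k' = 0) ↔
          ((i' < i ∧ j' < ixv ι f.c ∨ i' = i ∧ j' < j + 1) ∧ k' = 0) := by omega
        simp only [this]
    · simp only [part, Function.update_of_ne hba, hba, false_and, if_false]
  · rw [State.set_ix, h3.1 4 (by omega), hag 4 (by omega)]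
    simp [hι', Function.update_of_ne]

abbrev Blk : Type := List Fill

def Blk.comp : Blk → Cmd
  | [] => .skip
  | f :: fs => .seq f.comp (Blk.comp fs)

def Blk.den : Blk → Mem → (ℕ → ℕ) → Mem
  | [], μ, _ => μ
  | f :: fs, μ, ι => Blk.den fs (f.den μ ι) ι

def Blk.ok : Blk → Mem → (ℕ → ℕ) → Prop
  | [], _, _ => True
  | f :: fs, μ, ι => f.ok μ ι ∧ Blk.ok fs (f.den μ ι) ι

def Blk.wf (b : Blk) : Bool := b.all Fill.wf

def Blk.cost : Blk → (ℕ → ℕ) → ℕ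
  | [], _ => 0
  | f :: fs, ι => f.cost ι + Blk.cost fs ι

theorem Blk.comp_tot (b : Blk) {ι : ℕ → ℕ} : ∀ {μ : Mem} {s : State}, b.wf = true → b.ok μ ι →
    Agree μ ι s → Tot b.comp s (b.cost ι) (Agree (b.den μ ι) ι) := by
  induction b with
  | nil => exact fun _ _ hs => Tot.skip hs
  | cons f fs ih =>
    intro μ s hw hok hs
    simp only [Blk.wf, List.all_cons, Bool.and_eq_true] at hw
    exact Tot.seq (f.comp_tot hw.1 hok.1 hs) fun s' hs' => ih hw.2 hok.2 hs'

/-! ### Syntactic cost bounds -/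

/-- Sizes are bounded by powers of `n`: `ι v ≤ n ^ w v` for the three size variables. -/
def Sized (w : ℕ → ℕ) (n : ℕ) (ι : ℕ → ℕ) : Prop := 0 < n ∧ ∀ v < 3, ι v ≤ n ^ w v

/-- `cf` and `dg` give a bound `cf * n ^ dg` for the cost. Both are computed from the syntax, so for
a concrete program the degree condition is settled by `decide`. -/
def Ix.cf : Ix → ℕ
  | .lit k => k
  | .var _ => 1

def Ix.dg (w : ℕ → ℕ) : Ix → ℕ
  | .lit _ => 0
  | .var v => w v

def Tm.cf : Tm → ℕ
  | .rd .. => 1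
  | .cst _ => 1
  | .lt .. => 2
  | .bin _ e f => e.cf + (f.cf + 1)
  | .sqrt e => e.cf + 1
  | .sum b e => 1 + (b.cf * (e.cf + 1 + 1) + 1)

def Tm.dg (w : ℕ → ℕ) : Tm → ℕ
  | .rd .. => 0
  | .cst _ => 0
  | .lt .. => 0
  | .bin _ e f => max (e.dg w) (f.dg w)
  | .sqrt e => e.dg w
  | .sum b e => b.dg w + e.dg w

def Fill.cf (f : Fill) : ℕ := f.r.cf * (f.c.cf * (f.e.cf + 1 + 1) + 1 + 1) + 1

def Fill.dg (w : ℕ → ℕ) (f : Fill) : ℕ := f.r.dg w + (f.c.dg w + f.e.dg w)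

def Blk.cf : Blk → ℕ
  | [] => 0
  | f :: fs => f.cf + Blk.cf fs

def Blk.dgle (w : ℕ → ℕ) (d : ℕ) (b : Blk) : Bool := b.all fun f => decide (f.dg w ≤ d)

section
variable {w : ℕ → ℕ} {n : ℕ} {ι : ℕ → ℕ}

theorem Sized.ixv_le (h : Sized w n ι) {i : Ix} (hi : i.below 3 = true) :
    ixv ι i ≤ i.cf * n ^ i.dg w := by
  cases i with
  | lit k => simp [ixv, Ix.cf, Ix.dg]
  | var v => simpa [ixv, Ix.cf, Ix.dg] using h.2 v (by simpa [Ix.below] using hi)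

theorem Sized.one_le_pow (h : Sized w n ι) (d : ℕ) : 1 ≤ n ^ d := Nat.one_le_pow _ _ h.1

theorem Sized.add_const (h : Sized w n ι) {x c d k : ℕ} (hx : x ≤ c * n ^ d) :
    x + k ≤ (c + k) * n ^ d := by
  rw [add_mul]
  exact add_le_add hx (Nat.le_mul_of_pos_right _ (h.one_le_pow d))

theorem Sized.mono (h : Sized w n ι) {x c d d' : ℕ} (hx : x ≤ c * n ^ d) (hd : d ≤ d') :
    x ≤ c * n ^ d' :=
  hx.trans (Nat.mul_le_mul_left _ (Nat.pow_le_pow_right h.1 hd))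

theorem mul_le_pow {x y c c' d d' : ℕ} (hx : x ≤ c * n ^ d) (hy : y ≤ c' * n ^ d') :
    x * y ≤ (c * c') * n ^ (d + d') := by
  calc x * y ≤ (c * n ^ d) * (c' * n ^ d') := Nat.mul_le_mul hx hy
    _ = _ := by ring

theorem Tm.cost_le (h : Sized w n ι) {a : ℕ} (e : Tm) : ∀ l, e.wf a l = true →
    e.cost ι ≤ e.cf * n ^ e.dg w := by
  induction e with
  | rd | cst | lt => intro _ _; simp [Tm.cost, Tm.cf, Tm.dg]
  | bin o e f ihe ihf =>
    intro l hw
    simp only [Tm.wf, Bool.and_eq_true] at hw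
    have h1 := h.mono (ihe l hw.1) (le_max_left _ (f.dg w))
    have h2 := h.add_const (k := 1) (h.mono (ihf l hw.2) (le_max_right (e.dg w) _))
    simp only [Tm.cost, Tm.cf, Tm.dg]
    rw [add_mul]
    exact add_le_add h1 h2
  | sqrt e ih =>
    intro l hw
    exact h.add_const (ih l hw)
  | sum b e ih =>
    intro l hw
    simp only [Tm.wf, Bool.and_eq_true] at hw
    have h1 := mul_le_pow (h.ixv_le hw.1) (h.add_const (k := 1) (h.add_const (k := 1) (ih _ hw.2)))
    have h2 := h.add_const (k := 1) (h.add_const (k := 1) h1)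
    simp only [Tm.cost, Tm.cf, Tm.dg]
    rw [add_comm 1, add_comm 1]
    exact h2

theorem Fill.cost_le (h : Sized w n ι) (f : Fill) (hw : f.wf = true) :
    f.cost ι ≤ f.cf * n ^ f.dg w := by
  simp only [Fill.wf, Bool.and_eq_true, decide_eq_true_eq] at hw
  have h1 := mul_le_pow (h.ixv_le hw.1.2)
    (h.add_const (k := 1) (h.add_const (k := 1) (Tm.cost_le h f.e 6 hw.2)))
  have h2 := mul_le_pow (h.ixv_le hw.1.1.2) (h.add_const (k := 1) (h.add_const (k := 1) h1))
  exact h.add_const (k := 1) h2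

theorem Blk.cost_le (h : Sized w n ι) {d : ℕ} (b : Blk) (hw : b.wf = true)
    (hd : b.dgle w d = true) : b.cost ι ≤ b.cf * n ^ d := by
  induction b with
  | nil => simp [Blk.cost]
  | cons f fs ih =>
    simp only [Blk.wf, List.all_cons, Bool.and_eq_true] at hw
    simp only [Blk.dgle, List.all_cons, Bool.and_eq_true, decide_eq_true_eq] at hd
    simp only [Blk.cost, Blk.cf, add_mul]
    exact add_le_add (h.mono (f.cost_le h hw.1) hd.1) (ih hw.2 hd.2)

end

/-! ### Conjugate gradients on the normal equations -/

section CG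
variable {ρ υ : Type*} [Fintype ρ] [Fintype υ]

theorem dot_self_nonneg (v : ρ → ℝ) : 0 ≤ v ⬝ᵥ v := Finset.sum_nonneg fun _ _ => mul_self_nonneg _

theorem dot_self_pos {v : ρ → ℝ} (h : v ≠ 0) : 0 < v ⬝ᵥ v :=
  lt_of_le_of_ne (dot_self_nonneg v) fun h' => h (dotProduct_self_eq_zero.mp h'.symm)

theorem mulVec_dot (M : Matrix ρ υ ℝ) (u : υ → ℝ) (v : ρ → ℝ) :
    (M *ᵥ u) ⬝ᵥ v = u ⬝ᵥ (Mᵀ *ᵥ v) := by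
  rw [dotProduct_comm, dotProduct_mulVec, ← mulVec_transpose, dotProduct_comm]

/-- Iterate, residual and search direction. -/
structure CGState (ρ υ : Type*) : Type _ where
  u : υ → ℝ
  r : ρ → ℝ
  p : υ → ℝ

variable (M : Matrix ρ υ ℝ) (R : ρ → ℝ)

def CGState.s (x : CGState ρ υ) : υ → ℝ := Mᵀ *ᵥ x.r

def CGState.q (x : CGState ρ υ) : ρ → ℝ := M *ᵥ x.p

def CGState.alpha (x : CGState ρ υ) : ℝ := (x.s M ⬝ᵥ x.s M) / (x.q M ⬝ᵥ x.q M)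

def CGState.next (x : CGState ρ υ) : CGState ρ υ where
  u := x.u + x.alpha M • x.p
  r := x.r - x.alpha M • x.q M
  p := Mᵀ *ᵥ (x.r - x.alpha M • x.q M) +
    ((Mᵀ *ᵥ (x.r - x.alpha M • x.q M)) ⬝ᵥ (Mᵀ *ᵥ (x.r - x.alpha M • x.q M)) /
      (x.s M ⬝ᵥ x.s M)) • x.p

def cg : ℕ → CGState ρ υ
  | 0 => ⟨0, R, Mᵀ *ᵥ R⟩
  | k + 1 => (cg k).next M

theorem cg_u_succ (k : ℕ) : (cg M R (k + 1)).u = (cg M R k).u + (cg M R k).alpha M • (cg M R k).p :=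
  rfl

theorem cg_r_succ (k : ℕ) :
    (cg M R (k + 1)).r = (cg M R k).r - (cg M R k).alpha M • (cg M R k).q M := rfl

theorem cg_p_succ (k : ℕ) : (cg M R (k + 1)).p = (cg M R (k + 1)).s M +
    ((cg M R (k + 1)).s M ⬝ᵥ (cg M R (k + 1)).s M / ((cg M R k).s M ⬝ᵥ (cg M R k).s M)) •
      (cg M R k).p := rfl

theorem cg_s_succ (k : ℕ) : (cg M R (k + 1)).s M =
    (cg M R k).s M - (cg M R k).alpha M • (Mᵀ *ᵥ (cg M R k).q M) := by
  simp only [CGState.s, cg_r_succ, mulVec_sub, mulVec_smul]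

theorem cg_residual_eq (k : ℕ) : (cg M R k).r = R - M *ᵥ (cg M R k).u := by
  induction k with
  | zero => simp [cg]
  | succ k ih =>
    rw [cg_r_succ, cg_u_succ, mulVec_add, mulVec_smul, ih, CGState.q]
    abel

/-- Orthogonality relations of the conjugate gradient method. -/
theorem cg_orth (k : ℕ) (hs : ∀ i < k, (cg M R i).s M ≠ 0) :
    (∀ j < k, (cg M R k).s M ⬝ᵥ (cg M R j).p = 0) ∧
    (∀ j < k, (cg M R k).q M ⬝ᵥ (cg M R j).q M = 0) ∧
    (∀ j < k, (cg M R k).s M ⬝ᵥ (cg M R j).s M = 0) ∧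
    (cg M R k).s M ⬝ᵥ (cg M R k).p = (cg M R k).s M ⬝ᵥ (cg M R k).s M ∧
    ((cg M R k).s M ≠ 0 → 0 < (cg M R k).q M ⬝ᵥ (cg M R k).q M) := by
  induction k using Nat.strong_induction_on with
  | _ k ih =>
  -- If `Mp = 0`, then `s ⬝ p = r ⬝ Mp = 0`, contradicting `s ⬝ p = s ⬝ s > 0`. So the denominator
  -- of the step length does not vanish before the gradient does.
  have pos_of : ∀ k, (cg M R k).s M ⬝ᵥ (cg M R k).p = (cg M R k).s M ⬝ᵥ (cg M R k).s M →
      (cg M R k).s M ≠ 0 → 0 < (cg M R k).q M ⬝ᵥ (cg M R k).q M := by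
    intro k h1 h2
    refine dot_self_pos fun h3 => (dot_self_pos h2).ne' ?_
    have : (cg M R k).s M ⬝ᵥ (cg M R k).p = (cg M R k).q M ⬝ᵥ (cg M R k).r := by
      rw [CGState.q, mulVec_dot, dotProduct_comm]; rfl
    rw [← h1, this, h3, zero_dotProduct]
  rcases k with _ | k
  · have h4 : (cg M R 0).s M ⬝ᵥ (cg M R 0).p = (cg M R 0).s M ⬝ᵥ (cg M R 0).s M := rfl
    exact ⟨by simp, by simp, by simp, h4, pos_of 0 h4⟩
  obtain ⟨i1, i2, i3, i4, i5⟩ := ih k (by omega) fun i hi => hs i (by omega)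
  have hsk := hs k (by omega)
  have hq := i5 hsk
  have hss := dot_self_pos hsk
  have dotq : ∀ j, (Mᵀ *ᵥ (cg M R k).q M) ⬝ᵥ (cg M R j).p =
      (cg M R k).q M ⬝ᵥ (cg M R j).q M := fun j => by
    rw [dotProduct_comm, ← mulVec_dot, dotProduct_comm]; rfl
  have halpha : (cg M R k).alpha M * ((cg M R k).q M ⬝ᵥ (cg M R k).q M) =
      (cg M R k).s M ⬝ᵥ (cg M R k).s M := div_mul_cancel₀ _ hq.ne'
  have o1 : ∀ j < k + 1, (cg M R (k + 1)).s M ⬝ᵥ (cg M R j).p = 0 := by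
    intro j hj
    rw [cg_s_succ, sub_dotProduct, smul_dotProduct, dotq, smul_eq_mul]
    rcases Nat.lt_succ_iff_lt_or_eq.mp hj with hj | rfl
    · rw [i1 j hj, i2 j hj]; ring
    · rw [i4, halpha, sub_self]
  have o3 : ∀ j < k + 1, (cg M R (k + 1)).s M ⬝ᵥ (cg M R j).s M = 0 := by
    intro j hj
    rcases j with _ | j
    · exact o1 0 hj
    · have : (cg M R (j + 1)).s M = (cg M R (j + 1)).p - ((cg M R (j + 1)).s M ⬝ᵥ
          (cg M R (j + 1)).s M / ((cg M R j).s M ⬝ᵥ (cg M R j).s M)) • (cg M R j).p := by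
        rw [cg_p_succ]; abel
      rw [this, dotProduct_sub, dotProduct_smul, o1 _ hj, o1 j (by omega)]
      simp
  have o4 : (cg M R (k + 1)).s M ⬝ᵥ (cg M R (k + 1)).p =
      (cg M R (k + 1)).s M ⬝ᵥ (cg M R (k + 1)).s M := by
    rw [cg_p_succ, dotProduct_add, dotProduct_smul, o1 k (by omega)]
    simp
  refine ⟨o1, ?_, o3, o4, pos_of _ o4⟩
  intro j hj
  have hq' : ∀ v : ρ → ℝ, (cg M R (k + 1)).q M ⬝ᵥ v = (cg M R (k + 1)).s M ⬝ᵥ (Mᵀ *ᵥ v) +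
      ((cg M R (k + 1)).s M ⬝ᵥ (cg M R (k + 1)).s M / ((cg M R k).s M ⬝ᵥ (cg M R k).s M)) *
        ((cg M R k).q M ⬝ᵥ v) := by
    intro v
    rw [CGState.q, mulVec_dot, cg_p_succ, add_dotProduct, smul_dotProduct, smul_eq_mul,
      CGState.q, mulVec_dot]
  have hj5 : 0 < (cg M R j).q M ⬝ᵥ (cg M R j).q M :=
    (ih j hj fun i hi => hs i (by omega)).2.2.2.2 (hs j hj)
  have haj : (cg M R j).alpha M ≠ 0 := (div_pos (dot_self_pos (hs j hj)) hj5).ne'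
  -- `MᵀM pⱼ` is `(sⱼ - sⱼ₊₁)/αⱼ`. Conjugacy thus reduces to orthogonality of the gradients; only `j
  -- = k` leaves a term, which the coefficient of the new direction is chosen to cancel.
  have hAp : (cg M R j).alpha M * ((cg M R (k + 1)).s M ⬝ᵥ (Mᵀ *ᵥ (cg M R j).q M)) =
      (cg M R (k + 1)).s M ⬝ᵥ (cg M R j).s M - (cg M R (k + 1)).s M ⬝ᵥ (cg M R (j + 1)).s M := by
    rw [cg_s_succ M R j, dotProduct_sub, dotProduct_smul, smul_eq_mul]; ring
  rw [hq']
  rcases Nat.lt_succ_iff_lt_or_eq.mp hj with hj' | rfl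
  · rw [o3 j hj, o3 (j + 1) (by omega), sub_zero] at hAp
    rw [(mul_eq_zero.mp hAp).resolve_left haj, i2 j hj']; ring
  · rw [o3 j hj, zero_sub] at hAp
    apply mul_left_cancel₀ haj
    rw [mul_add, hAp, mul_zero]
    have : (cg M R j).alpha M * ((cg M R (j + 1)).s M ⬝ᵥ (cg M R (j + 1)).s M /
        ((cg M R j).s M ⬝ᵥ (cg M R j).s M) * ((cg M R j).q M ⬝ᵥ (cg M R j).q M)) =
      (cg M R (j + 1)).s M ⬝ᵥ (cg M R (j + 1)).s M := by
      rw [mul_comm (_ / _), ← mul_assoc, halpha]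
      field_simp
    rw [this]; ring

/-- For a consistent system the residual lies in the range of `M`. If `Mᵀr = 0`, then `r` is
orthogonal to that range, in particular to itself. -/
theorem cg_s_ne_zero {u : υ → ℝ} (hu : R = M *ᵥ u) {k : ℕ} (hr : (cg M R k).r ≠ 0) :
    (cg M R k).s M ≠ 0 := by
  intro h
  apply (dot_self_pos hr).ne'
  have : (cg M R k).r = M *ᵥ (u - (cg M R k).u) := by
    rw [mulVec_sub, ← hu, cg_residual_eq]
  nth_rw 1 [this]
  rw [mulVec_dot]
  have : Mᵀ *ᵥ (cg M R k).r = 0 := h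
  rw [this, dotProduct_zero]

variable [DecidableEq υ]

/-- The directions span the Krylov space: `MᵀM pᵢ` is a multiple of `sᵢ - sᵢ₊₁`, and each gradient
is a combination of two consecutive directions. -/
theorem cg_pow_mem_span (j : ℕ) (hs : ∀ i < j, (cg M R i).s M ≠ 0) :
    (Mᵀ * M) ^ j *ᵥ (Mᵀ *ᵥ R) ∈ Submodule.span ℝ ((fun i => (cg M R i).p) '' {i | i ≤ j}) := by
  have s_mem : ∀ i, (cg M R i).s M ∈ Submodule.span ℝ ((fun i => (cg M R i).p) '' {l | l ≤ i}) := by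
    intro i
    rcases i with _ | i
    · exact Submodule.subset_span ⟨0, by simp, rfl⟩
    · have : (cg M R (i + 1)).s M = (cg M R (i + 1)).p - ((cg M R (i + 1)).s M ⬝ᵥ
          (cg M R (i + 1)).s M / ((cg M R i).s M ⬝ᵥ (cg M R i).s M)) • (cg M R i).p := by
        rw [cg_p_succ]; abel
      rw [this]
      exact Submodule.sub_mem _ (Submodule.subset_span ⟨i + 1, by simp, rfl⟩)
        (Submodule.smul_mem _ _ (Submodule.subset_span ⟨i, by simp, rfl⟩))
  have mono : ∀ i k, i ≤ k → Submodule.span ℝ ((fun i => (cg M R i).p) '' {l | l ≤ i}) ≤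
      Submodule.span ℝ ((fun i => (cg M R i).p) '' {l | l ≤ k}) := fun i k h =>
    Submodule.span_mono (Set.image_mono fun l hl => le_trans hl h)
  induction j with
  | zero =>
    rw [pow_zero, one_mulVec]
    exact Submodule.subset_span ⟨0, by simp, rfl⟩
  | succ j ih =>
    rw [pow_succ', ← mulVec_mulVec]
    have h := ih fun i hi => hs i (by omega)
    have : Submodule.span ℝ ((fun i => (cg M R i).p) '' {l | l ≤ j}) ≤
        (Submodule.span ℝ ((fun i => (cg M R i).p) '' {l | l ≤ j + 1})).comap
          (Matrix.mulVecLin (Mᵀ * M)) := by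
      rw [Submodule.span_le]
      rintro _ ⟨i, hi, rfl⟩
      have hi : i ≤ j := hi
      simp only [Submodule.comap_coe, Set.mem_preimage, mulVecLin_apply, SetLike.mem_coe]
      have hsi := hs i (by omega)
      have hq := (cg_orth M R i fun l hl => hs l (by omega)).2.2.2.2 hsi
      have ha : (cg M R i).alpha M ≠ 0 := (div_pos (dot_self_pos hsi) hq).ne'
      have : (Mᵀ * M) *ᵥ (cg M R i).p = ((cg M R i).alpha M)⁻¹ •
          ((cg M R i).s M - (cg M R (i + 1)).s M) := by
        rw [cg_s_succ, sub_sub_cancel, smul_smul, inv_mul_cancel₀ ha, one_smul, CGState.q,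
          mulVec_mulVec]
      rw [this]
      exact Submodule.smul_mem _ _ (Submodule.sub_mem _ (mono i _ (by omega) (s_mem i))
        (mono (i + 1) _ (by omega) (s_mem (i + 1))))
    exact this h

/-- The residual of the `k`-th iterate is minimal among those of polynomial approximations. -/
theorem cg_optimal (k : ℕ) (hs : ∀ i < k, (cg M R i).s M ≠ 0) (f : ℝ[X]) (hf : f.natDegree < k) :
    (cg M R k).r ⬝ᵥ (cg M R k).r ≤
      (R - M *ᵥ polySolve f M R) ⬝ᵥ (R - M *ᵥ polySolve f M R) := by
  set S := Submodule.span ℝ ((fun i => (cg M R i).p) '' {i | i < k}) with hS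
  have hfm : polySolve f M R ∈ S := by
    rw [polySolve, aeval_eq_sum_range, Matrix.sum_mulVec]
    refine Submodule.sum_mem _ fun j hj => ?_
    rw [smul_mulVec]
    refine Submodule.smul_mem _ _ ?_
    have hj' : j < k := by have := Finset.mem_range.mp hj; omega
    refine Submodule.span_mono (Set.image_mono fun l hl => ?_)
      (cg_pow_mem_span M R j fun i hi => hs i (by omega))
    exact lt_of_le_of_lt (show l ≤ j from hl) hj'
  have hu : ∀ i ≤ k, (cg M R i).u ∈ S := by
    intro i
    induction i with
    | zero => exact fun _ => Submodule.zero_mem _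
    | succ i ih =>
      intro hi
      rw [cg_u_succ]
      exact Submodule.add_mem _ (ih (by omega)) (Submodule.smul_mem _ _
        (Submodule.subset_span ⟨i, show i < k by omega, rfl⟩))
  -- The gradient is orthogonal to the whole span, so the residual is orthogonal to `M v` for each
  -- `v` in it. The comparison with any other element of the span is then Pythagoras.
  have horth : ∀ v ∈ S, (cg M R k).s M ⬝ᵥ v = 0 := by
    intro v hv
    induction hv using Submodule.span_induction with
    | mem x hx => obtain ⟨i, hi, rfl⟩ := hx; exact (cg_orth M R k hs).1 i hi
    | zero => simp
    | add x y _ _ hx hy => rw [dotProduct_add, hx, hy, add_zero]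
    | smul c x _ hx => rw [dotProduct_smul, hx, smul_zero]
  set v := (cg M R k).u - polySolve f M R with hv
  have h0 : (cg M R k).r ⬝ᵥ (M *ᵥ v) = 0 := by
    rw [dotProduct_comm, mulVec_dot, dotProduct_comm]
    exact horth _ (Submodule.sub_mem _ (hu k le_rfl) hfm)
  have : R - M *ᵥ polySolve f M R = (cg M R k).r + M *ᵥ v := by
    rw [cg_residual_eq, hv, mulVec_sub]; abel
  rw [this, dotProduct_add, add_dotProduct, add_dotProduct, h0, dotProduct_comm (M *ᵥ v), h0]
  have := dot_self_nonneg (M *ᵥ v)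
  linarith

/-- The iterates are polynomial approximations. -/
theorem cg_poly (k : ℕ) : ∃ f : ℝ[X], f.natDegree ≤ k ∧ (cg M R k).u = polySolve f M R := by
  -- The search direction has to be carried along. Since the gradient is `MᵀR - MᵀM u`, it costs one
  -- degree more than the iterate.
  suffices h : ∃ f g : ℝ[X], f.natDegree ≤ k ∧ g.natDegree ≤ k ∧
      (cg M R k).u = polySolve f M R ∧ (cg M R k).p = polySolve g M R by
    obtain ⟨f, g, h1, -, h2, -⟩ := h
    exact ⟨f, h1, h2⟩
  have add : ∀ f g : ℝ[X], polySolve (f + g) M R = polySolve f M R + polySolve g M R :=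
    fun f g => by rw [polySolve, map_add, add_mulVec]; rfl
  have smul : ∀ (c : ℝ) (g : ℝ[X]), polySolve (C c * g) M R = c • polySolve g M R :=
    fun c g => by
      simp only [polySolve, map_mul, aeval_C, Algebra.algebraMap_eq_smul_one, smul_mul_assoc,
        one_mul, smul_mulVec]
  have one : polySolve 1 M R = Mᵀ *ᵥ R := by simp [polySolve]
  have X : ∀ g : ℝ[X], polySolve (-(X * g)) M R = -(Mᵀ *ᵥ (M *ᵥ polySolve g M R)) := fun g => by
    rw [polySolve, map_neg, map_mul, aeval_X, neg_mulVec, ← mulVec_mulVec, ← mulVec_mulVec]; rfl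
  have deg : ∀ (c : ℝ) (g : ℝ[X]) k, g.natDegree ≤ k → (C c * g).natDegree ≤ k + 1 :=
    fun c g k h => (natDegree_C_mul_le c g).trans (by omega)
  induction k with
  | zero => exact ⟨0, 1, by simp, by simp, by simp [cg, polySolve], by rw [one]; rfl⟩
  | succ k ih =>
    obtain ⟨f, g, hf, hg, hu, hp⟩ := ih
    set f' := f + C ((cg M R k).alpha M) * g
    have hu' : (cg M R (k + 1)).u = polySolve f' M R := by
      rw [cg_u_succ, add, smul, hu, hp]
    have hf' : f'.natDegree ≤ k :=
      (natDegree_add_le _ _).trans (max_le hf ((natDegree_C_mul_le _ g).trans hg))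
    refine ⟨f', (1 + -(Polynomial.X * f')) + C ((cg M R (k + 1)).s M ⬝ᵥ (cg M R (k + 1)).s M /
      ((cg M R k).s M ⬝ᵥ (cg M R k).s M)) * g, by omega, ?_, hu', ?_⟩
    · refine (natDegree_add_le _ _).trans (max_le ((natDegree_add_le _ _).trans
        (max_le (by simp) ?_)) (deg _ _ _ hg))
      rw [natDegree_neg]
      exact natDegree_mul_le.trans (by rw [natDegree_X]; omega)
    · rw [cg_p_succ, add, add, smul, ← hp, one, X, ← hu', CGState.s, cg_residual_eq, mulVec_sub,
        sub_eq_add_neg]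

/-- A polynomial with values at most `θ` on the spectrum contracts the residual by `θ`. -/
theorem residual_le_of_poly {a b θ : ℝ} {u : υ → ℝ} (p : ℝ[X])
    (hlo : ∀ v, a * (v ⬝ᵥ v) ≤ (M *ᵥ v) ⬝ᵥ (M *ᵥ v))
    (hhi : ∀ v, (M *ᵥ v) ⬝ᵥ (M *ᵥ v) ≤ b * (v ⬝ᵥ v))
    (ha : 0 ≤ a) (hp : ∀ t ∈ Set.Icc a b, (p.eval t) ^ 2 ≤ θ ^ 2) :
    (M *ᵥ (aeval (Mᵀ * M) p *ᵥ u)) ⬝ᵥ (M *ᵥ (aeval (Mᵀ * M) p *ᵥ u)) ≤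
      θ ^ 2 * ((M *ᵥ u) ⬝ᵥ (M *ᵥ u)) := by
  set A := Mᵀ * M with hA
  have hAs : IsSelfAdjoint A := by
    rw [IsSelfAdjoint, star_eq_conjTranspose, conjTranspose_eq_transpose_of_trivial, hA,
      transpose_mul, transpose_transpose]
  have spec : ∀ t ∈ spectrum ℝ A, t ∈ Set.Icc a b := by
    intro t ht
    rw [← spectrum_toLin', ← Module.End.hasEigenvalue_iff_mem_spectrum] at ht
    obtain ⟨v, hv⟩ := ht.exists_hasEigenvector
    have h1 : A *ᵥ v = t • v := by simpa using hv.apply_eq_smul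
    have h2 : (M *ᵥ v) ⬝ᵥ (M *ᵥ v) = t * (v ⬝ᵥ v) := by
      rw [mulVec_dot, mulVec_mulVec, h1, dotProduct_smul, smul_eq_mul]
    have h3 := dot_self_pos hv.2
    have h4 := hlo v
    have h5 := hhi v
    rw [h2] at h4 h5
    exact ⟨le_of_mul_le_mul_right h4 h3, le_of_mul_le_mul_right h5 h3⟩
  -- The function `t(θ² - p(t)²)` is nonnegative on the spectrum, so this polynomial in `A` is
  -- positive semidefinite; its quadratic form at `u` is the claimed inequality.
  have hnn : 0 ≤ aeval A (Polynomial.X * (C (θ ^ 2) - p ^ 2)) := by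
    rw [← cfc_polynomial _ A hAs]
    refine cfc_nonneg fun t ht => ?_
    have h1 := spec t ht
    simp only [eval_mul, eval_X, eval_sub, eval_C, eval_pow]
    exact mul_nonneg (ha.trans h1.1) (sub_nonneg.mpr (hp t h1))
  rw [nonneg_iff_posSemidef] at hnn
  have key := hnn.dotProduct_mulVec_nonneg u
  have hsymm : (aeval A p)ᵀ = aeval A p := by
    have hAt : Aᵀ = A := by rw [hA, transpose_mul, transpose_transpose]
    rw [aeval_eq_sum_range, transpose_sum]
    simp only [transpose_smul, transpose_pow, hAt]
  have e1 : (M *ᵥ (aeval A p *ᵥ u)) ⬝ᵥ (M *ᵥ (aeval A p *ᵥ u)) =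
      u ⬝ᵥ (aeval A (Polynomial.X * p ^ 2) *ᵥ u) := by
    rw [mulVec_dot, mulVec_dot, hsymm, mulVec_mulVec, mulVec_mulVec, mulVec_mulVec,
      Matrix.mul_assoc (_ * Mᵀ), ← Matrix.mul_assoc (_ * Mᵀ), Matrix.mul_assoc _ Mᵀ M, ← hA]
    have : aeval A (Polynomial.X * p ^ 2) = aeval A p * (A * aeval A p) := by
      rw [show Polynomial.X * p ^ 2 = p * (Polynomial.X * p) by ring]
      simp only [map_mul, aeval_X]
    rw [this, Matrix.mul_assoc]
  have e2 : (M *ᵥ u) ⬝ᵥ (M *ᵥ u) = u ⬝ᵥ (A *ᵥ u) := by rw [mulVec_dot, mulVec_mulVec]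
  rw [e1, e2]
  have e3 : aeval A (Polynomial.X * (C (θ ^ 2) - p ^ 2)) =
      (θ ^ 2) • A - aeval A (Polynomial.X * p ^ 2) := by
    rw [mul_sub, map_sub, map_mul _ _ (C _), aeval_X, aeval_C, Algebra.algebraMap_eq_smul_one,
      mul_smul_comm, mul_one]
  rw [e3, sub_mulVec, smul_mulVec, dotProduct_sub, dotProduct_smul, smul_eq_mul] at key
  have : star u = u := by ext; simp
  rw [this] at key
  linarith

/-- The recurrence gives `T_{k+2} - T_{k+1} = (T_{k+1} - T_k) + 2x T_{k+1}` at `1 + x`, so the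
differences grow by at least `2x` each time, and summation gives `k²x`. This quadratic growth
replaces the usual exponential one, as only a constant reduction of the residual is needed. -/
theorem chebyshev_growth {x : ℝ} (hx : 0 ≤ x) (k : ℕ) :
    1 + (k : ℝ) ^ 2 * x ≤ (Chebyshev.T ℝ k).eval (1 + x) := by
  suffices h : 1 + (k : ℝ) ^ 2 * x ≤ (Chebyshev.T ℝ k).eval (1 + x) ∧
      (2 * k + 1) * x ≤ (Chebyshev.T ℝ (k + 1 : ℕ)).eval (1 + x) -
        (Chebyshev.T ℝ k).eval (1 + x) from h.1
  induction k with
  | zero => simp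
  | succ k ih =>
    obtain ⟨h1, h2⟩ := ih
    have h3 : (Chebyshev.T ℝ (k + 1 + 1 : ℕ)).eval (1 + x) =
        2 * (1 + x) * (Chebyshev.T ℝ (k + 1 : ℕ)).eval (1 + x) -
          (Chebyshev.T ℝ k).eval (1 + x) := by
      have := Chebyshev.T_add_two ℝ k
      push_cast
      rw [show (k : ℤ) + 1 + 1 = k + 2 by ring, this]
      simp
    have h4 : 1 + ((k + 1 : ℕ) : ℝ) ^ 2 * x ≤ (Chebyshev.T ℝ (k + 1 : ℕ)).eval (1 + x) := by
      push_cast at h1 h2 ⊢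
      linarith
    refine ⟨h4, ?_⟩
    rw [h3]
    have h5 : x ≤ x * (Chebyshev.T ℝ (k + 1 : ℕ)).eval (1 + x) :=
      le_mul_of_one_le_right hx (le_trans (by
        have : 0 ≤ ((k + 1 : ℕ) : ℝ) ^ 2 * x := by positivity
        linarith) h4)
    push_cast at h2 h5 ⊢
    linarith

/-- Convergence of conjugate gradients for a consistent system. -/
theorem cg_converges {a b : ℝ} {u : υ → ℝ} (hu : R = M *ᵥ u)
    (hlo : ∀ v, a * (v ⬝ᵥ v) ≤ (M *ᵥ v) ⬝ᵥ (M *ᵥ v))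
    (hhi : ∀ v, (M *ᵥ v) ⬝ᵥ (M *ᵥ v) ≤ b * (v ⬝ᵥ v)) (ha : 0 < a) (hb : 0 < b)
    {k : ℕ} (hk : 0 < k) (hs : ∀ i < k, (cg M R i).s M ≠ 0) :
    (1 + 2 * (k : ℝ) ^ 2 * (a / b)) ^ 2 * ((cg M R k).r ⬝ᵥ (cg M R k).r) ≤ R ⬝ᵥ R := by
  set x : ℝ := 2 * a / b with hx
  have hx0 : 0 < x := by positivity
  set c := (Chebyshev.T ℝ k).eval (1 + x) with hc
  have hcg : 1 + (k : ℝ) ^ 2 * x ≤ c := chebyshev_growth hx0.le k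
  have hc1 : 0 < c := lt_of_lt_of_le (by positivity) hcg
  -- The affine map sends `0` to `1 + x`, `a` to `1` and `b` to `x - 1`. It therefore maps `[a, b]`
  -- into `[-1, 1]`, where Chebyshev polynomials are bounded by 1.
  set ℓ : ℝ[X] := C (1 + x) - C (2 / b) * X with hℓ
  set p : ℝ[X] := C c⁻¹ * (Chebyshev.T ℝ k).comp ℓ with hp
  have hp0 : p.eval 0 = 1 := by
    simp only [hp, hℓ, eval_mul, eval_C, eval_comp, eval_sub, eval_X, mul_zero, sub_zero, ← hc]
    exact inv_mul_cancel₀ hc1.ne'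
  have hpb : ∀ t ∈ Set.Icc a b, (p.eval t) ^ 2 ≤ (c⁻¹) ^ 2 := by
    intro t ht
    have habs : |1 + x - 2 / b * t| ≤ 1 := by
      rw [abs_le]
      have h1 : 2 / b * t ≤ 2 := by
        calc 2 / b * t ≤ 2 / b * b := by gcongr; exact ht.2
          _ = 2 := by field_simp
      have h2 : x ≤ 2 / b * t := by
        rw [hx, mul_div_right_comm]; gcongr; exact ht.1
      constructor <;> linarith
    have h3 := Chebyshev.abs_eval_T_real_le_one (k : ℤ) habs
    simp only [hp, hℓ, eval_mul, eval_C, eval_comp, eval_sub, eval_X, mul_pow]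
    refine mul_le_of_le_one_right (by positivity) ?_
    rwa [sq_le_one_iff_abs_le_one]
  have hdeg : p.natDegree ≤ k := by
    refine (natDegree_C_mul_le _ _).trans (natDegree_comp_le.trans ?_)
    have h1 : ℓ.natDegree ≤ 1 := by
      refine (natDegree_sub_le _ _).trans (max_le (by simp) ?_)
      exact (natDegree_C_mul_le _ _).trans natDegree_X_le
    calc _ ≤ (Chebyshev.T ℝ (k : ℤ)).natDegree * 1 := Nat.mul_le_mul_left _ h1
      _ = k := by rw [Chebyshev.natDegree_T]; simp
  -- Since `p(0) = 1`, one has `p = 1 - f X` with `deg f < k`. The residual of the approximation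
  -- given by `f` is then `M p(MᵀM) u`.
  set f : ℝ[X] := -p.divX with hf
  have hfd : f.natDegree < k := by
    rw [hf, natDegree_neg, natDegree_divX_eq_natDegree_tsub_one]; omega
  have hpf : p = 1 - f * X := by
    have h1 := divX_mul_X_add p
    have h2 : p.coeff 0 = 1 := by rw [coeff_zero_eq_eval_zero, hp0]
    rw [h2] at h1
    rw [hf, neg_mul, sub_neg_eq_add, add_comm]
    simpa using h1.symm
  have hres : R - M *ᵥ polySolve f M R = M *ᵥ (aeval (Mᵀ * M) p *ᵥ u) := by
    rw [hpf, map_sub, map_one, map_mul, aeval_X, sub_mulVec, one_mulVec, mulVec_sub, ← hu,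
      polySolve, hu, ← mulVec_mulVec, ← mulVec_mulVec]
  have h1 := cg_optimal M R k hs f hfd
  rw [hres] at h1
  have h2 := residual_le_of_poly M (u := u) p hlo hhi ha.le hpb
  rw [← hu] at h2
  have h3 : (1 + 2 * (k : ℝ) ^ 2 * (a / b)) ^ 2 ≤ c ^ 2 := by
    have : 1 + 2 * (k : ℝ) ^ 2 * (a / b) = 1 + (k : ℝ) ^ 2 * x := by rw [hx]; ring
    rw [this]
    gcongr
  calc _ ≤ c ^ 2 * (c⁻¹ ^ 2 * (R ⬝ᵥ R)) :=
        mul_le_mul h3 (h1.trans h2) (dot_self_nonneg _) (by positivity)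
    _ = R ⬝ᵥ R := by field_simp

/-- The first iteration at which the stopping criterion holds exists, and it is at most of the
order of the condition number. -/
theorem cg_stops {a b θ : ℝ} {u : υ → ℝ} (hu : R = M *ᵥ u)
    (hlo : ∀ v, a * (v ⬝ᵥ v) ≤ (M *ᵥ v) ⬝ᵥ (M *ᵥ v))
    (hhi : ∀ v, (M *ᵥ v) ⬝ᵥ (M *ᵥ v) ≤ b * (v ⬝ᵥ v)) (ha : 0 < a) (hb : 0 < b) (hθ : 0 < θ)
    (hR : R ≠ 0) :
    ∃ k : ℕ, (∀ i < k, θ ^ 2 * (R ⬝ᵥ R) < (cg M R i).r ⬝ᵥ (cg M R i).r) ∧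
      ¬ θ ^ 2 * (R ⬝ᵥ R) < (cg M R k).r ⬝ᵥ (cg M R k).r ∧
      (∀ i < k, (cg M R i).s M ≠ 0) ∧
      ∀ a' b' : ℝ, 0 < a' → 0 < b' → (∀ v, a' * (v ⬝ᵥ v) ≤ (M *ᵥ v) ⬝ᵥ (M *ᵥ v)) →
        (∀ v, (M *ᵥ v) ⬝ᵥ (M *ᵥ v) ≤ b' * (v ⬝ᵥ v)) → (k : ℝ) ≤ 1 + Real.sqrt (b' / (θ * a')) := by
  have hRR := dot_self_pos hR
  have hns : ∀ k, (∀ i < k, θ ^ 2 * (R ⬝ᵥ R) < (cg M R i).r ⬝ᵥ (cg M R i).r) →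
      ∀ i < k, (cg M R i).s M ≠ 0 := by
    intro k h i hi
    refine cg_s_ne_zero M R hu fun h0 => ?_
    have := h i hi
    rw [h0, zero_dotProduct] at this
    have h1 : 0 < θ ^ 2 * (R ⬝ᵥ R) := by positivity
    linarith
  have bound : ∀ a' b' : ℝ, 0 < a' → 0 < b' →
      (∀ v, a' * (v ⬝ᵥ v) ≤ (M *ᵥ v) ⬝ᵥ (M *ᵥ v)) →
      (∀ v, (M *ᵥ v) ⬝ᵥ (M *ᵥ v) ≤ b' * (v ⬝ᵥ v)) → ∀ j : ℕ,
      (∀ i ≤ j, θ ^ 2 * (R ⬝ᵥ R) < (cg M R i).r ⬝ᵥ (cg M R i).r) →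
      (j : ℝ) ≤ Real.sqrt (b' / (θ * a')) := by
    intro a' b' ha' hb' hlo' hhi' j hj
    rcases Nat.eq_zero_or_pos j with rfl | hj0
    · simp
    apply Real.le_sqrt_of_sq_le
    by_contra hlt
    push Not at hlt
    have h1 := cg_converges M R hu hlo' hhi' ha' hb' hj0 (hns j fun i hi => hj i hi.le)
    -- At `j² > b'/(θa')` the Chebyshev bound already forces the relative residual below `θ`. With
    -- `a', b'` squared singular values the number of passes is of order `κ/√θ`, linear in `κ` for
    -- fixed `θ`.
    have h2 : 1 ≤ (1 + 2 * (j : ℝ) ^ 2 * (a' / b')) * θ := by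
      have : 1 / θ ≤ (j : ℝ) ^ 2 * (a' / b') := by
        calc 1 / θ = b' / (θ * a') * (a' / b') := by field_simp
          _ ≤ (j : ℝ) ^ 2 * (a' / b') := by gcongr
      have h3 : 1 / θ ≤ 1 + 2 * (j : ℝ) ^ 2 * (a' / b') := by
        have : 0 ≤ (j : ℝ) ^ 2 * (a' / b') := by positivity
        linarith
      rwa [div_le_iff₀ hθ] at h3
    have h3 := hj j le_rfl
    have h4 : 1 ≤ (1 + 2 * (j : ℝ) ^ 2 * (a' / b')) ^ 2 * θ ^ 2 := by
      rw [← mul_pow]; exact one_le_pow₀ h2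
    have h5 : (1 + 2 * (j : ℝ) ^ 2 * (a' / b')) ^ 2 * (θ ^ 2 * (R ⬝ᵥ R)) <
        (1 + 2 * (j : ℝ) ^ 2 * (a' / b')) ^ 2 * ((cg M R j).r ⬝ᵥ (cg M R j).r) :=
      mul_lt_mul_of_pos_left h3 (by positivity)
    nlinarith
  have hex : ∃ k, ¬ θ ^ 2 * (R ⬝ᵥ R) < (cg M R k).r ⬝ᵥ (cg M R k).r := by
    by_contra hcon
    push Not at hcon
    obtain ⟨j, hj⟩ := exists_nat_gt (Real.sqrt (b / (θ * a)))
    exact absurd (bound a b ha hb hlo hhi j fun i _ => hcon i) (not_le.mpr hj)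
  classical
  refine ⟨Nat.find hex, fun i hi => not_not.mp (Nat.find_min hex hi), Nat.find_spec hex,
    hns _ fun i hi => not_not.mp (Nat.find_min hex hi), fun a' b' ha' hb' hlo' hhi' => ?_⟩
  rcases h : Nat.find hex with _ | j
  · simp; positivity
  · have := bound a' b' ha' hb' hlo' hhi' j fun i hi =>
      not_not.mp (Nat.find_min hex (by omega : i < Nat.find hex))
    push_cast
    linarith

end CG

/-! ### Reasoning about blocks -/

instance : Add Tm := ⟨.bin .add⟩
instance : Sub Tm := ⟨.bin .sub⟩
instance : Mul Tm := ⟨.bin .mul⟩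
instance : Div Tm := ⟨.bin .div⟩

section
variable {μ : Mem} {l : ℕ} {ι : ℕ → ℕ}

theorem Tm.ev_add (e f : Tm) : (e + f).ev μ l ι = e.ev μ l ι + f.ev μ l ι := rfl
theorem Tm.ev_sub (e f : Tm) : (e - f).ev μ l ι = e.ev μ l ι - f.ev μ l ι := rfl
theorem Tm.ev_mul (e f : Tm) : (e * f).ev μ l ι = e.ev μ l ι * f.ev μ l ι := rfl
theorem Tm.ev_div (e f : Tm) : (e / f).ev μ l ι = e.ev μ l ι / f.ev μ l ι := rfl

theorem Tm.ok_div {e f : Tm} (he : e.ok μ l ι) (hf : f.ok μ l ι) (h : f.ev μ l ι ≠ 0) :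
    (e / f).ok μ l ι := ⟨he, hf, fun _ => h⟩
theorem Tm.ok_mul {e f : Tm} (he : e.ok μ l ι) (hf : f.ok μ l ι) : (e * f).ok μ l ι :=
  ⟨he, hf, by simp⟩
theorem Tm.ok_add {e f : Tm} (he : e.ok μ l ι) (hf : f.ok μ l ι) : (e + f).ok μ l ι :=
  ⟨he, hf, by simp⟩
end

/-- Expressions without divisions and square roots. -/
def Tm.total : Tm → Bool
  | .bin o e f => (match o with | .div => false | _ => true) && e.total && f.total
  | .sqrt _ => false
  | .sum _ e => e.total
  | _ => true

theorem Tm.ok_of_total {μ : Mem} (e : Tm) : ∀ (l : ℕ) (ι : ℕ → ℕ), e.total = true →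
    e.ok μ l ι := by
  induction e with
  | rd | cst | lt => exact fun _ _ _ => trivial
  | bin o e f ihe ihf =>
    intro l ι h
    simp only [Tm.total, Bool.and_eq_true] at h
    refine ⟨ihe l ι h.1.2, ihf l ι h.2, ?_⟩
    rintro rfl
    exact absurd h.1.1 (by simp)
  | sqrt e ih => exact fun _ _ h => absurd h (by simp [Tm.total])
  | sum b e ih => exact fun l ι h k _ => ih _ _ h

theorem Fill.ok_of_total {f : Fill} {μ : Mem} {ι : ℕ → ℕ} (h : f.e.total = true) : f.ok μ ι :=
  fun _ _ _ _ => f.e.ok_of_total _ _ h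

theorem Fill.den_of_ne (f : Fill) (μ : Mem) (ι : ℕ → ℕ) {b : ℕ} (h : b ≠ f.a) :
    f.den μ ι b = μ b := Function.update_of_ne h _ _

theorem Fill.den_apply (f : Fill) (μ : Mem) (ι : ℕ → ℕ) {i j : ℕ} (hi : i < ixv ι f.r)
    (hj : j < ixv ι f.c) : f.den μ ι f.a i j 0 = f.val μ ι i j := by
  simp [Fill.den, hi, hj]

/-- The block `b` can be executed in memory `μ`, and the resulting memory satisfies `Q`. -/
def Blk.Sat (b : Blk) (μ : Mem) (ι : ℕ → ℕ) (Q : Mem → Prop) : Prop :=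
  b.ok μ ι ∧ Q (b.den μ ι)

section
variable {μ : Mem} {ι : ℕ → ℕ} {Q Q' : Mem → Prop} {f : Fill} {b b' : Blk}

theorem Blk.Sat.nil (h : Q μ) : Blk.Sat [] μ ι Q := ⟨trivial, h⟩

/-- After an assignment only two facts are kept: other arrays are unchanged, and the rectangle holds
the new values. Nothing is remembered about the target array outside the rectangle. -/
theorem Blk.Sat.cons (hok : f.ok μ ι) (h : ∀ μ', (∀ b ≠ f.a, μ' b = μ b) →
    (∀ i < ixv ι f.r, ∀ j < ixv ι f.c, μ' f.a i j 0 = f.val μ ι i j) → Blk.Sat b μ' ι Q) :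
    Blk.Sat (f :: b) μ ι Q := by
  have := h (f.den μ ι) (fun b hb => f.den_of_ne μ ι hb) (fun i hi j hj => f.den_apply μ ι hi hj)
  exact ⟨⟨hok, this.1⟩, this.2⟩

theorem Blk.Sat.append (h : Blk.Sat b μ ι fun μ' => Blk.Sat b' μ' ι Q) :
    Blk.Sat (b ++ b') μ ι Q := by
  induction b generalizing μ with
  | nil => exact h.2
  | cons f fs ih =>
    obtain ⟨⟨h1, h2⟩, h3⟩ := h
    have := ih (μ := f.den μ ι) ⟨h2, h3⟩
    exact ⟨⟨h1, this.1⟩, this.2⟩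

theorem Blk.Sat.mono (h : Blk.Sat b μ ι Q) (hQ : ∀ μ', Q μ' → Q' μ') : Blk.Sat b μ ι Q' :=
  ⟨h.1, hQ _ h.2⟩

theorem Blk.Sat.tot {w : ℕ → ℕ} {n d : ℕ} (h : Blk.Sat b μ ι Q) (hsz : Sized w n ι)
    (hw : b.wf = true) (hd : b.dgle w d = true) {s : State} (hs : Agree μ ι s) :
    Tot b.comp s (b.cf * n ^ d) fun s' => ∃ μ', Agree μ' ι s' ∧ Q μ' :=
  (b.comp_tot hw h.1 hs).mono (b.cost_le hsz hw hd) fun _ hs' => ⟨_, hs', h.2⟩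
end

/-! ### Views of the memory as matrices and vectors, and basic expressions -/

def Mem.mat (μ : Mem) (a r c : ℕ) : Matrix (Fin r) (Fin c) ℝ := Matrix.of fun i j => μ a i j 0
def Mem.vec (μ : Mem) (a r : ℕ) : Fin r → ℝ := fun i => μ a i 0 0
def Mem.sc (μ : Mem) (a : ℕ) : ℝ := μ a 0 0 0
def Mem.rvec (μ : Mem) (a n c : ℕ) : Fin n × Fin c → ℝ := fun x => μ a x.1 x.2 0
def Mem.uvec (μ : Mem) (a b p m : ℕ) : Fin p ⊕ Fin m → ℝ := Sum.elim (μ.vec a p) (μ.vec b m)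

/-- The entry of array `a` at the cell being assigned. -/
abbrev own (a : ℕ) : Tm := .rd a (.var 4) (.var 5) (.lit 0)
/-- The scalar stored in array `a`. -/
abbrev scl (a : ℕ) : Tm := .rd a (.lit 0) (.lit 0) (.lit 0)
/-- The matrix entry in row `i`, column `j` (index variables) of array `a`. -/
abbrev ent (a i j : ℕ) : Tm := .rd a (.var i) (.var j) (.lit 0)
/-- The vector entry `i` of array `a`. -/
abbrev ve (a i : ℕ) : Tm := .rd a (.var i) (.lit 0) (.lit 0)

abbrev setMat (a : ℕ) (c : Ix) (e : Tm) : Fill := ⟨a, .var 0, c, e⟩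
abbrev setZ (a : ℕ) (e : Tm) : Fill := ⟨a, .var 2, .lit 1, e⟩
abbrev setY (a : ℕ) (e : Tm) : Fill := ⟨a, .var 1, .lit 1, e⟩
abbrev setSc (a : ℕ) (e : Tm) : Fill := ⟨a, .lit 1, .lit 1, e⟩

/-- Squared norm of the vector in arrays `a`, `b`. -/
abbrev normSqU (a b : ℕ) : Tm :=
  .sum (.var 2) (ve a 6 * ve a 6) + .sum (.var 1) (ve b 6 * ve b 6)
/-- Squared Frobenius norm of the matrix in array `a`. -/
abbrev normSqR (c : Ix) (a : ℕ) : Tm := .sum (.var 0) (.sum c (ent a 6 7 * ent a 6 7))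

theorem ixv_var (ι : ℕ → ℕ) (v : ℕ) : ixv ι (.var v) = ι v := rfl
theorem ixv_lit (ι : ℕ → ℕ) (k : ℕ) : ixv ι (.lit k) = k := rfl

section
variable {μ : Mem} {ι : ℕ → ℕ} {l : ℕ}

theorem ev_normSqU {p m a b : ℕ} (h2 : ι 2 = p) (h1 : ι 1 = m) (i j : ℕ) :
    (normSqU a b).ev μ 6 (Function.update (Function.update ι 4 i) 5 j) =
      μ.uvec a b p m ⬝ᵥ μ.uvec a b p m := by
  simp [Tm.ev, Op.eval, ixv, h1, h2, Mem.uvec, dotProduct, Finset.sum_range,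
    Mem.vec]

theorem ev_normSqR {n c : ℕ} {ci : Ix} {a : ℕ} (h0 : ι 0 = n) (hci : ci.below 3 = true)
    (hc : ixv ι ci = c) (i j : ℕ) :
    (normSqR ci a).ev μ 6 (Function.update (Function.update ι 4 i) 5 j) =
      μ.rvec a n c ⬝ᵥ μ.rvec a n c := by
  have : ∀ x, ixv (Function.update (Function.update (Function.update ι 4 i) 5 j) 6 x) ci = c := by
    intro x
    rw [← hc]
    cases ci with
    | lit => rfl
    | var v =>
      have : v < 3 := by simpa [Ix.below] using hci
      simp only [ixv]
      rw [Function.update_of_ne (by omega), Function.update_of_ne (by omega),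
        Function.update_of_ne (by omega)]
  simp only [Tm.ev, this]
  simp [Op.eval, ixv, h0, dotProduct, Finset.sum_range, Fintype.sum_prod_type, Mem.rvec]
end

/-! ### The conjugate gradient program

Arrays: `20, 21` iterate, `22` residual, `23, 24` search direction, `25, 26` gradient, `27` its
squared norm, `28` image of the search direction, `29, 30, 31` coefficients, `33` squared norm of
the residual, `34` stopping threshold, `35` squared tolerance. -/

def cgUpdate (c : Ix) : Blk :=
  [setSc 29 (scl 27 / normSqR c 28),
    setZ 20 (own 20 + scl 29 * own 23),
    setY 21 (own 21 + scl 29 * own 24),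
    setMat 22 c (own 22 - scl 29 * own 28)]

def cgDirection (c : Ix) : Blk :=
  [setSc 31 (normSqU 25 26),
    setSc 30 (scl 31 / scl 27),
    setZ 23 (own 25 + scl 30 * own 23),
    setY 24 (own 26 + scl 30 * own 24),
    setSc 27 (scl 31),
    setSc 33 (normSqR c 22)]

def cgBody (c : Ix) (mv mvT : Blk) : Blk := mv ++ (cgUpdate c ++ (mvT ++ cgDirection c))

def cgStart (c : Ix) : Blk :=
  [setZ 20 (.cst 0), setY 21 (.cst 0), setZ 23 (own 25), setY 24 (own 26),
    setSc 27 (normSqU 25 26), setSc 33 (normSqR c 22), setSc 34 (scl 35 * scl 33)]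

def cgInit (c : Ix) (mvT : Blk) : Blk := mvT ++ cgStart c

def scRef (a : ℕ) : Ref := ⟨a, .lit 0, .lit 0, .lit 0⟩

def cgLoop (c : Ix) (mv mvT : Blk) : Cmd := .whileLt (scRef 34) (scRef 33) (cgBody c mv mvT).comp

/-- The blocks `mv` and `mvT` compute the products with `M` and its transpose. -/
structure Matvec {n m p c : ℕ} (ι : ℕ → ℕ) (μ₀ : Mem) (mv mvT : Blk)
    (M : Matrix (Fin n × Fin c) (Fin p ⊕ Fin m) ℝ) (RS : Set (Fin n × Fin c → ℝ)) : Prop where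
  mul : ∀ μ : Mem, (∀ b < 20, μ b = μ₀ b) → mv.Sat μ ι fun μ' =>
    (∀ b < 40, b ≠ 28 → μ' b = μ b) ∧ μ'.rvec 28 n c = M *ᵥ μ.uvec 23 24 p m
  mulT : ∀ μ : Mem, (∀ b < 20, μ b = μ₀ b) → μ.rvec 22 n c ∈ RS → mvT.Sat μ ι fun μ' =>
    (∀ b < 40, b ≠ 25 → b ≠ 26 → μ' b = μ b) ∧ μ'.uvec 25 26 p m = Mᵀ *ᵥ μ.rvec 22 n c

section
variable {n m p c : ℕ} {ι : ℕ → ℕ} {μ₀ : Mem} {mv mvT : Blk} {ci : Ix}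
  {M : Matrix (Fin n × Fin c) (Fin p ⊕ Fin m) ℝ} {RS : Set (Fin n × Fin c → ℝ)}

/-- The memory holds the `k`-th state of the conjugate gradient method. -/
structure CGMem (μ₀ : Mem) (M : Matrix (Fin n × Fin c) (Fin p ⊕ Fin m) ℝ) (thr : ℝ)
    (x : CGState (Fin n × Fin c) (Fin p ⊕ Fin m)) (μ : Mem) : Prop where
  frame : ∀ b < 20, μ b = μ₀ b
  u : μ.uvec 20 21 p m = x.u
  r : μ.rvec 22 n c = x.r
  p : μ.uvec 23 24 p m = x.p
  ss : μ.sc 27 = x.s M ⬝ᵥ x.s M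
  rr : μ.sc 33 = x.r ⬝ᵥ x.r
  thr : μ.sc 34 = thr

theorem Mem.uvec_congr {μ μ' : Mem} {a b a' b' : ℕ} (h1 : ∀ i < p, μ a i 0 0 = μ' a' i 0 0)
    (h2 : ∀ i < m, μ b i 0 0 = μ' b' i 0 0) : μ.uvec a b p m = μ'.uvec a' b' p m := by
  funext x
  rcases x with x | x
  · exact h1 x x.2
  · exact h2 x x.2

/-- Symbolic execution of one pass of conjugate gradients. The two nonvanishing hypotheses are the
denominators of the step length and of the direction update. The residual stays in `RS`, where the
transposed product is known to be correct. -/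
theorem cgBody_sat (hι0 : ι 0 = n) (hι1 : ι 1 = m) (hι2 : ι 2 = p) (hci : ci.below 3 = true)
    (hc : ixv ι ci = c) (H : Matvec ι μ₀ mv mvT M RS) {thr : ℝ}
    {x : CGState (Fin n × Fin c) (Fin p ⊕ Fin m)} {μ : Mem}
    (hx : CGMem μ₀ M thr x μ) (hq : x.q M ⬝ᵥ x.q M ≠ 0) (hs : x.s M ⬝ᵥ x.s M ≠ 0)
    (hRS : (x.next M).r ∈ RS) :
    (cgBody ci mv mvT).Sat μ ι (CGMem μ₀ M thr (x.next M)) := by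
  refine Blk.Sat.append ((H.mul μ hx.frame).mono fun μ1 ⟨f1, v1⟩ => ?_)
  refine Blk.Sat.append ?_
  have hq1 : ∀ i j, (normSqR ci 28).ev μ1 6 (Function.update (Function.update ι 4 i) 5 j) =
      x.q M ⬝ᵥ x.q M := fun i j => by
    rw [ev_normSqR hι0 hci hc, v1, hx.p]; rfl
  refine Blk.Sat.cons (fun i _ j _ => Tm.ok_div trivial (Tm.ok_of_total _ _ _ rfl)
    (by rw [hq1]; exact hq)) fun μ2 f2 v2 => ?_
  have a2 : μ2 29 0 0 0 = x.alpha M := by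
    rw [v2 0 (by simp [ixv]) 0 (by simp [ixv])]
    simp only [Fill.val, Tm.ev_div, hq1]
    simp only [Tm.ev, ixv, f1 27 (by norm_num) (by norm_num)]
    rw [show μ 27 0 0 0 = μ.sc 27 from rfl, hx.ss]
    rfl
  refine Blk.Sat.cons (Fill.ok_of_total rfl) fun μ3 f3 v3 => ?_
  refine Blk.Sat.cons (Fill.ok_of_total rfl) fun μ4 f4 v4 => ?_
  refine Blk.Sat.cons (Fill.ok_of_total rfl) fun μ5 f5 v5 => ?_
  refine Blk.Sat.nil (Blk.Sat.append ?_)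
  simp only [setSc, setZ, setY, setMat, ixv_var, ixv_lit, hι0, hι1, hι2, hc]
    at f2 v2 f3 v3 f4 v4 f5 v5
  -- What the product and the update of iterate and residual leave untouched; this carries the
  -- search direction and the old squared gradient norm to the second half of the pass.
  have g5 : ∀ b < 40, b ≠ 28 → b ≠ 29 → b ≠ 20 → b ≠ 21 → b ≠ 22 → μ5 b = μ b := by
    intro b h0 h1 h2 h3 h4 h5
    rw [f5 b h5, f4 b h4, f3 b h3, f2 b h2, f1 b h0 h1]
  have r5 : μ5.rvec 22 n c = (x.next M).r := by
    funext ⟨i, j⟩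
    simp only [Mem.rvec, CGState.next]
    rw [v5 i i.2 j j.2]
    simp only [Fill.val, Tm.ev_sub, Tm.ev_mul]
    simp only [Tm.ev, ixv, Function.update_self, Function.update_of_ne (show 4 ≠ 5 by norm_num)]
    rw [f4 22 (by norm_num), f3 22 (by norm_num), f2 22 (by norm_num), f1 22 (by norm_num)
      (by norm_num), f4 29 (by norm_num), f3 29 (by norm_num), a2, f4 28 (by norm_num),
      f3 28 (by norm_num), f2 28 (by norm_num)]
    have h1 := congrFun v1 (i, j)
    have h2 := congrFun hx.r (i, j)
    simp only [Mem.rvec] at h1 h2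
    rw [h1, h2, hx.p]
    rfl
  have u5 : μ5.uvec 20 21 p m = (x.next M).u := by
    funext y
    rcases y with i | i
    · have h1 := congrFun hx.u (.inl i)
      have h2 := congrFun hx.p (.inl i)
      simp only [Mem.uvec, Mem.vec, Sum.elim_inl] at h1 h2
      simp only [Mem.uvec, Mem.vec, Sum.elim_inl, CGState.next]
      rw [f5 20 (by norm_num), f4 20 (by norm_num), v3 i i.2 0 one_pos]
      simp only [Fill.val, Tm.ev_add, Tm.ev_mul]
      simp only [Tm.ev, ixv, Function.update_self, Function.update_of_ne (show 4 ≠ 5 by norm_num)]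
      rw [a2, f2 20 (by norm_num), f2 23 (by norm_num), f1 20 (by norm_num) (by norm_num),
        f1 23 (by norm_num) (by norm_num), h1, h2]
      rfl
    · have h1 := congrFun hx.u (.inr i)
      have h2 := congrFun hx.p (.inr i)
      simp only [Mem.uvec, Mem.vec, Sum.elim_inr] at h1 h2
      simp only [Mem.uvec, Mem.vec, Sum.elim_inr, CGState.next]
      rw [f5 21 (by norm_num), v4 i i.2 0 one_pos]
      simp only [Fill.val, Tm.ev_add, Tm.ev_mul]
      simp only [Tm.ev, ixv, Function.update_self, Function.update_of_ne (show 4 ≠ 5 by norm_num)]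
      rw [f3 29 (by norm_num), a2, f3 21 (by norm_num), f3 24 (by norm_num), f2 21 (by norm_num),
        f2 24 (by norm_num), f1 21 (by norm_num) (by norm_num),
        f1 24 (by norm_num) (by norm_num), h1, h2]
      rfl
  refine (H.mulT μ5 (fun b hb => by rw [g5 b (by omega) (by omega) (by omega) (by omega)
    (by omega) (by omega), hx.frame b hb]) (by rw [r5]; exact hRS)).mono fun μ6 ⟨f6, v6⟩ => ?_
  rw [r5] at v6
  refine Blk.Sat.cons (Fill.ok_of_total rfl) fun μ7 f7 v7 => ?_
  have s7 : μ7 31 0 0 0 = (x.next M).s M ⬝ᵥ (x.next M).s M := by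
    rw [v7 0 (by simp [ixv]) 0 (by simp [ixv])]
    simp only [Fill.val]
    rw [ev_normSqU hι2 hι1, v6]
    rfl
  simp only at f7
  have s27 : μ7 27 0 0 0 = x.s M ⬝ᵥ x.s M := by
    rw [f7 27 (by norm_num), f6 27 (by norm_num) (by norm_num) (by norm_num), g5 27 (by norm_num)
      (by norm_num) (by norm_num) (by norm_num) (by norm_num) (by norm_num)]
    exact hx.ss
  refine Blk.Sat.cons (fun i _ j _ => Tm.ok_div trivial trivial
    (by simp only [Tm.ev, ixv]; rw [s27]; exact hs)) fun μ8 f8 v8 => ?_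
  have b8 : μ8 30 0 0 0 = (x.next M).s M ⬝ᵥ (x.next M).s M / (x.s M ⬝ᵥ x.s M) := by
    rw [v8 0 (by simp [ixv]) 0 (by simp [ixv])]
    simp only [Fill.val, Tm.ev_div]
    simp only [Tm.ev, ixv]
    rw [s7, s27]
  refine Blk.Sat.cons (Fill.ok_of_total rfl) fun μ9 f9 v9 => ?_
  refine Blk.Sat.cons (Fill.ok_of_total rfl) fun μ10 f10 v10 => ?_
  refine Blk.Sat.cons (Fill.ok_of_total rfl) fun μ11 f11 v11 => ?_
  refine Blk.Sat.cons (Fill.ok_of_total rfl) fun μ12 f12 v12 => ?_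
  refine Blk.Sat.nil ?_
  simp only [setSc, setZ, setY, ixv, hι1, hι2] at f8 f9 v9 f10 v10 f11 v11 f12 v12
  have g12 : ∀ b < 40, b ≠ 33 → b ≠ 27 → b ≠ 24 → b ≠ 23 → b ≠ 30 → b ≠ 31 → b ≠ 25 → b ≠ 26 →
      μ12 b = μ5 b := by
    intro b h0 h1 h2 h3 h4 h5 h6 h7 h8
    rw [f12 b h1, f11 b h2, f10 b h3, f9 b h4, f8 b h5, f7 b h6, f6 b h0 h7 h8]
  refine ⟨?_, ?_, ?_, ?_, ?_, ?_, ?_⟩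
  · intro b hb
    rw [g12 b (by omega) (by omega) (by omega) (by omega) (by omega) (by omega) (by omega)
      (by omega) (by omega), g5 b (by omega) (by omega) (by omega) (by omega) (by omega)
      (by omega), hx.frame b hb]
  · rw [← u5]
    refine Mem.uvec_congr (fun i _ => ?_) (fun i _ => ?_) <;>
      rw [g12 _ (by norm_num) (by norm_num) (by norm_num) (by norm_num) (by norm_num)
        (by norm_num) (by norm_num) (by norm_num) (by norm_num)]
  · rw [← r5]
    funext y
    simp only [Mem.rvec]
    rw [g12 _ (by norm_num) (by norm_num) (by norm_num) (by norm_num) (by norm_num)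
        (by norm_num) (by norm_num) (by norm_num) (by norm_num)]
  · funext y
    rcases y with i | i
    · have h1 := congrFun v6 (.inl i)
      have h2 := congrFun hx.p (.inl i)
      simp only [Mem.uvec, Mem.vec, Sum.elim_inl] at h1 h2
      simp only [Mem.uvec, Mem.vec, Sum.elim_inl]
      rw [f12 23 (by norm_num), f11 23 (by norm_num), f10 23 (by norm_num), v9 i i.2 0 one_pos]
      simp only [Fill.val, Tm.ev_add, Tm.ev_mul]
      simp only [Tm.ev, ixv, Function.update_self, Function.update_of_ne (show 4 ≠ 5 by norm_num)]
      rw [b8, f8 25 (by norm_num), f7 25 (by norm_num), h1, f8 23 (by norm_num),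
        f7 23 (by norm_num), f6 23 (by norm_num) (by norm_num) (by norm_num),
        g5 23 (by norm_num) (by norm_num) (by norm_num) (by norm_num) (by norm_num)
        (by norm_num), h2]
      rfl
    · have h1 := congrFun v6 (.inr i)
      have h2 := congrFun hx.p (.inr i)
      simp only [Mem.uvec, Mem.vec, Sum.elim_inr] at h1 h2
      simp only [Mem.uvec, Mem.vec, Sum.elim_inr]
      rw [f12 24 (by norm_num), f11 24 (by norm_num), v10 i i.2 0 one_pos]
      simp only [Fill.val, Tm.ev_add, Tm.ev_mul]
      simp only [Tm.ev, ixv, Function.update_self, Function.update_of_ne (show 4 ≠ 5 by norm_num)]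
      rw [f9 30 (by norm_num), b8, f9 26 (by norm_num), f8 26 (by norm_num), f7 26 (by norm_num),
        h1, f9 24 (by norm_num), f8 24 (by norm_num),
        f7 24 (by norm_num), f6 24 (by norm_num) (by norm_num) (by norm_num),
        g5 24 (by norm_num) (by norm_num) (by norm_num) (by norm_num) (by norm_num)
        (by norm_num), h2]
      rfl
  · rw [Mem.sc, f12 27 (by norm_num), v11 0 one_pos 0 one_pos]
    simp only [Fill.val]
    simp only [Tm.ev, ixv]
    rw [f10 31 (by norm_num), f9 31 (by norm_num), f8 31 (by norm_num), s7]
  · rw [Mem.sc, v12 0 one_pos 0 one_pos, Fill.val, ev_normSqR hι0 hci hc]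
    have : μ11.rvec 22 n c = (x.next M).r := by
      rw [← r5]
      funext y
      simp only [Mem.rvec]
      rw [f11 22 (by norm_num), f10 22 (by norm_num), f9 22 (by norm_num), f8 22 (by norm_num),
        f7 22 (by norm_num), f6 22 (by norm_num) (by norm_num) (by norm_num)]
    rw [this]
  · rw [Mem.sc, g12 _ (by norm_num) (by norm_num) (by norm_num) (by norm_num) (by norm_num)
        (by norm_num) (by norm_num) (by norm_num) (by norm_num), g5 _ (by norm_num) (by norm_num)
        (by norm_num) (by norm_num) (by norm_num) (by norm_num)]
    exact hx.thr

/-- The right-hand side is the residual of the starting point `0`, so the first gradient and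
direction are both `MᵀR`. The threshold is fixed relative to the initial squared residual. -/
theorem cgInit_sat (hι0 : ι 0 = n) (hι1 : ι 1 = m) (hι2 : ι 2 = p) (hci : ci.below 3 = true)
    (hc : ixv ι ci = c) (H : Matvec ι μ₀ mv mvT M RS) {μ : Mem} (hμ : ∀ b < 20, μ b = μ₀ b)
    (hRS : μ.rvec 22 n c ∈ RS) :
    (cgInit ci mvT).Sat μ ι (CGMem μ₀ M (μ.sc 35 * (μ.rvec 22 n c ⬝ᵥ μ.rvec 22 n c))
      (cg M (μ.rvec 22 n c) 0)) := by
  refine Blk.Sat.append ((H.mulT μ hμ hRS).mono fun μ1 ⟨f1, v1⟩ => ?_)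
  refine Blk.Sat.cons (Fill.ok_of_total rfl) fun μ2 f2 v2 => ?_
  refine Blk.Sat.cons (Fill.ok_of_total rfl) fun μ3 f3 v3 => ?_
  refine Blk.Sat.cons (Fill.ok_of_total rfl) fun μ4 f4 v4 => ?_
  refine Blk.Sat.cons (Fill.ok_of_total rfl) fun μ5 f5 v5 => ?_
  refine Blk.Sat.cons (Fill.ok_of_total rfl) fun μ6 f6 v6 => ?_
  refine Blk.Sat.cons (Fill.ok_of_total rfl) fun μ7 f7 v7 => ?_
  refine Blk.Sat.cons (Fill.ok_of_total rfl) fun μ8 f8 v8 => ?_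
  refine Blk.Sat.nil ?_
  simp only [setSc, setZ, setY, ixv, hι1, hι2] at f2 v2 f3 v3 f4 v4 f5 v5 f6 v6 f7 v7 f8 v8
  have r22 : ∀ y, μ6.rvec 22 n c y = μ.rvec 22 n c y := by
    intro y
    simp only [Mem.rvec]
    rw [f6 22 (by norm_num), f5 22 (by norm_num), f4 22 (by norm_num),
      f3 22 (by norm_num), f2 22 (by norm_num), f1 22 (by norm_num) (by norm_num) (by norm_num)]
  have rr : μ7 33 0 0 0 = μ.rvec 22 n c ⬝ᵥ μ.rvec 22 n c := by
    rw [v7 0 one_pos 0 one_pos, Fill.val, ev_normSqR hι0 hci hc, funext r22]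
  refine ⟨?_, ?_, ?_, ?_, ?_, ?_, ?_⟩
  · intro b hb
    rw [f8 b (by omega), f7 b (by omega), f6 b (by omega), f5 b (by omega), f4 b (by omega),
      f3 b (by omega), f2 b (by omega), f1 b (by omega) (by omega) (by omega), hμ b hb]
  · funext y
    rcases y with i | i
    · simp only [Mem.uvec, Mem.vec, Sum.elim_inl, cg]
      rw [f8 20 (by norm_num), f7 20 (by norm_num), f6 20 (by norm_num), f5 20 (by norm_num),
        f4 20 (by norm_num), f3 20 (by norm_num), v2 i i.2 0 one_pos]
      simp [Fill.val, Tm.ev]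
    · simp only [Mem.uvec, Mem.vec, Sum.elim_inr, cg]
      rw [f8 21 (by norm_num), f7 21 (by norm_num), f6 21 (by norm_num), f5 21 (by norm_num),
        f4 21 (by norm_num), v3 i i.2 0 one_pos]
      simp [Fill.val, Tm.ev]
  · funext y
    change _ = μ.rvec 22 n c y
    rw [← r22 y]
    simp only [Mem.rvec]
    rw [f8 22 (by norm_num), f7 22 (by norm_num)]
  · funext y
    rcases y with i | i
    · simp only [Mem.uvec, Mem.vec, Sum.elim_inl, cg]
      rw [f8 23 (by norm_num), f7 23 (by norm_num), f6 23 (by norm_num), f5 23 (by norm_num),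
        v4 i i.2 0 one_pos]
      simp only [Fill.val, Tm.ev, ixv, Function.update_self,
        Function.update_of_ne (show 4 ≠ 5 by norm_num)]
      rw [f3 25 (by norm_num), f2 25 (by norm_num)]
      exact congrFun v1 (.inl i)
    · simp only [Mem.uvec, Mem.vec, Sum.elim_inr, cg]
      rw [f8 24 (by norm_num), f7 24 (by norm_num), f6 24 (by norm_num),
        v5 i i.2 0 one_pos]
      simp only [Fill.val, Tm.ev, ixv, Function.update_self,
        Function.update_of_ne (show 4 ≠ 5 by norm_num)]
      rw [f4 26 (by norm_num), f3 26 (by norm_num), f2 26 (by norm_num)]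
      exact congrFun v1 (.inr i)
  · rw [Mem.sc, f8 27 (by norm_num), f7 27 (by norm_num), v6 0 one_pos 0 one_pos, Fill.val,
      ev_normSqU hι2 hι1]
    have : μ5.uvec 25 26 p m = Mᵀ *ᵥ μ.rvec 22 n c := by
      rw [← v1]
      refine Mem.uvec_congr (fun i _ => ?_) (fun i _ => ?_)
      · rw [f5 25 (by norm_num), f4 25 (by norm_num), f3 25 (by norm_num), f2 25 (by norm_num)]
      · rw [f5 26 (by norm_num), f4 26 (by norm_num), f3 26 (by norm_num), f2 26 (by norm_num)]
    rw [this]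
    rfl
  · rw [Mem.sc, f8 33 (by norm_num), rr]
    rfl
  · rw [Mem.sc, v8 0 one_pos 0 one_pos, Fill.val, Tm.ev_mul]
    simp only [Tm.ev, ixv]
    rw [rr, f7 35 (by norm_num), f6 35 (by norm_num), f5 35 (by norm_num), f4 35 (by norm_num),
      f3 35 (by norm_num), f2 35 (by norm_num), f1 35 (by norm_num) (by norm_num) (by norm_num)]
    rfl

theorem Agree.get_scRef {μ : Mem} {s : State} (h : Agree μ ι s) {a : ℕ} (ha : a ≠ 8) :
    s.get (scRef a) = μ.sc a := by
  change s.mem a 0 0 0 = _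
  rw [h.2 a ha]
  rfl

/-- The conjugate gradient loop, started from residual `R = M u`, stops with a polynomial
approximate solution of relative residual at most `θ`, in a number of passes of the order of the
condition number. -/
theorem cgLoop_tot {w : ℕ → ℕ} {d : ℕ} (hsz : Sized w n ι)
    (hι0 : ι 0 = n) (hι1 : ι 1 = m) (hι2 : ι 2 = p) (hci : ci.below 3 = true)
    (hc : ixv ι ci = c) (H : Matvec ι μ₀ mv mvT M RS)
    (hwf : (cgBody ci mv mvT).wf = true) (hdg : (cgBody ci mv mvT).dgle w d = true)
    {a b θ : ℝ} {u : Fin p ⊕ Fin m → ℝ} {R : Fin n × Fin c → ℝ} (hu : R = M *ᵥ u)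
    (hRS : ∀ v, M *ᵥ v ∈ RS)
    (hlo : ∀ v, a * (v ⬝ᵥ v) ≤ (M *ᵥ v) ⬝ᵥ (M *ᵥ v))
    (hhi : ∀ v, (M *ᵥ v) ⬝ᵥ (M *ᵥ v) ≤ b * (v ⬝ᵥ v)) (ha : 0 < a) (hb : 0 < b) (hθ : 0 < θ)
    (hR : R ≠ 0) {s : State} {μ : Mem} (hs : Agree μ ι s)
    (hμ : CGMem μ₀ M (θ ^ 2 * (R ⬝ᵥ R)) (cg M R 0) μ) :
    ∃ (k : ℕ) (f : ℝ[X]) (v : Fin p ⊕ Fin m → ℝ), f.natDegree ≤ k ∧ v = polySolve f M R ∧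
      (R - M *ᵥ v) ⬝ᵥ (R - M *ᵥ v) ≤ θ ^ 2 * (R ⬝ᵥ R) ∧
      (∀ a' b' : ℝ, 0 < a' → 0 < b' → (∀ v, a' * (v ⬝ᵥ v) ≤ (M *ᵥ v) ⬝ᵥ (M *ᵥ v)) →
        (∀ v, (M *ᵥ v) ⬝ᵥ (M *ᵥ v) ≤ b' * (v ⬝ᵥ v)) →
        (k : ℝ) ≤ 1 + Real.sqrt (b' / (θ * a'))) ∧
      Tot (cgLoop ci mv mvT) s (k * ((cgBody ci mv mvT).cf * n ^ d + 1) + 1) fun s' =>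
        ∃ μ', Agree μ' ι s' ∧ (∀ b < 20, μ' b = μ₀ b) ∧ μ'.uvec 20 21 p m = v := by
  obtain ⟨k, h1, h2, h3, h4⟩ := cg_stops M R hu hlo hhi ha hb hθ hR
  obtain ⟨f, hf, hfu⟩ := cg_poly M R k
  refine ⟨k, f, (cg M R k).u, hf, hfu, ?_, h4, ?_⟩
  · rw [← cg_residual_eq]
    exact not_lt.mp h2
  have := Tot.whileLt (a := scRef 34) (b := scRef 33) (p := (cgBody ci mv mvT).comp)
    (C := (cgBody ci mv mvT).cf * n ^ d)
    (fun k s => ∃ μ, Agree μ ι s ∧ CGMem μ₀ M (θ ^ 2 * (R ⬝ᵥ R)) (cg M R k) μ) k ?_ ?_ ⟨μ, hs, hμ⟩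
  · exact this.mono le_rfl fun s' ⟨μ', hs', hμ'⟩ => ⟨μ', hs', hμ'.frame, hμ'.u⟩
  · rintro i hi s ⟨μ, hs, hμ⟩
    refine ⟨?_, ?_⟩
    · rw [hs.get_scRef (by norm_num), hs.get_scRef (by norm_num), hμ.thr, hμ.rr]
      exact h1 i hi
    · refine (cgBody_sat hι0 hι1 hι2 hci hc H hμ ?_ ?_ ?_).tot hsz hwf hdg hs
      · exact ((cg_orth M R i fun j hj => h3 j (by omega)).2.2.2.2 (h3 i hi)).ne'
      · exact (dot_self_pos (h3 i hi)).ne'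
      · have := cg_residual_eq M R (i + 1)
        change (cg M R (i + 1)).r ∈ RS
        rw [this, hu, ← mulVec_sub]
        exact hRS _
  · rintro s ⟨μ, hs, hμ⟩
    rw [hs.get_scRef (by norm_num), hs.get_scRef (by norm_num), hμ.thr, hμ.rr]
    exact h2

end

/-! ### The outer loop -/

theorem exec_while_of_run {a b : Ref} {body : Cmd} (st : ℕ → State) (t : ℕ → ℕ) (K : ℕ)
    (h : ∀ k < K, (st k).get a < (st k).get b ∧ Exec body (st k) (t k) (st (k + 1)))
    (hK : ¬ (st K).get a < (st K).get b) :
    Exec (.whileLt a b body) (st 0) (∑ k ∈ Finset.range K, (t k + 1) + 1) (st K) := by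
  induction K generalizing st t with
  | zero => simpa using Exec.while_false hK
  | succ K ih =>
    have h1 := ih (fun k => st (k + 1)) (fun k => t (k + 1)) (fun k hk => h (k + 1) (by omega)) hK
    have h2 := Exec.while_true (h 0 (by omega)).1 (h 0 (by omega)).2 h1
    rw [Finset.sum_range_succ']
    convert h2 using 1
    ring

/-- The outer loop in abstract form: an invariant `Good`, a geometric decrease of `ν`, and a cost
per pass linear in the number of inner passes. Both optimization problems are instances. The bounds
for `κ` come last, since the run does not depend on `κ`. -/
theorem ipm_run {init body : Cmd} {s₀ : State} (Start Good : State → Prop)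
    (Step : ℝ[X] → State → State → Prop) (cond : State → ℝ) {ε ρ ν₀ C₁ : ℝ} {T₀ C₂ : ℕ}
    (hε : 0 < ε) (hρ0 : 0 ≤ ρ) (hρ : ρ < 1)
    (heps : ∀ s, Good s → s.get epsRef = ε)
    (hinit : Tot init s₀ T₀ fun s => Start s ∧ Good s ∧ s.get nuRef ≤ ν₀)
    (hbody : ∀ s, Good s → ε < s.get nuRef → ∃ (k : ℕ) (q : ℝ[X]), q.natDegree ≤ k ∧
      (∀ κ, 1 ≤ κ → cond s ≤ κ → (k : ℝ) ≤ C₁ * κ) ∧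
      Tot body s (C₂ * (k + 1)) fun s' =>
        Good s' ∧ Step q s s' ∧ s'.get nuRef ≤ ρ * s.get nuRef) :
    ∃ (T K : ℕ) (st : ℕ → State) (q : ℕ → ℝ[X]),
      Exec (ipm init body) s₀ T (st K) ∧ Run init body s₀ K st ∧ Start (st 0) ∧
      (∀ k ≤ K, Good (st k)) ∧ (∀ k < K, Step (q k) (st k) (st (k + 1))) ∧
      (st K).get nuRef ≤ ε ∧ (K ≠ 0 → ε < ρ ^ (K - 1) * ν₀) ∧
      ∀ κ, 1 ≤ κ → (∀ k < K, cond (st k) ≤ κ) →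
        (T : ℝ) ≤ T₀ + K * (C₂ * (C₁ * κ + 1) + 1) + 1 ∧
        ∀ k < K, ((q k).natDegree : ℝ) ≤ C₁ * κ := by
  classical
  obtain ⟨t₀, s1, hex, ht₀, hstart, hgood, hν⟩ := hinit
  -- A successor is chosen for every state, with a dummy value where the hypotheses fail, so that
  -- the sequence of states can be defined by plain recursion.
  have hnext : ∀ s : State, ∃ (x : ℕ × ℕ × ℝ[X] × State), Good s → ε < s.get nuRef →
      x.2.2.1.natDegree ≤ x.1 ∧ (∀ κ, 1 ≤ κ → cond s ≤ κ → (x.1 : ℝ) ≤ C₁ * κ) ∧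
      x.2.1 ≤ C₂ * (x.1 + 1) ∧ Exec body s x.2.1 x.2.2.2 ∧ Good x.2.2.2 ∧
      Step x.2.2.1 s x.2.2.2 ∧ x.2.2.2.get nuRef ≤ ρ * s.get nuRef := by
    intro s
    by_cases h : Good s ∧ ε < s.get nuRef
    · obtain ⟨k, q, h1, h2, t, s', h3, h4, h5, h6, h7⟩ := hbody s h.1 h.2
      exact ⟨(k, t, q, s'), fun _ _ => ⟨h1, h2, h4, h3, h5, h6, h7⟩⟩
    · exact ⟨(0, 0, 0, s), fun h1 h2 => absurd ⟨h1, h2⟩ h⟩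
  choose nx hnx using hnext
  let st : ℕ → State := fun k => Nat.rec s1 (fun _ s => (nx s).2.2.2) k
  have st_succ : ∀ k, st (k + 1) = (nx (st k)).2.2.2 := fun k => rfl
  have inv : ∀ k, (∀ i < k, ε < (st i).get nuRef) →
      Good (st k) ∧ (st k).get nuRef ≤ ρ ^ k * ν₀ := by
    intro k
    induction k with
    | zero =>
      refine fun _ => ⟨hgood, ?_⟩
      rw [pow_zero, one_mul]
      exact hν
    | succ k ih =>
      intro hk
      obtain ⟨h1, h2⟩ := ih fun i hi => hk i (by omega)
      have h3 := hnx (st k) h1 (hk k (by omega))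
      refine ⟨h3.2.2.2.2.1, h3.2.2.2.2.2.2.trans ?_⟩
      rw [pow_succ', mul_assoc]
      exact mul_le_mul_of_nonneg_left h2 hρ0
  have hhalt : ∃ K, (st K).get nuRef ≤ ε := by
    by_contra hcon
    push Not at hcon
    have hlim : Filter.Tendsto (fun k => ρ ^ k * ν₀) Filter.atTop (nhds (0 * ν₀)) :=
      (tendsto_pow_atTop_nhds_zero_of_lt_one hρ0 hρ).mul_const _
    rw [zero_mul] at hlim
    obtain ⟨k, hk⟩ := (hlim.eventually (gt_mem_nhds hε)).exists
    exact absurd (((inv k fun i _ => hcon i).2).trans_lt hk) (not_lt.mpr (hcon k).le)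
  set K := Nat.find hhalt with hK
  have hlt : ∀ k < K, ε < (st k).get nuRef := fun k hk => not_le.mp (Nat.find_min hhalt hk)
  have hg : ∀ k ≤ K, Good (st k) := fun k hk => (inv k fun i hi => hlt i (by omega)).1
  have hn : ∀ k < K, _ := fun k hk => hnx (st k) (hg k hk.le) (hlt k hk)
  have hfin : ¬ (st K).get epsRef < (st K).get nuRef := by
    rw [heps _ (hg K le_rfl), not_lt]
    exact Nat.find_spec hhalt
  have hrun : ∀ k < K, (st k).get epsRef < (st k).get nuRef ∧
      Exec body (st k) (nx (st k)).2.1 (st (k + 1)) := fun k hk =>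
    ⟨by rw [heps _ (hg k hk.le)]; exact hlt k hk, (hn k hk).2.2.2.1⟩
  refine ⟨_, K, st, fun k => (nx (st k)).2.2.1,
    Exec.seq hex (exec_while_of_run st (fun k => (nx (st k)).2.1) K hrun hfin),
    ⟨⟨t₀, hex⟩, fun k hk => ⟨(hrun k hk).1, _, (hrun k hk).2⟩, hfin⟩, hstart, hg,
    fun k hk => (hn k hk).2.2.2.2.2.1, Nat.find_spec hhalt, ?_, ?_⟩
  -- The exponent is `K - 1` because state `K - 1` is the last one in which the loop condition held.
  · intro h0
    exact (hlt (K - 1) (by omega)).trans_le (inv (K - 1) fun i hi => hlt i (by omega)).2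
  · intro κ hκ hcond
    refine ⟨?_, fun k hk => ?_⟩
    · have hsum : ∑ k ∈ Finset.range K, (((nx (st k)).2.1 : ℝ) + 1) ≤
          ∑ k ∈ Finset.range K, ((C₂ : ℝ) * (C₁ * κ + 1) + 1) := by
        refine Finset.sum_le_sum fun k hk => ?_
        have hk := Finset.mem_range.mp hk
        have h1 := (hn k hk).2.1 κ hκ (hcond k hk)
        have h2 : ((nx (st k)).2.1 : ℝ) ≤ C₂ * (((nx (st k)).1 : ℝ) + 1) := by
          exact_mod_cast (hn k hk).2.2.1
        have h3 : (C₂ : ℝ) * (((nx (st k)).1 : ℝ) + 1) ≤ C₂ * (C₁ * κ + 1) := by gcongr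
        linarith
      rw [Finset.sum_const, Finset.card_range, nsmul_eq_mul] at hsum
      have h0 : (t₀ : ℝ) ≤ T₀ := by exact_mod_cast ht₀
      push_cast
      linarith
    · have h1 : ((nx (st k)).2.2.1.natDegree : ℝ) ≤ (nx (st k)).1 := by
        exact_mod_cast (hn k hk).1
      exact h1.trans ((hn k hk).2.1 κ hκ (hcond k hk))

/-- Iteration bound: geometric decrease by `1 - d / √n` needs `O(√n log(1/ε))` iterations. -/
theorem iterations_le {n K : ℕ} {d ε ν₀ : ℝ} (hn : 0 < n) (hd : 0 < d) (hd1 : d < 1) (hε : 0 < ε)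
    (hK : K ≠ 0 → ε < (1 - d / Real.sqrt n) ^ (K - 1) * ν₀) :
    (K : ℝ) ≤ Real.sqrt n * Real.log (2 + 1 / ε) *
      ((1 + (Real.log (1 + |ν₀|)) / d) / Real.log 2 + 1 / d) := by
  have hn1 : 1 ≤ Real.sqrt n := by
    rw [Real.one_le_sqrt]; exact_mod_cast hn
  have hε' : 0 < 1 / ε := by positivity
  have hlog2 : 0 < Real.log 2 := Real.log_pos (by norm_num)
  have hL : Real.log 2 ≤ Real.log (2 + 1 / ε) := Real.log_le_log (by norm_num) (by linarith)
  set L := Real.log (2 + 1 / ε)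
  have hA : 0 ≤ Real.log (1 + |ν₀|) := Real.log_nonneg (by linarith [abs_nonneg ν₀])
  rcases Nat.eq_zero_or_pos K with rfl | hpos
  · simp only [Nat.cast_zero]
    have : 0 < L := lt_of_lt_of_le hlog2 hL
    positivity
  have h1 := hK hpos.ne'
  have hx1 : d / Real.sqrt n ≤ 1 := by
    rw [div_le_one (by linarith)]; linarith
  have h2 : (1 - d / Real.sqrt n) ^ (K - 1) ≤ Real.exp (-((K - 1 : ℕ) * (d / Real.sqrt n))) := by
    have := Real.one_sub_le_exp_neg (d / Real.sqrt n)
    calc _ ≤ (Real.exp (-(d / Real.sqrt n))) ^ (K - 1) :=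
          pow_le_pow_left₀ (by linarith) this _
      _ = _ := by rw [← Real.exp_nat_mul]; congr 1; ring
  -- No sign of `ν₀` is assumed; `1 + |ν₀|` replaces it and has a nonnegative logarithm.
  have h3 : ε < Real.exp (-((K - 1 : ℕ) * (d / Real.sqrt n))) * (1 + |ν₀|) := by
    refine h1.trans_le (mul_le_mul h2 (by linarith [le_abs_self ν₀]) ?_ (Real.exp_pos _).le)
    by_contra hneg
    push Not at hneg
    have : (1 - d / Real.sqrt n) ^ (K - 1) * ν₀ ≤ 0 :=
      mul_nonpos_of_nonneg_of_nonpos (pow_nonneg (by linarith) _) hneg.le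
    linarith
  have h4 := Real.log_lt_log hε h3
  rw [Real.log_mul (Real.exp_pos _).ne' (by linarith [abs_nonneg ν₀]), Real.log_exp] at h4
  have h5 : -Real.log ε ≤ L := by
    rw [← Real.log_inv]
    exact Real.log_le_log (by positivity) (by rw [one_div]; linarith)
  have h6 : ((K - 1 : ℕ) : ℝ) = K - 1 := by
    rw [Nat.cast_sub hpos, Nat.cast_one]
  rw [h6] at h4
  have h7 : ((K : ℝ) - 1) * (d / Real.sqrt n) ≤ Real.log (1 + |ν₀|) + L := by linarith
  have h8 : (K : ℝ) - 1 ≤ (Real.log (1 + |ν₀|) + L) * (Real.sqrt n / d) := by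
    have : ((K : ℝ) - 1) = ((K : ℝ) - 1) * (d / Real.sqrt n) * (Real.sqrt n / d) := by
      field_simp
    rw [this]
    gcongr
  have h9 : 1 ≤ Real.sqrt n * L / Real.log 2 := by
    rw [le_div_iff₀ hlog2, one_mul]
    nlinarith
  have h10 : Real.log (1 + |ν₀|) ≤ Real.log (1 + |ν₀|) * (L / Real.log 2) :=
    le_mul_of_one_le_right hA (by rwa [le_div_iff₀ hlog2, one_mul])
  have h11 : (Real.log (1 + |ν₀|) + L) * (Real.sqrt n / d) ≤
      (Real.log (1 + |ν₀|) * (L / Real.log 2) + L) * (Real.sqrt n / d) := by gcongr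
  calc (K : ℝ) ≤ Real.sqrt n * L / Real.log 2 +
        (Real.log (1 + |ν₀|) * (L / Real.log 2) + L) * (Real.sqrt n / d) := by linarith
    _ = _ := by field_simp; ring

/-- The constant of the complexity bound. -/
def boundConst (d ν₀ C₁ C₂ : ℝ) : ℝ :=
  (C₂ + 1 + C₁) / Real.log 2 +
    ((1 + (Real.log (1 + |ν₀|)) / d) / Real.log 2 + 1 / d) * (C₂ * (C₁ + 1) + 1)

theorem boundConst_pos {d ν₀ C₁ C₂ : ℝ} (hd : 0 < d) (h1 : 0 ≤ C₁) (h2 : 0 ≤ C₂) :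
    0 < boundConst d ν₀ C₁ C₂ := by
  have hlog2 : 0 < Real.log 2 := Real.log_pos (by norm_num)
  have hA : 0 ≤ Real.log (1 + |ν₀|) := Real.log_nonneg (by linarith [abs_nonneg ν₀])
  unfold boundConst
  positivity

/-- The `√n` from the iteration count turns `n^e` into `n^(e + 1/2)`. The part of `boundConst`
divided by `log 2` pays for initialization, the last loop test and the degree bound, because the
logarithm of `2 + 1/ε` is at least `log 2`. -/
theorem complexity_bound {n K e : ℕ} {d ε ν₀ C₁ C₂ κ T : ℝ} (hn : 0 < n) (hd : 0 < d) (hd1 : d < 1)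
    (hε : 0 < ε) (h1 : 0 ≤ C₁) (h2 : 0 ≤ C₂) (hκ : 1 ≤ κ)
    (hK : K ≠ 0 → ε < (1 - d / Real.sqrt n) ^ (K - 1) * ν₀)
    (hT : T ≤ C₂ * n ^ e + K * (C₂ * n ^ e * (C₁ * κ + 1) + 1) + 1) :
    T ≤ boundConst d ν₀ C₁ C₂ * (n : ℝ) ^ ((e : ℝ) + 1 / 2) * κ * polylog 1 κ ε ∧
    C₁ * κ ≤ boundConst d ν₀ C₁ C₂ * κ * polylog 1 κ ε := by
  have hlog2 : 0 < Real.log 2 := Real.log_pos (by norm_num)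
  have hA : 0 ≤ Real.log (1 + |ν₀|) := Real.log_nonneg (by linarith [abs_nonneg ν₀])
  have hε' : 0 < 1 / ε := by positivity
  have hL : Real.log 2 ≤ Real.log (2 + 1 / ε) := Real.log_le_log (by norm_num) (by linarith)
  have hKb := iterations_le hn hd hd1 hε hK
  have hn1 : (1 : ℝ) ≤ n := by exact_mod_cast hn
  have hs1 : 1 ≤ Real.sqrt n := by rwa [Real.one_le_sqrt]
  have hpow : (n : ℝ) ^ ((e : ℝ) + 1 / 2) = n ^ e * Real.sqrt n := by
    rw [Real.rpow_add (by linarith), Real.rpow_natCast, Real.sqrt_eq_rpow]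
  -- As `κ ≥ 1` gives `2 + κ ≥ 3 > e`, the factor `log(2 + κ)` is not really used; it is only
  -- bounded below by 1.
  have hκl : 1 ≤ Real.log (2 + κ) := by
    rw [Real.le_log_iff_exp_le (by linarith)]
    linarith [Real.exp_one_lt_d9]
  have hne : (1 : ℝ) ≤ n ^ e := one_le_pow₀ hn1
  set L := Real.log (2 + 1 / ε)
  set A := (1 + (Real.log (1 + |ν₀|)) / d) / Real.log 2 + 1 / d with hAdef
  have hA0 : 0 ≤ A := by positivity
  have hL0 : 0 < L := hlog2.trans_le hL
  have hLl : 1 ≤ L / Real.log 2 := by rwa [le_div_iff₀ hlog2, one_mul]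
  have hP : L ≤ polylog 1 κ ε := by
    unfold polylog
    rw [pow_one]
    exact le_mul_of_one_le_left hL0.le hκl
  have hB : boundConst d ν₀ C₁ C₂ = (C₂ + 1 + C₁) / Real.log 2 + A * (C₂ * (C₁ + 1) + 1) := rfl
  have hB0 := boundConst_pos (ν₀ := ν₀) hd h1 h2
  refine ⟨?_, ?_⟩
  · have e1 : C₂ * n ^ e + 1 ≤ (C₂ + 1) * (n ^ e * Real.sqrt n * κ * (L / Real.log 2)) := by
      have : (n : ℝ) ^ e ≤ n ^ e * Real.sqrt n * κ * (L / Real.log 2) := by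
        calc (n : ℝ) ^ e = n ^ e * 1 * 1 * 1 := by ring
          _ ≤ _ := by gcongr
      calc C₂ * n ^ e + 1 ≤ (C₂ + 1) * n ^ e := by linarith
        _ ≤ _ := by gcongr
    have e2 : C₂ * n ^ e * (C₁ * κ + 1) + 1 ≤ n ^ e * κ * (C₂ * (C₁ + 1) + 1) := by
      have h3 : 1 ≤ n ^ e * κ := by nlinarith
      have h4 : C₂ * n ^ e * (C₁ * κ + 1) ≤ C₂ * n ^ e * (C₁ * κ + κ) := by gcongr
      linarith
    have e3 : K * (C₂ * n ^ e * (C₁ * κ + 1) + 1) ≤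
        (Real.sqrt n * L * A) * (n ^ e * κ * (C₂ * (C₁ + 1) + 1)) := by
      have : 0 ≤ C₂ * (n : ℝ) ^ e * (C₁ * κ + 1) + 1 := by positivity
      gcongr
    rw [hpow]
    have hC : 0 ≤ C₁ / Real.log 2 * (n ^ e * Real.sqrt n * κ * L) := by positivity
    calc T ≤ boundConst d ν₀ C₁ C₂ * (n ^ e * Real.sqrt n) * κ * L := by
          have e4 : boundConst d ν₀ C₁ C₂ * (n ^ e * Real.sqrt n) * κ * L =
            (C₂ + 1) * (n ^ e * Real.sqrt n * κ * (L / Real.log 2)) +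
            C₁ / Real.log 2 * (n ^ e * Real.sqrt n * κ * L) +
            (Real.sqrt n * L * A) * (n ^ e * κ * (C₂ * (C₁ + 1) + 1)) := by
            rw [hB]; ring
          rw [e4]; linarith
      _ ≤ _ := by gcongr
  · have e1 : C₁ * κ ≤ boundConst d ν₀ C₁ C₂ * κ * L := by
      have h3 : C₁ ≤ C₁ / Real.log 2 * L := by
        rw [div_mul_eq_mul_div, mul_div_assoc]
        exact le_mul_of_one_le_right h1 hLl
      have h4 : C₁ / Real.log 2 ≤ boundConst d ν₀ C₁ C₂ := by
        rw [hB]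
        have h5 : C₁ / Real.log 2 ≤ (C₂ + 1 + C₁) / Real.log 2 := by gcongr; linarith
        have h6 : 0 ≤ A * (C₂ * (C₁ + 1) + 1) := by positivity
        linarith
      have h5 : C₁ / Real.log 2 * L ≤ boundConst d ν₀ C₁ C₂ * L := by gcongr
      calc C₁ * κ ≤ (boundConst d ν₀ C₁ C₂ * L) * κ := by gcongr; linarith
        _ = _ := by ring
    exact e1.trans (by gcongr)

/-! ### Singular values -/

section
variable {ρ υ : Type*} [Fintype ρ] [Fintype υ]

theorem vnorm_sq (v : ρ → ℝ) : vnorm v ^ 2 = v ⬝ᵥ v := by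
  rw [vnorm, Real.sq_sqrt (Finset.sum_nonneg fun _ _ => sq_nonneg _)]
  simp [dotProduct, sq]

theorem vnorm_nonneg (v : ρ → ℝ) : 0 ≤ vnorm v := Real.sqrt_nonneg _

theorem vnorm_eq_sqrt_dot (v : ρ → ℝ) : vnorm v = Real.sqrt (v ⬝ᵥ v) := by
  rw [← vnorm_sq, Real.sqrt_sq (vnorm_nonneg v)]

theorem vnorm_smul (c : ℝ) (v : ρ → ℝ) : vnorm (c • v) = |c| * vnorm v := by
  rw [vnorm_eq_sqrt_dot, vnorm_eq_sqrt_dot, smul_dotProduct, dotProduct_smul, smul_smul,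
    smul_eq_mul, Real.sqrt_mul (mul_self_nonneg c), Real.sqrt_mul_self_eq_abs]

/-- An injective linear map between finite-dimensional spaces is bounded below and above. The
constants are not explicit: they serve to show that the smallest singular value is positive and the
largest finite. -/
theorem exists_sq_bounds (M : Matrix ρ υ ℝ) (h : ∀ v, M *ᵥ v = 0 → v = 0) :
    ∃ a b : ℝ, 0 < a ∧ 0 < b ∧ (∀ v, a * (v ⬝ᵥ v) ≤ (M *ᵥ v) ⬝ᵥ (M *ᵥ v)) ∧
      ∀ v, (M *ᵥ v) ⬝ᵥ (M *ᵥ v) ≤ b * (v ⬝ᵥ v) := by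
  classical
  let E := EuclideanSpace ℝ υ
  let F := EuclideanSpace ℝ ρ
  let f : E →ₗ[ℝ] F := (WithLp.linearEquiv 2 ℝ (ρ → ℝ)).symm.toLinearMap ∘ₗ
    M.mulVecLin ∘ₗ (WithLp.linearEquiv 2 ℝ (υ → ℝ)).toLinearMap
  have hf : ∀ v : υ → ℝ, f (WithLp.toLp 2 v) = WithLp.toLp 2 (M *ᵥ v) := fun v => rfl
  have hn : ∀ v : υ → ℝ, ‖(WithLp.toLp 2 v : E)‖ ^ 2 = v ⬝ᵥ v := fun v => by
    rw [EuclideanSpace.real_norm_sq_eq]; simp [dotProduct, sq]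
  have hn' : ∀ v : ρ → ℝ, ‖(WithLp.toLp 2 v : F)‖ ^ 2 = v ⬝ᵥ v := fun v => by
    rw [EuclideanSpace.real_norm_sq_eq]; simp [dotProduct, sq]
  have hker : LinearMap.ker f = ⊥ := by
    rw [LinearMap.ker_eq_bot']
    intro v hv
    have h1 : f v = WithLp.toLp 2 (M *ᵥ (WithLp.ofLp v)) := rfl
    rw [h1] at hv
    have h2 : M *ᵥ (WithLp.ofLp v) = 0 := by
      simpa using congrArg WithLp.ofLp hv
    have h3 := h _ h2
    ext i
    exact congrFun h3 i
  obtain ⟨K, hK, hanti⟩ := f.exists_antilipschitzWith hker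
  set g := LinearMap.toContinuousLinearMap f
  refine ⟨1 / (K : ℝ) ^ 2, ‖g‖ ^ 2 + 1, by positivity, by positivity, fun v => ?_, fun v => ?_⟩
  · have h1 := hanti.le_mul_norm_sub (WithLp.toLp 2 v : E) 0
    rw [map_zero, add_zero, add_zero, norm_neg, norm_neg, hf] at h1
    rw [← hn, ← hn', div_mul_eq_mul_div, one_mul, div_le_iff₀ (by positivity)]
    calc _ ≤ ((K : ℝ) * ‖(WithLp.toLp 2 (M *ᵥ v) : F)‖) ^ 2 := by gcongr
      _ = _ := by ring
  · have h1 := g.le_opNorm (WithLp.toLp 2 v : E)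
    have h2 : g (WithLp.toLp 2 v) = WithLp.toLp 2 (M *ᵥ v) := rfl
    rw [h2] at h1
    rw [← hn, ← hn']
    calc _ ≤ (‖g‖ * ‖(WithLp.toLp 2 v : E)‖) ^ 2 := by gcongr
      _ = ‖g‖ ^ 2 * ‖(WithLp.toLp 2 v : E)‖ ^ 2 := by ring
      _ ≤ _ := by nlinarith [sq_nonneg ‖(WithLp.toLp 2 v : E)‖]

/-- For an injective matrix, the extreme singular values are attained as bounds and their
quotient is the condition number. -/
theorem condNumber_bounds [Nonempty υ] (M : Matrix ρ υ ℝ) (h : ∀ v, M *ᵥ v = 0 → v = 0) :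
    ∃ a b : ℝ, 0 < a ∧ 0 < b ∧ condNumber M = b / a ∧
      (∀ v, a ^ 2 * (v ⬝ᵥ v) ≤ (M *ᵥ v) ⬝ᵥ (M *ᵥ v)) ∧
      ∀ v, (M *ᵥ v) ⬝ᵥ (M *ᵥ v) ≤ b ^ 2 * (v ⬝ᵥ v) := by
  classical
  obtain ⟨a₀, b₀, ha₀, hb₀, hlo, hhi⟩ := exists_sq_bounds M h
  set S := {r : ℝ | ∃ u : υ → ℝ, vnorm u = 1 ∧ r = vnorm (M *ᵥ u)} with hS
  have unit : ∀ u : υ → ℝ, vnorm u = 1 → u ⬝ᵥ u = 1 := fun u hu => by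
    rw [← vnorm_sq, hu, one_pow]
  have bdA : ∀ r ∈ S, r ≤ Real.sqrt b₀ := by
    rintro r ⟨u, hu, rfl⟩
    apply Real.le_sqrt_of_sq_le
    rw [vnorm_sq]
    simpa [unit u hu] using hhi u
  have bdB : ∀ r ∈ S, Real.sqrt a₀ ≤ r := by
    rintro r ⟨u, hu, rfl⟩
    apply Real.sqrt_le_iff.mpr ⟨vnorm_nonneg _, ?_⟩
    rw [vnorm_sq]
    simpa [unit u hu] using hlo u
  have hne : S.Nonempty := by
    obtain ⟨i⟩ := ‹Nonempty υ›
    refine ⟨_, Pi.single i 1, ?_, rfl⟩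
    rw [vnorm_eq_sqrt_dot]
    simp
  have habove : BddAbove S := ⟨_, bdA⟩
  have hbelow : BddBelow S := ⟨_, bdB⟩
  have hmin : 0 < sigmaMin M := lt_of_lt_of_le (Real.sqrt_pos.mpr ha₀) (le_csInf hne bdB)
  have hmax : 0 < sigmaMax M := by
    obtain ⟨r, hr⟩ := hne
    exact lt_of_lt_of_le (lt_of_lt_of_le (Real.sqrt_pos.mpr ha₀) (bdB r hr)) (le_csSup habove hr)
  have scale : ∀ v : υ → ℝ, v ≠ 0 → ∃ r ∈ S, (M *ᵥ v) ⬝ᵥ (M *ᵥ v) = r ^ 2 * (v ⬝ᵥ v) := by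
    intro v hv
    have hv0 := dot_self_pos hv
    have hvn : 0 < vnorm v := by rw [vnorm_eq_sqrt_dot]; exact Real.sqrt_pos.mpr hv0
    refine ⟨_, ⟨(vnorm v)⁻¹ • v, ?_, rfl⟩, ?_⟩
    · rw [vnorm_smul, abs_of_pos (by positivity), inv_mul_cancel₀ hvn.ne']
    · rw [mulVec_smul, vnorm_smul, mul_pow, vnorm_sq, ← vnorm_sq v, sq_abs]
      field_simp
  refine ⟨sigmaMin M, sigmaMax M, hmin, hmax, rfl, fun v => ?_, fun v => ?_⟩
  · by_cases hv : v = 0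
    · simp [hv]
    obtain ⟨r, hr, h1⟩ := scale v hv
    rw [h1]
    have := csInf_le hbelow hr
    exact mul_le_mul_of_nonneg_right (pow_le_pow_left₀ hmin.le this 2) (dot_self_nonneg v)
  · by_cases hv : v = 0
    · simp [hv]
    obtain ⟨r, hr, h1⟩ := scale v hv
    rw [h1]
    have := le_csSup habove hr
    have hr0 : 0 ≤ r := (Real.sqrt_nonneg _).trans (bdB r hr)
    exact mul_le_mul_of_nonneg_right (pow_le_pow_left₀ hr0 this 2) (dot_self_nonneg v)

end

/-! ### Frobenius norm -/

section Frob
variable {ι κ l : Type*} [Fintype ι] [Fintype κ] [Fintype l]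

theorem frob_nonneg (M : Matrix ι κ ℝ) : 0 ≤ frob M := Real.sqrt_nonneg _

theorem frob_sq_sum (M : Matrix ι κ ℝ) : frob M ^ 2 = ∑ i, ∑ j, M i j ^ 2 :=
  Real.sq_sqrt (Finset.sum_nonneg fun _ _ => Finset.sum_nonneg fun _ _ => sq_nonneg _)

theorem frob_sq (M : Matrix ι κ ℝ) : frob M ^ 2 = (Mᵀ * M).trace := by
  rw [frob_sq_sum, Finset.sum_comm]
  simp [trace, mul_apply, sq]

section
open scoped Matrix.Norms.Frobenius

theorem frob_eq_norm (M : Matrix ι κ ℝ) : frob M = ‖M‖ := by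
  rw [Matrix.frobenius_norm_def, frob, Real.sqrt_eq_rpow]
  simp

theorem frob_add_le (M N : Matrix ι κ ℝ) : frob (M + N) ≤ frob M + frob N := by
  simp only [frob_eq_norm]; exact norm_add_le M N

theorem frob_sub_le (M N : Matrix ι κ ℝ) : frob (M - N) ≤ frob M + frob N := by
  simp only [frob_eq_norm]; exact norm_sub_le M N

theorem frob_smul (c : ℝ) (M : Matrix ι κ ℝ) : frob (c • M) = |c| * frob M := by
  simp only [frob_eq_norm]; exact norm_smul c M

theorem frob_mul_le (M : Matrix ι κ ℝ) (N : Matrix κ l ℝ) : frob (M * N) ≤ frob M * frob N := by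
  simp only [frob_eq_norm]; exact Matrix.frobenius_norm_mul M N

theorem frob_eq_zero {M : Matrix ι κ ℝ} : frob M = 0 ↔ M = 0 := by
  rw [frob_eq_norm]; exact norm_eq_zero

end

theorem frob_transpose (M : Matrix ι κ ℝ) : frob Mᵀ = frob M := by
  simp only [frob, transpose_apply]
  rw [Finset.sum_comm]

theorem frob_neg (M : Matrix ι κ ℝ) : frob (-M) = frob M := by simp [frob]

theorem frob_le_of_sq_le {M : Matrix ι κ ℝ} {c : ℝ} (hc : 0 ≤ c) (h : frob M ^ 2 ≤ c ^ 2) :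
    frob M ≤ c := abs_le_of_sq_le_sq' h hc |>.2

theorem abs_trace_le {n : ℕ} (M : Matrix (Fin n) (Fin n) ℝ) : |M.trace| ≤ Real.sqrt n * frob M := by
  have h1 : M.trace ^ 2 ≤ n * frob M ^ 2 := by
    have h2 := sq_sum_le_card_mul_sum_sq (s := (Finset.univ : Finset (Fin n))) (f := fun i => M i i)
    rw [Finset.card_univ, Fintype.card_fin] at h2
    refine h2.trans (mul_le_mul_of_nonneg_left ?_ (Nat.cast_nonneg _))
    rw [frob_sq_sum]
    exact Finset.sum_le_sum fun i _ =>
      Finset.single_le_sum (f := fun j => M i j ^ 2) (fun _ _ => sq_nonneg _) (Finset.mem_univ i)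
  rw [← Real.sqrt_sq (frob_nonneg M), ← Real.sqrt_mul (Nat.cast_nonneg _)]
  exact Real.abs_le_sqrt h1

theorem frob_eq_vnorm (M : Matrix ι κ ℝ) : frob M = vnorm fun x : ι × κ => M x.1 x.2 := by
  rw [frob, vnorm, Fintype.sum_prod_type]

theorem frob_replicateCol (w : ι → ℝ) : frob (replicateCol Unit w) = vnorm w := by
  simp [frob, vnorm]

theorem vnorm_mulVec_le (M : Matrix ι κ ℝ) (v : κ → ℝ) : vnorm (M *ᵥ v) ≤ frob M * vnorm v := by
  have h1 := frob_mul_le M (replicateCol Unit v)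
  rw [← replicateCol_mulVec, frob_replicateCol, frob_replicateCol] at h1
  exact h1

theorem abs_dot_le (u v : ι → ℝ) : |u ⬝ᵥ v| ≤ vnorm u * vnorm v := by
  rw [vnorm_eq_sqrt_dot, vnorm_eq_sqrt_dot, ← Real.sqrt_mul (dot_self_nonneg u)]
  apply Real.abs_le_sqrt
  have := Finset.sum_mul_sq_le_sq_mul_sq Finset.univ u v
  simpa [dotProduct, sq] using this

theorem abs_quadForm_le (M : Matrix ι ι ℝ) (v : ι → ℝ) :
    |v ⬝ᵥ (M *ᵥ v)| ≤ frob M * (v ⬝ᵥ v) := by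
  calc _ ≤ vnorm v * (frob M * vnorm v) := (abs_dot_le _ _).trans
        (mul_le_mul_of_nonneg_left (vnorm_mulVec_le M v) (vnorm_nonneg v))
    _ = frob M * (v ⬝ᵥ v) := by rw [← vnorm_sq]; ring

end Frob

/-! ### The inexact Newton step in scaled coordinates -/

section Scaled
variable {n : ℕ}



theorem posDef_of_isSymm {A : Matrix (Fin n) (Fin n) ℝ} (hA : Aᵀ = A) (h : ∀ v ≠ 0, 0 < v ⬝ᵥ (A *ᵥ v)) : A.PosDef := by
  refine Matrix.PosDef.of_dotProduct_mulVec_pos ?_ fun v hv => ?_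
  · rw [IsHermitian, conjTranspose_eq_transpose_of_trivial, hA]
  · simpa using h v hv

theorem PosDef.transpose_eq {A : Matrix (Fin n) (Fin n) ℝ} (hA : A.PosDef) : Aᵀ = A := by
  have := hA.isHermitian
  rwa [IsHermitian, conjTranspose_eq_transpose_of_trivial] at this

theorem PosDef.quad_pos {A : Matrix (Fin n) (Fin n) ℝ} (hA : A.PosDef) {v : Fin n → ℝ} (hv : v ≠ 0) :
    0 < v ⬝ᵥ (A *ᵥ v) := by simpa using hA.dotProduct_mulVec_pos hv

/-- The Frobenius norm bounds the quadratic form of the perturbation, so the form of `A` stays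
positive. -/
theorem posDef_of_near {A : Matrix (Fin n) (Fin n) ℝ} {c : ℝ} (hA : Aᵀ = A)
    (h : frob (A - c • (1 : Matrix (Fin n) (Fin n) ℝ)) < c) : A.PosDef := by
  refine posDef_of_isSymm hA fun v hv => ?_
  have h1 := abs_quadForm_le (A - c • (1 : Matrix (Fin n) (Fin n) ℝ)) v
  have h2 := dot_self_pos hv
  rw [sub_mulVec, smul_mulVec, one_mulVec, dotProduct_sub, dotProduct_smul, smul_eq_mul] at h1
  have h3 := (abs_le.mp h1).1
  nlinarith

/-- Write `A² - I = (A - I) + A(A - I)`. The cross term in the squared norm is twice the trace of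
`(A - I)A(A - I)`, which is nonnegative because `A` is positive definite. -/
theorem frob_sub_one_le {A : Matrix (Fin n) (Fin n) ℝ} (hA : A.PosDef) : frob (A - 1) ≤ frob (A * A - 1) := by
  have hAt := PosDef.transpose_eq hA
  refine frob_le_of_sq_le (frob_nonneg _) ?_
  have e1 : A * A - 1 = (A - 1) + A * (A - 1) := by noncomm_ring
  have e2 : frob (A * A - 1) ^ 2 = frob (A - 1) ^ 2 + 2 * ((A - 1)ᵀ * A * (A - 1)).trace +
      frob (A * (A - 1)) ^ 2 := by
    rw [frob_sq, frob_sq, frob_sq, e1]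
    simp only [transpose_add, transpose_mul, transpose_sub, transpose_one, hAt, add_mul, mul_add,
      trace_add]
    simp only [Matrix.mul_assoc]
    ring
  have h3 : 0 ≤ ((A - 1)ᵀ * A * (A - 1)).trace := by
    have := (hA.posSemidef.conjTranspose_mul_mul_same (A - 1)).trace_nonneg
    rwa [conjTranspose_eq_transpose_of_trivial] at this
  nlinarith [sq_nonneg (frob (A * (A - 1)))]

/-- Symmetric and skew-symmetric parts. -/
def symP (Z : Matrix (Fin n) (Fin n) ℝ) : Matrix (Fin n) (Fin n) ℝ := (1 / 2 : ℝ) • (Z + Zᵀ)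
def skewP (Z : Matrix (Fin n) (Fin n) ℝ) : Matrix (Fin n) (Fin n) ℝ := (1 / 2 : ℝ) • (Z - Zᵀ)

theorem symP_transpose (Z : Matrix (Fin n) (Fin n) ℝ) : (symP Z)ᵀ = symP Z := by
  simp [symP, add_comm]

theorem symP_add (Z Y : Matrix (Fin n) (Fin n) ℝ) : symP (Z + Y) = symP Z + symP Y := by
  unfold symP; rw [transpose_add]; module

theorem symP_sub (Z Y : Matrix (Fin n) (Fin n) ℝ) : symP (Z - Y) = symP Z - symP Y := by
  unfold symP; rw [transpose_sub]; module

theorem skewP_sub (Z Y : Matrix (Fin n) (Fin n) ℝ) : skewP (Z - Y) = skewP Z - skewP Y := by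
  unfold skewP; rw [transpose_sub]; module

theorem symP_of_symm {Z : Matrix (Fin n) (Fin n) ℝ} (h : Zᵀ = Z) : symP Z = Z := by
  unfold symP; rw [h]; module

theorem skewP_of_symm {Z : Matrix (Fin n) (Fin n) ℝ} (h : Zᵀ = Z) : skewP Z = 0 := by
  unfold skewP; rw [h]; module

theorem trace_transpose_mul_self_comm (Z : Matrix (Fin n) (Fin n) ℝ) : (Z * Zᵀ).trace = (Zᵀ * Z).trace :=
  trace_mul_comm _ _

/-- The squared norm of the symmetric part splits into `tr Z²`, which is invariant under similarity,
and `‖Z‖²`, which is nearly invariant under nearly orthogonal similarity. This identity underlies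
the comparison of two scalings. -/
theorem frob_symP_sq (Z : Matrix (Fin n) (Fin n) ℝ) : frob (symP Z) ^ 2 = (1 / 2) * (Z * Z).trace +
    (1 / 2) * frob Z ^ 2 := by
  rw [frob_sq, frob_sq, symP_transpose]
  have h1 : (Zᵀ * Zᵀ).trace = (Z * Z).trace := by rw [← transpose_mul, trace_transpose]
  have h2 := trace_transpose_mul_self_comm Z
  simp only [symP, smul_mul_assoc, mul_smul_comm, trace_smul, add_mul, mul_add, trace_add, h1, h2,
    smul_eq_mul]
  ring

theorem frob_sq_eq (Z : Matrix (Fin n) (Fin n) ℝ) : frob Z ^ 2 = frob (symP Z) ^ 2 + frob (skewP Z) ^ 2 := by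
  have h1 : (Zᵀ * Zᵀ).trace = (Z * Z).trace := by rw [← transpose_mul, trace_transpose]
  have h2 := trace_transpose_mul_self_comm Z
  have h3 : frob (skewP Z) ^ 2 = -(1 / 2) * (Z * Z).trace + (1 / 2) * frob Z ^ 2 := by
    rw [frob_sq, frob_sq]
    simp only [skewP, transpose_smul, transpose_sub, transpose_transpose, smul_mul_assoc,
      mul_smul_comm, trace_smul, sub_mul, mul_sub, trace_sub, h1, h2, smul_eq_mul]
    ring
  rw [h3, frob_symP_sq]; ring

theorem frob_symP_le (Z : Matrix (Fin n) (Fin n) ℝ) : frob (symP Z) ≤ frob Z :=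
  frob_le_of_sq_le (frob_nonneg _) (by rw [frob_sq_eq Z]; nlinarith [sq_nonneg (frob (skewP Z))])

/-- Here the skew part contributes with a negative sign, so it can be dropped. -/
theorem trace_mul_self_le (Z : Matrix (Fin n) (Fin n) ℝ) : (Z * Z).trace ≤ frob (symP Z) ^ 2 := by
  have h1 := frob_symP_sq Z
  have h2 := frob_sq_eq Z
  nlinarith [sq_nonneg (frob (skewP Z))]

theorem trace_symP (Z : Matrix (Fin n) (Fin n) ℝ) : (symP Z).trace = Z.trace := by
  simp [symP, trace_add, trace_transpose]; ring

/-- The scaled iterate `V`, close to a multiple of the identity. -/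
structure Frame (V : Matrix (Fin n) (Fin n) ℝ) (ν γ : ℝ) : Prop where
  pd : V.PosDef
  nu_pos : 0 < ν
  near : frob (V * V - ν • (1 : Matrix (Fin n) (Fin n) ℝ)) ≤ γ * ν

/-- `frob_sub_one_le` applied to `V / √ν`: closeness of `V²` to `νI` implies closeness of `V` to `√ν
I`. -/
theorem Frame.sub_le {V : Matrix (Fin n) (Fin n) ℝ} {ν γ : ℝ} (h : Frame V ν γ) :
    frob (V - Real.sqrt ν • (1 : Matrix (Fin n) (Fin n) ℝ)) ≤ γ * Real.sqrt ν := by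
  have hw : 0 < Real.sqrt ν := Real.sqrt_pos.mpr h.nu_pos
  set w := Real.sqrt ν with hwdef
  have hww : w * w = ν := Real.mul_self_sqrt h.nu_pos.le
  have hU : (w⁻¹ • V).PosDef := h.pd.smul (inv_pos.mpr hw)
  have h1 := frob_sub_one_le hU
  have e1 : w⁻¹ • V - 1 = w⁻¹ • (V - w • (1 : Matrix (Fin n) (Fin n) ℝ)) := by
    rw [smul_sub, smul_smul, inv_mul_cancel₀ hw.ne', one_smul]
  have e2 : (w⁻¹ • V) * (w⁻¹ • V) - 1 = ν⁻¹ • (V * V - ν • (1 : Matrix (Fin n) (Fin n) ℝ)) := by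
    rw [smul_sub, smul_smul, inv_mul_cancel₀ h.nu_pos.ne', one_smul, smul_mul_smul_comm,
      ← mul_inv, hww]
  rw [e1, e2, frob_smul, frob_smul, abs_of_pos (by positivity),
    abs_of_pos (inv_pos.mpr h.nu_pos)] at h1
  have h2 : ν⁻¹ * frob (V * V - ν • (1 : Matrix (Fin n) (Fin n) ℝ)) ≤ γ := by
    rw [inv_mul_le_iff₀ h.nu_pos, mul_comm]; exact h.near
  calc _ = w * (w⁻¹ * frob (V - w • (1 : Matrix (Fin n) (Fin n) ℝ))) := by rw [mul_inv_cancel_left₀ hw.ne']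
    _ ≤ w * γ := by gcongr; exact h1.trans h2
    _ = γ * w := mul_comm _ _

/-- The scaled linearization. -/
def lin (V dx ds : Matrix (Fin n) (Fin n) ℝ) : Matrix (Fin n) (Fin n) ℝ := dx * V + V * ds

section
variable {V dx ds : Matrix (Fin n) (Fin n) ℝ} {ν γ : ℝ}

/-- The symmetric part is `½(DV + VD)` with `D = dx + ds`, and `V` differs from `√ν I` by at most
`γ√ν`. -/
theorem Frame.symP_lin_ge (h : Frame V ν γ) (hx : dxᵀ = dx) (hs : dsᵀ = ds) :
    (1 - γ) * Real.sqrt ν * frob (dx + ds) ≤ frob (symP (lin V dx ds)) := by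
  set w := Real.sqrt ν
  have hV := PosDef.transpose_eq h.pd
  have hw : 0 ≤ w := Real.sqrt_nonneg ν
  obtain ⟨V0, hV0⟩ : ∃ V0, V0 = V - w • (1 : Matrix (Fin n) (Fin n) ℝ) := ⟨_, rfl⟩
  have hVe : V = w • (1 : Matrix (Fin n) (Fin n) ℝ) + V0 := by rw [hV0, add_sub_cancel]
  set D := dx + ds with hD
  have e : w • D = symP (lin V dx ds) - (1 / 2 : ℝ) • (D * V0 + V0 * D) := by
    have : symP (lin V dx ds) = (1 / 2 : ℝ) • (D * V + V * D) := by
      simp only [symP, lin, transpose_add, transpose_mul, hx, hs, hV, hD, add_mul, mul_add]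
      congr 1; abel
    rw [this, hVe]
    simp only [mul_add, add_mul, mul_smul_comm, smul_mul_assoc, mul_one, one_mul]
    module
  have h0 := h.sub_le
  rw [← hV0] at h0
  have h1 : frob (w • D) ≤ frob (symP (lin V dx ds)) + γ * w * frob D := by
    rw [e]
    refine (frob_sub_le _ _).trans (add_le_add le_rfl ?_)
    rw [frob_smul, abs_of_pos (by norm_num : (0 : ℝ) < 1 / 2)]
    have h2 := frob_mul_le D V0
    have h3 := frob_mul_le V0 D
    have h4 := frob_add_le (D * V0) (V0 * D)
    have h5 := mul_le_mul_of_nonneg_right h0 (frob_nonneg D)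
    linarith
  rw [frob_smul, abs_of_nonneg hw] at h1
  linarith

theorem frob_add_sq (hx : dxᵀ = dx) (h : (dx * ds).trace = 0) :
    frob (dx + ds) ^ 2 = frob dx ^ 2 + frob ds ^ 2 := by
  have h' : (dsᵀ * dx).trace = 0 := by rw [← trace_transpose, transpose_mul]; simpa [hx] using h
  rw [frob_sq, frob_sq, frob_sq]
  simp only [transpose_add, add_mul, mul_add, trace_add, h']
  rw [hx, h]; ring

/-- The skew part is `½(DV - VD)` with `D = dx - ds`, so the multiple of the identity in `V` cancels
and only the deviation counts. Orthogonality makes `dx - ds` and `dx + ds` equally long. -/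
theorem Frame.skewP_lin_le (h : Frame V ν γ) (hx : dxᵀ = dx) (hs : dsᵀ = ds)
    (horth : (dx * ds).trace = 0) :
    frob (skewP (lin V dx ds)) ≤ γ * Real.sqrt ν * frob (dx + ds) := by
  set w := Real.sqrt ν
  have hV := PosDef.transpose_eq h.pd
  obtain ⟨V0, hV0⟩ : ∃ V0, V0 = V - w • (1 : Matrix (Fin n) (Fin n) ℝ) := ⟨_, rfl⟩
  have hVe : V = w • (1 : Matrix (Fin n) (Fin n) ℝ) + V0 := by rw [hV0, add_sub_cancel]
  set D := dx - ds with hD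
  have hDn : frob D = frob (dx + ds) := by
    have h1 := frob_add_sq hx horth
    have h2 : frob (dx + -ds) ^ 2 = frob dx ^ 2 + frob (-ds) ^ 2 :=
      frob_add_sq hx (by rw [mul_neg, trace_neg, horth, neg_zero])
    rw [frob_neg, ← h1, ← sub_eq_add_neg] at h2
    exact (pow_left_inj₀ (frob_nonneg _) (frob_nonneg _) two_ne_zero).mp h2
  have e : skewP (lin V dx ds) = (1 / 2 : ℝ) • (D * V0 - V0 * D) := by
    simp only [skewP, lin, transpose_add, transpose_mul, hx, hs, hV, hD]
    rw [hVe]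
    simp only [mul_add, add_mul, mul_sub, sub_mul, mul_smul_comm, smul_mul_assoc, mul_one, one_mul]
    module
  rw [e, frob_smul, abs_of_pos (by norm_num : (0 : ℝ) < 1 / 2), ← hDn]
  have h2 := frob_mul_le D V0
  have h3 := frob_mul_le V0 D
  have h4 := frob_sub_le (D * V0) (V0 * D)
  have h0 := h.sub_le
  rw [← hV0] at h0
  have h5 := mul_le_mul_of_nonneg_right h0 (frob_nonneg D)
  linarith

/-- The quotient of the two preceding bounds is `γ/(1 - γ)`, at most `1/5` for `γ ≤ 1/6`. -/
theorem Frame.skewP_le_symP (h : Frame V ν γ) (hγ1 : γ ≤ 1 / 6) (hx : dxᵀ = dx)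
    (hs : dsᵀ = ds) (horth : (dx * ds).trace = 0) :
    frob (skewP (lin V dx ds)) ≤ (1 / 5) * frob (symP (lin V dx ds)) := by
  have h1 := h.symP_lin_ge hx hs
  have h2 := h.skewP_lin_le hx hs horth
  have h3 : 0 ≤ Real.sqrt ν * frob (dx + ds) := mul_nonneg (Real.sqrt_nonneg _) (frob_nonneg _)
  nlinarith

/-- Consequences of the conditions on the parameters. -/
structure Params (n : ℕ) (γ δ : ℝ) : Prop where
  n_pos : 0 < n
  γ_pos : 0 < γ
  δ_pos : 0 < δ
  main : 6 * (γ ^ 2 + δ ^ 2) ≤ centering n δ * γ * (1 - γ)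
  γ_le : γ ≤ 1 / 6
  δ_le : δ ≤ 1 / 6
  σ_ge : 5 / 6 ≤ centering n δ
  σ_le : centering n δ ≤ 1

/-- Positivity of `β` forces the fraction in the admissibility condition to be at most 1. Since `2 +
√2 ≤ 3.415` and `21.7 / 3.415 > 6`, this is the inequality `main`, from which `γ ≤ 1/6` and then `δ
≤ 1/6` follow. -/
theorem Params.of_admissible {δ β : ℝ} (hn : 0 < n) (hγ : 0 < γ) (hγ1 : γ < 1) (hδ : 0 < δ)
    (hδ1 : δ < 1) (hβ : 0 < β) (h : Admissible n γ δ β) : Params n γ δ := by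
  have hs1 : 1 ≤ Real.sqrt n := by rw [Real.one_le_sqrt]; exact_mod_cast hn
  have hd : δ / Real.sqrt n ≤ δ := div_le_self hδ.le hs1
  have hd0 : 0 < δ / Real.sqrt n := by positivity
  have hσ0 : 0 < centering n δ := by unfold centering; linarith
  have hσ1 : centering n δ ≤ 1 := by unfold centering; linarith
  have h2 := h.2
  have hsq : Real.sqrt 2 ≤ 1.415 := Real.sqrt_le_iff.mpr ⟨by norm_num, by norm_num⟩
  have hs0 : 0 ≤ Real.sqrt 2 := Real.sqrt_nonneg 2
  have hden : 0 < (2 + Real.sqrt 2) * (1 - δ / Real.sqrt n) * γ * (1 - γ) := by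
    have : 0 < 1 - δ / Real.sqrt n := hσ0
    have : 0 < 1 - γ := by linarith
    positivity
  have hγn : 0 < γ / Real.sqrt n := by positivity
  have h3 : 21.7 * (γ ^ 2 + δ ^ 2) / ((2 + Real.sqrt 2) * (1 - δ / Real.sqrt n) * γ * (1 - γ)) ≤ 1 := by
    linarith
  rw [div_le_one hden] at h3
  have h4 : (2 + Real.sqrt 2) * (1 - δ / Real.sqrt n) * γ * (1 - γ) ≤
      3.415 * (centering n δ * γ * (1 - γ)) := by
    have : 0 ≤ centering n δ * γ * (1 - γ) :=
      mul_nonneg (mul_nonneg hσ0.le hγ.le) (by linarith)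
    calc _ = (2 + Real.sqrt 2) * (centering n δ * γ * (1 - γ)) := by unfold centering; ring
      _ ≤ _ := by gcongr; linarith
  have hmain : 6 * (γ ^ 2 + δ ^ 2) ≤ centering n δ * γ * (1 - γ) := by
    nlinarith [sq_nonneg γ, sq_nonneg δ]
  have h5 : centering n δ * γ * (1 - γ) ≤ γ := by
    have : centering n δ * (1 - γ) ≤ 1 := mul_le_one₀ hσ1 (by linarith) (by linarith)
    nlinarith
  have hγ6 : γ ≤ 1 / 6 := by nlinarith [sq_nonneg δ]
  have hδ6 : δ ≤ 1 / 6 := by nlinarith [sq_nonneg γ]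
  exact ⟨hn, hγ, hδ, hmain, hγ6, hδ6, by unfold centering; linarith, hσ1⟩

theorem Params.one_le_sqrt {δ : ℝ} (h : Params n γ δ) : 1 ≤ Real.sqrt n := by
  rw [Real.one_le_sqrt]; exact_mod_cast h.n_pos

/-- Norm of the right-hand side. -/
theorem rhs_sq {A : Matrix (Fin n) (Fin n) ℝ} {ν γ δ : ℝ} (hn : 0 < n) (hA : Aᵀ = A) (htr : A.trace = n * ν)
    (hnear : frob (A - ν • (1 : Matrix (Fin n) (Fin n) ℝ)) ≤ γ * ν) :
    frob ((centering n δ * ν) • (1 : Matrix (Fin n) (Fin n) ℝ) - A) ^ 2 ≤ (γ ^ 2 + δ ^ 2) * ν ^ 2 := by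
  have hn0 : (0 : ℝ) < n := by exact_mod_cast hn
  have hs : Real.sqrt n * Real.sqrt n = n := Real.mul_self_sqrt hn0.le
  have hs0 : 0 < Real.sqrt n := Real.sqrt_pos.mpr hn0
  set c := (centering n δ * ν) with hc
  have h1 : frob (c • (1 : Matrix (Fin n) (Fin n) ℝ) - A) ^ 2 = c ^ 2 * n - 2 * c * (n * ν) + (A * A).trace := by
    rw [frob_sq]
    simp only [transpose_sub, transpose_smul, transpose_one, hA, sub_mul, mul_sub, smul_mul_assoc,
      mul_smul_comm, one_mul, mul_one, trace_sub, trace_smul, trace_one, Fintype.card_fin, htr,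
      smul_eq_mul]
    ring
  have h2 : frob (A - ν • (1 : Matrix (Fin n) (Fin n) ℝ)) ^ 2 = (A * A).trace - n * ν ^ 2 := by
    rw [frob_sq]
    simp only [transpose_sub, transpose_smul, transpose_one, hA, sub_mul, mul_sub, smul_mul_assoc,
      mul_smul_comm, one_mul, mul_one, trace_sub, trace_smul, trace_one, Fintype.card_fin, htr,
      smul_eq_mul]
    ring
  have h3 : frob (A - ν • (1 : Matrix (Fin n) (Fin n) ℝ)) ^ 2 ≤ (γ * ν) ^ 2 :=
    pow_le_pow_left₀ (frob_nonneg _) hnear 2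
  -- Pythagoras: `A - νI` has trace zero, hence is orthogonal to the shift `(1 - σ)νI`, whose
  -- squared norm is `(δ/√n)²ν² · n = δ²ν²`.
  have h4 : c ^ 2 * n - 2 * c * (n * ν) = -n * ν ^ 2 + δ ^ 2 * ν ^ 2 := by
    have h5 : (δ / Real.sqrt n) ^ 2 * n = δ ^ 2 := by
      rw [div_pow, Real.sq_sqrt hn0.le]; field_simp
    rw [hc, centering, ← h5]
    ring
  rw [h1, h4]
  linarith

set_option maxHeartbeats 800000 in
/-- One step of the inexact method in the scaled space. -/
theorem Frame.step {δ τ : ℝ} (hp : Params n γ δ) (h : Frame V ν γ)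
    (htr : (V * V).trace = n * ν) (hx : dxᵀ = dx) (hs : dsᵀ = ds) (horth : (dx * ds).trace = 0)
    (hτγ : τ ≤ γ / 100) (hτδ : τ ≤ δ)
    (hres : frob (symP (lin V dx ds) - ((centering n δ * ν) • (1 : Matrix (Fin n) (Fin n) ℝ) - V * V) : Matrix (Fin n) (Fin n) ℝ) ≤
      τ * frob ((centering n δ * ν) • (1 : Matrix (Fin n) (Fin n) ℝ) - V * V : Matrix (Fin n) (Fin n) ℝ)) :
    (V + dx).PosDef ∧ (V + ds).PosDef ∧
      ∃ ν' : ℝ, ((V + dx) * (V + ds)).trace = n * ν' ∧ 0 < ν' ∧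
        ν' ≤ (1 - (δ / 2) / Real.sqrt n) * ν ∧
        (((V + dx) * (V + ds) - ν' • (1 : Matrix (Fin n) (Fin n) ℝ)) * ((V + dx) * (V + ds) - ν' • (1 : Matrix (Fin n) (Fin n) ℝ))).trace ≤
          (γ * ν') ^ 2 := by
  obtain ⟨hn, hγ, hδ, hmain, hγ6, hδ6, hσ56, hσ1⟩ := hp
  have hn0 : (0 : ℝ) < n := by exact_mod_cast hn
  have hsn1 : 1 ≤ Real.sqrt n := by rw [Real.one_le_sqrt]; exact_mod_cast hn
  have hV := PosDef.transpose_eq h.pd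
  have hVV : (V * V)ᵀ = V * V := by rw [transpose_mul, hV]
  have hν := h.nu_pos
  set σ := centering n δ with hσ
  set w := Real.sqrt ν with hw
  have hw0 : 0 < w := Real.sqrt_pos.mpr hν
  have hww : w * w = ν := Real.mul_self_sqrt hν.le
  set R := (σ * ν) • (1 : Matrix (Fin n) (Fin n) ℝ) - V * V with hR
  set ρ := frob R with hρ
  have hρ0 : 0 ≤ ρ := frob_nonneg _
  have hρsq : ρ ^ 2 ≤ (γ ^ 2 + δ ^ 2) * ν ^ 2 := rhs_sq hn hVV htr h.near
  have hgd : γ ^ 2 + δ ^ 2 ≤ 1 / 36 := by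
    have : σ * γ * (1 - γ) ≤ 1 / 6 := by
      have : σ * (1 - γ) ≤ 1 := mul_le_one₀ hσ1 (by linarith) (by linarith)
      have := mul_le_mul_of_nonneg_left this hγ.le
      linarith
    linarith
  have hρν : ρ ≤ ν / 6 := abs_le_of_sq_le_sq'
    (hρsq.trans (by linarith [mul_le_mul_of_nonneg_right hgd (sq_nonneg ν)])) (by positivity) |>.2
  set r := symP (lin V dx ds) - R with hr
  set D := frob (dx + ds) with hD
  have hD0 : 0 ≤ D := frob_nonneg _
  have hZ : frob (symP (lin V dx ds)) ≤ (1 + τ) * ρ := by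
    have e : symP (lin V dx ds) = r + R := by rw [hr]; abel
    rw [e]
    have := frob_add_le r R
    linarith
  have hDle : (1 - γ) * w * D ≤ (1 + τ) * ρ := (h.symP_lin_ge hx hs).trans hZ
  have hDsq : (1 - γ) ^ 2 * ν * D ^ 2 ≤ (1.01) ^ 2 * ρ ^ 2 := by
    have h1 : (1 - γ) * w * D ≤ 1.01 * ρ := hDle.trans (by gcongr; linarith)
    have h2 : 0 ≤ (1 - γ) * w * D := by
      have : 0 ≤ 1 - γ := by linarith
      positivity
    calc _ = ((1 - γ) * w * D) ^ 2 := by rw [← hww]; ring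
      _ ≤ (1.01 * ρ) ^ 2 := pow_le_pow_left₀ h2 h1 2
      _ = _ := by ring
  -- The inequality `main` contributes `1.01²/6`, and division by `1 - γ ≥ 5/6` keeps this below
  -- `0.22`. Half of it, `0.11`, bounds the second-order term below.
  have hDD : D ^ 2 ≤ 0.22 * (σ * γ * ν) := by
    have h1 : (1 - γ) ^ 2 * ν * D ^ 2 ≤ (1.01) ^ 2 * (σ * γ * (1 - γ) / 6) * ν ^ 2 := by
      refine hDsq.trans ?_
      have : (γ ^ 2 + δ ^ 2) * ν ^ 2 ≤ (σ * γ * (1 - γ) / 6) * ν ^ 2 := by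
        gcongr; linarith
      linarith [mul_le_mul_of_nonneg_left (hρsq.trans this) (by norm_num : (0 : ℝ) ≤ 1.01 ^ 2)]
    have h2 : (1 - γ) * D ^ 2 ≤ (1.01) ^ 2 * (σ * γ / 6) * ν := by
      have h3 : 0 < (1 - γ) * ν := mul_pos (by linarith) hν
      refine le_of_mul_le_mul_left ?_ h3
      calc _ = (1 - γ) ^ 2 * ν * D ^ 2 := by ring
        _ ≤ _ := h1
        _ = _ := by ring
    have h3 : 0 ≤ σ * γ * ν := by have : 0 < σ := by linarith
                                  positivity
    have h4 : 5 / 6 * D ^ 2 ≤ (1 - γ) * D ^ 2 :=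
      mul_le_mul_of_nonneg_right (by linarith) (sq_nonneg D)
    linarith
  have hsplit := frob_add_sq hx horth
  have hDw : D ≤ 0.21 * w := by
    have h1 : D ^ 2 ≤ (0.21 * w) ^ 2 := by
      have h3 : σ * γ ≤ 1 / 6 := (mul_le_of_le_one_left hγ.le hσ1).trans hγ6
      have h2 : σ * γ * ν ≤ 1 / 6 * ν := mul_le_mul_of_nonneg_right h3 hν.le
      rw [mul_pow, sq w, hww]
      linarith
    exact abs_le_of_sq_le_sq' h1 (by positivity) |>.2
  have hdxD : frob dx ≤ D := frob_le_of_sq_le hD0 (by rw [hsplit]; linarith [sq_nonneg (frob ds)])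
  have hdsD : frob ds ≤ D := frob_le_of_sq_le hD0 (by rw [hsplit]; linarith [sq_nonneg (frob dx)])
  have pd : ∀ d : Matrix (Fin n) (Fin n) ℝ, dᵀ = d → frob d ≤ D → (V + d).PosDef := by
    intro d hd hdD
    refine posDef_of_near (c := w) (by rw [transpose_add, hV, hd]) ?_
    have e : V + d - w • (1 : Matrix (Fin n) (Fin n) ℝ) = (V - w • (1 : Matrix (Fin n) (Fin n) ℝ)) + d := by abel
    rw [e]
    have h1 := frob_add_le (V - w • (1 : Matrix (Fin n) (Fin n) ℝ)) d
    have h2 := h.sub_le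
    have h3 : γ * w ≤ 1 / 6 * w := mul_le_mul_of_nonneg_right hγ6 hw0.le
    linarith
  refine ⟨pd dx hx hdxD, pd ds hs hdsD, ?_⟩
  set Z' := (V + dx) * (V + ds) with hZ'
  have eZ : Z' = V * V + lin V dx ds + dx * ds := by
    rw [hZ', lin]; noncomm_ring
  set ν' := Z'.trace / n with hν'
  have htr' : Z'.trace = n * ν' := by rw [hν']; field_simp
  have hrn : frob r ≤ τ * ρ := hres
  have hrν : frob r ≤ γ * ν / 600 := by
    calc frob r ≤ τ * ρ := hrn
      _ ≤ (γ / 100) * (ν / 6) := by gcongr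
      _ = _ := by ring
  have eS : symP Z' = (σ * ν) • (1 : Matrix (Fin n) (Fin n) ℝ) + r + symP (dx * ds) := by
    rw [eZ, symP_add, symP_add, symP_of_symm hVV, hr, hR]; abel
  have htrr : n * ν' = n * (σ * ν) + r.trace := by
    rw [← htr', ← trace_symP, eS]
    simp [trace_add, trace_symP, horth, trace_smul, mul_comm]
  -- Since `tr(dx ds) = 0`, the new `ν'` deviates from `σν` only through `tr r`, and `|tr r| ≤ √n
  -- ‖r‖`. The deviation is at most `‖r‖/√n`, which a decrease of order `δ/√n` can absorb.
  have hdiff : |ν' - σ * ν| * Real.sqrt n ≤ frob r := by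
    have h1 := abs_trace_le r
    have h2 : r.trace = n * (ν' - σ * ν) := by rw [mul_sub, htrr]; ring
    rw [h2, abs_mul, abs_of_pos hn0] at h1
    have hs : Real.sqrt n * Real.sqrt n = n := Real.mul_self_sqrt hn0.le
    nth_rw 1 [← hs] at h1
    have h3 : 0 < Real.sqrt n := by linarith
    refine le_of_mul_le_mul_left ?_ h3
    linarith
  have hdiff' : |ν' - σ * ν| ≤ frob r :=
    (le_mul_of_one_le_right (abs_nonneg _) hsn1).trans hdiff
  have hlow : σ * ν - γ * ν / 600 ≤ ν' := by linarith [(abs_le.mp hdiff').1]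
  have hν'0 : 0 < ν' := by
    have : 0 < ν * (σ - γ / 600) := mul_pos hν (by linarith)
    linarith
  refine ⟨ν', htr', hν'0, ?_, ?_⟩
  · have h1 : (ν' - σ * ν) * Real.sqrt n ≤ δ * ν / 6 := by
      calc _ ≤ |ν' - σ * ν| * Real.sqrt n := by gcongr; exact le_abs_self _
        _ ≤ τ * ρ := hdiff.trans hrn
        _ ≤ δ * (ν / 6) := by gcongr
        _ = _ := by ring
    have hs0 : 0 < Real.sqrt n := by linarith
    have h2 : ν' - σ * ν ≤ δ * ν / 6 / Real.sqrt n := by rwa [le_div_iff₀ hs0]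
    have h3 : δ * ν / 6 / Real.sqrt n ≤ δ / 2 / Real.sqrt n * ν := by
      rw [div_div, div_div, div_mul_eq_mul_div, div_le_div_iff₀ (by positivity) (by positivity)]
      have : 0 ≤ δ * ν * Real.sqrt n := by positivity
      linarith
    have h4 : σ = 1 - δ / Real.sqrt n := rfl
    have h5 : δ / 2 / Real.sqrt n = δ / Real.sqrt n / 2 := by ring
    have h6 : 0 ≤ δ / Real.sqrt n := by positivity
    rw [h5] at h3 ⊢
    have h7 : σ * ν = ν - δ / Real.sqrt n * ν := by rw [h4]; ring
    linarith
  -- The Newton equation prescribes only the symmetric part of the product. That is enough, because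
  -- the neighborhood is measured by the trace of a square.
  · refine (trace_mul_self_le _).trans ?_
    have e1 : symP (Z' - ν' • (1 : Matrix (Fin n) (Fin n) ℝ)) =
        (σ * ν - ν') • (1 : Matrix (Fin n) (Fin n) ℝ) + r + symP (dx * ds) := by
      rw [symP_sub, eS, symP_of_symm (by simp : (ν' • (1 : Matrix (Fin n) (Fin n) ℝ))ᵀ = ν' • (1 : Matrix (Fin n) (Fin n) ℝ))]
      module
    rw [e1]
    refine pow_le_pow_left₀ (frob_nonneg _) ?_ 2
    have h1 : frob ((σ * ν - ν') • (1 : Matrix (Fin n) (Fin n) ℝ)) ≤ frob r := by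
      rw [frob_smul, abs_sub_comm]
      have : frob (1 : Matrix (Fin n) (Fin n) ℝ) = Real.sqrt n := by
        rw [← Real.sqrt_sq (frob_nonneg _), frob_sq]; simp
      rw [this]; exact hdiff
    have h2 : frob (symP (dx * ds)) ≤ D ^ 2 / 2 := by
      refine (frob_symP_le _).trans ((frob_mul_le _ _).trans ?_)
      rw [hsplit]
      linarith [two_mul_le_add_sq (frob dx) (frob ds)]
    have h3 := frob_add_le ((σ * ν - ν') • (1 : Matrix (Fin n) (Fin n) ℝ) + r) (symP (dx * ds))
    have h4 := frob_add_le ((σ * ν - ν') • (1 : Matrix (Fin n) (Fin n) ℝ)) r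
    have h5 : frob ((σ * ν - ν') • (1 : Matrix (Fin n) (Fin n) ℝ) + r + symP (dx * ds)) ≤
        γ * ν / 300 + 0.11 * (σ * γ * ν) := by linarith
    refine h5.trans ?_
    have h6 : γ * (σ * ν - γ * ν / 600) ≤ γ * ν' := by gcongr
    have h7 : 0 ≤ γ * ν := by positivity
    have h8 : 0 ≤ γ * ν * (0.89 * σ - 1 / 300 - γ / 600) := mul_nonneg h7 (by linarith)
    linarith

end

end Scaled

/-! ### Almost orthogonal changes of scaling -/

section
variable {n : ℕ} {E F Z : Matrix (Fin n) (Fin n) ℝ} {η : ℝ}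

theorem abs_trace_mul_le (A B : Matrix (Fin n) (Fin n) ℝ) : |(A * B).trace| ≤ frob A * frob B := by
  have h := abs_dot_le (fun x : Fin n × Fin n => A x.1 x.2) (fun x => Bᵀ x.1 x.2)
  rw [← frob_eq_vnorm, ← frob_eq_vnorm, frob_transpose] at h
  refine le_of_eq_of_le ?_ h
  simp [trace, mul_apply, dotProduct, Fintype.sum_prod_type]

theorem frob_mul_transpose_sub_one (E : Matrix (Fin n) (Fin n) ℝ) :
    frob (E * Eᵀ - 1) = frob (Eᵀ * E - 1) := by
  have h : frob (E * Eᵀ - 1) ^ 2 = frob (Eᵀ * E - 1) ^ 2 := by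
    rw [frob_sq, frob_sq]
    simp only [transpose_sub, transpose_mul, transpose_transpose, transpose_one, sub_mul, mul_sub,
      one_mul, mul_one, trace_sub]
    rw [trace_mul_comm E Eᵀ, show E * Eᵀ * (E * Eᵀ) = E * (Eᵀ * E * Eᵀ) by simp only [mul_assoc],
      trace_mul_comm E, show Eᵀ * E * Eᵀ * E = Eᵀ * E * (Eᵀ * E) by simp only [mul_assoc]]
  exact (pow_left_inj₀ (frob_nonneg _) (frob_nonneg _) two_ne_zero).mp h

theorem abs_frob_mul_sq_sub_le (h : frob (Eᵀ * E - 1) ≤ η) (Y : Matrix (Fin n) (Fin n) ℝ) :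
    |frob (E * Y) ^ 2 - frob Y ^ 2| ≤ η * frob Y ^ 2 := by
  have e : frob (E * Y) ^ 2 - frob Y ^ 2 = ((Eᵀ * E - 1) * (Y * Yᵀ)).trace := by
    rw [frob_sq, frob_sq, trace_mul_comm, trace_mul_comm Yᵀ, ← trace_sub]
    rw [transpose_mul, trace_sub, show E * Y * (Yᵀ * Eᵀ) = E * (Y * Yᵀ * Eᵀ) by
      simp only [mul_assoc], trace_mul_comm E, ← trace_sub, sub_mul, one_mul, trace_sub,
      trace_sub, mul_assoc, trace_mul_comm (Y * Yᵀ)]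
  rw [e]
  refine (abs_trace_mul_le _ _).trans ?_
  have h1 := frob_mul_le Y Yᵀ
  rw [frob_transpose, ← sq] at h1
  exact mul_le_mul h h1 (frob_nonneg _) ((frob_nonneg _).trans h)

/-- Multiplication by `E` nearly preserves norms. Applied to `ZF` it compares `EZF` with `ZF`;
applied on the other side it compares `Z = (ZF)E` with `ZF`. -/
theorem abs_frob_conj_sq_sub_le (hEF : E * F = 1) (h : frob (Eᵀ * E - 1) ≤ η) (hη : η ≤ 1 / 3) :
    |frob (E * Z * F) ^ 2 - frob Z ^ 2| ≤ 3 * η * frob Z ^ 2 := by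
  have hFE : F * E = 1 := mul_eq_one_comm.mp hEF
  have h1 := abs_frob_mul_sq_sub_le h (Z * F)
  have h2 := abs_frob_mul_sq_sub_le (E := Eᵀ) (η := η)
    (by rw [transpose_transpose, frob_mul_transpose_sub_one]; exact h) (Z * F)ᵀ
  rw [← transpose_mul, frob_transpose, frob_transpose, mul_assoc, hFE, mul_one] at h2
  rw [← mul_assoc] at h1
  have h0 : 0 ≤ η := (frob_nonneg _).trans h
  set t := frob (Z * F) ^ 2
  have ht : 0 ≤ t := sq_nonneg _
  rw [abs_le] at h1 h2 ⊢
  have h3 : η * t ≤ 1 / 3 * t := mul_le_mul_of_nonneg_right hη ht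
  have h4 : t ≤ 3 / 2 * frob Z ^ 2 := by linarith
  have h5 : η * t ≤ η * (3 / 2 * frob Z ^ 2) := mul_le_mul_of_nonneg_left h4 h0
  constructor <;> linarith [h1.1, h1.2, h2.1, h2.2]

theorem abs_frob_symP_conj_sq_sub_le (hEF : E * F = 1) (h : frob (Eᵀ * E - 1) ≤ η)
    (hη : η ≤ 1 / 3) :
    |frob (symP (E * Z * F)) ^ 2 - frob (symP Z) ^ 2| ≤ 3 / 2 * η * frob Z ^ 2 := by
  have hFE : F * E = 1 := mul_eq_one_comm.mp hEF
  have h1 := abs_frob_conj_sq_sub_le (Z := Z) hEF h hη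
  have h2 : (E * Z * F * (E * Z * F)).trace = (Z * Z).trace := by
    rw [show E * Z * F * (E * Z * F) = E * (Z * (F * E) * Z * F) by simp only [mul_assoc], hFE,
      mul_one, trace_mul_comm, mul_assoc, hFE, mul_one]
  rw [frob_symP_sq, frob_symP_sq, h2]
  rw [abs_le] at h1 ⊢
  constructor <;> linarith [h1.1, h1.2]

variable {V dx ds : Matrix (Fin n) (Fin n) ℝ} {ν γ τ : ℝ}

theorem Frame.frob_lin_sq_le (h : Frame V ν γ) (hγ1 : γ ≤ 1 / 6) (hx : dxᵀ = dx)
    (hs : dsᵀ = ds) (horth : (dx * ds).trace = 0) :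
    frob (lin V dx ds) ^ 2 ≤ 1.04 * frob (symP (lin V dx ds)) ^ 2 := by
  have h1 := pow_le_pow_left₀ (frob_nonneg _) (h.skewP_le_symP hγ1 hx hs horth) 2
  rw [mul_pow] at h1
  rw [frob_sq_eq (lin V dx ds)]
  linarith

theorem Frame.symP_conj_bounds (h : Frame V ν γ) (hγ1 : γ ≤ 1 / 6) (hx : dxᵀ = dx)
    (hs : dsᵀ = ds) (horth : (dx * ds).trace = 0) (hEF : E * F = 1)
    (hE : frob (Eᵀ * E - 1) ≤ η) (hη : η ≤ 1 / 100) :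
    0.8 * frob (symP (lin V dx ds)) ^ 2 ≤ frob (symP (E * lin V dx ds * F)) ^ 2 ∧
      frob (symP (E * lin V dx ds * F)) ^ 2 ≤ 1.2 * frob (symP (lin V dx ds)) ^ 2 := by
  have h1 := h.frob_lin_sq_le hγ1 hx hs horth
  have h2 := abs_frob_symP_conj_sq_sub_le (Z := lin V dx ds) hEF hE (by linarith)
  have h3 : η * frob (lin V dx ds) ^ 2 ≤ 1 / 100 * frob (lin V dx ds) ^ 2 :=
    mul_le_mul_of_nonneg_right hη (sq_nonneg _)
  rw [abs_le] at h2
  have := sq_nonneg (frob (symP (lin V dx ds)))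
  constructor <;> linarith [h2.1, h2.2]

/-- An approximate solution for a perturbed scaling is one for the exact scaling. -/
theorem Frame.residual_le (h : Frame V ν γ) (hγ1 : γ ≤ 1 / 6) (hx : dxᵀ = dx)
    (hs : dsᵀ = ds) (horth : (dx * ds).trace = 0) (hEF : E * F = 1) (hτ0 : 0 ≤ τ)
    (hτ : τ ≤ 1 / 100) (hE : frob (Eᵀ * E - 1) ≤ τ ^ 2 / 100)
    {R : Matrix (Fin n) (Fin n) ℝ} (hR : Rᵀ = R)
    (hres : frob (symP (E * (lin V dx ds - R) * F)) ^ 2 ≤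
      (τ / 2) ^ 2 * frob (symP (E * R * F)) ^ 2) :
    frob (symP (lin V dx ds) - R) ≤ τ * frob R := by
  have hτ2 : τ ^ 2 ≤ 1 / 10000 := by
    calc τ ^ 2 ≤ (1 / 100) ^ 2 := pow_le_pow_left₀ hτ0 hτ 2
      _ = _ := by norm_num
  set L := lin V dx ds with hL
  have h1 := abs_frob_symP_conj_sq_sub_le (Z := R) hEF hE (by linarith)
  have h2 := abs_frob_symP_conj_sq_sub_le (Z := L - R) hEF hE (by linarith)
  have h3 := h.skewP_le_symP hγ1 hx hs horth
  rw [← hL] at h3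
  have e1 : symP (L - R) = symP L - R := by rw [symP_sub, symP_of_symm hR]
  have e2 : skewP (L - R) = skewP L := by rw [skewP_sub, skewP_of_symm hR, sub_zero]
  rw [frob_sq_eq (L - R), e1, e2] at h2
  rw [symP_of_symm hR] at h1
  have h4 : frob (symP L) ≤ frob (symP L - R) + frob R := by
    have := frob_add_le (symP L - R) R
    rwa [sub_add_cancel] at this
  set s := frob (symP L - R)
  set k := frob (skewP L)
  set ρ := frob R
  have hs0 : 0 ≤ s := frob_nonneg _
  have hk0 : 0 ≤ k := frob_nonneg _
  have hρ0 : 0 ≤ ρ := frob_nonneg _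
  -- The skew part of `L - R` is that of `L`, at most a fifth of `‖symP L‖ ≤ s + ρ`. The error made
  -- by conjugation is then a multiple of `τ²(s² + ρ²)`, comparable to the square of the allowed
  -- residual; hence the tolerance for the scaling is quadratic in `τ`.
  have h5 : k ^ 2 ≤ 2 / 25 * (s ^ 2 + ρ ^ 2) := by
    have : k ^ 2 ≤ (1 / 5 * (s + ρ)) ^ 2 := pow_le_pow_left₀ hk0 (by linarith) 2
    linarith [two_mul_le_add_sq s ρ, (by ring : (1 / 5 * (s + ρ)) ^ 2 =
      1 / 25 * (s ^ 2 + 2 * s * ρ + ρ ^ 2))]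
  rw [abs_le] at h1 h2
  have h6 : frob (symP (E * R * F)) ^ 2 ≤ 1.01 * ρ ^ 2 := by
    have : τ ^ 2 * ρ ^ 2 ≤ 1 / 10000 * ρ ^ 2 := mul_le_mul_of_nonneg_right hτ2 (sq_nonneg ρ)
    have := sq_nonneg ρ
    linarith [h1.2]
  have h7 : (τ / 2) ^ 2 * frob (symP (E * R * F)) ^ 2 ≤ (τ / 2) ^ 2 * (1.01 * ρ ^ 2) :=
    mul_le_mul_of_nonneg_left h6 (sq_nonneg _)
  have h8 : τ ^ 2 * (s ^ 2 + k ^ 2) ≤ τ ^ 2 * (1.08 * s ^ 2 + 0.08 * ρ ^ 2) :=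
    mul_le_mul_of_nonneg_left (by linarith) (sq_nonneg τ)
  have h9 : τ ^ 2 * s ^ 2 ≤ 1 / 10000 * s ^ 2 := mul_le_mul_of_nonneg_right hτ2 (sq_nonneg s)
  have h10 : 0 ≤ τ ^ 2 * ρ ^ 2 := by positivity
  refine abs_le_of_sq_le_sq' ?_ (by positivity) |>.2
  rw [mul_pow]
  linarith [h2.1, sq_nonneg s]

end

/-! ### Symmetric vectorization -/

section
variable {n m p : ℕ}

/-- Row-major vectorization. -/
def vc (M : Matrix (Fin n) (Fin n) ℝ) : Fin n × Fin n → ℝ := fun x => M x.1 x.2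

theorem vc_dot (A B : Matrix (Fin n) (Fin n) ℝ) : vc A ⬝ᵥ vc B = (Aᵀ * B).trace := by
  simp only [vc, dotProduct, Fintype.sum_prod_type, trace, diag_apply, mul_apply, transpose_apply]
  exact Finset.sum_comm

theorem vc_dot_self (A : Matrix (Fin n) (Fin n) ℝ) : vc A ⬝ᵥ vc A = frob A ^ 2 := by
  rw [vc_dot, frob_sq]

theorem vc_sub (A B : Matrix (Fin n) (Fin n) ℝ) : vc (A - B) = vc A - vc B := rfl

theorem vc_injective : Function.Injective (vc : Matrix (Fin n) (Fin n) ℝ → _) := fun A B h => by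
  ext i j
  exact congrFun h (i, j)

theorem smat_transpose (v : SIdx n → ℝ) : (smat v)ᵀ = smat v := by
  ext i j
  simp only [smat, transpose_apply, of_apply]
  rcases lt_trichotomy i j with h | h | h
  · simp [h.ne, h.ne', h.le, not_le.mpr h]
  · subst h; simp
  · simp [h.ne, h.ne', h.le, not_le.mpr h]

theorem svec_smat (v : SIdx n → ℝ) : svec (smat v) = v := by
  funext ⟨⟨i, j⟩, h⟩
  simp only [svec, smat, of_apply]
  split_ifs with h1
  · have h1 : i = j := h1
    subst h1; rfl
  · rw [mul_div_cancel₀ _ (by positivity)]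

theorem smat_svec {G : Matrix (Fin n) (Fin n) ℝ} (hG : Gᵀ = G) : smat (svec G) = G := by
  ext i j
  have h2 : Real.sqrt 2 ≠ 0 := by positivity
  have hs : G j i = G i j := congrFun (congrFun hG i) j
  simp only [svec, smat, of_apply]
  split_ifs with h1 h3 h4
  · subst h1; rfl
  · rw [mul_div_cancel_left₀ _ h2]
  · exact absurd h4.symm h1
  · rw [mul_div_cancel_left₀ _ h2, hs]

/-- Sum over the positions on or below the diagonal. -/
theorem symV_transpose_mulVec (v : SIdx n → ℝ) : (symV n)ᵀ *ᵥ v = vc (smat v) := by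
  funext ⟨i, j⟩
  simp only [mulVec, dotProduct, transpose_apply, symV, of_apply, vc, smat]
  have key : ∀ a b : Fin n, ∀ hab : b ≤ a, ((a, b) = (i, j) ∨ (a, b) = (j, i)) →
      (∑ x : SIdx n, (if (i, j) = x.1 ∨ (i, j) = x.1.swap then
        if x.1.1 = x.1.2 then 1 else 1 / Real.sqrt 2 else 0) * v x) =
      (if a = b then 1 else 1 / Real.sqrt 2) * v ⟨(a, b), hab⟩ := by
    intro a b hab h
    rw [Finset.sum_eq_single (⟨(a, b), hab⟩ : SIdx n)]
    · rw [if_pos]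
      rcases h with h | h
      · exact Or.inl h.symm
      · exact Or.inr (by rw [Prod.swap_prod_mk]; simp only [Prod.mk.injEq] at h ⊢; exact ⟨h.2.symm, h.1.symm⟩)
    · rintro ⟨⟨c, d⟩, hcd⟩ - hne
      rw [if_neg, zero_mul]
      rintro (h' | h') <;> rcases h with h | h <;> simp only [Prod.mk.injEq, Prod.swap_prod_mk] at h h' <;>
        apply hne <;> simp only [Subtype.mk.injEq, Prod.mk.injEq]
      · exact ⟨h'.1.symm.trans h.1.symm, h'.2.symm.trans h.2.symm⟩
      · have hcd : d ≤ c := hcd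
        rw [← h'.1, ← h'.2, ← h.1, ← h.2] at hcd
        have := le_antisymm hcd hab
        rw [← h'.1, ← h'.2, ← h.1, ← h.2]
        exact ⟨this.symm, this⟩
      · have hcd : d ≤ c := hcd
        rw [← h'.1, ← h'.2, ← h.1, ← h.2] at hcd
        have := le_antisymm hcd hab
        rw [← h'.1, ← h'.2, ← h.1, ← h.2]
        exact ⟨this.symm, this⟩
      · exact ⟨h'.2.symm.trans h.1.symm, h'.1.symm.trans h.2.symm⟩
    · simp
  rcases lt_trichotomy i j with h | h | h
  · rw [key j i h.le (Or.inr rfl)]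
    simp [h.ne, h.ne', not_le.mpr h, div_eq_inv_mul]
  · subst h
    rw [key i i le_rfl (Or.inl rfl)]
    simp
  · rw [key i j h.le (Or.inl rfl)]
    simp [h.ne', h.le, div_eq_inv_mul]

theorem symV_mulVec {G : Matrix (Fin n) (Fin n) ℝ} (hG : Gᵀ = G) : symV n *ᵥ vc G = svec G := by
  funext ⟨⟨i, j⟩, h⟩
  have hs : G j i = G i j := congrFun (congrFun hG i) j
  have h2 : Real.sqrt 2 * Real.sqrt 2 = 2 := Real.mul_self_sqrt (by norm_num)
  have h20 : Real.sqrt 2 ≠ 0 := by positivity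
  simp only [mulVec, dotProduct, symV, of_apply, vc, svec, Prod.swap_prod_mk]
  by_cases hij : i = j
  · subst hij
    rw [Finset.sum_eq_single (i, i)]
    · simp
    · intro b _ hb; simp [hb]
    · simp
  · rw [← Finset.sum_subset (Finset.subset_univ {(i, j), (j, i)})]
    · rw [Finset.sum_pair (by simpa using fun h1 => absurd h1 hij)]
      simp only [if_neg hij, true_or, or_true, if_true, hs]
      field_simp
      rw [sq, h2]
      ring
    · intro x _ hx
      simp only [Finset.mem_insert, Finset.mem_singleton] at hx
      rw [if_neg hx, zero_mul]

theorem symV_transpose_svec {G : Matrix (Fin n) (Fin n) ℝ} (hG : Gᵀ = G) :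
    (symV n)ᵀ *ᵥ svec G = vc G := by
  rw [symV_transpose_mulVec, smat_svec hG]

theorem symV_mul_transpose : symV n * (symV n)ᵀ = 1 := by
  apply Matrix.ext_of_mulVec_single
  intro i
  rw [← mulVec_mulVec, symV_transpose_mulVec, symV_mulVec (smat_transpose _), svec_smat, one_mulVec]

theorem svec_dot {G H : Matrix (Fin n) (Fin n) ℝ} (hG : Gᵀ = G) (hH : Hᵀ = H) :
    svec G ⬝ᵥ svec H = (G * H).trace := by
  rw [← symV_mulVec hG, dotProduct_comm, dotProduct_mulVec, ← mulVec_transpose,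
    symV_transpose_svec hH, vc_dot, hH, trace_mul_comm]

theorem kron_mulVec (G K H : Matrix (Fin n) (Fin n) ℝ) : (G ⊗ₖ K) *ᵥ vc H = vc (G * H * Kᵀ) := by
  funext ⟨i, j⟩
  simp only [mulVec, dotProduct, vc, kroneckerMap_apply, mul_apply, transpose_apply,
    Fintype.sum_prod_type, Finset.sum_mul]
  rw [Finset.sum_comm]
  exact Finset.sum_congr rfl fun _ _ => Finset.sum_congr rfl fun _ _ => by ring

/-- `G ⊗ K` acts as `H ↦ GHKᵀ`. For symmetric `H` the product with exchanged factors is the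
transpose, so the half sum is the symmetric part. -/
theorem symKron_mulVec (G K : Matrix (Fin n) (Fin n) ℝ) (v : SIdx n → ℝ) :
    symKron G K *ᵥ v = svec (symP (G * smat v * Kᵀ)) := by
  have h : (G ⊗ₖ K + K ⊗ₖ G) *ᵥ vc (smat v) = (2 : ℝ) • vc (symP (G * smat v * Kᵀ)) := by
    rw [add_mulVec, kron_mulVec, kron_mulVec]
    have e : (G * smat v * Kᵀ)ᵀ = K * smat v * Gᵀ := by
      simp only [transpose_mul, transpose_transpose, smat_transpose, mul_assoc]
    unfold symP
    rw [e]
    funext x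
    simp [vc]
    ring
  rw [symKron, smul_mulVec, ← mulVec_mulVec, ← mulVec_mulVec, symV_transpose_mulVec, h, mulVec_smul,
    symV_mulVec (symP_transpose _), smul_smul]
  norm_num

theorem svec_sub (G H : Matrix (Fin n) (Fin n) ℝ) : svec (G - H) = svec G - svec H := by
  funext x
  simp only [svec, Pi.sub_apply, Matrix.sub_apply]
  split_ifs <;> ring

theorem svec_add (G H : Matrix (Fin n) (Fin n) ℝ) : svec (G + H) = svec G + svec H := by
  funext x
  simp only [svec, Pi.add_apply, Matrix.add_apply]
  split_ifs <;> ring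

theorem svec_smul (c : ℝ) (G : Matrix (Fin n) (Fin n) ℝ) : svec (c • G) = c • svec G := by
  funext x
  simp only [svec, Pi.smul_apply, Matrix.smul_apply, smul_eq_mul]
  split_ifs <;> ring

theorem svec_sum_smul (y : Fin m → ℝ) (A : Fin m → Matrix (Fin n) (Fin n) ℝ) :
    svec (∑ i, y i • A i) = ∑ i, y i • svec (A i) := by
  have : svec = (⟨⟨svec, svec_add⟩, svec_smul⟩ : Matrix (Fin n) (Fin n) ℝ →ₗ[ℝ] SIdx n → ℝ) := rfl
  rw [this, map_sum]
  simp only [map_smul]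

theorem vnorm_svec {G : Matrix (Fin n) (Fin n) ℝ} (hG : Gᵀ = G) : vnorm (svec G) = frob G := by
  rw [vnorm_eq_sqrt_dot, svec_dot hG hG, ← Real.sqrt_sq (frob_nonneg G), frob_sq, hG]

theorem symmetrize_eq (P M : Matrix (Fin n) (Fin n) ℝ) :
    symmetrize P M = symP (P * M * P⁻¹) := by
  simp only [symmetrize, symP, transpose_mul, mul_assoc]

variable (D : SDO n m) (Q : Matrix (SIdx n) (Fin p) ℝ)

/-- The primal direction belonging to `z`. -/
def dirX (Q : Matrix (SIdx n) (Fin p) ℝ) (u : Fin p ⊕ Fin m → ℝ) : Matrix (Fin n) (Fin n) ℝ :=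
  smat (Q *ᵥ fun i => u (.inl i))

/-- The negative of the dual direction belonging to `y`. -/
def SDO.dirS (D : SDO n m) (u : Fin p ⊕ Fin m → ℝ) : Matrix (Fin n) (Fin n) ℝ :=
  smat (D.Asᵀ *ᵥ fun i => u (.inr i))

theorem dirX_transpose (u : Fin p ⊕ Fin m → ℝ) : (dirX Q u)ᵀ = dirX Q u := smat_transpose _

variable {D} in
theorem SDO.dirS_transpose (u : Fin p ⊕ Fin m → ℝ) : (D.dirS u)ᵀ = D.dirS u := smat_transpose _

theorem SDO.dirS_eq (u : Fin p ⊕ Fin m → ℝ) : D.dirS u = ∑ i, u (.inr i) • D.A i := by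
  have h : D.Asᵀ *ᵥ (fun i => u (.inr i)) = svec (∑ i, u (.inr i) • D.A i) := by
    rw [svec_sum_smul]
    funext x
    simp [mulVec, dotProduct, SDO.As, mul_comm]
  rw [SDO.dirS, h, smat_svec]
  rw [transpose_sum]
  exact Finset.sum_congr rfl fun i _ => by rw [transpose_smul, (D.A_symm i).eq]

variable {D Q}

theorem inn_A_dirX (hQ : IsNullBasis D.As Q) (u : Fin p ⊕ Fin m → ℝ) (i : Fin m) :
    inn (D.A i) (dirX Q u) = 0 := by
  have h := congrFun ((hQ.2 _).mpr ⟨fun i => u (.inl i), rfl⟩) i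
  rw [inn, ← svec_dot (D.A_symm i).eq (dirX_transpose Q u), dirX, svec_smat]
  exact h

/-- The dual direction is a combination of the `Aᵢ`, and the primal direction lies in their
orthogonal complement for every `z`, exact solution or not. -/
theorem trace_dirX_dirS (hQ : IsNullBasis D.As Q) (u : Fin p ⊕ Fin m → ℝ) :
    (dirX Q u * D.dirS u).trace = 0 := by
  rw [SDO.dirS_eq, trace_mul_comm, Finset.sum_mul, trace_sum]
  refine Finset.sum_eq_zero fun i _ => ?_
  rw [smul_mul_assoc, trace_smul]
  have := inn_A_dirX hQ u i
  rw [inn] at this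
  rw [this, smul_zero]

variable {P X S : Matrix (Fin n) (Fin n) ℝ}

theorem SDO.newtonMatrix_mulVec (hS : Sᵀ = S) (u : Fin p ⊕ Fin m → ℝ) :
    D.newtonMatrix Q P X S *ᵥ u =
      svec (symP (P * (dirX Q u * S - X * D.dirS u) * P⁻¹)) := by
  have e1 : u ∘ Sum.inl = fun i => u (.inl i) := rfl
  have e2 : u ∘ Sum.inr = fun i => u (.inr i) := rfl
  rw [SDO.newtonMatrix, fromCols_mulVec, ← mulVec_mulVec, ← mulVec_mulVec, neg_mulVec, mulVec_neg,
    symKron_mulVec, symKron_mulVec, ← sub_eq_add_neg, ← svec_sub, ← symP_sub, e1, e2]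
  congr 2
  simp only [transpose_mul, transpose_transpose, hS, mul_sub, sub_mul, mul_assoc, dirX, SDO.dirS]

/-- The coefficient matrix acting on full symmetric matrices. -/
def SDO.fullMatrix (D : SDO n m) (Q : Matrix (SIdx n) (Fin p) ℝ)
    (P X S : Matrix (Fin n) (Fin n) ℝ) : Matrix (Fin n × Fin n) (Fin p ⊕ Fin m) ℝ :=
  (symV n)ᵀ * D.newtonMatrix Q P X S

theorem SDO.fullMatrix_mulVec (hS : Sᵀ = S) (u : Fin p ⊕ Fin m → ℝ) :
    D.fullMatrix Q P X S *ᵥ u = vc (symP (P * (dirX Q u * S - X * D.dirS u) * P⁻¹)) := by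
  rw [SDO.fullMatrix, ← mulVec_mulVec, SDO.newtonMatrix_mulVec hS,
    symV_transpose_svec (symP_transpose _)]

/-- `Vᵀ` embeds the `svec` coordinates isometrically into full matrices, so both systems have the
same normal equations. The program may thus work with full symmetric residuals while the step is
stated with `svec`. -/
theorem SDO.polySolve_fullMatrix (f : ℝ[X]) {R : Matrix (Fin n) (Fin n) ℝ} (hR : Rᵀ = R) :
    polySolve f (D.fullMatrix Q P X S) (vc R) = polySolve f (D.newtonMatrix Q P X S) (svec R) := by
  unfold polySolve SDO.fullMatrix
  have h1 : (((symV n)ᵀ * D.newtonMatrix Q P X S)ᵀ * ((symV n)ᵀ * D.newtonMatrix Q P X S)) =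
      (D.newtonMatrix Q P X S)ᵀ * D.newtonMatrix Q P X S := by
    rw [transpose_mul, transpose_transpose, Matrix.mul_assoc, ← Matrix.mul_assoc (symV n),
      symV_mul_transpose, Matrix.one_mul]
  rw [h1, transpose_mul, transpose_transpose, ← mulVec_mulVec, symV_mulVec hR]

/-! ### Nesterov-Todd scaling -/

theorem posDef_sqrt (hX : X.PosDef) : (CFC.sqrt X).PosDef := by
  have h1 : (CFC.sqrt X).PosSemidef := (CFC.sqrt_nonneg X).posSemidef
  refine h1.posDef_iff_isUnit.mpr ?_
  have h2 : CFC.sqrt X * CFC.sqrt X = X := CFC.sqrt_mul_sqrt_self X hX.posSemidef.nonneg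
  have h3 : IsUnit (CFC.sqrt X * CFC.sqrt X) := by rw [h2]; exact hX.isUnit
  exact isUnit_of_mul_isUnit_left h3

theorem PosDef.sandwich (hX : X.PosDef) (hP : Pᵀ = P) (hP' : IsUnit P) : (P * X * P).PosDef := by
  have := hX.conjTranspose_mul_mul_same (B := P) (mulVec_injective_of_isUnit hP')
  rwa [conjTranspose_eq_transpose_of_trivial, hP] at this

/-- The point `(X, S)` in the coordinates given by the symmetric scaling matrix `P`. -/
structure ScaledTo (X S P V : Matrix (Fin n) (Fin n) ℝ) : Prop where
  symm : Pᵀ = P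
  unit : P * P⁻¹ = 1
  pd : V.PosDef
  X_eq : P * X * P = V
  S_eq : P⁻¹ * S * P⁻¹ = V

/-- `WSW = X`. With `H = W^{1/2}` this gives `H⁻¹XH⁻¹ = HSH`, and this common matrix is `V`. -/
theorem ntScaled (hX : X.PosDef) (hS : S.PosDef) :
    ∃ V, ScaledTo X S (ntP X S) V ∧ ntP X S * ntW X S * ntP X S = 1 := by
  set R := CFC.sqrt S with hRdef
  have hR : R.PosDef := posDef_sqrt hS
  have hRR : R * R = S := CFC.sqrt_mul_sqrt_self S hS.posSemidef.nonneg
  have hRi : R * R⁻¹ = 1 := mul_nonsing_inv _ ((isUnit_iff_isUnit_det _).mp hR.isUnit)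
  have hRi' : R⁻¹ * R = 1 := mul_eq_one_comm.mp hRi
  set T := CFC.sqrt (R * X * R) with hTdef
  have hRXR : (R * X * R).PosDef := PosDef.sandwich hX (PosDef.transpose_eq hR) hR.isUnit
  have hT : T.PosDef := posDef_sqrt hRXR
  have hTT : T * T = R * X * R := CFC.sqrt_mul_sqrt_self _ hRXR.posSemidef.nonneg
  have hWeq : ntW X S = R⁻¹ * T * R⁻¹ := rfl
  have hW : (ntW X S).PosDef := by
    rw [hWeq]
    exact PosDef.sandwich hT (PosDef.transpose_eq hR.inv) hR.inv.isUnit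
  have hWSW : ntW X S * S * ntW X S = X := by
    rw [hWeq, ← hRR]
    calc R⁻¹ * T * R⁻¹ * (R * R) * (R⁻¹ * T * R⁻¹)
        = R⁻¹ * T * (R⁻¹ * R) * (R * R⁻¹) * T * R⁻¹ := by noncomm_ring
      _ = R⁻¹ * (T * T) * R⁻¹ := by rw [hRi, hRi']; noncomm_ring
      _ = (R⁻¹ * R) * X * (R * R⁻¹) := by rw [hTT]; noncomm_ring
      _ = X := by rw [hRi, hRi']; simp
  set H := CFC.sqrt (ntW X S) with hHdef
  have hH : H.PosDef := posDef_sqrt hW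
  have hHH : H * H = ntW X S := CFC.sqrt_mul_sqrt_self _ hW.posSemidef.nonneg
  have hPeq : ntP X S = H⁻¹ := rfl
  have hHi : H * H⁻¹ = 1 := mul_nonsing_inv _ ((isUnit_iff_isUnit_det _).mp hH.isUnit)
  have hHi' : H⁻¹ * H = 1 := mul_eq_one_comm.mp hHi
  have hPi : (ntP X S)⁻¹ = H := by rw [hPeq, nonsing_inv_nonsing_inv _ ((isUnit_iff_isUnit_det _).mp hH.isUnit)]
  refine ⟨H * S * H, ⟨?_, ?_, ?_, ?_, ?_⟩, ?_⟩
  · rw [hPeq]; exact PosDef.transpose_eq hH.inv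
  · rw [hPi, hPeq, hHi']
  · exact PosDef.sandwich hS (PosDef.transpose_eq hH) hH.isUnit
  · rw [hPeq]
    nth_rw 1 [← hWSW]
    rw [← hHH]
    calc H⁻¹ * (H * H * S * (H * H)) * H⁻¹ = (H⁻¹ * H) * H * S * H * (H * H⁻¹) := by noncomm_ring
      _ = H * S * H := by rw [hHi, hHi']; simp
  · rw [hPi]
  · rw [hPeq, ← hHH]
    calc H⁻¹ * (H * H) * H⁻¹ = (H⁻¹ * H) * (H * H⁻¹) := by noncomm_ring
      _ = 1 := by rw [hHi, hHi', one_mul]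

namespace ScaledTo
variable {V : Matrix (Fin n) (Fin n) ℝ} (h : ScaledTo X S P V)
include h

theorem unit' : P⁻¹ * P = 1 := mul_eq_one_comm.mp h.unit

theorem isUnit : IsUnit P := IsUnit.of_mul_eq_one _ h.unit

theorem inv_symm : (P⁻¹)ᵀ = P⁻¹ := by rw [transpose_nonsing_inv, h.symm]

theorem XS_eq : P * (X * S) * P⁻¹ = V * V := by
  nth_rw 1 [← h.X_eq]
  rw [← h.S_eq]
  calc P * (X * S) * P⁻¹ = P * X * 1 * S * P⁻¹ := by noncomm_ring
    _ = _ := by rw [← h.unit]; noncomm_ring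

theorem trace_eq : (V * V).trace = inn X S := by
  rw [← h.XS_eq, trace_mul_comm, ← mul_assoc, h.unit', one_mul, inn]

end ScaledTo

end

/-! ### Dimensions -/

section
variable {m p : ℕ} {ρ υ : Type*} [Fintype ρ] [Fintype υ]

theorem IsNullBasis.mulVec_eq_zero [DecidableEq ρ] {B : Matrix (Fin m) ρ ℝ} {Q : Matrix ρ (Fin p) ℝ} (h : IsNullBasis B Q)
    {z : Fin p → ℝ} (hz : Q *ᵥ z = 0) : z = 0 := by
  have h1 : Function.Injective Q.mulVec := Matrix.mulVec_injective_iff.mpr h.1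
  exact h1 (hz.trans (mulVec_zero Q).symm)

/-- Rank-nullity, with `p` as the dimension of the kernel; it makes the Newton matrix square. -/
theorem IsNullBasis.card [DecidableEq ρ] {B : Matrix (Fin m) ρ ℝ} {Q : Matrix ρ (Fin p) ℝ}
    (h : IsNullBasis B Q) (hB : LinearIndependent ℝ B.row) : p + m = Fintype.card ρ := by
  have h1 := B.mulVecLin.finrank_range_add_finrank_ker
  have h2 : Module.finrank ℝ (LinearMap.range B.mulVecLin) = m := by
    have := hB.rank_matrix
    rwa [Fintype.card_fin] at this
  have h3 : LinearMap.ker B.mulVecLin = LinearMap.range Q.mulVecLin := by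
    ext v
    rw [LinearMap.mem_ker, LinearMap.mem_range]
    exact (h.2 v).trans (exists_congr fun z => eq_comm)
  have h4 : Module.finrank ℝ (LinearMap.range Q.mulVecLin) = p := by
    have : Qᵀ.rank = Fintype.card (Fin p) := LinearIndependent.rank_matrix h.1
    rw [rank_transpose, Fintype.card_fin] at this
    exact this
  rw [h2, h3, h4, Module.finrank_fintype_fun_eq_card] at h1
  omega

theorem exists_mulVec_eq (M : Matrix ρ υ ℝ) (hcard : Fintype.card υ = Fintype.card ρ)
    (h : ∀ v, M *ᵥ v = 0 → v = 0) (R : ρ → ℝ) : ∃ u, M *ᵥ u = R := by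
  have h1 : Function.Injective M.mulVecLin := by
    rw [← LinearMap.ker_eq_bot, LinearMap.ker_eq_bot']
    exact h
  exact (LinearMap.injective_iff_surjective_of_finrank_eq_finrank (by simpa using hcard)).mp h1 R
end

/-! ### The step for semidefinite optimization -/

section
variable {n m p : ℕ} {D : SDO n m} {Q : Matrix (SIdx n) (Fin p) ℝ}
  {X S P V P' : Matrix (Fin n) (Fin n) ℝ} {y : Fin m → ℝ} {u : Fin p ⊕ Fin m → ℝ} {γ δ β τ : ℝ}

theorem trace_sub_smul_sq (A : Matrix (Fin n) (Fin n) ℝ) (c : ℝ) :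
    ((A - c • (1 : Matrix (Fin n) (Fin n) ℝ)) * (A - c • (1 : Matrix (Fin n) (Fin n) ℝ))).trace =
      (A * A).trace - 2 * c * A.trace + c ^ 2 * n := by
  simp only [sub_mul, mul_sub, smul_mul_assoc, mul_smul_comm, one_mul, mul_one, trace_sub,
    trace_smul, trace_one, Fintype.card_fin, smul_eq_mul]
  ring

theorem trace_sub_smul_sq_comm (A B : Matrix (Fin n) (Fin n) ℝ) (c : ℝ) :
    ((A * B - c • (1 : Matrix (Fin n) (Fin n) ℝ)) *
      (A * B - c • (1 : Matrix (Fin n) (Fin n) ℝ))).trace =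
    ((B * A - c • (1 : Matrix (Fin n) (Fin n) ℝ)) *
      (B * A - c • (1 : Matrix (Fin n) (Fin n) ℝ))).trace := by
  rw [trace_sub_smul_sq, trace_sub_smul_sq, trace_mul_comm A B, mul_assoc A B, trace_mul_comm A]
  simp only [mul_assoc]

theorem frob_sq_of_symm {A : Matrix (Fin n) (Fin n) ℝ} (hA : Aᵀ = A) :
    frob A ^ 2 = (A * A).trace := by rw [frob_sq, hA]

theorem sub_smul_one_transpose {A : Matrix (Fin n) (Fin n) ℝ} (hA : Aᵀ = A) (c : ℝ) :
    (A - c • (1 : Matrix (Fin n) (Fin n) ℝ))ᵀ = A - c • (1 : Matrix (Fin n) (Fin n) ℝ) := by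
  simp [hA]

/-- `X^{1/2}SX^{1/2}` is symmetric and has the same trace and trace of the square as `XS`. The
neighborhood condition depends only on these invariants, so it can be tested in any scaling. -/
theorem frob_sqrt_sq (hX : X.PosDef) (hS : Sᵀ = S) (c : ℝ) :
    frob (CFC.sqrt X * S * CFC.sqrt X - c • (1 : Matrix (Fin n) (Fin n) ℝ)) ^ 2 =
      ((X * S - c • (1 : Matrix (Fin n) (Fin n) ℝ)) *
        (X * S - c • (1 : Matrix (Fin n) (Fin n) ℝ))).trace := by
  have h1 : CFC.sqrt X * CFC.sqrt X = X := CFC.sqrt_mul_sqrt_self _ hX.posSemidef.nonneg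
  have h2 := PosDef.transpose_eq (posDef_sqrt hX)
  rw [frob_sq_of_symm (sub_smul_one_transpose (by simp only [transpose_mul, h2, hS, mul_assoc]) c),
    mul_assoc, trace_sub_smul_sq_comm, mul_assoc, h1, trace_sub_smul_sq_comm]

theorem ScaledTo.frob_sq (h : ScaledTo X S P V) (c : ℝ) :
    frob (V * V - c • (1 : Matrix (Fin n) (Fin n) ℝ)) ^ 2 =
      ((X * S - c • (1 : Matrix (Fin n) (Fin n) ℝ)) *
        (X * S - c • (1 : Matrix (Fin n) (Fin n) ℝ))).trace := by
  have hV := PosDef.transpose_eq h.pd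
  rw [frob_sq_of_symm (sub_smul_one_transpose (by rw [transpose_mul, hV]) c), ← h.XS_eq,
    trace_sub_smul_sq_comm, ← mul_assoc, h.unit', one_mul]

theorem ScaledTo.frame (hn : 0 < n) (h : ScaledTo X S P V) (hX : X.PosDef) (hS : S.PosDef)
    (hN : frob (CFC.sqrt X * S * CFC.sqrt X - nu X S • (1 : Matrix (Fin n) (Fin n) ℝ)) ≤
      γ * nu X S) : Frame V (nu X S) γ ∧ (V * V).trace = n * nu X S := by
  have hn0 : (0 : ℝ) < n := by exact_mod_cast hn
  have htr : (V * V).trace = n * nu X S := by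
    rw [h.trace_eq, nu]; field_simp
  refine ⟨⟨h.pd, ?_, ?_⟩, htr⟩
  · have h1 : 0 < frob V ^ 2 := by
      refine pow_pos (lt_of_le_of_ne (frob_nonneg _) fun h0 => ?_) 2
      have h2 := frob_eq_zero.mp h0.symm
      have h3 := h.pd.isUnit
      rw [h2] at h3
      have : Nonempty (Fin n) := ⟨⟨0, hn⟩⟩
      exact not_isUnit_zero h3
    rw [frob_sq_of_symm (PosDef.transpose_eq h.pd), htr] at h1
    exact pos_of_mul_pos_right h1 hn0.le
  · have h1 := frob_sqrt_sq hX (PosDef.transpose_eq hS) (nu X S)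
    rw [← h.frob_sq] at h1
    rwa [(pow_left_inj₀ (frob_nonneg _) (frob_nonneg _) two_ne_zero).mp h1] at hN

/-- The primal and dual directions in the scaled space. -/
def dirx (Q : Matrix (SIdx n) (Fin p) ℝ) (P : Matrix (Fin n) (Fin n) ℝ) (u : Fin p ⊕ Fin m → ℝ) :
    Matrix (Fin n) (Fin n) ℝ := P * dirX Q u * P

def SDO.dirs (D : SDO n m) (P : Matrix (Fin n) (Fin n) ℝ) (u : Fin p ⊕ Fin m → ℝ) :
    Matrix (Fin n) (Fin n) ℝ := -(P⁻¹ * D.dirS u * P⁻¹)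

namespace ScaledTo
variable (h : ScaledTo X S P V)
include h

theorem dirx_transpose (u : Fin p ⊕ Fin m → ℝ) : (dirx Q P u)ᵀ = dirx Q P u := by
  simp only [dirx, transpose_mul, h.symm, dirX_transpose, mul_assoc]

theorem dirs_transpose (u : Fin p ⊕ Fin m → ℝ) : (D.dirs P u)ᵀ = D.dirs P u := by
  simp only [SDO.dirs, transpose_neg, transpose_mul, h.inv_symm, SDO.dirS_transpose, mul_assoc]

theorem trace_dirx_dirs (hQ : IsNullBasis D.As Q) (u : Fin p ⊕ Fin m → ℝ) :
    (dirx Q P u * D.dirs P u).trace = 0 := by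
  have e : dirx Q P u * D.dirs P u = -(P * (dirX Q u * D.dirS u * P⁻¹)) := by
    calc _ = -(P * dirX Q u * (P * P⁻¹) * D.dirS u * P⁻¹) := by
          simp only [dirx, SDO.dirs]; noncomm_ring
      _ = _ := by rw [h.unit]; noncomm_ring
  rw [e, trace_neg, trace_mul_comm, mul_assoc, h.unit', mul_one, trace_dirX_dirS hQ, neg_zero]

theorem conj_eq (u : Fin p ⊕ Fin m → ℝ) :
    P * (dirX Q u * S - X * D.dirS u) * P⁻¹ = lin V (dirx Q P u) (D.dirs P u) := by
  rw [lin, dirx, SDO.dirs]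
  nth_rw 1 [← h.S_eq]
  rw [← h.X_eq]
  calc _ = P * dirX Q u * 1 * S * P⁻¹ - P * X * 1 * D.dirS u * P⁻¹ := by noncomm_ring
    _ = _ := by rw [← h.unit]; noncomm_ring

/-- A vanishing symmetric part forces `dx + ds = 0`; by orthogonality both directions vanish, and
independence of the columns of `Q` and of the `Aᵢ` gives `u = 0`. -/
theorem nt_injective (hQ : IsNullBasis D.As Q) (hγ : γ ≤ 1 / 6) {ν : ℝ} (hF : Frame V ν γ)
    (hu : frob (symP (lin V (dirx Q P u) (D.dirs P u))) = 0) : u = 0 := by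
  have h1 := hF.symP_lin_ge (h.dirx_transpose (Q := Q) u) (h.dirs_transpose (D := D) u)
  rw [hu] at h1
  have h2 : 0 < (1 - γ) * Real.sqrt ν := mul_pos (by linarith) (Real.sqrt_pos.mpr hF.nu_pos)
  have h3 : frob (dirx Q P u + D.dirs P u) = 0 :=
    le_antisymm (by_contra fun hc => absurd h1 (not_le.mpr (mul_pos h2 (not_le.mp hc))))
      (frob_nonneg _)
  have h4 := frob_add_sq (h.dirx_transpose (Q := Q) u) (h.trace_dirx_dirs (D := D) hQ u)
  rw [h3] at h4
  have h5 : dirx Q P u = 0 := by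
    refine frob_eq_zero.mp (pow_eq_zero_iff two_ne_zero |>.mp ?_)
    linarith [sq_nonneg (frob (dirx Q P u)), sq_nonneg (frob (D.dirs P u))]
  have h6 : D.dirs P u = 0 := by
    refine frob_eq_zero.mp (pow_eq_zero_iff two_ne_zero |>.mp ?_)
    linarith [sq_nonneg (frob (dirx Q P u)), sq_nonneg (frob (D.dirs P u))]
  have h7 : dirX Q u = 0 := by
    calc dirX Q u = (P⁻¹ * P) * dirX Q u * (P * P⁻¹) := by rw [h.unit, h.unit']; simp
      _ = P⁻¹ * dirx Q P u * P⁻¹ := by rw [dirx]; noncomm_ring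
      _ = 0 := by rw [h5]; simp
  have h8 : D.dirS u = 0 := by
    calc D.dirS u = (P * P⁻¹) * D.dirS u * (P⁻¹ * P) := by rw [h.unit, h.unit']; simp
      _ = -(P * D.dirs P u * P) := by rw [SDO.dirs]; noncomm_ring
      _ = 0 := by rw [h6]; simp
  have h9 : (fun i => u (.inl i)) = 0 := by
    refine hQ.mulVec_eq_zero ?_
    rw [← svec_smat (Q *ᵥ fun i => u (.inl i))]
    change svec (dirX Q u) = 0
    rw [h7]
    funext x; simp [svec]
  rw [SDO.dirS_eq] at h8
  have h10 := Fintype.linearIndependent_iff.mp D.A_indep _ h8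
  funext x
  rcases x with x | x
  · exact congrFun h9 x
  · exact h10 x

end ScaledTo

theorem SDO.As_indep (D : SDO n m) : LinearIndependent ℝ D.As.row := by
  rw [Fintype.linearIndependent_iff]
  intro g hg
  refine Fintype.linearIndependent_iff.mp D.A_indep g ?_
  have h1 : svec (∑ i, g i • D.A i) = 0 := by
    rw [svec_sum_smul]
    exact hg
  rw [← smat_svec (G := ∑ i, g i • D.A i), h1]
  · ext i j; simp [smat]
  · rw [transpose_sum]
    exact Finset.sum_congr rfl fun i _ => by rw [transpose_smul, (D.A_symm i).eq]

theorem SDO.card_eq (hQ : IsNullBasis D.As Q) : p + m = Fintype.card (SIdx n) :=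
  hQ.card D.As_indep

theorem card_sIdx_le : Fintype.card (SIdx n) ≤ n ^ 2 := by
  refine (Fintype.card_subtype_le _).trans ?_
  simp [sq]

/-- Everything that one iteration of the method needs to know about the Newton system scaled by
`P'`. -/
structure SDO.StepFacts (D : SDO n m) (Q : Matrix (SIdx n) (Fin p) ℝ) (γ δ τ : ℝ)
    (X : Matrix (Fin n) (Fin n) ℝ) (y : Fin m → ℝ) (S P' : Matrix (Fin n) (Fin n) ℝ) : Prop where
  solvable : ∀ R : Matrix (Fin n) (Fin n) ℝ, Rᵀ = R → ∃ u, vc R = D.fullMatrix Q P' X S *ᵥ u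
  nt_injective : ∀ u, D.ntMatrix Q X S *ᵥ u = 0 → u = 0
  lower : ∀ u, 0.8 * (D.ntMatrix Q X S *ᵥ u ⬝ᵥ D.ntMatrix Q X S *ᵥ u) ≤
    D.fullMatrix Q P' X S *ᵥ u ⬝ᵥ D.fullMatrix Q P' X S *ᵥ u
  upper : ∀ u, D.fullMatrix Q P' X S *ᵥ u ⬝ᵥ D.fullMatrix Q P' X S *ᵥ u ≤
    1.2 * (D.ntMatrix Q X S *ᵥ u ⬝ᵥ D.ntMatrix Q X S *ᵥ u)
  rhs_ne : (centering n δ * nu X S) • (1 : Matrix (Fin n) (Fin n) ℝ) -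
    symmetrize P' (X * S) ≠ 0
  step : ∀ (u : Fin p ⊕ Fin m → ℝ) (R : Matrix (Fin n) (Fin n) ℝ),
    R = (centering n δ * nu X S) • (1 : Matrix (Fin n) (Fin n) ℝ) - symmetrize P' (X * S) →
    (vc R - D.fullMatrix Q P' X S *ᵥ u) ⬝ᵥ (vc R - D.fullMatrix Q P' X S *ᵥ u) ≤
      (τ / 2) ^ 2 * (vc R ⬝ᵥ vc R) →
    vnorm (D.ntMatrix Q X S *ᵥ u - newtonRhs (centering n δ) (ntP X S) X S) ≤
      τ * vnorm (newtonRhs (centering n δ) (ntP X S) X S) ∧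
    D.Neighborhood γ (X + dirX Q u) (y + fun i => u (.inr i)) (S - D.dirS u) ∧
    nu (X + dirX Q u) (S - D.dirS u) ≤ (1 - (δ / 2) / Real.sqrt n) * nu X S

/-- With `E = P'P⁻¹`, everything built from `P'` is the conjugate by `E` of the corresponding object
in the coordinates of `V`. Since `EEᵀ = P'WP'ᵀ`, the hypothesis on `P'` says that `E` is nearly
orthogonal, and the comparison lemmas for the scaled space apply. -/
theorem SDO.stepFacts (hp : Params n γ δ) (hQ : IsNullBasis D.As Q) (hN : D.Neighborhood γ X y S)
    (hτ0 : 0 ≤ τ) (hτ1 : τ ≤ 1 / 100) (hτγ : τ ≤ γ / 100) (hτδ : τ ≤ δ) (hP' : P' * P'⁻¹ = 1)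
    (hW : frob (P' * ntW X S * P'ᵀ - 1) ≤ τ ^ 2 / 100) : D.StepFacts Q γ δ τ X y S P' := by
  obtain ⟨heq, hX, hS, hnear⟩ := hN
  obtain ⟨V, hsc, hPW⟩ := ntScaled hX hS
  set P := ntP X S with hP
  obtain ⟨hF, htr⟩ := hsc.frame hp.n_pos hX hS hnear
  have hn0 : (0 : ℝ) < n := by exact_mod_cast hp.n_pos
  have hSt := PosDef.transpose_eq hS
  have hXt := PosDef.transpose_eq hX
  have hVt := PosDef.transpose_eq hsc.pd
  have hVVt : (V * V)ᵀ = V * V := by rw [transpose_mul, hVt]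
  have hPP := hsc.unit
  have hPP' := hsc.unit'
  have hP'' : P'⁻¹ * P' = 1 := mul_eq_one_comm.mp hP'
  set E := P' * P⁻¹ with hE
  set F := P * P'⁻¹ with hFdef
  have hEF : E * F = 1 := by
    calc E * F = P' * (P⁻¹ * P) * P'⁻¹ := by rw [hE, hFdef]; noncomm_ring
      _ = 1 := by rw [hPP', mul_one, hP']
  have hW2 : ntW X S = P⁻¹ * P⁻¹ := by
    calc ntW X S = (P⁻¹ * P) * ntW X S * (P * P⁻¹) := by rw [hPP', hPP]; simp
      _ = P⁻¹ * (P * ntW X S * P) * P⁻¹ := by noncomm_ring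
      _ = _ := by rw [hPW, mul_one]
  have hEE : frob (Eᵀ * E - 1) ≤ τ ^ 2 / 100 := by
    rw [← frob_mul_transpose_sub_one]
    rw [hW2] at hW
    have : E * Eᵀ = P' * (P⁻¹ * P⁻¹) * P'ᵀ := by
      rw [hE, transpose_mul, hsc.inv_symm]; noncomm_ring
    rwa [this]
  have conj : ∀ A : Matrix (Fin n) (Fin n) ℝ, P' * A * P'⁻¹ = E * (P * A * P⁻¹) * F := by
    intro A
    calc P' * A * P'⁻¹ = P' * 1 * A * 1 * P'⁻¹ := by simp
      _ = P' * (P⁻¹ * P) * A * (P⁻¹ * P) * P'⁻¹ := by rw [hPP']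
      _ = _ := by rw [hE, hFdef]; noncomm_ring
  have hη : τ ^ 2 / 100 ≤ 1 / 100 := by
    have : τ ^ 2 ≤ 1 := pow_le_one₀ hτ0 (by linarith)
    linarith
  have full : ∀ u : Fin p ⊕ Fin m → ℝ, D.fullMatrix Q P' X S *ᵥ u =
      vc (symP (E * lin V (dirx Q P u) (D.dirs P u) * F)) := fun u => by
    rw [SDO.fullMatrix_mulVec hSt, conj, hsc.conj_eq]
  have nt : ∀ u : Fin p ⊕ Fin m → ℝ, D.ntMatrix Q X S *ᵥ u =
      svec (symP (lin V (dirx Q P u) (D.dirs P u))) := fun u => by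
    rw [SDO.ntMatrix, SDO.newtonMatrix_mulVec hSt, hsc.conj_eq]
  have ntsq : ∀ u : Fin p ⊕ Fin m → ℝ, D.ntMatrix Q X S *ᵥ u ⬝ᵥ D.ntMatrix Q X S *ᵥ u =
      frob (symP (lin V (dirx Q P u) (D.dirs P u))) ^ 2 := fun u => by
    rw [nt, ← vnorm_sq, vnorm_svec (symP_transpose _)]
  have bounds := fun u : Fin p ⊕ Fin m → ℝ => hF.symP_conj_bounds hp.γ_le
    (hsc.dirx_transpose (Q := Q) u) (hsc.dirs_transpose (D := D) u) (hsc.trace_dirx_dirs hQ u)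
    hEF hEE hη
  have inj : ∀ u, D.ntMatrix Q X S *ᵥ u = 0 → u = 0 := by
    intro u hu
    refine hsc.nt_injective hQ hp.γ_le hF ?_
    have := ntsq u
    rw [hu, zero_dotProduct] at this
    exact pow_eq_zero_iff two_ne_zero |>.mp this.symm
  have hXSP' : symmetrize P' (X * S) = symP (E * (V * V) * F) := by
    rw [symmetrize_eq, conj, hsc.XS_eq]
  have hXSP : symmetrize P (X * S) = V * V := by
    rw [symmetrize_eq, hsc.XS_eq, symP_of_symm hVVt]
  refine ⟨?_, inj, ?_, ?_, ?_, ?_⟩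
  · intro R hR
    have hinj : ∀ u, D.newtonMatrix Q P' X S *ᵥ u = 0 → u = 0 := by
      intro u hu
      refine hsc.nt_injective hQ hp.γ_le hF ?_
      have h1 : D.fullMatrix Q P' X S *ᵥ u = 0 := by
        rw [SDO.fullMatrix, ← mulVec_mulVec, hu, mulVec_zero]
      have h2 := (bounds u).1
      rw [← vc_dot_self (symP (E * _ * F)), ← full, h1, zero_dotProduct] at h2
      refine pow_eq_zero_iff two_ne_zero |>.mp ?_
      linarith [sq_nonneg (frob (symP (lin V (dirx Q P u) (D.dirs P u))))]
    obtain ⟨u, hu⟩ := exists_mulVec_eq (D.newtonMatrix Q P' X S)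
      (by simpa using D.card_eq hQ) hinj (svec R)
    exact ⟨u, by rw [SDO.fullMatrix, ← mulVec_mulVec, hu, symV_transpose_svec hR]⟩
  · intro u
    rw [ntsq, full, vc_dot_self]
    exact (bounds u).1
  · intro u
    rw [ntsq, full, vc_dot_self]
    exact (bounds u).2
  -- The trace of the right-hand side is `(σ - 1)nν`, nonzero because `δ > 0` makes `σ < 1`.
  · intro h0
    have h1 := congrArg trace h0
    rw [trace_sub, hXSP', trace_symP, trace_mul_comm, ← mul_assoc,
      mul_eq_one_comm.mp hEF, one_mul, htr, trace_smul, trace_one, Fintype.card_fin, trace_zero,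
      smul_eq_mul] at h1
    have h2 : centering n δ < 1 := by
      have : 0 < δ / Real.sqrt n := div_pos hp.δ_pos (by linarith [hp.one_le_sqrt])
      unfold centering; linarith
    have h3 : 0 < nu X S * n * (1 - centering n δ) :=
      mul_pos (mul_pos hF.nu_pos hn0) (by linarith)
    linarith
  · intro u R hR hres
    set L := lin V (dirx Q P u) (D.dirs P u) with hL
    set R₀ := (centering n δ * nu X S) • (1 : Matrix (Fin n) (Fin n) ℝ) - V * V with hR₀
    have hR₀t : R₀ᵀ = R₀ := by rw [hR₀]; simp [hVt]
    -- The multiple of the identity is unchanged by conjugation, so the right-hand side for `P'` is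
    -- the symmetric part of the conjugated right-hand side for `P`.
    have e1 : R = symP (E * R₀ * F) := by
      have : E * R₀ * F = (centering n δ * nu X S) • (1 : Matrix (Fin n) (Fin n) ℝ) -
          E * (V * V) * F := by
        rw [hR₀, mul_sub, sub_mul]
        simp only [mul_smul_comm, smul_mul_assoc, mul_one, hEF]
      rw [this, symP_sub, symP_of_symm (by simp), hR, hXSP']
    have e2 : vc R - D.fullMatrix Q P' X S *ᵥ u = -vc (symP (E * (L - R₀) * F)) := by
      rw [full, ← hL, e1, ← vc_sub, ← symP_sub]
      funext x
      simp only [vc, Pi.neg_apply, symP, Matrix.sub_apply, Matrix.add_apply, transpose_apply, mul_sub, sub_mul,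
        Matrix.smul_apply, smul_eq_mul]
      ring
    rw [e2, neg_dotProduct_neg, vc_dot_self, vc_dot_self, e1] at hres
    have hfin := hF.residual_le hp.γ_le (hsc.dirx_transpose (Q := Q) u)
      (hsc.dirs_transpose (D := D) u) (hsc.trace_dirx_dirs hQ u) hEF hτ0 hτ1 hEE hR₀t hres
    have hrhs : newtonRhs (centering n δ) P X S = svec R₀ := by rw [newtonRhs, hXSP]
    refine ⟨?_, ?_⟩
    · rw [nt, hrhs, ← svec_sub, vnorm_svec hR₀t, vnorm_svec (by
        rw [transpose_sub, symP_transpose, hR₀t])]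
      exact hfin
    obtain ⟨hpx, hps, ν', hν', hν'0, hν'le, hnew⟩ := hF.step hp htr
      (hsc.dirx_transpose (Q := Q) u) (hsc.dirs_transpose (D := D) u) (hsc.trace_dirx_dirs hQ u)
      hτγ hτδ hfin
    have hPiU : IsUnit P⁻¹ := IsUnit.of_mul_eq_one _ hPP'
    have eX : X + dirX Q u = P⁻¹ * (V + dirx Q P u) * P⁻¹ := by
      calc _ = (P⁻¹ * P) * (X + dirX Q u) * (P * P⁻¹) := by rw [hPP, hPP']; simp
        _ = P⁻¹ * (P * X * P + dirx Q P u) * P⁻¹ := by rw [dirx]; noncomm_ring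
        _ = _ := by rw [hsc.X_eq]
    have eS : S - D.dirS u = P * (V + D.dirs P u) * P := by
      calc _ = (P * P⁻¹) * (S - D.dirS u) * (P⁻¹ * P) := by rw [hPP, hPP']; simp
        _ = P * (P⁻¹ * S * P⁻¹ + D.dirs P u) * P := by rw [SDO.dirs]; noncomm_ring
        _ = _ := by rw [hsc.S_eq]
    have hX1 : (X + dirX Q u).PosDef := by
      rw [eX]; exact PosDef.sandwich hpx hsc.inv_symm hPiU
    have hS1 : (S - D.dirS u).PosDef := by
      rw [eS]; exact PosDef.sandwich hps hsc.symm hsc.isUnit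
    have eXS : (X + dirX Q u) * (S - D.dirS u) =
        P⁻¹ * ((V + dirx Q P u) * (V + D.dirs P u) * P) := by
      rw [eX, eS]
      calc _ = P⁻¹ * (V + dirx Q P u) * (P⁻¹ * P) * (V + D.dirs P u) * P := by noncomm_ring
        _ = _ := by rw [hPP']; noncomm_ring
    have hnu : nu (X + dirX Q u) (S - D.dirS u) = ν' := by
      rw [nu, inn, eXS, trace_mul_comm, mul_assoc, hPP, mul_one, hν']
      field_simp
    refine ⟨⟨⟨fun i => ?_, ?_⟩, hX1, hS1, ?_⟩, ?_⟩
    · have h1 := inn_A_dirX hQ u i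
      rw [inn] at h1 ⊢
      rw [mul_add, trace_add, h1, add_zero]
      exact heq.1 i
    · rw [SDO.dirS_eq, ← heq.2]
      simp only [Pi.add_apply, add_smul, Finset.sum_add_distrib]
      abel
    · rw [hnu]
      refine abs_le_of_sq_le_sq' ?_ (by have := hp.γ_pos; positivity) |>.2
      rw [frob_sqrt_sq hX1 (PosDef.transpose_eq hS1), eXS, trace_sub_smul_sq_comm, mul_assoc, hPP,
        mul_one]
      exact hnew
    · rw [hnu]; exact hν'le

end

/-! ### The step for linear optimization -/

section
variable {n m p : ℕ} {L : LO n m} {Q : Matrix (Fin n) (Fin p) ℝ}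
  {x s : Fin n → ℝ} {y : Fin m → ℝ} {u : Fin p ⊕ Fin m → ℝ} {γ δ β τ : ℝ}

theorem frob_diagonal (w : Fin n → ℝ) : frob (diagonal w) = vnorm w := by
  unfold frob vnorm
  congr 1
  refine Finset.sum_congr rfl fun i _ => ?_
  rw [Finset.sum_eq_single i (fun j _ hj => by simp [diagonal_apply_ne' _ hj]) (by simp)]
  simp

/-- The primal direction and the negative of the dual direction belonging to `u`. -/
def dirXLO (Q : Matrix (Fin n) (Fin p) ℝ) (u : Fin p ⊕ Fin m → ℝ) : Fin n → ℝ :=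
  Q *ᵥ fun i => u (.inl i)

def LO.dirS (L : LO n m) (u : Fin p ⊕ Fin m → ℝ) : Fin n → ℝ := L.Aᵀ *ᵥ fun i => u (.inr i)

theorem LO.newtonMatrix_mulVec (u : Fin p ⊕ Fin m → ℝ) :
    L.newtonMatrix Q x s *ᵥ u = fun i => s i * dirXLO Q u i - x i * L.dirS u i := by
  have e1 : u ∘ Sum.inl = fun i => u (.inl i) := rfl
  have e2 : u ∘ Sum.inr = fun i => u (.inr i) := rfl
  rw [LO.newtonMatrix, fromCols_mulVec, ← mulVec_mulVec, ← mulVec_mulVec, neg_mulVec, mulVec_neg,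
    e1, e2]
  funext i
  rw [Pi.add_apply, Pi.neg_apply, mulVec_diagonal,
    mulVec_diagonal, ← sub_eq_add_neg]
  rfl

theorem LO.dir_dot (hQ : IsNullBasis L.A Q) (u : Fin p ⊕ Fin m → ℝ) :
    dirXLO Q u ⬝ᵥ L.dirS u = 0 := by
  have h : L.A *ᵥ dirXLO Q u = 0 := (hQ.2 _).mpr ⟨_, rfl⟩
  rw [LO.dirS, dotProduct_mulVec, vecMul_transpose, h, zero_dotProduct]

/-- A kernel vector satisfies `Δxᵢ = (xᵢ/sᵢ)(Aᵀy)ᵢ`. Orthogonality of the two directions then makes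
a sum of nonnegative terms vanish. -/
theorem LO.injective (hQ : IsNullBasis L.A Q) (hx : ∀ i, 0 < x i) (hs : ∀ i, 0 < s i)
    (hu : L.newtonMatrix Q x s *ᵥ u = 0) : u = 0 := by
  rw [LO.newtonMatrix_mulVec] at hu
  have h1 : ∀ i, dirXLO Q u i = x i / s i * L.dirS u i := fun i => by
    have := congrFun hu i
    simp only [Pi.zero_apply] at this
    have := (hs i).ne'
    field_simp
    linarith
  have h2 := LO.dir_dot hQ u
  simp only [dotProduct, h1] at h2
  have h3 : ∀ i, L.dirS u i = 0 := fun i => by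
    have h4 := (Finset.sum_eq_zero_iff_of_nonneg (fun i _ => by
      have : 0 ≤ x i / s i := (div_pos (hx i) (hs i)).le
      rw [mul_assoc]
      exact mul_nonneg this (mul_self_nonneg _))).mp h2 i (Finset.mem_univ i)
    have h5 := (div_pos (hx i) (hs i)).ne'
    rw [mul_assoc] at h4
    exact mul_self_eq_zero.mp ((mul_eq_zero.mp h4).resolve_left h5)
  have h4 : dirXLO Q u = 0 := by funext i; simp [h1, h3]
  have h5 := hQ.mulVec_eq_zero h4
  have h6 : (fun i => u (.inr i)) = 0 := by
    have h7 : Function.Injective L.Aᵀ.mulVec := Matrix.mulVec_injective_iff.mpr L.A_indep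
    exact h7 ((funext h3 : L.dirS u = 0).trans (mulVec_zero L.Aᵀ).symm)
  funext i
  rcases i with i | i
  · exact congrFun h5 i
  · exact congrFun h6 i

theorem nuLO_pos (hn : 0 < n) (hx : ∀ i, 0 < x i) (hs : ∀ i, 0 < s i) : 0 < nuLO x s := by
  have : Nonempty (Fin n) := ⟨⟨0, hn⟩⟩
  have h1 : 0 < x ⬝ᵥ s :=
    Finset.sum_pos (fun i _ => mul_pos (hx i) (hs i)) Finset.univ_nonempty
  exact div_pos h1 (by exact_mod_cast hn)

theorem LO.rhs_ne (hp : Params n γ δ) (hx : ∀ i, 0 < x i) (hs : ∀ i, 0 < s i) :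
    newtonRhsLO (centering n δ) x s ≠ 0 := by
  intro h0
  have hn0 : (0 : ℝ) < n := by exact_mod_cast hp.n_pos
  have h1 : ∑ i, newtonRhsLO (centering n δ) x s i = 0 := by rw [h0]; simp
  simp only [newtonRhsLO, Finset.sum_sub_distrib, Finset.sum_const, Finset.card_univ,
    Fintype.card_fin, nsmul_eq_mul] at h1
  have h2 : ∑ i, x i * s i = n * nuLO x s := by
    rw [nuLO, dotProduct]; field_simp
  have h3 : centering n δ < 1 := by
    have : 0 < δ / Real.sqrt n := div_pos hp.δ_pos (by linarith [hp.one_le_sqrt])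
    unfold centering; linarith
  have h4 : 0 < nuLO x s * n * (1 - centering n δ) :=
    mul_pos (mul_pos (nuLO_pos hp.n_pos hx hs) hn0) (by linarith)
  rw [h2] at h1
  linarith

/-- The scaled step for `V = diag(√(xᵢsᵢ))` with directions `Δxᵢ√(sᵢ/xᵢ)` and `Δsᵢ√(xᵢ/sᵢ)`.
Diagonal matrices are symmetric, so the symmetrization disappears and the scaled residual is the
original one. -/
theorem LO.step (hp : Params n γ δ) (hQ : IsNullBasis L.A Q) (hN : L.Neighborhood γ x y s)
    (hτγ : τ ≤ γ / 100) (hτδ : τ ≤ δ)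
    (hres : vnorm (L.newtonMatrix Q x s *ᵥ u - newtonRhsLO (centering n δ) x s) ≤
      τ * vnorm (newtonRhsLO (centering n δ) x s)) :
    L.Neighborhood γ (x + dirXLO Q u) (y + fun i => u (.inr i)) (s - L.dirS u) ∧
    nuLO (x + dirXLO Q u) (s - L.dirS u) ≤ (1 - (δ / 2) / Real.sqrt n) * nuLO x s := by
  obtain ⟨heq, hx, hs, hnear⟩ := hN
  have hn0 : (0 : ℝ) < n := by exact_mod_cast hp.n_pos
  set v : Fin n → ℝ := fun i => Real.sqrt (x i) * Real.sqrt (s i) with hv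
  have rx : ∀ i, 0 < Real.sqrt (x i) := fun i => Real.sqrt_pos.mpr (hx i)
  have rs : ∀ i, 0 < Real.sqrt (s i) := fun i => Real.sqrt_pos.mpr (hs i)
  have ex : ∀ i, Real.sqrt (x i) * Real.sqrt (x i) = x i := fun i => Real.mul_self_sqrt (hx i).le
  have es : ∀ i, Real.sqrt (s i) * Real.sqrt (s i) = s i := fun i => Real.mul_self_sqrt (hs i).le
  have hvv : ∀ i, v i * v i = x i * s i := fun i => by
    rw [← ex i, ← es i, hv]; ring
  set a := dirXLO Q u
  set b := L.dirS u
  set dx : Fin n → ℝ := fun i => a i * (Real.sqrt (s i) / Real.sqrt (x i)) with hdx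
  set ds : Fin n → ℝ := fun i => -(b i * (Real.sqrt (x i) / Real.sqrt (s i))) with hds
  have e1 : ∀ i, dx i * v i = a i * s i := fun i => by
    have := (rx i).ne'
    rw [← es i]
    simp only [hdx, hv]
    field_simp
  have e2 : ∀ i, v i * ds i = -(b i * x i) := fun i => by
    have := (rs i).ne'
    rw [← ex i]
    simp only [hds, hv]
    field_simp
  have e3 : ∀ i, dx i * ds i = -(a i * b i) := fun i => by
    have := (rs i).ne'
    have := (rx i).ne'
    simp only [hdx, hds]
    field_simp
  have hD : diagonal v * diagonal v = diagonal fun i => x i * s i := by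
    rw [diagonal_mul_diagonal]; simp only [hvv]
  have hF : Frame (diagonal v) (nuLO x s) γ := by
    refine ⟨PosDef.diagonal fun i => mul_pos (rx i) (rs i), nuLO_pos hp.n_pos hx hs, ?_⟩
    rw [hD, smul_one_eq_diagonal, diagonal_sub, frob_diagonal]
    exact hnear
  have hlin : lin (diagonal v) (diagonal dx) (diagonal ds) =
      diagonal (L.newtonMatrix Q x s *ᵥ u) := by
    rw [lin, diagonal_mul_diagonal, diagonal_mul_diagonal, diagonal_add, LO.newtonMatrix_mulVec]
    congr 1
    funext i
    rw [e1, e2]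
    ring
  have hrhs : (centering n δ * nuLO x s) • (1 : Matrix (Fin n) (Fin n) ℝ) -
      diagonal v * diagonal v = diagonal (newtonRhsLO (centering n δ) x s) := by
    rw [hD, smul_one_eq_diagonal, diagonal_sub]; rfl
  obtain ⟨h1, h2, ν', h3, h4, h5, h6⟩ := hF.step (dx := diagonal dx) (ds := diagonal ds) hp
    (by rw [hD, trace_diagonal, nuLO, dotProduct]; field_simp)
    (diagonal_transpose _) (diagonal_transpose _)
    (by
      rw [diagonal_mul_diagonal, trace_diagonal]
      simp only [e3, Finset.sum_neg_distrib]
      rw [neg_eq_zero]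
      exact LO.dir_dot hQ u) hτγ hτδ
    (by
      rw [hlin, symP_of_symm (diagonal_transpose _), hrhs, diagonal_sub, frob_diagonal,
        frob_diagonal]
      exact hres)
  rw [diagonal_add] at h1 h2
  have h1' : ∀ i, 0 < v i + dx i := posDef_diagonal_iff.mp h1
  have h2' : ∀ i, 0 < v i + ds i := posDef_diagonal_iff.mp h2
  have px : ∀ i, (x + a) i = (v i + dx i) * (Real.sqrt (x i) / Real.sqrt (s i)) := fun i => by
    have := (rs i).ne'
    have := (rx i).ne'
    rw [Pi.add_apply, ← ex i]
    simp only [hdx, hv]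
    rw [ex i]
    field_simp
    rw [sq, ex i]
  have ps : ∀ i, (s - b) i = (v i + ds i) * (Real.sqrt (s i) / Real.sqrt (x i)) := fun i => by
    have := (rs i).ne'
    have := (rx i).ne'
    rw [Pi.sub_apply, ← es i]
    simp only [hds, hv]
    rw [es i]
    field_simp
    rw [sq, es i]
    ring
  have pxs : ∀ i, (v i + dx i) * (v i + ds i) = (x + a) i * (s - b) i := fun i => by
    have := (rs i).ne'
    have := (rx i).ne'
    rw [px, ps]
    field_simp
  rw [diagonal_add, diagonal_add, diagonal_mul_diagonal] at h3 h6
  simp only [pxs] at h3 h6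
  rw [trace_diagonal] at h3
  have hnu : nuLO (x + a) (s - b) = ν' := by
    rw [nuLO, dotProduct, h3]; field_simp
  refine ⟨⟨⟨?_, ?_⟩, fun i => ?_, fun i => ?_, ?_⟩, hnu ▸ h5⟩
  · rw [mulVec_add, heq.1, (hQ.2 a).mpr ⟨_, rfl⟩, add_zero]
  · rw [mulVec_add, ← heq.2]
    change L.Aᵀ *ᵥ y + b + (s - b) = _
    abel
  · rw [px]; exact mul_pos (h1' i) (div_pos (rx i) (rs i))
  · rw [ps]; exact mul_pos (h2' i) (div_pos (rs i) (rx i))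
  · rw [hnu]
    refine abs_le_of_sq_le_sq' ?_ (by have := hp.γ_pos; positivity) |>.2
    rw [smul_one_eq_diagonal, diagonal_sub, diagonal_mul_diagonal, trace_diagonal] at h6
    rw [vnorm_sq]
    exact h6

theorem LO.card_eq (hQ : IsNullBasis L.A Q) : p + m = n := by
  simpa using hQ.card L.A_indep

end

/-! ### Block rules for vectors, matrices and scalars -/

section
variable {μ μ' : Mem} {ι : ℕ → ℕ} {Q : Mem → Prop} {b : Blk} {n m p a : ℕ} {e : Tm}

/-- The index environment inside a fill. -/
abbrev env (ι : ℕ → ℕ) (i j : ℕ) : ℕ → ℕ := Function.update (Function.update ι 4 i) 5 j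

theorem Blk.Sat.setMat (h0 : ι 0 = n) (M : Matrix (Fin n) (Fin n) ℝ) (hok : e.total = true)
    (hev : ∀ i j : Fin n, e.ev μ 6 (env ι i j) = M i j)
    (h : ∀ μ', (∀ b ≠ a, μ' b = μ b) → μ'.mat a n n = M → Blk.Sat b μ' ι Q) :
    Blk.Sat (setMat a (.var 0) e :: b) μ ι Q :=
  Blk.Sat.cons (Fill.ok_of_total hok) fun μ' f v => h μ' f <| by
    ext i j
    rw [← hev]
    exact v i (by simp [ixv, h0]) j (by simp [ixv, h0])

theorem Blk.Sat.setCol (h0 : ι 0 = n) (w : Fin n → ℝ) (hok : e.total = true)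
    (hev : ∀ i : Fin n, e.ev μ 6 (env ι i 0) = w i)
    (h : ∀ μ', (∀ b ≠ a, μ' b = μ b) → μ'.vec a n = w → Blk.Sat b μ' ι Q) :
    Blk.Sat (IFIPM.setMat a (.lit 1) e :: b) μ ι Q :=
  Blk.Sat.cons (Fill.ok_of_total hok) fun μ' f v => h μ' f <| by
    funext i
    rw [← hev]
    exact v i (by simp [ixv, h0]) 0 (by simp [ixv])

theorem Blk.Sat.setZ (h0 : ι 2 = p) (w : Fin p → ℝ) (hok : e.total = true)
    (hev : ∀ i : Fin p, e.ev μ 6 (env ι i 0) = w i)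
    (h : ∀ μ', (∀ b ≠ a, μ' b = μ b) → μ'.vec a p = w → Blk.Sat b μ' ι Q) :
    Blk.Sat (IFIPM.setZ a e :: b) μ ι Q :=
  Blk.Sat.cons (Fill.ok_of_total hok) fun μ' f v => h μ' f <| by
    funext i
    rw [← hev]
    exact v i (by simp [ixv, h0]) 0 (by simp [ixv])

theorem Blk.Sat.setY (h0 : ι 1 = m) (w : Fin m → ℝ) (hok : e.total = true)
    (hev : ∀ i : Fin m, e.ev μ 6 (env ι i 0) = w i)
    (h : ∀ μ', (∀ b ≠ a, μ' b = μ b) → μ'.vec a m = w → Blk.Sat b μ' ι Q) :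
    Blk.Sat (IFIPM.setY a e :: b) μ ι Q :=
  Blk.Sat.cons (Fill.ok_of_total hok) fun μ' f v => h μ' f <| by
    funext i
    rw [← hev]
    exact v i (by simp [ixv, h0]) 0 (by simp [ixv])

theorem Blk.Sat.setSc (x : ℝ) (hok : e.ok μ 6 (env ι 0 0)) (hev : e.ev μ 6 (env ι 0 0) = x)
    (h : ∀ μ', (∀ b ≠ a, μ' b = μ b) → μ'.sc a = x → Blk.Sat b μ' ι Q) :
    Blk.Sat (IFIPM.setSc a e :: b) μ ι Q := by
  refine Blk.Sat.cons (fun i hi j hj => ?_) fun μ' f v => h μ' f ?_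
  · have hi : i = 0 := by simpa [ixv] using hi
    have hj : j = 0 := by simpa [ixv] using hj
    subst hi hj
    exact hok
  · rw [← hev]
    exact v 0 (by simp [ixv]) 0 (by simp [ixv])

end

/-- The number `n` of the size variable `0`. -/
abbrev countTm : Tm := .sum (.var 0) (.cst 1)

/-- Entry `i` of the array of scalars. -/
abbrev par (i : ℕ) : Tm := .rd 0 (.lit i) (.lit 0) (.lit 0)

/-- Stores `ip / n` as the current value of `ν`. -/
def nuBlk (ip : Tm) : Blk :=
  [setSc 60 ip, setSc 61 countTm,
    ⟨0, .lit 5, .lit 1, own 0 + .lt (.lit 3) (.var 4) * (scl 60 / scl 61 - own 0)⟩]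

/-- An assignment always covers a rectangle starting at the origin, so position 4 is reached by
rewriting positions 0 to 4; the indicator of `3 < i` keeps the parameters stored before it. -/
theorem nuBlk_sat {μ : Mem} {ι : ℕ → ℕ} {n : ℕ} {ip : Tm} (h0 : ι 0 = n) (hn : 0 < n)
    (hip : ip.total = true) {Q : Mem → Prop}
    (h : ∀ μ' : Mem, (∀ b < 60, b ≠ 0 → μ' b = μ b) → (∀ i < 4, μ' 0 i 0 0 = μ 0 i 0 0) →
      μ' 0 4 0 0 = ip.ev μ 6 (env ι 0 0) / n → Q μ') : (nuBlk ip).Sat μ ι Q := by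
  have hn0 : (n : ℝ) ≠ 0 := by exact_mod_cast hn.ne'
  refine Blk.Sat.setSc _ (Tm.ok_of_total _ _ _ hip) rfl fun μ1 f1 v1 => ?_
  refine Blk.Sat.setSc (n : ℝ) (Tm.ok_of_total _ _ _ rfl) (by simp [Tm.ev, ixv, h0])
    fun μ2 f2 v2 => ?_
  refine Blk.Sat.cons (fun i _ j _ => ⟨trivial, ⟨trivial, ⟨⟨trivial, trivial, fun _ => ?_⟩, trivial,
    by simp⟩, by simp⟩, by simp⟩) fun μ3 f3 v3 => Blk.Sat.nil (h μ3 ?_ ?_ ?_)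
  · simp only [Tm.ev, ixv]
    change μ2.sc 61 ≠ 0
    rw [v2]; exact hn0
  · intro b hb hb0
    rw [f3 b hb0, f2 b (by omega), f1 b (by omega)]
  · intro i hi
    have := v3 i (by simp only [ixv]; omega) 0 (by simp [ixv])
    simp only at this
    rw [this]
    simp only [Fill.val, Tm.ev_add, Tm.ev_mul, Tm.ev_sub]
    simp only [Tm.ev, ixv, Function.update_self, Function.update_of_ne (show 4 ≠ 5 by norm_num)]
    rw [if_neg (by omega), zero_mul, add_zero, f2 0 (by norm_num), f1 0 (by norm_num)]
  · have := v3 4 (by simp only [ixv]; omega) 0 (by simp [ixv])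
    simp only at this
    rw [this]
    simp only [Fill.val, Tm.ev_add, Tm.ev_mul, Tm.ev_sub, Tm.ev_div]
    simp only [Tm.ev, ixv, Function.update_self, Function.update_of_ne (show 4 ≠ 5 by norm_num)]
    rw [if_pos (by norm_num), one_mul, add_sub_cancel]
    change μ2.sc 60 / μ2.sc 61 = _
    rw [v2, Mem.sc, f2 60 (by norm_num)]
    change μ1.sc 60 / _ = _
    rw [v1]

/-- The tolerance of the inner solver. -/
def tol (γ δ β : ℝ) : ℝ := γ * δ * β / 100

/-- Computes the parameters of one iteration: `61` is `n`, `62` the tolerance, `35` the squared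
relative residual tolerance, `63` the tolerance for the scaling, `64` is `σ ν`. -/
def parBlk : Blk :=
  [setSc 61 countTm,
    setSc 62 (par 1 * par 2 * par 3 / .cst 100),
    setSc 35 (scl 62 * scl 62 / .cst 4),
    setSc 63 (scl 62 * scl 62 / .cst 100 * (scl 62 * scl 62 / .cst 100)),
    setSc 64 ((.cst 1 - par 2 / .sqrt (scl 61)) * par 4)]

theorem parBlk_sat {μ : Mem} {ι : ℕ → ℕ} {n : ℕ} {γ δ β ν : ℝ} (h0 : ι 0 = n) (hn : 0 < n)
    (h1 : μ 0 1 0 0 = γ) (h2 : μ 0 2 0 0 = δ) (h3 : μ 0 3 0 0 = β) (h4 : μ 0 4 0 0 = ν)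
    {Q : Mem → Prop}
    (h : ∀ μ' : Mem, (∀ b < 60, b ≠ 35 → μ' b = μ b) → μ'.sc 35 = (tol γ δ β / 2) ^ 2 →
      μ'.sc 63 = (tol γ δ β ^ 2 / 100) ^ 2 → μ'.sc 64 = centering n δ * ν → Q μ') :
    parBlk.Sat μ ι Q := by
  have hn0 : (0 : ℝ) < n := by exact_mod_cast hn
  refine Blk.Sat.setSc (n : ℝ) (Tm.ok_of_total _ _ _ rfl) (by simp [Tm.ev, ixv, h0])
    fun μ1 f1 v1 => ?_
  refine Blk.Sat.setSc (tol γ δ β) ⟨⟨⟨trivial, trivial, by simp⟩, trivial, by simp⟩, trivial,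
    by simp [Tm.ev]⟩ ?_ fun μ2 f2 v2 => ?_
  · simp only [Tm.ev_div, Tm.ev_mul]
    simp only [Tm.ev, ixv]
    rw [f1 0 (by norm_num), h1, h2, h3, tol]
    norm_num
  refine Blk.Sat.setSc ((tol γ δ β / 2) ^ 2) ⟨⟨trivial, trivial, by simp⟩, trivial,
    by simp [Tm.ev]⟩ ?_ fun μ3 f3 v3 => ?_
  · simp only [Tm.ev_div, Tm.ev_mul]
    simp only [Tm.ev, ixv]
    change μ2.sc 62 * μ2.sc 62 / _ = _
    rw [v2]
    push_cast
    ring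
  have e3 : μ3.sc 62 = tol γ δ β := by rw [← v2, Mem.sc, f3 62 (by norm_num), Mem.sc]
  refine Blk.Sat.setSc ((tol γ δ β ^ 2 / 100) ^ 2) ⟨⟨⟨trivial, trivial, by simp⟩, trivial,
    by simp [Tm.ev]⟩, ⟨⟨trivial, trivial, by simp⟩, trivial, by simp [Tm.ev]⟩, by simp⟩ ?_
    fun μ4 f4 v4 => ?_
  · simp only [Tm.ev_div, Tm.ev_mul]
    simp only [Tm.ev, ixv]
    change μ3.sc 62 * μ3.sc 62 / _ * (μ3.sc 62 * μ3.sc 62 / _) = _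
    rw [e3]
    push_cast
    ring
  have e4 : μ4 61 0 0 0 = n := by
    rw [f4 61 (by norm_num), f3 61 (by norm_num), f2 61 (by norm_num)]; exact v1
  have g4 : μ4 0 = μ 0 := by
    rw [f4 0 (by norm_num), f3 0 (by norm_num), f2 0 (by norm_num), f1 0 (by norm_num)]
  refine Blk.Sat.setSc (centering n δ * ν) ⟨⟨trivial, ⟨trivial, ⟨trivial, ?_⟩, fun _ => ?_⟩,
    by simp⟩, trivial, by simp⟩ ?_ fun μ5 f5 v5 => Blk.Sat.nil (h μ5 ?_ ?_ ?_ v5)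
  · simp only [Tm.ev, ixv, e4]; exact hn0.le
  · simp only [Tm.ev, ixv, e4]; exact (Real.sqrt_pos.mpr hn0).ne'
  · simp only [Tm.ev_mul, Tm.ev_sub, Tm.ev_div]
    simp only [Tm.ev, ixv, e4, g4, h2, h4, centering]
    push_cast
    ring
  · intro b hb hb0
    rw [f5 b (by omega), f4 b (by omega), f3 b hb0, f2 b (by omega), f1 b (by omega)]
  · rw [Mem.sc, f5 35 (by norm_num), f4 35 (by norm_num)]; exact v3
  · rw [Mem.sc, f5 63 (by norm_num)]; exact v4

/-! ### Solving the Newton system -/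

/-- The conjugate gradient method with its initialization. -/
def cgSolve (c : Ix) (mv mvT : Blk) : Cmd := .seq (cgInit c mvT).comp (cgLoop c mv mvT)

/-- A cost constant for `cgSolve`. -/
def cgCost (c : Ix) (mv mvT : Blk) : ℕ := (cgInit c mvT).cf + (cgBody c mv mvT).cf + 2

/-- Bound on the number of conjugate gradient passes per unit of condition number. -/
def cgFactor (θ : ℝ) : ℝ := 1 + Real.sqrt (3 / 2 / θ)

theorem cgFactor_nonneg (θ : ℝ) : 0 ≤ cgFactor θ := by unfold cgFactor; positivity

/-- `M` is the matrix used by the program, `N` the one whose condition number appears in the bound.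
Their quadratic forms differ by factors between `0.8` and `1.2`, whence the `3/2` in `cgFactor`. -/
theorem cgSolve_tot {w : ℕ → ℕ} {n m p c d : ℕ} {ι : ℕ → ℕ} {μ : Mem} {mv mvT : Blk} {ci : Ix}
    {M : Matrix (Fin n × Fin c) (Fin p ⊕ Fin m) ℝ} {RS : Set (Fin n × Fin c → ℝ)}
    {ρ : Type*} [Fintype ρ] {N : Matrix ρ (Fin p ⊕ Fin m) ℝ}
    (hsz : Sized w n ι) (hι0 : ι 0 = n) (hι1 : ι 1 = m) (hι2 : ι 2 = p) (hci : ci.below 3 = true)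
    (hc : ixv ι ci = c) (H : Matvec ι μ mv mvT M RS)
    (hwf : (cgInit ci mvT).wf = true) (hwf' : (cgBody ci mv mvT).wf = true)
    (hdg : (cgInit ci mvT).dgle w d = true) (hdg' : (cgBody ci mv mvT).dgle w d = true)
    (hpm : 0 < p + m) (hN : ∀ v, N *ᵥ v = 0 → v = 0)
    (hlo : ∀ v, 0.8 * (N *ᵥ v ⬝ᵥ N *ᵥ v) ≤ M *ᵥ v ⬝ᵥ M *ᵥ v)
    (hhi : ∀ v, M *ᵥ v ⬝ᵥ M *ᵥ v ≤ 1.2 * (N *ᵥ v ⬝ᵥ N *ᵥ v))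
    {θ : ℝ} {u : Fin p ⊕ Fin m → ℝ} {R : Fin n × Fin c → ℝ} (hu : R = M *ᵥ u)
    (hRS : ∀ v, M *ᵥ v ∈ RS) (hθ : 0 < θ) (hR : R ≠ 0) {s : State} (hs : Agree μ ι s)
    (hμθ : μ.sc 35 = θ ^ 2) (hμR : μ.rvec 22 n c = R) :
    ∃ (k : ℕ) (f : ℝ[X]) (v : Fin p ⊕ Fin m → ℝ), f.natDegree ≤ k ∧ v = polySolve f M R ∧
      (R - M *ᵥ v) ⬝ᵥ (R - M *ᵥ v) ≤ θ ^ 2 * (R ⬝ᵥ R) ∧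
      (∀ κ, 1 ≤ κ → condNumber N ≤ κ → (k : ℝ) ≤ cgFactor θ * κ) ∧
      Tot (cgSolve ci mv mvT) s (cgCost ci mv mvT * n ^ d * (k + 1)) fun s' =>
        ∃ μ', Agree μ' ι s' ∧ (∀ b < 20, μ' b = μ b) ∧ μ'.uvec 20 21 p m = v := by
  have hne : Nonempty (Fin p ⊕ Fin m) := by
    rw [← Fintype.card_pos_iff]; simpa using hpm
  obtain ⟨a, b, ha, hb, hcond, hNlo, hNhi⟩ := condNumber_bounds N hN
  have hlo' : ∀ v, 0.8 * a ^ 2 * (v ⬝ᵥ v) ≤ M *ᵥ v ⬝ᵥ M *ᵥ v := fun v =>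
    le_trans (by linarith [hNlo v]) (hlo v)
  have hhi' : ∀ v, M *ᵥ v ⬝ᵥ M *ᵥ v ≤ 1.2 * b ^ 2 * (v ⬝ᵥ v) := fun v =>
    (hhi v).trans (by linarith [hNhi v])
  have h1 := cgInit_sat hι0 hι1 hι2 hci hc H (fun _ _ => rfl) (by rw [hμR, hu]; exact hRS u)
  rw [hμR, hμθ] at h1
  obtain ⟨t, s1, hex, ht, μ1, hs1, hμ1⟩ := h1.tot hsz hwf hdg hs
  obtain ⟨k, f, v, h2, h3, h4, h5, h6⟩ := cgLoop_tot hsz hι0 hι1 hι2 hci hc H hwf' hdg' hu hRS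
    hlo' hhi' (by positivity) (by positivity) hθ hR hs1 hμ1
  refine ⟨k, f, v, h2, h3, h4, ?_, ?_⟩
  · intro κ hκ hle
    have h7 := h5 _ _ (by positivity) (by positivity) hlo' hhi'
    have h8 : 1.2 * b ^ 2 / (θ * (0.8 * a ^ 2)) = 3 / 2 / θ * condNumber N ^ 2 := by
      rw [hcond]; field_simp; norm_num
    have h9 : 0 ≤ condNumber N := by rw [hcond]; positivity
    rw [h8, Real.sqrt_mul (by positivity), Real.sqrt_sq h9] at h7
    calc (k : ℝ) ≤ 1 + Real.sqrt (3 / 2 / θ) * condNumber N := h7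
      _ ≤ 1 * κ + Real.sqrt (3 / 2 / θ) * κ := by gcongr; linarith
      _ = _ := by rw [cgFactor]; ring
  · obtain ⟨t', s2, hex', ht', hpost⟩ := h6
    refine ⟨_, s2, Exec.seq hex hex', ?_, hpost⟩
    have hone := hsz.one_le_pow d
    rw [cgCost]
    generalize (cgInit ci mvT).cf = A at *
    generalize (cgBody ci mv mvT).cf = C at *
    generalize n ^ d = Z at *
    have hk : k ≤ k * Z := Nat.le_mul_of_pos_right _ hone
    have hAk : 0 ≤ A * Z * k := Nat.zero_le _
    calc t + t' ≤ A * Z + (k * (C * Z + 1) + 1) := add_le_add ht ht'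
      _ ≤ (A + C + 2) * Z * (k + 1) := by
        have : (A + C + 2) * Z * (k + 1) = A * Z + (k * (C * Z) + k * Z) + Z + (A * Z * k + C * Z +
          k * Z + Z) := by ring
        rw [this, mul_add, mul_one]
        omega

/-! ### The program for linear optimization -/

theorem Mem.mat_congr {μ μ' : Mem} {a r c : ℕ} (h : μ' a = μ a) : μ'.mat a r c = μ.mat a r c := by
  unfold Mem.mat; rw [h]

theorem Mem.vec_congr {μ μ' : Mem} {a r : ℕ} (h : μ' a = μ a) : μ'.vec a r = μ.vec a r := by
  unfold Mem.vec; rw [h]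

theorem tol_pos {γ δ β : ℝ} (hγ : 0 < γ) (hδ : 0 < δ) (hβ : 0 < β) : 0 < tol γ δ β := by
  unfold tol; positivity

theorem tol_le {n : ℕ} {γ δ β : ℝ} (hp : Params n γ δ) (hβ : 0 < β) (hβ1 : β < 1) :
    tol γ δ β ≤ γ / 100 ∧ tol γ δ β ≤ δ ∧ tol γ δ β ≤ β := by
  refine ⟨?_, ?_, ?_⟩
  · have : γ * δ * β ≤ γ := by
      have h := mul_le_one₀ (hp.δ_le.trans (by norm_num)) hβ.le hβ1.le
      rw [mul_assoc]
      exact mul_le_of_le_one_right hp.γ_pos.le h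
    unfold tol; linarith
  · have h := mul_le_one₀ (hp.γ_le.trans (by norm_num)) hβ.le hβ1.le
    have : γ * δ * β ≤ δ := by
      rw [mul_right_comm]
      exact mul_le_of_le_one_left hp.δ_pos.le h
    have := hp.δ_pos
    unfold tol; linarith
  · have h := mul_le_one₀ (hp.γ_le.trans (by norm_num)) hp.δ_pos.le (hp.δ_le.trans (by norm_num))
    have : γ * δ * β ≤ β := mul_le_of_le_one_left hβ.le h
    unfold tol; linarith

namespace LOProg

def mv : Blk :=
  [setMat 28 (.lit 1) (ve 3 4 * .sum (.var 2) (ent 7 4 6 * ve 23 6) -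
    ve 1 4 * .sum (.var 1) (ent 4 6 4 * ve 24 6))]

def mvT : Blk :=
  [setZ 25 (.sum (.var 0) (ent 7 6 4 * (ve 3 6 * ve 22 6))),
    setY 26 (.cst 0 - .sum (.var 0) (ent 4 4 6 * (ve 1 6 * ve 22 6)))]

def rhs : Blk := [setMat 22 (.lit 1) (scl 64 - ve 1 4 * ve 3 4)]

def gap : Tm := .sum (.var 0) (ve 1 6 * ve 3 6)

def update : Blk :=
  [setMat 1 (.lit 1) (own 1 + .sum (.var 2) (ent 7 4 6 * ve 20 6)),
    setY 2 (own 2 + own 21),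
    setMat 3 (.lit 1) (own 3 - .sum (.var 1) (ent 4 6 4 * ve 21 6))]

def init : Cmd := (nuBlk gap).comp

def body : Cmd :=
  .seq (parBlk ++ rhs).comp (.seq (cgSolve (.lit 1) mv mvT) (update ++ nuBlk gap).comp)

section
variable {n m p : ℕ} {L : LO n m} {Q : Matrix (Fin n) (Fin p) ℝ} {ε γ δ β : ℝ}

/-- The memory holds the problem data. -/
structure Data (L : LO n m) (Q : Matrix (Fin n) (Fin p) ℝ) (ε γ δ β : ℝ) (μ : Mem) : Prop where
  ε : μ 0 0 0 0 = ε
  γ : μ 0 1 0 0 = γ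
  δ : μ 0 2 0 0 = δ
  β : μ 0 3 0 0 = β
  A : μ.mat 4 m n = L.A
  Q : μ.mat 7 n p = Q

/-- The coefficient matrix with rows indexed by the cells of a column. -/
def colMatrix (L : LO n m) (Q : Matrix (Fin n) (Fin p) ℝ) (x s : Fin n → ℝ) :
    Matrix (Fin n × Fin 1) (Fin p ⊕ Fin m) ℝ :=
  (L.newtonMatrix Q x s).submatrix (Equiv.prodUnique (Fin n) (Fin 1)) id

theorem colMatrix_mulVec (x s : Fin n → ℝ) (u : Fin p ⊕ Fin m → ℝ) :
    colMatrix L Q x s *ᵥ u = (L.newtonMatrix Q x s *ᵥ u) ∘ Equiv.prodUnique (Fin n) (Fin 1) := rfl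

theorem dot_comp_equiv (v w : Fin n → ℝ) :
    (v ∘ Equiv.prodUnique (Fin n) (Fin 1)) ⬝ᵥ (w ∘ Equiv.prodUnique (Fin n) (Fin 1)) = v ⬝ᵥ w :=
  Equiv.sum_comp (Equiv.prodUnique (Fin n) (Fin 1)) fun i => v i * w i

theorem colMatrix_transpose_mulVec (x s : Fin n → ℝ) (v : Fin n → ℝ) :
    (colMatrix L Q x s)ᵀ *ᵥ (v ∘ Equiv.prodUnique (Fin n) (Fin 1)) =
      (L.newtonMatrix Q x s)ᵀ *ᵥ v := by
  funext j
  exact dot_comp_equiv (fun i => L.newtonMatrix Q x s i j) v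

theorem polySolve_colMatrix (f : ℝ[X]) (x s v : Fin n → ℝ) :
    polySolve f (colMatrix L Q x s) (v ∘ Equiv.prodUnique (Fin n) (Fin 1)) =
      polySolve f (L.newtonMatrix Q x s) v := by
  have h : (colMatrix L Q x s)ᵀ * colMatrix L Q x s =
      (L.newtonMatrix Q x s)ᵀ * L.newtonMatrix Q x s := by
    ext i j
    exact dot_comp_equiv (fun k => L.newtonMatrix Q x s k i) fun k => L.newtonMatrix Q x s k j
  rw [polySolve, polySolve, h, colMatrix_transpose_mulVec]

theorem newtonMatrix_transpose_mulVec (x s v : Fin n → ℝ) :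
    (L.newtonMatrix Q x s)ᵀ *ᵥ v = Sum.elim (Qᵀ *ᵥ fun i => s i * v i)
      (-(L.A *ᵥ fun i => x i * v i)) := by
  rw [LO.newtonMatrix, transpose_fromCols, fromRows_mulVec]
  congr 1
  · rw [transpose_mul, diagonal_transpose, ← mulVec_mulVec]
    congr 1
    funext i
    exact mulVec_diagonal _ _ _
  · rw [transpose_mul, diagonal_transpose, ← mulVec_mulVec, transpose_neg, transpose_transpose,
      neg_mulVec]
    congr 2
    funext i
    exact mulVec_diagonal _ _ _

/-- The transposed product is valid for every residual here, so the admissible set is everything.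
All sums have at most `n` terms, which gives degree 2. -/
theorem matvec {ι : ℕ → ℕ} {μ₀ : Mem} (h0 : ι 0 = n) (h1 : ι 1 = m) (h2 : ι 2 = p)
    (hd : Data L Q ε γ δ β μ₀) :
    Matvec ι μ₀ mv mvT (colMatrix L Q (μ₀.vec 1 n) (μ₀.vec 3 n)) Set.univ := by
  have hA : ∀ (i : Fin m) (j : Fin n), L.A i j = μ₀ 4 i j 0 := fun i j => by rw [← hd.A]; rfl
  have hQ : ∀ (i : Fin n) (j : Fin p), Q i j = μ₀ 7 i j 0 := fun i j => by rw [← hd.Q]; rfl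
  constructor
  · intro μ hμ
    refine Blk.Sat.setCol h0 (L.newtonMatrix Q (μ₀.vec 1 n) (μ₀.vec 3 n) *ᵥ μ.uvec 23 24 p m) rfl
      (fun i => ?_) fun μ1 f1 v1 => Blk.Sat.nil ⟨fun b _ hb => f1 b hb, ?_⟩
    · rw [LO.newtonMatrix_mulVec]
      simp only [Tm.ev_sub, Tm.ev_mul]
      simp [Tm.ev, Op.eval, ixv, h1, h2, Finset.sum_range, dirXLO, LO.dirS, mulVec, dotProduct,
        Mem.uvec, Mem.vec, hA, hQ, hμ]
    · rw [colMatrix_mulVec, ← v1]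
      funext ⟨i, j⟩
      have : j = 0 := Subsingleton.elim _ _
      subst this
      rfl
  · intro μ hμ _
    have hr : μ.rvec 22 n 1 = μ.vec 22 n ∘ Equiv.prodUnique (Fin n) (Fin 1) := by
      funext ⟨i, j⟩
      have : j = 0 := Subsingleton.elim _ _
      subst this
      rfl
    rw [hr, colMatrix_transpose_mulVec, newtonMatrix_transpose_mulVec]
    refine Blk.Sat.setZ h2 (Qᵀ *ᵥ fun i => μ₀.vec 3 n i * μ.vec 22 n i) rfl (fun i => ?_)
      fun μ1 f1 v1 => ?_
    · simp [Tm.ev, Op.eval, ixv, h0, Finset.sum_range, mulVec, dotProduct, Mem.vec, hQ, hμ]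
    refine Blk.Sat.setY h1 (-(L.A *ᵥ fun i => μ₀.vec 1 n i * μ.vec 22 n i)) rfl (fun i => ?_)
      fun μ2 f2 v2 => Blk.Sat.nil ⟨fun b _ hb hb' => (f2 b hb').trans (f1 b hb), ?_⟩
    · simp only [Tm.ev_sub]
      simp [Tm.ev, Op.eval, ixv, h0, Finset.sum_range, mulVec, dotProduct, Mem.vec, hA, hμ, f1]
    · rw [Mem.uvec, v2, Mem.vec_congr (f2 25 (by norm_num)), v1]


/-- The memory holds the problem data and an iterate in the neighborhood. -/
structure Good (L : LO n m) (Q : Matrix (Fin n) (Fin p) ℝ) (ε γ δ β : ℝ) (s : State) : Prop where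
  size0 : s.ix 0 = n
  size1 : s.ix 1 = m
  size2 : s.ix 2 = p
  data : Data L Q ε γ δ β s.mem
  gap : s.mem 0 4 0 0 = nuLO (s.vec 1 n) (s.vec 3 n)
  nbhd : L.Neighborhood γ (s.vec 1 n) (s.vec 2 m) (s.vec 3 n)

theorem Data.congr {μ μ' : Mem} (h : Data L Q ε γ δ β μ) (h0 : ∀ i < 4, μ' 0 i 0 0 = μ 0 i 0 0)
    (h4 : μ' 4 = μ 4) (h7 : μ' 7 = μ 7) : Data L Q ε γ δ β μ' :=
  ⟨(h0 0 (by norm_num)).trans h.ε, (h0 1 (by norm_num)).trans h.γ, (h0 2 (by norm_num)).trans h.δ,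
    (h0 3 (by norm_num)).trans h.β, (Mem.mat_congr h4).trans h.A, (Mem.mat_congr h7).trans h.Q⟩

/-- A cost constant for one iteration. -/
def cost : ℕ :=
  (parBlk ++ rhs).cf + cgCost (.lit 1) mv mvT + (update ++ nuBlk gap).cf + (nuBlk gap).cf

abbrev wt : ℕ → ℕ := fun _ => 1

theorem sized (hQ : IsNullBasis L.A Q) (hn : 0 < n) {ι : ℕ → ℕ} (h0 : ι 0 = n) (h1 : ι 1 = m)
    (h2 : ι 2 = p) : Sized wt n ι := by
  have h := L.card_eq hQ
  refine ⟨hn, fun v hv => ?_⟩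
  interval_cases v <;> simp only [pow_one] <;> omega

theorem ev_gap {μ : Mem} {ι : ℕ → ℕ} (h0 : ι 0 = n) :
    gap.ev μ 6 (env ι 0 0) = μ.vec 1 n ⬝ᵥ μ.vec 3 n := by
  simp [gap, Tm.ev, Op.eval, ixv, h0, Finset.sum_range, dotProduct, Mem.vec]

/-- The inner solver is asked for `τ/2`, and the step needs `τ`. Because the program uses the Newton
system itself, no change of scaling intervenes. -/
theorem body_tot (hp : Params n γ δ) (hβ : 0 < β) (hβ1 : β < 1) (hQ : IsNullBasis L.A Q)
    {s : State} (hs : Good L Q ε γ δ β s) :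
    ∃ (k : ℕ) (q : ℝ[X]), q.natDegree ≤ k ∧
      (∀ κ, 1 ≤ κ → condNumber (L.newtonMatrix Q (s.vec 1 n) (s.vec 3 n)) ≤ κ →
        (k : ℝ) ≤ cgFactor (tol γ δ β / 2) * κ) ∧
      Tot body s (cost * n ^ 2 * (k + 1)) fun s' => Good L Q ε γ δ β s' ∧
        L.InexactStep Q (centering n δ) β q (s.vec 1 n) (s.vec 2 m) (s.vec 3 n)
          (s'.vec 1 n) (s'.vec 2 m) (s'.vec 3 n) ∧
        s'.get nuRef ≤ (1 - (δ / 2) / Real.sqrt n) * s.get nuRef := by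
  obtain ⟨h0, h1, h2, hd, hgap, hN⟩ := hs
  set x := s.vec 1 n with hx
  set y := s.vec 2 m with hy
  set z := s.vec 3 n with hz
  have hsz := sized hQ hp.n_pos h0 h1 h2
  have hτ := tol_pos hp.γ_pos hp.δ_pos hβ
  obtain ⟨hτγ, hτδ, hτβ⟩ := tol_le hp hβ hβ1
  set R := newtonRhsLO (centering n δ) x z with hR
  have hpre : (parBlk ++ rhs).Sat s.mem s.ix fun μ => (∀ b < 20, μ b = s.mem b) ∧
      μ.sc 35 = (tol γ δ β / 2) ^ 2 ∧
      μ.rvec 22 n 1 = R ∘ Equiv.prodUnique (Fin n) (Fin 1) := by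
    refine Blk.Sat.append (parBlk_sat h0 hp.n_pos hd.γ hd.δ hd.β hgap fun μ1 f1 v35 _ v64 => ?_)
    refine Blk.Sat.setCol h0 R rfl (fun i => ?_) fun μ2 f2 v2 => Blk.Sat.nil ⟨fun b hb => ?_, ?_, ?_⟩
    · simp only [Tm.ev_sub, Tm.ev_mul]
      simp only [Tm.ev, ixv, Function.update_self, Function.update_of_ne (show 4 ≠ 5 by norm_num)]
      rw [f1 1 (by norm_num) (by norm_num), f1 3 (by norm_num) (by norm_num)]
      change μ1.sc 64 - _ = _
      rw [v64]
      rfl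
    · rw [f2 b (by omega), f1 b (by omega) (by omega)]
    · rw [Mem.sc, f2 35 (by norm_num)]; exact v35
    · rw [← v2]
      funext ⟨i, j⟩
      have : j = 0 := Subsingleton.elim _ _
      subst this
      rfl
  obtain ⟨t1, s1, hex1, ht1, μ1, hs1, hμ1, hθ1, hr1⟩ :=
    hpre.tot (s := s) (d := 2) hsz (by decide) (by decide) ⟨fun _ _ => rfl, fun _ _ => rfl⟩
  have hd1 : Data L Q ε γ δ β μ1 := hd.congr (fun i _ => by rw [hμ1 0 (by norm_num)])
    (hμ1 4 (by norm_num)) (hμ1 7 (by norm_num))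
  have ex1 : μ1.vec 1 n = x := Mem.vec_congr (hμ1 1 (by norm_num))
  have ez1 : μ1.vec 3 n = z := Mem.vec_congr (hμ1 3 (by norm_num))
  have hmv := matvec h0 h1 h2 hd1
  rw [ex1, ez1] at hmv
  have hinj : ∀ v, L.newtonMatrix Q x z *ᵥ v = 0 → v = 0 := fun v hv =>
    LO.injective hQ hN.2.1 hN.2.2.1 hv
  obtain ⟨u₀, hu₀⟩ := exists_mulVec_eq (L.newtonMatrix Q x z) (by simpa using L.card_eq hQ) hinj R
  have hsq : ∀ v, colMatrix L Q x z *ᵥ v ⬝ᵥ colMatrix L Q x z *ᵥ v =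
      L.newtonMatrix Q x z *ᵥ v ⬝ᵥ L.newtonMatrix Q x z *ᵥ v := fun v => by
    rw [colMatrix_mulVec]; exact dot_comp_equiv _ _
  have hpos : ∀ v, 0 ≤ L.newtonMatrix Q x z *ᵥ v ⬝ᵥ L.newtonMatrix Q x z *ᵥ v := fun v =>
    dot_self_nonneg _
  obtain ⟨k, f, u, hk1, hu, hres, hk2, hT⟩ := cgSolve_tot (N := L.newtonMatrix Q x z) (d := 2)
    (ci := .lit 1) (c := 1) (mv := mv) (mvT := mvT) (M := colMatrix L Q x z)
    (R := R ∘ Equiv.prodUnique (Fin n) (Fin 1)) (u := u₀) hsz h0 h1 h2 rfl rfl hmv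
    (by decide) (by decide) (by decide) (by decide)
    (by rw [L.card_eq hQ]; exact hp.n_pos) hinj
    (fun v => by rw [hsq]; linarith [hpos v]) (fun v => by rw [hsq]; linarith [hpos v])
    (by rw [colMatrix_mulVec, hu₀]) (fun v => Set.mem_univ _) (half_pos hτ)
    (fun h => LO.rhs_ne hp hN.2.1 hN.2.2.1 (funext fun i => congrFun h (i, 0))) hs1 hθ1 hr1
  obtain ⟨t2, s2, hex2, ht2, μ2, hs2, hμ2, hu2⟩ := hT
  rw [polySolve_colMatrix] at hu
  have hres' : vnorm (L.newtonMatrix Q x z *ᵥ u - R) ≤ tol γ δ β * vnorm R := by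
    have e : R ∘ Equiv.prodUnique (Fin n) (Fin 1) - colMatrix L Q x z *ᵥ u =
        (R - L.newtonMatrix Q x z *ᵥ u) ∘ Equiv.prodUnique (Fin n) (Fin 1) := rfl
    rw [e, dot_comp_equiv, dot_comp_equiv, ← vnorm_sq, ← vnorm_sq, ← mul_pow] at hres
    have h3 := abs_le_of_sq_le_sq' hres (mul_nonneg (half_pos hτ).le (vnorm_nonneg _)) |>.2
    have e2 : vnorm (L.newtonMatrix Q x z *ᵥ u - R) = vnorm (R - L.newtonMatrix Q x z *ᵥ u) := by
      simp only [vnorm, Pi.sub_apply]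
      congr 1
      exact Finset.sum_congr rfl fun i _ => by ring
    rw [e2]
    have := mul_nonneg hτ.le (vnorm_nonneg R)
    linarith
  obtain ⟨hN', hν'⟩ := LO.step hp hQ hN hτγ hτδ hres'
  set x' := x + dirXLO Q u with hx'
  set y' := (y + fun i => u (.inr i)) with hy'
  set z' := z - L.dirS u with hz'
  have e20 : ∀ i : Fin p, μ2 20 i 0 0 = u (.inl i) := fun i => congrFun hu2 (.inl i)
  have e21 : ∀ i : Fin m, μ2 21 i 0 0 = u (.inr i) := fun i => congrFun hu2 (.inr i)
  have hA : ∀ (i : Fin m) (j : Fin n), L.A i j = μ2 4 i j 0 := fun i j => by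
    rw [← hd1.A, hμ2 4 (by norm_num)]; rfl
  have hQm : ∀ (i : Fin n) (j : Fin p), Q i j = μ2 7 i j 0 := fun i j => by
    rw [hμ2 7 (by norm_num)]; exact (congrFun (congrFun hd1.Q i) j).symm
  have hpost : (update ++ nuBlk gap).Sat μ2 s.ix fun μ => Data L Q ε γ δ β μ ∧
      μ.vec 1 n = x' ∧ μ.vec 2 m = y' ∧ μ.vec 3 n = z' ∧ μ 0 4 0 0 = nuLO x' z' := by
    refine Blk.Sat.append ?_
    refine Blk.Sat.setCol h0 x' rfl (fun i => ?_) fun μ3 f3 v3 => ?_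
    · simp only [Tm.ev_add]
      simp only [Tm.ev, Op.eval, ixv, Function.update_self, h2, Finset.sum_range,
        Function.update_of_ne (show 4 ≠ 5 by norm_num), Function.update_of_ne (show 4 ≠ 6 by norm_num),
        Function.update_of_ne (show 2 ≠ 5 by norm_num), Function.update_of_ne (show 2 ≠ 4 by norm_num)]
      rw [hx', ← ex1]
      simp [Mem.vec, dirXLO, mulVec, dotProduct, hQm, e20, hμ2]
    refine Blk.Sat.setY h1 y' rfl (fun i => ?_) fun μ4 f4 v4 => ?_
    · simp only [Tm.ev_add]
      simp only [Tm.ev, ixv, Function.update_self,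
        Function.update_of_ne (show 4 ≠ 5 by norm_num)]
      rw [f3 2 (by norm_num), f3 21 (by norm_num), e21, hμ2 2 (by norm_num), hμ1 2 (by norm_num)]
      rfl
    refine Blk.Sat.setCol h0 z' rfl (fun i => ?_) fun μ5 f5 v5 => ?_
    · simp only [Tm.ev_sub]
      simp only [Tm.ev, Op.eval, ixv, Function.update_self, h1, Finset.sum_range,
        Function.update_of_ne (show 4 ≠ 5 by norm_num), Function.update_of_ne (show 4 ≠ 6 by norm_num),
        Function.update_of_ne (show 1 ≠ 5 by norm_num), Function.update_of_ne (show 1 ≠ 4 by norm_num)]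
      rw [hz', ← ez1]
      simp [Mem.vec, LO.dirS, mulVec, dotProduct, hA, e21, hμ2, f3, f4]
    refine Blk.Sat.nil (nuBlk_sat h0 hp.n_pos rfl fun μ6 f6 g6 v6 => ?_)
    have g0 : μ5 0 = s.mem 0 := by
      rw [f5 0 (by norm_num), f4 0 (by norm_num), f3 0 (by norm_num), hμ2 0 (by norm_num),
        hμ1 0 (by norm_num)]
    have ex5 : μ5.vec 1 n = x' := by
      rw [Mem.vec_congr (f5 1 (by norm_num)), Mem.vec_congr (f4 1 (by norm_num)), v3]
    refine ⟨hd.congr (fun i hi => by rw [g6 i hi, g0]) ?_ ?_, ?_, ?_, ?_, ?_⟩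
    · rw [f6 4 (by norm_num) (by norm_num), f5 4 (by norm_num), f4 4 (by norm_num),
        f3 4 (by norm_num), hμ2 4 (by norm_num), hμ1 4 (by norm_num)]
    · rw [f6 7 (by norm_num) (by norm_num), f5 7 (by norm_num), f4 7 (by norm_num),
        f3 7 (by norm_num), hμ2 7 (by norm_num), hμ1 7 (by norm_num)]
    · rw [Mem.vec_congr (f6 1 (by norm_num) (by norm_num)), ex5]
    · rw [Mem.vec_congr (f6 2 (by norm_num) (by norm_num)), Mem.vec_congr (f5 2 (by norm_num)), v4]
    · rw [Mem.vec_congr (f6 3 (by norm_num) (by norm_num)), v5]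
    · rw [v6, ev_gap h0, ex5, v5, nuLO]
  obtain ⟨t3, s3, hex3, ht3, μ3, hs3, hd3, hx3, hy3, hz3, hν3⟩ :=
    hpost.tot (s := s2) (d := 2) hsz (by decide) (by decide) hs2
  have em : ∀ b ≠ 8, s3.mem b = μ3 b := hs3.2
  have vx : s3.vec 1 n = x' := by
    rw [← hx3]; exact Mem.vec_congr (em 1 (by norm_num))
  have vy : s3.vec 2 m = y' := by
    rw [← hy3]; exact Mem.vec_congr (em 2 (by norm_num))
  have vz : s3.vec 3 n = z' := by
    rw [← hz3]; exact Mem.vec_congr (em 3 (by norm_num))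
  have vν : s3.mem 0 4 0 0 = nuLO x' z' := by rw [em 0 (by norm_num), hν3]
  refine ⟨k, f, hk1, hk2, _, s3, Exec.seq hex1 (Exec.seq hex2 hex3), ?_, ⟨?_, ?_, ?_, ?_, ?_, ?_⟩,
    ⟨u, hu, hres'.trans (mul_le_mul_of_nonneg_right hτβ (vnorm_nonneg _)), vx, vy, vz⟩, ?_⟩
  · have hz1 := hsz.one_le_pow 2
    unfold cost
    generalize (parBlk ++ rhs).cf = a at *
    generalize (update ++ nuBlk gap).cf = b at *
    generalize (nuBlk gap).cf = c at *
    generalize cgCost (.lit 1) mv mvT = e at *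
    generalize n ^ 2 = N at *
    calc t1 + (t2 + t3) ≤ a * N + (e * N * (k + 1) + b * N) := by gcongr
      _ ≤ a * N * (k + 1) + (e * N * (k + 1) + b * N * (k + 1)) + c * N * (k + 1) := by
        have h3 : a * N ≤ a * N * (k + 1) := Nat.le_mul_of_pos_right _ (by omega)
        have h4 : b * N ≤ b * N * (k + 1) := Nat.le_mul_of_pos_right _ (by omega)
        omega
      _ = _ := by ring
  · rw [hs3.1 0 (by norm_num), h0]
  · rw [hs3.1 1 (by norm_num), h1]
  · rw [hs3.1 2 (by norm_num), h2]
  · exact hd3.congr (fun i _ => by rw [em 0 (by norm_num)]) (em 4 (by norm_num)) (em 7 (by norm_num))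
  · rw [vν, vx, vz]
  · rw [vx, vy, vz]; exact hN'
  · change s3.mem 0 4 0 0 ≤ _ * s.mem 0 4 0 0
    rw [vν, hgap]
    exact hν'

theorem data_input (x₀ : Fin n → ℝ) (y₀ : Fin m → ℝ) (s₀ : Fin n → ℝ) :
    Data L Q ε γ δ β (L.input Q ε γ δ β x₀ y₀ s₀).mem := by
  refine ⟨rfl, rfl, rfl, rfl, ?_, ?_⟩ <;> ext i j <;> simp [LO.input, Mem.mat, put2]

theorem init_tot (hQ : IsNullBasis L.A Q) (hn : 0 < n) {x₀ s₀ : Fin n → ℝ} {y₀ : Fin m → ℝ}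
    (hN : L.Neighborhood γ x₀ y₀ s₀) :
    Tot init (L.input Q ε γ δ β x₀ y₀ s₀) (cost * n ^ 2) fun s =>
      (s.vec 1 n = x₀ ∧ s.vec 2 m = y₀ ∧ s.vec 3 n = s₀) ∧ Good L Q ε γ δ β s ∧
        s.get nuRef = nuLO x₀ s₀ := by
  set s := L.input Q ε γ δ β x₀ y₀ s₀ with hs
  have hsz : Sized wt n s.ix := sized hQ hn rfl rfl rfl
  have e1 : Mem.vec s.mem 1 n = x₀ := by funext i; simp [hs, LO.input, Mem.vec, put1]
  have e2 : Mem.vec s.mem 2 m = y₀ := by funext i; simp [hs, LO.input, Mem.vec, put1]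
  have e3 : Mem.vec s.mem 3 n = s₀ := by funext i; simp [hs, LO.input, Mem.vec, put1]
  have h0 : s.ix 0 = n := rfl
  have hd : Data L Q ε γ δ β s.mem := data_input x₀ y₀ s₀
  have h : (nuBlk gap).Sat s.mem s.ix fun μ => Data L Q ε γ δ β μ ∧ μ.vec 1 n = x₀ ∧
      μ.vec 2 m = y₀ ∧ μ.vec 3 n = s₀ ∧ μ 0 4 0 0 = nuLO x₀ s₀ := by
    refine nuBlk_sat h0 hn rfl fun μ f g v => ⟨hd.congr g (f 4 (by norm_num) (by norm_num))
      (f 7 (by norm_num) (by norm_num)), ?_, ?_, ?_, ?_⟩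
    · rw [Mem.vec_congr (f 1 (by norm_num) (by norm_num)), e1]
    · rw [Mem.vec_congr (f 2 (by norm_num) (by norm_num)), e2]
    · rw [Mem.vec_congr (f 3 (by norm_num) (by norm_num)), e3]
    · rw [v, ev_gap h0, e1, e3, nuLO]
  refine (h.tot (d := 2) hsz (by decide) (by decide) ⟨fun _ _ => rfl, fun _ _ => rfl⟩).mono
    (Nat.mul_le_mul_right _ (Nat.le_add_left _ _)) ?_
  rintro s' ⟨μ, hμ, hd', hx, hy, hz, hν⟩
  have vx : s'.vec 1 n = x₀ := by rw [← hx]; exact Mem.vec_congr (hμ.2 1 (by norm_num))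
  have vy : s'.vec 2 m = y₀ := by rw [← hy]; exact Mem.vec_congr (hμ.2 2 (by norm_num))
  have vz : s'.vec 3 n = s₀ := by rw [← hz]; exact Mem.vec_congr (hμ.2 3 (by norm_num))
  have vν : s'.mem 0 4 0 0 = nuLO x₀ s₀ := by rw [hμ.2 0 (by norm_num), hν]
  refine ⟨⟨vx, vy, vz⟩, ⟨hμ.1 0 (by norm_num), hμ.1 1 (by norm_num), hμ.1 2 (by norm_num), ?_, ?_,
    ?_⟩, vν⟩
  · exact hd'.congr (fun i _ => by rw [hμ.2 0 (by norm_num)]) (hμ.2 4 (by norm_num))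
      (hμ.2 7 (by norm_num))
  · rw [vν, vx, vz]
  · rw [vx, vy, vz]; exact hN

end

end LOProg

/-! ### The theorem for linear optimization -/

theorem linear_main :
    ∃ (init body : Cmd) (c : ℕ), ∀ γ δ β ν₀ : ℝ,
      0 < γ → γ < 1 → 0 < δ → δ < 1 → 0 < β → β < 1 → ∃ B : ℝ, 0 < B ∧
      ∀ (n m p : ℕ) (L : LO n m) (Q : Matrix (Fin n) (Fin p) ℝ) (ε : ℝ)
        (x₀ : Fin n → ℝ) (y₀ : Fin m → ℝ) (s₀ : Fin n → ℝ),
        0 < n → Admissible n γ δ β → IsNullBasis L.A Q → 0 < ε →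
        L.Neighborhood γ x₀ y₀ s₀ → nuLO x₀ s₀ ≤ ν₀ →
        ∃ (T K : ℕ) (st : ℕ → State) (q : ℕ → Polynomial ℝ),
          Exec (ipm init body) (L.input Q ε γ δ β x₀ y₀ s₀) T (st K) ∧
          Run init body (L.input Q ε γ δ β x₀ y₀ s₀) K st ∧
          (st 0).vec 1 n = x₀ ∧ (st 0).vec 2 m = y₀ ∧ (st 0).vec 3 n = s₀ ∧
          (∀ k ≤ K, (st k).scalar 0 = ε ∧
            (st k).scalar 4 = nuLO ((st k).vec 1 n) ((st k).vec 3 n) ∧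
            L.Neighborhood γ ((st k).vec 1 n) ((st k).vec 2 m) ((st k).vec 3 n)) ∧
          (∀ k < K, L.InexactStep Q (centering n δ) β (q k)
            ((st k).vec 1 n) ((st k).vec 2 m) ((st k).vec 3 n)
            ((st (k + 1)).vec 1 n) ((st (k + 1)).vec 2 m) ((st (k + 1)).vec 3 n)) ∧
          L.EpsOptimal ε ((st K).vec 1 n) ((st K).vec 2 m) ((st K).vec 3 n) ∧
          ∀ κ : ℝ, 1 ≤ κ →
            (∀ k < K, condNumber (L.newtonMatrix Q ((st k).vec 1 n) ((st k).vec 3 n)) ≤ κ) →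
            (T : ℝ) ≤ B * (n : ℝ) ^ (5 / 2 : ℝ) * κ * polylog c κ ε ∧
            ∀ k < K, ((q k).natDegree : ℝ) ≤ B * κ * polylog c κ ε := by
  -- The constant depends on `γ, δ, β, ν₀` alone. The decrease rate enters as `δ/2`, half of the
  -- centering rate being given up for the inexact solution.
  refine ⟨LOProg.init, LOProg.body, 1, fun γ δ β ν₀ hγ hγ1 hδ hδ1 hβ hβ1 =>
    ⟨boundConst (δ / 2) ν₀ (cgFactor (tol γ δ β / 2)) LOProg.cost,
      boundConst_pos (half_pos hδ) (cgFactor_nonneg _) (Nat.cast_nonneg _), ?_⟩⟩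
  intro n m p L Q ε x₀ y₀ s₀ hn hadm hQ hε hN hν₀
  have hp := Params.of_admissible hn hγ hγ1 hδ hδ1 hβ hadm
  have hsn := hp.one_le_sqrt
  have hd0 : 0 < δ / 2 / Real.sqrt n := by positivity
  have hd1 : δ / 2 / Real.sqrt n ≤ 1 := by
    rw [div_le_one (by linarith)]; linarith
  obtain ⟨T, K, st, q, h1, h2, h3, h4, h5, h6, h7, h8⟩ := ipm_run
    (fun s => s.vec 1 n = x₀ ∧ s.vec 2 m = y₀ ∧ s.vec 3 n = s₀)
    (LOProg.Good L Q ε γ δ β)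
    (fun q s s' => L.InexactStep Q (centering n δ) β q (s.vec 1 n) (s.vec 2 m) (s.vec 3 n)
          (s'.vec 1 n) (s'.vec 2 m) (s'.vec 3 n))
    (fun s => condNumber (L.newtonMatrix Q (s.vec 1 n) (s.vec 3 n)))
    (ρ := 1 - δ / 2 / Real.sqrt n) (ν₀ := ν₀) (C₁ := cgFactor (tol γ δ β / 2))
    (C₂ := LOProg.cost * n ^ 2)
    hε (by linarith) (by linarith) (fun s hs => hs.data.ε)
    ((LOProg.init_tot (ε := ε) (δ := δ) (β := β) hQ hn hN).mono le_rfl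
      fun s hs => ⟨hs.1, hs.2.1, hs.2.2.trans_le hν₀⟩)
    (fun s hs _ => LOProg.body_tot hp hβ hβ1 hQ hs)
  refine ⟨T, K, st, q, h1, h2, h3.1, h3.2.1, h3.2.2, fun k hk => ?_, h5, ?_, ?_⟩
  · exact ⟨(h4 k hk).data.ε, (h4 k hk).gap, (h4 k hk).nbhd⟩
  · have hg := h4 K le_rfl
    refine ⟨hg.nbhd.1, fun i => (hg.nbhd.2.1 i).le, fun i => (hg.nbhd.2.2.1 i).le, ?_⟩
    rw [← hg.gap]
    exact h6
  · intro κ hκ hle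
    obtain ⟨h9, h10⟩ := h8 κ hκ hle
    push_cast at h9
    obtain ⟨h11, h12⟩ := complexity_bound (e := 2) hn (half_pos hδ) (by linarith) hε
      (cgFactor_nonneg _) (Nat.cast_nonneg LOProg.cost) hκ h7 h9
    refine ⟨?_, fun k hk => (h10 k hk).trans h12⟩
    have : (5 / 2 : ℝ) = ((2 : ℕ) : ℝ) + 1 / 2 := by norm_num
    rw [this]
    exact h11

/-! ### Newton's method for the inverse square root -/

section
variable {n : ℕ} {X S P V E : Matrix (Fin n) (Fin n) ℝ} {ν γ η c : ℝ}

/-- The defect `1 - E Y²` of `Y` as an inverse square root of `E`. -/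
def defect (E Y : Matrix (Fin n) (Fin n) ℝ) : Matrix (Fin n) (Fin n) ℝ := 1 - E * (Y * Y)

/-- Newton's iteration for the inverse square root of `E`, started from `c⁻¹ I`. -/
def invSqrtIter (E : Matrix (Fin n) (Fin n) ℝ) (c : ℝ) : ℕ → Matrix (Fin n) (Fin n) ℝ
  | 0 => (1 / c) • 1
  | k + 1 => invSqrtIter E c k + (1 / 2 : ℝ) • (invSqrtIter E c k * defect E (invSqrtIter E c k))

/-- The approximate inverse square root `Y` of `X S`, in the scaled space: `G = V (P Y P⁻¹)` is a
positive definite approximation of the identity. -/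
structure NearInvSqrt (X S P V Y G : Matrix (Fin n) (Fin n) ℝ) (r : ℝ) : Prop where
  pd : G.PosDef
  comm : V * (P * Y * P⁻¹) = P * Y * P⁻¹ * V
  eq : G = V * (P * Y * P⁻¹)
  near : frob (G * G - 1) ≤ r

/-- In scaled coordinates `XS` is `V²` and `Y` becomes `Z`, which commutes with `V`; hence `V²Z² =
(VZ)² = G²`. -/
theorem NearInvSqrt.conj_defect {Y G : Matrix (Fin n) (Fin n) ℝ} {r : ℝ}
    (hsc : ScaledTo X S P V) (h : NearInvSqrt X S P V Y G r) :
    P * defect (X * S) Y * P⁻¹ = 1 - G * G := by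
  rw [defect, h.eq]
  have e : P * (X * S) * (P⁻¹ * P) * Y * (P⁻¹ * P) * Y * P⁻¹ =
      (P * (X * S) * P⁻¹) * (P * Y * P⁻¹) * (P * Y * P⁻¹) := by noncomm_ring
  rw [hsc.unit', mul_one, mul_one, hsc.XS_eq] at e
  have hc := h.comm
  set Z := P * Y * P⁻¹
  calc P * (1 - X * S * (Y * Y)) * P⁻¹
      = P * P⁻¹ - P * (X * S) * Y * Y * P⁻¹ := by noncomm_ring
    _ = 1 - V * (V * Z) * Z := by rw [hsc.unit, e]; noncomm_ring
    _ = 1 - V * (Z * V) * Z := by rw [hc]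
    _ = _ := by noncomm_ring

/-- This makes the stopping test computable: the left side involves only `XS` and `Y`, neither `P`
nor `V`, yet equals the squared norm in the scaled space. -/
theorem NearInvSqrt.trace_defect {Y G : Matrix (Fin n) (Fin n) ℝ} {r : ℝ}
    (hsc : ScaledTo X S P V) (h : NearInvSqrt X S P V Y G r) :
    (defect (X * S) Y * defect (X * S) Y).trace = frob (G * G - 1) ^ 2 := by
  have hG := PosDef.transpose_eq h.pd
  have h1 : (P * (defect (X * S) Y * defect (X * S) Y) * P⁻¹).trace =
      (defect (X * S) Y * defect (X * S) Y).trace := by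
    rw [trace_mul_comm, ← mul_assoc, hsc.unit', one_mul]
  have h2 : P * (defect (X * S) Y * defect (X * S) Y) * P⁻¹ =
      (P * defect (X * S) Y * P⁻¹) * (P * defect (X * S) Y * P⁻¹) := by
    calc _ = P * defect (X * S) Y * 1 * defect (X * S) Y * P⁻¹ := by noncomm_ring
      _ = _ := by rw [← hsc.unit']; noncomm_ring
  rw [← h1, h2, h.conj_defect hsc, frob_sq_of_symm (by rw [transpose_sub, transpose_mul, hG,
    transpose_one])]
  congr 1
  noncomm_ring

/-- With `R = I - G²` the new matrix is `G(I + R/2)`, and its square differs from `I` by `¾R² +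
¼R³`. Convergence is quadratic, but the factor `1/6` suffices. Positive definiteness is kept because
it allows `‖G - I‖ ≤ ‖G² - I‖`. -/
theorem NearInvSqrt.next {Y G : Matrix (Fin n) (Fin n) ℝ} {r : ℝ} (hsc : ScaledTo X S P V)
    (h : NearInvSqrt X S P V Y G r) (hr : r ≤ 1 / 6) :
    ∃ G', NearInvSqrt X S P V (Y + (1 / 2 : ℝ) • (Y * defect (X * S) Y)) G' (r * (1 / 6)) := by
  have hG := PosDef.transpose_eq h.pd
  set Z := P * Y * P⁻¹ with hZ
  have hcd := h.conj_defect hsc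
  set R := 1 - G * G with hR
  have hRt : Rᵀ = R := by rw [hR, transpose_sub, transpose_mul, hG, transpose_one]
  have hGR : G * R = R * G := by rw [hR]; noncomm_ring
  have eY : P * (Y + (1 / 2 : ℝ) • (Y * defect (X * S) Y)) * P⁻¹ = Z + (1 / 2 : ℝ) • (Z * R) := by
    rw [← hcd, hZ]
    calc _ = P * Y * P⁻¹ + (1 / 2 : ℝ) • (P * Y * 1 * defect (X * S) Y * P⁻¹) := by
          simp only [mul_add, add_mul, mul_smul_comm, smul_mul_assoc, mul_one, mul_assoc]
      _ = _ := by rw [← hsc.unit']; simp only [mul_assoc]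
  have hVG : V * G = G * V := by rw [h.eq]; nth_rw 1 [h.comm]; noncomm_ring
  have hVR : V * R = R * V := by
    rw [hR, mul_sub, sub_mul, mul_one, one_mul, ← mul_assoc, hVG, mul_assoc, hVG, mul_assoc]
  set ρ := frob (G * G - 1) with hρ
  have hρ0 : 0 ≤ ρ := frob_nonneg _
  have hρR : frob R = ρ := by rw [hR, hρ, ← frob_neg, neg_sub]
  have hρr : ρ ≤ r := h.near
  have hGG : G * G = 1 - R := by rw [hR]; abel
  refine ⟨G + (1 / 2 : ℝ) • (G * R), ?_, ?_, ?_, ?_⟩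
  · refine posDef_of_near (c := 1) ?_ ?_
    · rw [transpose_add, transpose_smul, transpose_mul, hG, hRt, hGR]
    · rw [one_smul]
      have e : G + (1 / 2 : ℝ) • (G * R) - 1 = (G - 1) + (1 / 2 : ℝ) • ((G - 1) * R + R) := by
        rw [sub_mul, one_mul, sub_add_cancel]; abel
      have h1 := frob_sub_one_le h.pd
      have h2 := frob_add_le (G - 1) ((1 / 2 : ℝ) • ((G - 1) * R + R))
      have h3 := frob_add_le ((G - 1) * R) R
      have h4 := frob_mul_le (G - 1) R
      have h5 : frob (G - 1) * frob R ≤ 1 * frob R :=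
        mul_le_mul_of_nonneg_right (by linarith) (frob_nonneg _)
      rw [e]
      rw [frob_smul, abs_of_pos (by norm_num : (0 : ℝ) < 1 / 2)] at h2
      linarith
  · rw [eY]
    simp only [mul_add, add_mul, mul_smul_comm, smul_mul_assoc]
    rw [h.comm, ← mul_assoc V, h.comm, mul_assoc Z, hVR, mul_assoc Z]
  · have hVZ : V * Z = G := h.eq.symm
    rw [eY, mul_add, mul_smul_comm, ← mul_assoc V Z R, hVZ]
  · have e : (G + (1 / 2 : ℝ) • (G * R)) * (G + (1 / 2 : ℝ) • (G * R)) - 1 =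
        -((3 / 4 : ℝ) • (R * R) + (1 / 4 : ℝ) • (R * R * R)) := by
      have e1 : (G + (1 / 2 : ℝ) • (G * R)) * (G + (1 / 2 : ℝ) • (G * R)) =
          G * G + (1 / 2 : ℝ) • (G * G * R) + (1 / 2 : ℝ) • (G * (R * G)) +
            (1 / 4 : ℝ) • (G * (R * G) * R) := by
        simp only [mul_add, add_mul, mul_smul_comm, smul_mul_assoc, mul_assoc]
        module
      rw [e1, ← hGR, ← mul_assoc, hGG]
      simp only [sub_mul, one_mul]
      module
    rw [e, frob_neg]
    have h1 := frob_add_le ((3 / 4 : ℝ) • (R * R)) ((1 / 4 : ℝ) • (R * R * R))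
    rw [frob_smul, frob_smul, abs_of_pos (by norm_num : (0 : ℝ) < 3 / 4),
      abs_of_pos (by norm_num : (0 : ℝ) < 1 / 4)] at h1
    have h2 := frob_mul_le R R
    have h3 := frob_mul_le (R * R) R
    rw [hρR] at h2 h3
    have h4 : ρ * ρ ≤ r * (1 / 6) := mul_le_mul hρr (hρr.trans hr) hρ0 (hρ0.trans hρr)
    have h5 : frob (R * R) * ρ ≤ frob (R * R) * 1 :=
      mul_le_mul_of_nonneg_left (by linarith) (frob_nonneg _)
    linarith

/-- The initial error is exactly the neighborhood condition divided by `ν`, so the iteration starts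
in its region of convergence. -/
theorem NearInvSqrt.start (hsc : ScaledTo X S P V) (hF : Frame V ν γ) :
    NearInvSqrt X S P V ((1 / Real.sqrt ν) • 1) ((1 / Real.sqrt ν) • V) γ := by
  have hs : 0 < Real.sqrt ν := Real.sqrt_pos.mpr hF.nu_pos
  have e : P * ((1 / Real.sqrt ν) • (1 : Matrix (Fin n) (Fin n) ℝ)) * P⁻¹ =
      (1 / Real.sqrt ν) • 1 := by
    rw [mul_smul_comm, smul_mul_assoc, mul_one, hsc.unit]
  refine ⟨hF.pd.smul (by positivity), ?_, ?_, ?_⟩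
  · rw [e]; simp
  · rw [e]; simp
  · have e2 : (1 / Real.sqrt ν) • V * (1 / Real.sqrt ν) • V - 1 =
        (1 / ν) • (V * V - ν • (1 : Matrix (Fin n) (Fin n) ℝ)) := by
      have h1 : 1 / Real.sqrt ν * (1 / Real.sqrt ν) = 1 / ν := by
        rw [div_mul_div_comm, one_mul, Real.mul_self_sqrt hF.nu_pos.le]
      rw [smul_mul_smul_comm, h1, smul_sub, smul_smul, one_div_mul_cancel hF.nu_pos.ne', one_smul]
    rw [e2, frob_smul, abs_of_pos (one_div_pos.mpr hF.nu_pos), one_div, inv_mul_le_iff₀ hF.nu_pos,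
      mul_comm]
    exact hF.near

theorem nearInvSqrt_iter (hsc : ScaledTo X S P V) (hF : Frame V ν γ) (hγ : γ ≤ 1 / 6)
    (hγ0 : 0 ≤ γ) (k : ℕ) :
    ∃ G, NearInvSqrt X S P V (invSqrtIter (X * S) (Real.sqrt ν) k) G (γ * (1 / 6) ^ k) := by
  induction k with
  | zero => exact ⟨_, by rw [pow_zero, mul_one]; exact NearInvSqrt.start hsc hF⟩
  | succ k ih =>
    obtain ⟨G, hG⟩ := ih
    obtain ⟨G', hG'⟩ := hG.next hsc ((mul_le_of_le_one_right hγ0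
      (pow_le_one₀ (by norm_num) (by norm_num))).trans hγ)
    exact ⟨G', by rw [pow_succ, ← mul_assoc]; exact hG'⟩

/-- A bound on the number of Newton steps that reach the tolerance `η`. -/
def newtonSteps (η : ℝ) : ℕ := ⌈Real.log (1 / η)⌉₊

theorem newtonSteps_spec (hη : 0 < η) : (1 / 6 : ℝ) ^ newtonSteps η ≤ η := by
  have h1 : Real.log (1 / η) ≤ newtonSteps η := Nat.le_ceil _
  have h2 : Real.exp 1 ≤ 6 := by linarith [Real.exp_one_lt_d9]
  rw [one_div, Real.log_inv, neg_le] at h1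
  have h3 : (1 / 6 : ℝ) ≤ Real.exp (-1) := by
    rw [Real.exp_neg, ← one_div]; gcongr
  calc (1 / 6 : ℝ) ^ newtonSteps η ≤ Real.exp (-1) ^ newtonSteps η := by gcongr
    _ = Real.exp (-(newtonSteps η : ℝ)) := by rw [← Real.exp_nat_mul]; ring_nf
    _ ≤ Real.exp (Real.log η) := Real.exp_le_exp.mpr h1
    _ = η := Real.exp_log hη

/-! ### Scaling matrices from an approximate inverse square root -/

theorem NearInvSqrt.mul_S {Y G : Matrix (Fin n) (Fin n) ℝ} {r : ℝ} (hsc : ScaledTo X S P V)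
    (h : NearInvSqrt X S P V Y G r) : S * Y = P * G * P := by
  rw [h.eq, ← hsc.S_eq]
  calc S * Y = 1 * S * 1 * Y * 1 := by simp
    _ = (P * P⁻¹) * S * (P⁻¹ * P) * Y * (P⁻¹ * P) := by rw [hsc.unit, hsc.unit']
    _ = _ := by noncomm_ring

theorem NearInvSqrt.mul_S_posDef {Y G : Matrix (Fin n) (Fin n) ℝ} {r : ℝ} (hsc : ScaledTo X S P V)
    (h : NearInvSqrt X S P V Y G r) : (S * Y).PosDef := by
  rw [h.mul_S hsc]
  exact PosDef.sandwich h.pd hsc.symm hsc.isUnit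

/-- If `T (S Y) Tᵀ = 1`, then `T S Y` is close to the Nesterov-Todd scaling, up to an orthogonal
factor. -/
theorem NearInvSqrt.scaling {Y G T : Matrix (Fin n) (Fin n) ℝ} {r : ℝ} (hsc : ScaledTo X S P V)
    (hW : P * ntW X S * P = 1) (h : NearInvSqrt X S P V Y G r) (hT : T * (S * Y) * Tᵀ = 1) :
    (T * (S * Y))⁻¹ = Tᵀ ∧ T * (S * Y) * (T * (S * Y))⁻¹ = 1 ∧
      frob (T * (S * Y) * ntW X S * (T * (S * Y))ᵀ - 1) ≤ r := by
  have hinv : (T * (S * Y))⁻¹ = Tᵀ := inv_eq_right_inv hT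
  refine ⟨hinv, by rw [hinv, hT], ?_⟩
  have hG := PosDef.transpose_eq h.pd
  have hPP := hsc.unit
  have hPP' := hsc.unit'
  rw [h.mul_S hsc] at hT ⊢
  have hW2 : ntW X S = P⁻¹ * P⁻¹ := by
    calc ntW X S = (P⁻¹ * P) * ntW X S * (P * P⁻¹) := by rw [hPP', hPP]; simp
      _ = P⁻¹ * (P * ntW X S * P) * P⁻¹ := by noncomm_ring
      _ = _ := by rw [hW, mul_one]
  set F := T * P * G with hF
  have e1 : T * (P * G * P) * ntW X S * (T * (P * G * P))ᵀ = F * Fᵀ := by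
    rw [hW2]
    simp only [transpose_mul, hsc.symm, hG, hF]
    calc _ = T * P * G * (P * P⁻¹) * (P⁻¹ * P) * G * P * Tᵀ := by noncomm_ring
      _ = _ := by rw [hPP, hPP']; noncomm_ring
  -- `T(PGP)Tᵀ = I` says that `TP` and `GPTᵀ` are inverse to each other. Multiplied in the other
  -- order they give `FᵀF = G`, which is close to `I`.
  have e2 : Fᵀ * F = G := by
    have h1 : (T * P) * (G * (P * Tᵀ)) = 1 := by rw [← hT]; noncomm_ring
    have h2 : G * (P * Tᵀ) * (T * P) = 1 := mul_eq_one_comm.mp h1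
    calc Fᵀ * F = (G * (P * Tᵀ) * (T * P)) * G := by
          simp only [hF, transpose_mul, hsc.symm, hG]; noncomm_ring
      _ = G := by rw [h2, one_mul]
  rw [e1, frob_mul_transpose_sub_one, e2]
  exact (frob_sub_one_le h.pd).trans h.near

/-! ### One step of the Gram-Schmidt process -/

/-- The first `i` rows of `T` are orthonormal with respect to `G` and form a lower triangular
matrix; the other rows are zero. -/
structure PartialGS (G T : Matrix (Fin n) (Fin n) ℝ) (i : ℕ) : Prop where
  orth : T * G * Tᵀ = diagonal fun k => if k.1 < i then 1 else 0
  lower : ∀ k j : Fin n, k < j → T k j = 0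
  zero : ∀ k j : Fin n, i ≤ k.1 → T k j = 0

theorem PartialGS.start (G : Matrix (Fin n) (Fin n) ℝ) : PartialGS G 0 0 :=
  ⟨by simp, by simp, by simp⟩

/-- The component of the `i`-th unit vector orthogonal to the rows of `T`. -/
def gsVec (G T : Matrix (Fin n) (Fin n) ℝ) (i : Fin n) : Fin n → ℝ :=
  Pi.single i 1 - Tᵀ *ᵥ (T *ᵥ (G *ᵥ Pi.single i 1))

theorem PartialGS.mulVec_gsVec {G T : Matrix (Fin n) (Fin n) ℝ} {i : Fin n}
    (h : PartialGS G T i) : T *ᵥ (G *ᵥ gsVec G T i) = 0 := by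
  have h1 : T *ᵥ (G *ᵥ (Tᵀ *ᵥ (T *ᵥ (G *ᵥ Pi.single i 1)))) = T *ᵥ (G *ᵥ Pi.single i 1) := by
    rw [mulVec_mulVec, mulVec_mulVec, h.orth]
    funext k
    rw [mulVec_diagonal]
    split_ifs with hk
    · rw [one_mul]
    · rw [zero_mul, mulVec, dotProduct]
      exact (Finset.sum_eq_zero fun j _ => by rw [h.zero k j (not_lt.mp hk), zero_mul]).symm
  rw [gsVec, mulVec_sub, mulVec_sub, h1, sub_self]

/-- Earlier rows are triangular and later ones zero, so the correction does not touch entry `i`.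
This shows that the new vector is nonzero, as the normalization requires. -/
theorem PartialGS.gsVec_ne {G T : Matrix (Fin n) (Fin n) ℝ} {i : Fin n}
    (h : PartialGS G T i) : gsVec G T i i = 1 := by
  have : (Tᵀ *ᵥ (T *ᵥ (G *ᵥ Pi.single i 1))) i = 0 := by
    rw [mulVec, dotProduct]
    refine Finset.sum_eq_zero fun k _ => ?_
    rw [transpose_apply]
    rcases lt_or_ge k i with hk | hk
    · rw [h.lower k i hk, zero_mul]
    · rw [h.zero k i hk, zero_mul]
  rw [gsVec, Pi.sub_apply, this]
  simp

theorem PartialGS.gsVec_eq_zero {G T : Matrix (Fin n) (Fin n) ℝ} {i j : Fin n}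
    (h : PartialGS G T i) (hij : i < j) : gsVec G T i j = 0 := by
  have : (Tᵀ *ᵥ (T *ᵥ (G *ᵥ Pi.single i 1))) j = 0 := by
    rw [mulVec, dotProduct]
    refine Finset.sum_eq_zero fun k _ => ?_
    rw [transpose_apply]
    rcases lt_or_ge k j with hk | hk
    · rw [h.lower k j hk, zero_mul]
    · rw [h.zero k j (hij.le.trans hk), zero_mul]
  rw [gsVec, Pi.sub_apply, this]
  simp [hij.ne']

/-- Squared `G`-norm of `gsVec`. -/
def gsNorm (G T : Matrix (Fin n) (Fin n) ℝ) (i : Fin n) : ℝ :=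
  gsVec G T i ⬝ᵥ (G *ᵥ gsVec G T i)

theorem PartialGS.gsNorm_pos {G T : Matrix (Fin n) (Fin n) ℝ} {i : Fin n} (hG : G.PosDef)
    (h : PartialGS G T i) : 0 < gsNorm G T i :=
  PosDef.quad_pos hG fun h0 => by
    have := h.gsVec_ne
    rw [h0] at this
    simp at this

/-- The matrix with the next row added. -/
def gsNext (G T : Matrix (Fin n) (Fin n) ℝ) (i : Fin n) : Matrix (Fin n) (Fin n) ℝ :=
  T + vecMulVec (Pi.single i 1) ((1 / Real.sqrt (gsNorm G T i)) • gsVec G T i)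

theorem gsNext_apply (G T : Matrix (Fin n) (Fin n) ℝ) (i k j : Fin n) :
    gsNext G T i k j = T k j + (if k = i then 1 else 0) *
      (1 / Real.sqrt (gsNorm G T i) * gsVec G T i j) := by
  simp [gsNext, vecMulVec_apply, Pi.single_apply]

/-- The rank-one update adds a row that is `G`-orthogonal to the old ones, so the cross terms vanish
and one more diagonal entry becomes 1. -/
theorem PartialGS.next {G T : Matrix (Fin n) (Fin n) ℝ} {i : Fin n} (hG : G.PosDef)
    (h : PartialGS G T i) : PartialGS G (gsNext G T i) (i + 1) := by
  have hq := h.gsNorm_pos hG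
  have hs : 0 < Real.sqrt (gsNorm G T i) := Real.sqrt_pos.mpr hq
  have hGt := PosDef.transpose_eq hG
  refine ⟨?_, fun k j hkj => ?_, fun k j hk => ?_⟩
  · set e : Fin n → ℝ := Pi.single i 1
    set v := (1 / Real.sqrt (gsNorm G T i)) • gsVec G T i with hv
    have h1 : T *ᵥ (G *ᵥ v) = 0 := by
      rw [hv, mulVec_smul, mulVec_smul, h.mulVec_gsVec, smul_zero]
    have h2 : v ⬝ᵥ (G *ᵥ v) = 1 := by
      rw [hv, mulVec_smul, smul_dotProduct, dotProduct_smul, smul_eq_mul, smul_eq_mul]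
      change _ * (_ * gsNorm G T i) = 1
      rw [← mul_assoc, div_mul_div_comm, one_mul, Real.mul_self_sqrt hq.le,
        one_div_mul_cancel hq.ne']
    have e1 : T * G * (vecMulVec e v)ᵀ = 0 := by
      rw [transpose_vecMulVec, mul_vecMulVec, ← mulVec_mulVec, h1, zero_vecMulVec]
    have e2 : vecMulVec e v * G * Tᵀ = 0 := by
      have := congrArg transpose e1
      simp only [transpose_mul, transpose_transpose, hGt, transpose_zero] at this
      rw [mul_assoc]; exact this
    have e3 : vecMulVec e v * G * (vecMulVec e v)ᵀ = vecMulVec e e := by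
      rw [transpose_vecMulVec, mul_assoc, mul_vecMulVec, vecMulVec_mul_vecMulVec, h2]
      simp
    have e4 : gsNext G T i = T + vecMulVec e v := rfl
    rw [e4, transpose_add, mul_add, add_mul, add_mul, add_mul, h.orth, e1, e2, e3, add_zero,
      zero_add]
    ext k l
    simp only [Matrix.add_apply, diagonal_apply, vecMulVec_apply, e, Pi.single_apply]
    by_cases hkl : k = l
    · subst hkl
      by_cases hki : k = i
      · subst hki; simp
      · have : k.1 ≠ i.1 := fun h => hki (Fin.ext h)
        simp only [if_true, if_neg hki]
        rw [zero_mul, add_zero]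
        refine if_congr ?_ rfl rfl
        omega
    · by_cases hki : k = i
      · subst hki; simp [hkl, Ne.symm hkl]
      · simp [hkl, hki]
  · rw [gsNext_apply, h.lower k j hkj]
    split_ifs with hki
    · subst hki
      rw [h.gsVec_eq_zero hkj]; simp
    · simp
  · rw [gsNext_apply, h.zero k j (by omega), if_neg (fun h => by subst h; omega)]
    simp

end

/-! ### Expressions for matrix products -/

/-- Entry of the product of the matrices in arrays `a` and `b`. -/
abbrev mm (a b : ℕ) : Tm := .sum (.var 0) (ent a 4 6 * ent b 6 5)
/-- Entry of the product of the matrix in array `a` and the transpose of that in array `b`. -/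
abbrev mmT (a b : ℕ) : Tm := .sum (.var 0) (ent a 4 6 * ent b 5 6)
/-- Entry of the product of the transpose of the matrix in array `a` and the matrix in `b`. -/
abbrev mTm (a b : ℕ) : Tm := .sum (.var 0) (ent a 6 4 * ent b 6 5)
/-- Indicator of the equality of two index variables. -/
abbrev deltaTm (i j : ℕ) : Tm := .cst 1 - .lt (.var i) (.var j) - .lt (.var j) (.var i)
/-- Sum of the entrywise products of the matrix in `a` with the expression `e`, which refers to
row `6` and column `7`. -/
abbrev sumSum (e : Tm) : Tm := .sum (.var 0) (.sum (.var 0) e)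

section
variable {μ : Mem} {ι : ℕ → ℕ} {Q : Mem → Prop} {blk : Blk} {n a c d : ℕ}
  {A B : Matrix (Fin n) (Fin n) ℝ}

theorem ev_mm (h0 : ι 0 = n) (hA : μ.mat c n n = A) (hB : μ.mat d n n = B) (i j : Fin n) :
    (mm c d).ev μ 6 (env ι i j) = (A * B) i j := by
  subst hA hB
  simp only [Tm.ev, Op.eval]
  simp [ixv, h0, Finset.sum_range, mul_apply, Mem.mat]

theorem ev_mmT (h0 : ι 0 = n) (hA : μ.mat c n n = A) (hB : μ.mat d n n = B) (i j : Fin n) :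
    (mmT c d).ev μ 6 (env ι i j) = (A * Bᵀ) i j := by
  subst hA hB
  simp only [Tm.ev, Op.eval]
  simp [ixv, h0, Finset.sum_range, mul_apply, Mem.mat]

theorem ev_mTm (h0 : ι 0 = n) (hA : μ.mat c n n = A) (hB : μ.mat d n n = B) (i j : Fin n) :
    (mTm c d).ev μ 6 (env ι i j) = (Aᵀ * B) i j := by
  subst hA hB
  simp only [Tm.ev, Op.eval]
  simp [ixv, h0, Finset.sum_range, mul_apply, Mem.mat]

theorem ev_deltaTm {l v w : ℕ} {i j : Fin n} (hv : ι v = i) (hw : ι w = j) :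
    (deltaTm v w).ev μ l ι = (1 : Matrix (Fin n) (Fin n) ℝ) i j := by
  simp only [Tm.ev_sub]
  simp only [Tm.ev, ixv, hv, hw, one_apply, Fin.ext_iff]
  rcases lt_trichotomy i.1 j.1 with h | h | h
  · simp [h, h.ne, h.not_gt]
  · simp [h]
  · simp [h, h.ne', h.not_gt]

theorem ev_own (hA : μ.mat c n n = A) (i j : Fin n) : (own c).ev μ 6 (env ι i j) = A i j := by
  subst hA
  simp [Tm.ev, ixv, Mem.mat]

theorem ev_ent_swap (hA : μ.mat c n n = A) (i j : Fin n) :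
    (ent c 5 4).ev μ 6 (env ι i j) = A j i := by
  subst hA
  simp [Tm.ev, ixv, Mem.mat]

theorem ev_scl (μ : Mem) (ι : ℕ → ℕ) (l : ℕ) (c : ℕ) : (scl c).ev μ l ι = μ.sc c := rfl

theorem ev_trace_mul (h0 : ι 0 = n) (hA : μ.mat c n n = A) (hB : μ.mat d n n = B) (i j : ℕ) :
    (sumSum (ent c 6 7 * ent d 7 6)).ev μ 6 (env ι i j) = (A * B).trace := by
  subst hA hB
  simp only [Tm.ev, Op.eval]
  simp [ixv, h0, Finset.sum_range, mul_apply, Mem.mat, trace]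

theorem Blk.Sat.setMM (h0 : ι 0 = n) (hA : μ.mat c n n = A) (hB : μ.mat d n n = B)
    (h : ∀ μ', (∀ b ≠ a, μ' b = μ b) → μ'.mat a n n = A * B → Blk.Sat blk μ' ι Q) :
    Blk.Sat (IFIPM.setMat a (.var 0) (mm c d) :: blk) μ ι Q :=
  Blk.Sat.setMat h0 _ rfl (fun i j => ev_mm h0 hA hB i j) h

theorem Blk.Sat.setMMT (h0 : ι 0 = n) (hA : μ.mat c n n = A) (hB : μ.mat d n n = B)
    (h : ∀ μ', (∀ b ≠ a, μ' b = μ b) → μ'.mat a n n = A * Bᵀ → Blk.Sat blk μ' ι Q) :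
    Blk.Sat (IFIPM.setMat a (.var 0) (mmT c d) :: blk) μ ι Q :=
  Blk.Sat.setMat h0 _ rfl (fun i j => ev_mmT h0 hA hB i j) h

theorem Blk.Sat.setMTM (h0 : ι 0 = n) (hA : μ.mat c n n = A) (hB : μ.mat d n n = B)
    (h : ∀ μ', (∀ b ≠ a, μ' b = μ b) → μ'.mat a n n = Aᵀ * B → Blk.Sat blk μ' ι Q) :
    Blk.Sat (IFIPM.setMat a (.var 0) (mTm c d) :: blk) μ ι Q :=
  Blk.Sat.setMat h0 _ rfl (fun i j => ev_mTm h0 hA hB i j) h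

theorem Mem.mat_of_eq {μ' : Mem} (h : μ' c = μ c) (hA : μ.mat c n n = A) : μ'.mat c n n = A := by
  rw [← hA]; unfold Mem.mat; rw [h]

theorem Mem.sc_of_eq {μ' : Mem} {x : ℝ} (h : μ' c = μ c) (hx : μ.sc c = x) : μ'.sc c = x := by
  rw [← hx]; unfold Mem.sc; rw [h]

end

namespace SDOProg

/-! ### Program for the scaling matrix

Arrays: `10` `G = S Y`, `11` `T`, `12` the scaling matrix `P' = T G`, `13` the weights of `smat`,
`40` `E = X S`, `41` `Y`, `42` its defect, `43` the squared norm of the defect. -/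

def residual : Blk :=
  [setMat 48 (.var 0) (mm 41 41), setMat 42 (.var 0) (deltaTm 4 5 - mm 40 48),
    setSc 43 (sumSum (ent 42 6 7 * ent 42 7 6))]

def newtonStart : Blk :=
  setMat 40 (.var 0) (mm 1 3) :: setMat 41 (.var 0) (deltaTm 4 5 / .sqrt (par 4)) :: residual

def newtonPass : Blk :=
  setMat 48 (.var 0) (mm 41 42) :: setMat 41 (.var 0) (own 41 + .cst (1 / 2) * own 48) :: residual

def newtonLoop : Cmd := .whileLt (scRef 63) (scRef 43) newtonPass.comp

section
variable {n : ℕ} {ι : ℕ → ℕ} {μ₀ μ : Mem} {E Y X S G T : Matrix (Fin n) (Fin n) ℝ} {Q : Mem → Prop}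

/-- The memory holds `E`, `Y` and the defect of `Y`. -/
structure NewtonMem (μ₀ : Mem) (E Y : Matrix (Fin n) (Fin n) ℝ) (μ : Mem) : Prop where
  frame : ∀ b, b < 40 ∨ 60 ≤ b → μ b = μ₀ b
  mem_E : μ.mat 40 n n = E
  mem_Y : μ.mat 41 n n = Y
  mem_defect : μ.mat 42 n n = IFIPM.defect E Y
  sc : μ.sc 43 = (IFIPM.defect E Y * IFIPM.defect E Y).trace

theorem residual_sat (h0 : ι 0 = n) (hf : ∀ b, b < 40 ∨ 60 ≤ b → μ b = μ₀ b)
    (hE : μ.mat 40 n n = E) (hY : μ.mat 41 n n = Y) : residual.Sat μ ι (NewtonMem μ₀ E Y) := by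
  refine Blk.Sat.setMM h0 hY hY fun μ1 f1 v1 => ?_
  have hE1 := Mem.mat_of_eq (f1 40 (by norm_num)) hE
  refine Blk.Sat.setMat h0 (IFIPM.defect E Y) rfl (fun i j => ?_) fun μ2 f2 v2 => ?_
  · rw [Tm.ev_sub, ev_deltaTm (i := i) (j := j) (by simp) (by simp), ev_mm h0 hE1 v1]
    rfl
  refine Blk.Sat.setSc _ (Tm.ok_of_total _ _ _ rfl) (ev_trace_mul h0 v2 v2 0 0) fun μ3 f3 v3 =>
    Blk.Sat.nil ⟨fun b hb => ?_, ?_, ?_, ?_, v3⟩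
  · rw [f3 b (by omega), f2 b (by omega), f1 b (by omega), hf b hb]
  · exact Mem.mat_of_eq (f3 40 (by norm_num)) (Mem.mat_of_eq (f2 40 (by norm_num)) hE1)
  · exact Mem.mat_of_eq (f3 41 (by norm_num)) (Mem.mat_of_eq (f2 41 (by norm_num))
      (Mem.mat_of_eq (f1 41 (by norm_num)) hY))
  · exact Mem.mat_of_eq (f3 42 (by norm_num)) v2

theorem newtonStart_sat {ν : ℝ} (h0 : ι 0 = n) (hν : 0 < ν) (hμν : μ 0 4 0 0 = ν)
    (hX : μ.mat 1 n n = X) (hS : μ.mat 3 n n = S) :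
    newtonStart.Sat μ ι (NewtonMem μ (X * S) (invSqrtIter (X * S) (Real.sqrt ν) 0)) := by
  have hs := Real.sqrt_pos.mpr hν
  refine Blk.Sat.setMM h0 hX hS fun μ1 f1 v1 => ?_
  have e4 : μ1 0 4 0 0 = ν := by rw [f1 0 (by norm_num), hμν]
  refine Blk.Sat.cons (fun i _ j _ => Tm.ok_div (Tm.ok_of_total _ _ _ rfl) ⟨trivial, ?_⟩ ?_)
    fun μ2 f2 v2 => ?_
  · simp only [Tm.ev, ixv, e4]; exact hν.le
  · simp only [Tm.ev, ixv, e4]; exact hs.ne'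
  simp only at f2
  refine residual_sat h0 (fun b hb => by rw [f2 b (by omega), f1 b (by omega)])
    (Mem.mat_of_eq (f2 40 (by norm_num)) v1) ?_
  ext i j
  have := v2 i (by simp [ixv, h0]) j (by simp [ixv, h0])
  refine Eq.trans this ?_
  rw [Fill.val, Tm.ev_div, ev_deltaTm (i := i) (j := j) (by simp) (by simp)]
  simp only [Tm.ev, ixv, e4, invSqrtIter, Matrix.smul_apply, smul_eq_mul]
  ring

theorem newtonPass_sat (h0 : ι 0 = n) (hμ : NewtonMem μ₀ E Y μ) :
    newtonPass.Sat μ ι (NewtonMem μ₀ E (Y + (1 / 2 : ℝ) • (Y * IFIPM.defect E Y))) := by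
  refine Blk.Sat.setMM h0 hμ.mem_Y hμ.mem_defect fun μ1 f1 v1 => ?_
  have hY1 := Mem.mat_of_eq (f1 41 (by norm_num)) hμ.mem_Y
  refine Blk.Sat.setMat h0 (Y + (1 / 2 : ℝ) • (Y * IFIPM.defect E Y)) rfl (fun i j => ?_)
    fun μ2 f2 v2 => residual_sat h0 (fun b hb => ?_)
      (Mem.mat_of_eq (f2 40 (by norm_num)) (Mem.mat_of_eq (f1 40 (by norm_num)) hμ.mem_E)) v2
  · rw [Tm.ev_add, Tm.ev_mul, ev_own hY1, ev_own v1]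
    simp [Tm.ev]
  · rw [f2 b (by omega), f1 b (by omega), hμ.frame b hb]

/-- The loop stops at the first index where the trace of the squared defect is at most `η²`. That
index is at most `newtonSteps η`, which depends on neither the problem nor `n`. -/
theorem newtonLoop_tot {w : ℕ → ℕ} {d : ℕ} {γ η ν : ℝ} {P V : Matrix (Fin n) (Fin n) ℝ}
    (hsz : Sized w n ι) (hdg : newtonPass.dgle w d = true) (h0 : ι 0 = n)
    (hsc : ScaledTo X S P V) (hF : Frame V ν γ) (hγ : γ ≤ 1 / 6) (hγ0 : 0 ≤ γ) (hη : 0 < η)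
    (hη' : μ₀.sc 63 = η ^ 2) {s : State} (hs : Agree μ ι s)
    (hμ : NewtonMem μ₀ (X * S) (invSqrtIter (X * S) (Real.sqrt ν) 0) μ) :
    ∃ Y G, NearInvSqrt X S P V Y G η ∧
      Tot newtonLoop s (newtonSteps η * (newtonPass.cf * n ^ d + 1) + 1) fun s' =>
        ∃ μ', Agree μ' ι s' ∧ NewtonMem μ₀ (X * S) Y μ' := by
  classical
  set Yk := invSqrtIter (X * S) (Real.sqrt ν) with hYk
  set r : ℕ → ℝ := fun k => (IFIPM.defect (X * S) (Yk k) * IFIPM.defect (X * S) (Yk k)).trace with hr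
  have hG := nearInvSqrt_iter hsc hF hγ hγ0
  have hsteps : r (newtonSteps η) ≤ η ^ 2 := by
    obtain ⟨G, hG⟩ := hG (newtonSteps η)
    rw [hr]
    simp only
    rw [hG.trace_defect hsc]
    have h1 : γ * (1 / 6) ^ newtonSteps η ≤ 1 * η :=
      mul_le_mul (by linarith) (newtonSteps_spec hη) (by positivity) zero_le_one
    rw [one_mul] at h1
    exact pow_le_pow_left₀ (frob_nonneg _) (hG.near.trans h1) 2
  have hex : ∃ k, r k ≤ η ^ 2 := ⟨_, hsteps⟩
  have hle : Nat.find hex ≤ newtonSteps η := Nat.find_min' hex hsteps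
  obtain ⟨G, hGK⟩ := hG (Nat.find hex)
  have hK : r (Nat.find hex) ≤ η ^ 2 := Nat.find_spec hex
  refine ⟨Yk (Nat.find hex), G, ⟨hGK.pd, hGK.comm, hGK.eq, ?_⟩, ?_⟩
  · have hK := (hGK.trace_defect hsc).symm.trans_le hK
    exact abs_le_of_sq_le_sq' hK hη.le |>.2
  have := Tot.whileLt (a := scRef 63) (b := scRef 43) (p := newtonPass.comp)
    (C := newtonPass.cf * n ^ d)
    (fun k s => ∃ μ, Agree μ ι s ∧ NewtonMem μ₀ (X * S) (Yk k) μ) (Nat.find hex) ?_ ?_ ⟨μ, hs, hμ⟩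
  · exact this.mono (by gcongr) fun _ h => h
  · rintro i hi s ⟨μ, hs, hμ⟩
    refine ⟨?_, (newtonPass_sat h0 hμ).tot hsz (by decide) hdg hs⟩
    rw [hs.get_scRef (by norm_num), hs.get_scRef (by norm_num), hμ.sc,
      Mem.sc_of_eq (hμ.frame 63 (by norm_num)) hη']
    exact not_le.mp (Nat.find_min hex hi)
  · rintro s ⟨μ, hs, hμ⟩
    rw [hs.get_scRef (by norm_num), hs.get_scRef (by norm_num), hμ.sc,
      Mem.sc_of_eq (hμ.frame 63 (by norm_num)) hη']
    exact not_lt.mpr hK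

/-! ### Gram-Schmidt orthonormalization with respect to `SY` -/

def gsStart : Blk := [setMat 10 (.var 0) (mm 3 41), setMat 11 (.var 0) (.cst 0)]

def gsPass : Blk :=
  [setMat 45 (.lit 1) (.sum (.var 0) (ent 11 4 6 * ent 10 6 3)),
    setMat 46 (.lit 1) (deltaTm 4 3 - .sum (.var 0) (ent 11 6 4 * ve 45 6)),
    setSc 47 (.sum (.var 0) (ve 46 6 * .sum (.var 0) (ent 10 6 7 * ve 46 7))),
    setMat 11 (.var 0) (own 11 + deltaTm 4 3 * (ve 46 5 / .sqrt (scl 47)))]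

def gsLoop : Cmd := .forLt 3 (.var 0) gsPass.comp

/-- The memory holds `G` and a partial orthonormalization. -/
structure GSMem (μ₀ : Mem) (G : Matrix (Fin n) (Fin n) ℝ) (k : ℕ) (μ : Mem) : Prop where
  frame : ∀ b, b < 10 ∨ 12 ≤ b ∧ b ≤ 40 ∨ 60 ≤ b → μ b = μ₀ b
  mem_G : μ.mat 10 n n = G
  T : PartialGS G (μ.mat 11 n n) k

theorem gsStart_sat (h0 : ι 0 = n) (hS : μ.mat 3 n n = S) (hY : μ.mat 41 n n = Y) :
    gsStart.Sat μ ι (GSMem μ (S * Y) 0) := by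
  refine Blk.Sat.setMM h0 hS hY fun μ1 f1 v1 => ?_
  refine Blk.Sat.setMat h0 0 rfl (fun i j => by simp [Tm.ev]) fun μ2 f2 v2 =>
    Blk.Sat.nil ⟨fun b hb => ?_, Mem.mat_of_eq (f2 10 (by norm_num)) v1, ?_⟩
  · rw [f2 b (by omega), f1 b (by omega)]
  · rw [v2]; exact PartialGS.start _

/-- Arrays 45, 46 and 47 hold `TGeᵢ`, the orthogonal component of `eᵢ` and its squared `G`-norm. -/
theorem gsPass_sat (h0 : ι 0 = n) (hG : G.PosDef) {i : Fin n} (h3 : ι 3 = i)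
    (hμ : GSMem μ₀ G i μ) : gsPass.Sat μ ι (GSMem μ₀ G (i + 1)) := by
  obtain ⟨hf, hG0, hT⟩ := hμ
  set T := μ.mat 11 n n with hTd
  have eG : ∀ a b : Fin n, μ 10 a b 0 = G a b := fun a b => by rw [← hG0]; rfl
  have eT : ∀ a b : Fin n, μ 11 a b 0 = T a b := fun a b => rfl
  refine Blk.Sat.setCol h0 (T *ᵥ (G *ᵥ Pi.single i 1)) rfl (fun k => ?_) fun μ1 f1 v1 => ?_
  · simp only [Tm.ev, Op.eval]
    simp [ixv, h0, h3, Finset.sum_range, mulVec, dotProduct, eG, eT, Pi.single_apply]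
  have e45 : ∀ a : Fin n, μ1 45 a 0 0 = (T *ᵥ (G *ᵥ Pi.single i 1)) a := fun a => congrFun v1 a
  refine Blk.Sat.setCol h0 (gsVec G T i) rfl (fun k => ?_) fun μ2 f2 v2 => ?_
  · rw [Tm.ev_sub, ev_deltaTm (i := k) (j := i) (by simp) (by simp [h3])]
    simp only [Tm.ev, Op.eval]
    rw [gsVec, Pi.sub_apply, mulVec, dotProduct]
    congr 1
    · simp [one_apply, Pi.single_apply]
    · simp [ixv, h0, Finset.sum_range, e45, f1 11, eT]
  have e46 : ∀ a : Fin n, μ2 46 a 0 0 = gsVec G T i a := fun a => congrFun v2 a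
  refine Blk.Sat.setSc (gsNorm G T i) (Tm.ok_of_total _ _ _ rfl) ?_ fun μ3 f3 v3 => ?_
  · simp only [Tm.ev, Op.eval]
    simp [ixv, h0, Finset.sum_range, e46, f2 10, f1 10, eG, gsNorm, dotProduct, mulVec]
  have hpos := hT.gsNorm_pos hG
  have e47 : μ3 47 0 0 0 = gsNorm G T i := v3
  refine Blk.Sat.cons (fun a _ b _ => Tm.ok_add trivial (Tm.ok_mul (Tm.ok_of_total _ _ _ rfl)
    (Tm.ok_div trivial ⟨trivial, ?_⟩ ?_))) fun μ4 f4 v4 => Blk.Sat.nil ?_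
  · simp only [Tm.ev, ixv, e47]; exact hpos.le
  · simp only [Tm.ev, ixv, e47]; exact (Real.sqrt_pos.mpr hpos).ne'
  simp only at f4
  have e11 : μ4.mat 11 n n = gsNext G T i := by
    ext k j
    refine (v4 k (by simp [ixv, h0]) j (by simp [ixv, h0])).trans ?_
    rw [Fill.val, Tm.ev_add, Tm.ev_mul, Tm.ev_div,
      ev_deltaTm (i := k) (j := i) (by simp) (by simp [h3]), gsNext_apply, one_apply]
    simp only [Tm.ev, ixv, e47]
    simp [f3 11, f3 46, f2 11, f1 11, eT, e46]
    rw [div_eq_inv_mul]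
  refine ⟨fun b hb => ?_, ?_, ?_⟩
  · rw [f4 b (by omega), f3 b (by omega), f2 b (by omega), f1 b (by omega), hf b hb]
  · exact Mem.mat_of_eq (f4 10 (by norm_num)) (Mem.mat_of_eq (f3 10 (by norm_num))
      (Mem.mat_of_eq (f2 10 (by norm_num)) (Mem.mat_of_eq (f1 10 (by norm_num)) hG0)))
  · rw [e11]; exact hT.next hG

theorem gsLoop_tot {w : ℕ → ℕ} {d : ℕ} (hsz : Sized w n ι) (hdg : gsPass.dgle w d = true)
    (h0 : ι 0 = n) (hG : G.PosDef) {s : State} (hs : Agree μ ι s) (hμ : GSMem μ₀ G 0 μ) :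
    Tot gsLoop s (n * (gsPass.cf * n ^ d + 1) + 1) fun s' =>
      -- The loop leaves its counter in variable 3, so the index environment changes there; the
      -- sizes stay the same.
      ∃ μ' ι', (∀ v < 3, ι' v = ι v) ∧ Agree μ' ι' s' ∧ GSMem μ₀ G n μ' := by
  have hn : s.ixVal (.var 0) = n := by rw [State.ixVal, hs.1 0 (by norm_num), h0]
  have := Tot.forLt (v := 3) (b := .var 0) (s := s) (C := gsPass.cf * n ^ d) (p := gsPass.comp)
    (fun k s' => ∃ μ' ι', (∀ v < 3, ι' v = ι v) ∧ Agree μ' ι' s' ∧ GSMem μ₀ G k μ')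
    ⟨μ, ι, fun _ _ => rfl, hs, hμ⟩ ?_
  · rw [hn] at this
    exact this
  rintro k hk s1 ⟨μ1, ι1, hι1, hs1, hμ1⟩
  rw [hn] at hk
  set ι2 := Function.update ι1 3 k with hι2
  have e2 : ∀ v < 3, ι2 v = ι v := fun v hv => by
    rw [hι2, Function.update_of_ne (by omega), hι1 v hv]
  have hs2 : Agree μ1 ι2 (s1.setIx 3 k) := by
    refine ⟨fun v hv => ?_, hs1.2⟩
    by_cases h : v = 3
    · subst h; simp [State.setIx, hι2]
    · simp only [State.setIx, hι2, Function.update_of_ne h]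
      exact hs1.1 v hv
  have h1 := gsPass_sat (i := ⟨k, hk⟩) ((e2 0 (by norm_num)).trans h0) hG (by simp [hι2]) hμ1
  refine (h1.tot (w := w) (d := d) ⟨hsz.1, fun v hv => by rw [e2 v hv]; exact hsz.2 v hv⟩
    (by decide) hdg hs2).mono le_rfl ?_
  rintro s3 ⟨μ3, hs3, hμ3⟩
  exact ⟨μ3, ι2, e2, hs3, hμ3⟩

end

end SDOProg

namespace SDOProg

/-! ### Products with the Newton matrix -/

section
variable {n m p : ℕ} {D : SDO n m} {Q : Matrix (SIdx n) (Fin p) ℝ} {ε γ δ β : ℝ}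
  {X S T P' : Matrix (Fin n) (Fin n) ℝ} {ι : ℕ → ℕ} {μ₀ μ : Mem}

/-- The entries of the columns of `Q` as stored in memory. -/
def lowerQ (Q : Matrix (SIdx n) (Fin p) ℝ) (i j : Fin n) (l : Fin p) : ℝ :=
  if h : j ≤ i then Q ⟨(i, j), h⟩ l else 0

/-- The weights that turn `lowerQ i j + lowerQ j i` into the entries of `smat`. -/
def smatWeight (n : ℕ) : Matrix (Fin n) (Fin n) ℝ := of fun i j =>
  if i = j then 1 / 2 else 1 / Real.sqrt 2

/-- Off the diagonal only one of the two summands is nonzero, on the diagonal both are equal; this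
explains the weights `1/√2` and `1/2`. -/
theorem dirX_apply (u : Fin p ⊕ Fin m → ℝ) (i j : Fin n) : dirX Q u i j =
    smatWeight n i j * ∑ l, (lowerQ Q i j l + lowerQ Q j i l) * u (.inl l) := by
  simp only [dirX, smat, smatWeight, of_apply]
  rcases lt_trichotomy i j with h | h | h
  · rw [if_neg h.ne, dif_neg (not_le.mpr h), if_neg h.ne, div_eq_inv_mul, one_div]
    simp [lowerQ, h.le, h.not_ge, mulVec, dotProduct]
  · subst h
    simp only [if_true, lowerQ, le_refl, dif_pos, mulVec, dotProduct, Finset.mul_sum]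
    exact Finset.sum_congr rfl fun l _ => by ring
  · rw [if_neg h.ne', dif_pos h.le, if_neg h.ne', div_eq_inv_mul, one_div]
    simp [lowerQ, h.le, h.not_ge, mulVec, dotProduct]

/-- For symmetric `R` the symmetrization can be dropped in the inner product, leaving `tr(B(ΔX S - X
Δ))` with `B = TᵀRP'` and `Δ` the combination of the `Aₖ`. The coefficients of `z` and `y` are
contractions of `SB` and `BX` with the stored arrays. They cost `n²` operations for each of at most
`n²` unknowns, hence `n⁴`. -/
theorem fullMatrix_transpose_mulVec (hS : Sᵀ = S) (hT : P'⁻¹ = Tᵀ) {R : Matrix (Fin n) (Fin n) ℝ}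
    (hR : Rᵀ = R) : (D.fullMatrix Q P' X S)ᵀ *ᵥ vc R = Sum.elim
      (fun l => ∑ i, ∑ j, (S * (Tᵀ * R * P')) i j * smatWeight n i j *
        (lowerQ Q i j l + lowerQ Q j i l))
      (fun k => -∑ i, ∑ j, (Tᵀ * R * P' * X) i j * D.A k i j) := by
  refine dotProduct_eq _ _ fun u => ?_
  set B := Tᵀ * R * P' with hB
  have e1 : (D.fullMatrix Q P' X S)ᵀ *ᵥ vc R ⬝ᵥ u =
      (S * B * dirX Q u).trace - (B * X * D.dirS u).trace := by
    rw [dotProduct_comm, dotProduct_mulVec, vecMul_transpose, SDO.fullMatrix_mulVec hS, vc_dot,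
      symP_transpose, hT]
    set Z := P' * (dirX Q u * S - X * D.dirS u) * Tᵀ with hZ
    have h1 : (Zᵀ * R).trace = (Z * R).trace := by
      rw [← trace_transpose, transpose_mul, transpose_transpose, hR, trace_mul_comm]
    have h2 : (symP Z * R).trace = (Z * R).trace := by
      rw [symP, smul_mul_assoc, add_mul, trace_smul, trace_add, h1, smul_eq_mul]; ring
    have h3 : (Z * R).trace = (B * (dirX Q u * S - X * D.dirS u)).trace := by
      rw [hZ, hB]
      calc _ = (P' * ((dirX Q u * S - X * D.dirS u) * Tᵀ * R)).trace := by
            simp only [mul_assoc]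
        _ = ((dirX Q u * S - X * D.dirS u) * (Tᵀ * R * P')).trace := by
            rw [trace_mul_comm]; simp only [mul_assoc]
        _ = _ := trace_mul_comm _ _
    rw [h2, h3, mul_sub, trace_sub, ← mul_assoc, trace_mul_comm, ← mul_assoc, mul_assoc B X]
  rw [e1]
  simp only [dotProduct, Fintype.sum_sum_type, Sum.elim_inl, Sum.elim_inr]
  have e2 : (S * B * dirX Q u).trace = ∑ l, (∑ i, ∑ j, (S * B) i j * smatWeight n i j *
      (lowerQ Q i j l + lowerQ Q j i l)) * u (.inl l) := by
    have h1 : ∀ i j, dirX Q u j i = dirX Q u i j := fun i j => by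
      conv_lhs => rw [← dirX_transpose (Q := Q) u, transpose_apply]
    simp only [trace, diag_apply, mul_apply (M := S * B), h1, dirX_apply, Finset.sum_mul,
      Finset.mul_sum]
    rw [Finset.sum_comm' (t' := Finset.univ) (s' := fun _ => Finset.univ) (by simp)]
    conv_rhs => rw [Finset.sum_comm]
    rw [Finset.sum_comm]
    refine Finset.sum_congr rfl fun i _ => ?_
    conv_rhs => rw [Finset.sum_comm]
    exact Finset.sum_congr rfl fun j _ => Finset.sum_congr rfl fun l _ => by ring
  have e3 : (B * X * D.dirS u).trace =
      ∑ k, (∑ i, ∑ j, (B * X) i j * D.A k i j) * u (.inr k) := by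
    rw [SDO.dirS_eq, Finset.mul_sum, trace_sum]
    refine Finset.sum_congr rfl fun k _ => ?_
    rw [mul_smul_comm, trace_smul, smul_eq_mul, mul_comm]
    congr 1
    simp only [trace, diag_apply, mul_apply (M := B * X)]
    refine Finset.sum_congr rfl fun i _ => Finset.sum_congr rfl fun j _ => ?_
    rw [(D.A_symm k).apply]
  rw [e2, e3, sub_eq_add_neg, ← Finset.sum_neg_distrib]
  congr 1
  exact Finset.sum_congr rfl fun k _ => by ring

/-- The memory holds the problem data. -/
structure Data (D : SDO n m) (Q : Matrix (SIdx n) (Fin p) ℝ) (ε γ δ β : ℝ) (μ : Mem) : Prop where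
  ε : μ 0 0 0 0 = ε
  γ : μ 0 1 0 0 = γ
  δ : μ 0 2 0 0 = δ
  β : μ 0 3 0 0 = β
  A : ∀ (k : Fin m) (i j : Fin n), μ 4 k i j = D.A k i j
  Q : ∀ (i j : Fin n) (l : Fin p), μ 7 i j l = lowerQ Q i j l

theorem Data.congr {μ μ' : Mem} (h : Data D Q ε γ δ β μ) (h0 : ∀ i < 4, μ' 0 i 0 0 = μ 0 i 0 0)
    (h4 : μ' 4 = μ 4) (h7 : μ' 7 = μ 7) : Data D Q ε γ δ β μ' :=
  ⟨(h0 0 (by norm_num)).trans h.ε, (h0 1 (by norm_num)).trans h.γ, (h0 2 (by norm_num)).trans h.δ,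
    (h0 3 (by norm_num)).trans h.β, fun k i j => by rw [h4, h.A], fun i j l => by rw [h7, h.Q]⟩

/-- The memory holds the iterate and the scaling matrix. -/
structure ScaleMem (X S T P' : Matrix (Fin n) (Fin n) ℝ) (μ : Mem) : Prop where
  X : μ.mat 1 n n = X
  S : μ.mat 3 n n = S
  T : μ.mat 11 n n = T
  P : μ.mat 12 n n = P'
  wt : μ.mat 13 n n = smatWeight n

theorem ScaleMem.congr {μ' : Mem} (h : ScaleMem X S T P' μ) (hμ : ∀ b < 20, μ' b = μ b) :
    ScaleMem X S T P' μ' :=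
  ⟨Mem.mat_of_eq (hμ 1 (by norm_num)) h.X, Mem.mat_of_eq (hμ 3 (by norm_num)) h.S,
    Mem.mat_of_eq (hμ 11 (by norm_num)) h.T, Mem.mat_of_eq (hμ 12 (by norm_num)) h.P,
    Mem.mat_of_eq (hμ 13 (by norm_num)) h.wt⟩

/-- Stores the primal direction of `z` in array `50` and the negative dual direction of `y` in
array `51`. -/
def dirBlk (z y : ℕ) : Blk :=
  [setMat 50 (.var 0) (ent 13 4 5 * .sum (.var 2)
      ((.rd 7 (.var 4) (.var 5) (.var 6) + .rd 7 (.var 5) (.var 4) (.var 6)) * ve z 6)),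
    setMat 51 (.var 0) (.sum (.var 1) (.rd 4 (.var 6) (.var 4) (.var 5) * ve y 6))]

def mv : Blk := dirBlk 23 24 ++
  [setMat 52 (.var 0) (mm 50 3 - mm 1 51), setMat 53 (.var 0) (mm 12 52),
    setMat 54 (.var 0) (mmT 53 11),
    setMat 28 (.var 0) (.cst (1 / 2) * (ent 54 4 5 + ent 54 5 4))]

def mvT : Blk :=
  [setMat 55 (.var 0) (mTm 11 22), setMat 56 (.var 0) (mm 55 12), setMat 57 (.var 0) (mm 3 56),
    setMat 58 (.var 0) (mm 56 1), setMat 59 (.var 0) (ent 57 4 5 * ent 13 4 5),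
    setZ 25 (sumSum (ent 59 6 7 *
      (.rd 7 (.var 6) (.var 7) (.var 4) + .rd 7 (.var 7) (.var 6) (.var 4)))),
    setY 26 (.cst 0 - sumSum (ent 58 6 7 * .rd 4 (.var 4) (.var 6) (.var 7)))]

theorem dirBlk_sat {z y : ℕ} (h0 : ι 0 = n) (h1 : ι 1 = m) (h2 : ι 2 = p) (hy : y ≠ 50)
    (hA : ∀ (k : Fin m) (i j : Fin n), μ 4 k i j = D.A k i j)
    (hQ : ∀ (i j : Fin n) (l : Fin p), μ 7 i j l = lowerQ Q i j l)
    (hw : μ.mat 13 n n = smatWeight n) {u : Fin p ⊕ Fin m → ℝ} (hu : μ.uvec z y p m = u)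
    {blk : Blk} {R : Mem → Prop} (h : ∀ μ', (∀ b, b ≠ 50 → b ≠ 51 → μ' b = μ b) →
      μ'.mat 50 n n = dirX Q u → μ'.mat 51 n n = D.dirS u → blk.Sat μ' ι R) :
    (dirBlk z y ++ blk).Sat μ ι R := by
  subst hu
  refine Blk.Sat.setMat h0 (dirX Q (μ.uvec z y p m)) rfl (fun i j => ?_) fun μ1 f1 v1 => ?_
  · rw [dirX_apply, ← hw]
    simp only [Tm.ev, Op.eval]
    simp [ixv, h2, Finset.sum_range, hQ, Mem.mat, Mem.uvec, Mem.vec]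
  refine Blk.Sat.setMat h0 (D.dirS (μ.uvec z y p m)) rfl (fun i j => ?_) fun μ2 f2 v2 =>
    h μ2 (fun b h50 h51 => by rw [f2 b h51, f1 b h50]) (Mem.mat_of_eq (f2 50 (by norm_num)) v1) v2
  rw [SDO.dirS_eq, Matrix.sum_apply]
  simp only [Tm.ev, Op.eval]
  simp [ixv, h1, Finset.sum_range, hA, f1 4, f1 y hy, Mem.uvec, Mem.vec, mul_comm]

theorem rvec_eq (μ : Mem) (a : ℕ) : μ.rvec a n n = vc (μ.mat a n n) := rfl

/-- The symmetric matrices as residuals. -/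
def symmSet (n : ℕ) : Set (Fin n × Fin n → ℝ) := {r | ∃ R : Matrix (Fin n) (Fin n) ℝ, Rᵀ = R ∧
  r = vc R}

/-- The transposed product is claimed for symmetric residuals only. All residuals met by the solver
are of this kind, since they lie in the range of the full matrix. -/
theorem matvec (h0 : ι 0 = n) (h1 : ι 1 = m) (h2 : ι 2 = p) (hd : Data D Q ε γ δ β μ₀)
    (hm : ScaleMem X S T P' μ₀) (hS : Sᵀ = S) (hT : P'⁻¹ = Tᵀ) :
    Matvec ι μ₀ mv mvT (D.fullMatrix Q P' X S) (symmSet n) := by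
  constructor
  · intro μ hμ
    have hm' := hm.congr hμ
    have hd' : Data D Q ε γ δ β μ := hd.congr (fun i _ => by rw [hμ 0 (by norm_num)])
      (hμ 4 (by norm_num)) (hμ 7 (by norm_num))
    set u := μ.uvec 23 24 p m with hu
    refine dirBlk_sat h0 h1 h2 (by norm_num) hd'.A hd'.Q hm'.wt hu.symm fun μ1 f1 v50 v51 => ?_
    have g1 : ∀ b < 20, μ1 b = μ b := fun b hb => f1 b (by omega) (by omega)
    have hm1 := hm'.congr g1
    refine Blk.Sat.setMat h0 (dirX Q u * S - X * D.dirS u) rfl (fun i j => ?_) fun μ2 f2 v2 => ?_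
    · rw [Tm.ev_sub, ev_mm h0 v50 hm1.S, ev_mm h0 hm1.X v51]; rfl
    have hm2 := hm1.congr (μ' := μ2) fun b hb => f2 b (by omega)
    refine Blk.Sat.setMM h0 hm2.P v2 fun μ3 f3 v3 => ?_
    have hm3 := hm2.congr (μ' := μ3) fun b hb => f3 b (by omega)
    refine Blk.Sat.setMMT h0 v3 hm3.T fun μ4 f4 v4 => ?_
    refine Blk.Sat.setMat h0 (symP (P' * (dirX Q u * S - X * D.dirS u) * Tᵀ)) rfl (fun i j => ?_)
      fun μ5 f5 v5 => Blk.Sat.nil ⟨fun b hb hb' => ?_, ?_⟩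
    · rw [Tm.ev_mul, Tm.ev_add, ev_own v4, ev_ent_swap v4]
      simp only [Tm.ev, symP, Matrix.smul_apply, Matrix.add_apply, transpose_apply, smul_eq_mul]
      norm_num
    · rw [f5 b hb', f4 b (by omega), f3 b (by omega), f2 b (by omega),
        f1 b (by omega) (by omega)]
    · rw [SDO.fullMatrix_mulVec hS, rvec_eq, v5, hT]
  · rintro μ hμ ⟨R, hR, hμR⟩
    have hm' := hm.congr hμ
    have hd' : Data D Q ε γ δ β μ := hd.congr (fun i _ => by rw [hμ 0 (by norm_num)])
      (hμ 4 (by norm_num)) (hμ 7 (by norm_num))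
    have v22 : μ.mat 22 n n = R := vc_injective hμR
    rw [hμR, fullMatrix_transpose_mulVec hS hT hR]
    set B := Tᵀ * R * P' with hB
    refine Blk.Sat.setMTM h0 hm'.T v22 fun μ1 f1 v1 => ?_
    have hm1 := hm'.congr (μ' := μ1) fun b hb => f1 b (by omega)
    refine Blk.Sat.setMM h0 v1 hm1.P fun μ2 f2 v2 => ?_
    have hm2 := hm1.congr (μ' := μ2) fun b hb => f2 b (by omega)
    refine Blk.Sat.setMM h0 hm2.S v2 fun μ3 f3 v3 => ?_
    have hm3 := hm2.congr (μ' := μ3) fun b hb => f3 b (by omega)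
    refine Blk.Sat.setMM h0 (Mem.mat_of_eq (f3 56 (by norm_num)) v2) hm3.X fun μ4 f4 v4 => ?_
    have hm4 := hm3.congr (μ' := μ4) fun b hb => f4 b (by omega)
    have v57 := Mem.mat_of_eq (f4 57 (by norm_num)) v3
    refine Blk.Sat.setMat h0 (of fun i j => (S * B) i j * smatWeight n i j) rfl (fun i j => ?_)
      fun μ5 f5 v5 => ?_
    · rw [Tm.ev_mul, ev_own v57, ev_own hm4.wt]; rfl
    have g5 : ∀ b < 40, μ5 b = μ b := fun b hb => by
      rw [f5 b (by omega), f4 b (by omega), f3 b (by omega), f2 b (by omega), f1 b (by omega)]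
    have e59 : ∀ i j : Fin n, μ5 59 i j 0 = (S * B) i j * smatWeight n i j := fun i j =>
      congrFun (congrFun v5 i) j
    refine Blk.Sat.setZ h2 (fun l => ∑ i, ∑ j, (S * B) i j * smatWeight n i j *
        (lowerQ Q i j l + lowerQ Q j i l)) rfl (fun l => ?_) fun μ6 f6 v6 => ?_
    · simp only [Tm.ev, Op.eval]
      simp [ixv, h0, Finset.sum_range, e59, g5 7, hd'.Q]
    have e58 : ∀ i j : Fin n, μ6 58 i j 0 = (B * X) i j := fun i j => by
      rw [f6 58 (by norm_num), f5 58 (by norm_num)]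
      exact congrFun (congrFun v4 i) j
    refine Blk.Sat.setY h1 (fun k => -∑ i, ∑ j, (B * X) i j * D.A k i j) rfl (fun k => ?_)
      fun μ7 f7 v7 => Blk.Sat.nil ⟨fun b hb h25 h26 => ?_, ?_⟩
    · simp only [Tm.ev_sub, Tm.ev, Op.eval]
      simp [ixv, h0, Finset.sum_range, e58, f6 4, g5 4, hd'.A]
    · rw [f7 b h26, f6 b h25, g5 b hb]
    · rw [Mem.uvec, v7, Mem.vec_congr (f7 25 (by norm_num)), v6]

end

end SDOProg

namespace SDOProg

/-! ### The program for semidefinite optimization -/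

/-- No matrix is inverted: `P' = TG` has inverse `Tᵀ`, so the conjugate of `XS` is a product of
stored matrices. -/
def rhs : Blk :=
  [setMat 12 (.var 0) (mm 11 10),
    setMat 13 (.var 0) (deltaTm 4 5 * .cst (1 / 2) + (.cst 1 - deltaTm 4 5) / .sqrt (.cst 2)),
    setMat 48 (.var 0) (mm 12 40), setMat 49 (.var 0) (mmT 48 11),
    setMat 22 (.var 0) (scl 64 * deltaTm 4 5 - .cst (1 / 2) * (ent 49 4 5 + ent 49 5 4))]

/-- Computes the scaling matrix and the right-hand side. -/
def scale : Cmd :=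
  .seq (parBlk ++ newtonStart).comp
    (.seq newtonLoop (.seq gsStart.comp (.seq gsLoop rhs.comp)))

def gap : Tm := sumSum (ent 1 6 7 * ent 3 7 6)

def update : Blk := dirBlk 20 21 ++
  [setMat 1 (.var 0) (own 1 + own 50), setY 2 (own 2 + own 21),
    setMat 3 (.var 0) (own 3 - own 51)]

def init : Cmd := (nuBlk gap).comp

def body : Cmd :=
  .seq scale (.seq (cgSolve (.var 0) mv mvT) (update ++ nuBlk gap).comp)

section
variable {n m p : ℕ} {D : SDO n m} {Q : Matrix (SIdx n) (Fin p) ℝ} {ε γ δ β : ℝ}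

/-- The memory holds the problem data and an iterate in the neighborhood. -/
structure Good (D : SDO n m) (Q : Matrix (SIdx n) (Fin p) ℝ) (ε γ δ β : ℝ) (s : State) : Prop where
  size0 : s.ix 0 = n
  size1 : s.ix 1 = m
  size2 : s.ix 2 = p
  data : Data D Q ε γ δ β s.mem
  gap : s.mem 0 4 0 0 = nu (s.mat 1 n n) (s.mat 3 n n)
  nbhd : D.Neighborhood γ (s.mat 1 n n) (s.vec 2 m) (s.mat 3 n n)

/-- Degrees of the sizes `n`, `m`, `p` in terms of `n`. -/
abbrev wt : ℕ → ℕ := fun v => if v = 0 then 1 else 2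

/-- A cost constant for `scale`. -/
def scaleCost (η : ℝ) : ℕ := (parBlk ++ newtonStart).cf +
  (newtonSteps η * (newtonPass.cf + 1) + 1) + gsStart.cf + (gsPass.cf + 2) + rhs.cf

/-- A cost constant for one iteration. -/
def cost (η : ℝ) : ℕ :=
  scaleCost η + cgCost (.var 0) mv mvT + (update ++ nuBlk gap).cf + (nuBlk gap).cf

theorem card_sIdx_pos (hn : 0 < n) : 0 < Fintype.card (SIdx n) :=
  Fintype.card_pos_iff.mpr ⟨⟨(⟨0, hn⟩, ⟨0, hn⟩), le_rfl⟩⟩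

theorem sized (hQ : IsNullBasis D.As Q) (hn : 0 < n) {ι : ℕ → ℕ} (h0 : ι 0 = n) (h1 : ι 1 = m)
    (h2 : ι 2 = p) : Sized wt n ι := by
  have h := SDO.card_eq hQ
  have h' := card_sIdx_le (n := n)
  refine ⟨hn, fun v hv => ?_⟩
  interval_cases v
  · simp [h0]
  · simp only [h1]; change m ≤ n ^ 2; omega
  · simp only [h2]; change p ≤ n ^ 2; omega

theorem rhs_sat {ι : ℕ → ℕ} {μ : Mem} {X S T GG : Matrix (Fin n) (Fin n) ℝ} {c : ℝ} (h0 : ι 0 = n)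
    (hX : μ.mat 1 n n = X) (hS : μ.mat 3 n n = S) (hG : μ.mat 10 n n = GG) (hT : μ.mat 11 n n = T)
    (hE : μ.mat 40 n n = X * S) (hc : μ.sc 64 = c) (hinv : (T * GG)⁻¹ = Tᵀ) :
    rhs.Sat μ ι fun μ' => (∀ b < 10, μ' b = μ b) ∧ μ' 35 = μ 35 ∧ ScaleMem X S T (T * GG) μ' ∧
      μ'.mat 22 n n = c • (1 : Matrix (Fin n) (Fin n) ℝ) - symmetrize (T * GG) (X * S) := by
  refine Blk.Sat.setMM h0 hT hG fun μ1 f1 v1 => ?_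
  refine Blk.Sat.cons (fun i _ j _ => Tm.ok_add (Tm.ok_of_total _ _ _ rfl)
    (Tm.ok_div (Tm.ok_of_total _ _ _ rfl) ⟨trivial, ?_⟩ ?_)) fun μ2 f2 v2 => ?_
  · simp [Tm.ev]
  · simp [Tm.ev]
  simp only at f2
  have w2 : μ2.mat 13 n n = smatWeight n := by
    ext i j
    refine (v2 i (by simp [ixv, h0]) j (by simp [ixv, h0])).trans ?_
    rw [Fill.val, Tm.ev_add, Tm.ev_mul, Tm.ev_div, Tm.ev_sub (.cst 1) (deltaTm 4 5),
      ev_deltaTm (i := i) (j := j) (by simp) (by simp), smatWeight, of_apply, one_apply]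
    simp only [Tm.ev]
    split_ifs <;> norm_num
  refine Blk.Sat.setMM h0 (Mem.mat_of_eq (f2 12 (by norm_num)) v1)
    (Mem.mat_of_eq (f2 40 (by norm_num)) (Mem.mat_of_eq (f1 40 (by norm_num)) hE))
    fun μ3 f3 v3 => ?_
  have g3 : ∀ b < 12, μ3 b = μ b := fun b hb => by
    rw [f3 b (by omega), f2 b (by omega), f1 b (by omega)]
  refine Blk.Sat.setMMT h0 v3 (Mem.mat_of_eq (g3 11 (by norm_num)) hT) fun μ4 f4 v4 => ?_
  have c4 : μ4.sc 64 = c := Mem.sc_of_eq (f4 64 (by norm_num)) (Mem.sc_of_eq (f3 64 (by norm_num))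
    (Mem.sc_of_eq (f2 64 (by norm_num)) (Mem.sc_of_eq (f1 64 (by norm_num)) hc)))
  refine Blk.Sat.setMat h0
    (c • (1 : Matrix (Fin n) (Fin n) ℝ) - symmetrize (T * GG) (X * S)) rfl (fun i j => ?_)
    fun μ5 f5 v5 => Blk.Sat.nil ⟨fun b hb => ?_, ?_, ⟨?_, ?_, ?_, ?_, ?_⟩, v5⟩
  · rw [Tm.ev_sub, Tm.ev_mul, Tm.ev_mul, Tm.ev_add, ev_own v4, ev_ent_swap v4, ev_scl, c4,
      ev_deltaTm (i := i) (j := j) (by simp) (by simp), symmetrize_eq, hinv]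
    simp only [Tm.ev, symP, Matrix.sub_apply, Matrix.smul_apply, Matrix.add_apply, transpose_apply,
      smul_eq_mul]
    norm_num
  · rw [f5 b (by omega), f4 b (by omega), g3 b (by omega)]
  · rw [f5 35 (by norm_num), f4 35 (by norm_num), f3 35 (by norm_num), f2 35 (by norm_num),
      f1 35 (by norm_num)]
  · exact Mem.mat_of_eq (by rw [f5 1 (by norm_num), f4 1 (by norm_num), g3 1 (by norm_num)]) hX
  · exact Mem.mat_of_eq (by rw [f5 3 (by norm_num), f4 3 (by norm_num), g3 3 (by norm_num)]) hS
  · exact Mem.mat_of_eq (by rw [f5 11 (by norm_num), f4 11 (by norm_num), g3 11 (by norm_num)]) hT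
  · exact Mem.mat_of_eq (by rw [f5 12 (by norm_num), f4 12 (by norm_num), f3 12 (by norm_num),
      f2 12 (by norm_num)]) v1
  · exact Mem.mat_of_eq (by rw [f5 13 (by norm_num), f4 13 (by norm_num), f3 13 (by norm_num)]) w2

/-- The positive definite matrix `SY` produced by Newton's iteration is what Gram-Schmidt needs.
After `n` passes all rows of `T` are orthonormal, and the bound on `G² - I` becomes the bound on
`P'WP'ᵀ - I`. -/
theorem scale_tot (hp : Params n γ δ) (hβ : 0 < β) (hQ : IsNullBasis D.As Q) {s : State}
    (hs : Good D Q ε γ δ β s) :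
    ∃ P' T : Matrix (Fin n) (Fin n) ℝ, P'⁻¹ = Tᵀ ∧ P' * P'⁻¹ = 1 ∧
      frob (P' * ntW (s.mat 1 n n) (s.mat 3 n n) * P'ᵀ - 1) ≤ tol γ δ β ^ 2 / 100 ∧
      Tot scale s (scaleCost (tol γ δ β ^ 2 / 100) * n ^ 4) fun s' => ∃ μ ι,
        (∀ v < 3, ι v = s.ix v) ∧ Agree μ ι s' ∧ (∀ b < 10, μ b = s.mem b) ∧
        μ.sc 35 = (tol γ δ β / 2) ^ 2 ∧ ScaleMem (s.mat 1 n n) (s.mat 3 n n) T P' μ ∧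
        μ.mat 22 n n = (centering n δ * nu (s.mat 1 n n) (s.mat 3 n n)) •
          (1 : Matrix (Fin n) (Fin n) ℝ) - symmetrize P' (s.mat 1 n n * s.mat 3 n n) := by
  obtain ⟨h0, h1, h2, hd, hgap, heq, hX, hS, hnear⟩ := hs
  set X := s.mat 1 n n with hXd
  set S := s.mat 3 n n with hSd
  have hsz := sized hQ hp.n_pos h0 h1 h2
  obtain ⟨V, hsc, hPW⟩ := ntScaled hX hS
  obtain ⟨hF, -⟩ := hsc.frame hp.n_pos hX hS hnear
  have hη : 0 < tol γ δ β ^ 2 / 100 := by have := tol_pos hp.γ_pos hp.δ_pos hβ; positivity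
  set η := tol γ δ β ^ 2 / 100 with hηd
  have hpre : (parBlk ++ newtonStart).Sat s.mem s.ix fun μ => ∃ μ₀ : Mem, (∀ b < 35, μ₀ b = s.mem b) ∧
      μ₀.sc 35 = (tol γ δ β / 2) ^ 2 ∧ μ₀.sc 63 = η ^ 2 ∧ μ₀.sc 64 = centering n δ * nu X S ∧
      NewtonMem μ₀ (X * S) (invSqrtIter (X * S) (Real.sqrt (nu X S)) 0) μ := by
    refine Blk.Sat.append (parBlk_sat h0 hp.n_pos hd.γ hd.δ hd.β hgap fun μ1 f1 v35 v63 v64 => ?_)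
    refine (newtonStart_sat h0 hF.nu_pos ?_ (Mem.mat_of_eq (f1 1 (by norm_num) (by norm_num)) rfl)
      (Mem.mat_of_eq (f1 3 (by norm_num) (by norm_num)) rfl)).mono fun μ2 h =>
        ⟨μ1, fun b hb => f1 b (by omega) (by omega), v35, v63, v64, h⟩
    rw [f1 0 (by norm_num) (by norm_num), hgap]
  obtain ⟨t1, s1, hex1, ht1, μ1, hs1, μ₀, f0, v35, v63, v64, hn1⟩ :=
    hpre.tot (s := s) (d := 4) hsz (by decide) (by decide) ⟨fun _ _ => rfl, fun _ _ => rfl⟩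
  obtain ⟨Y, G, hYG, t2, s2, hex2, ht2, μ2, hs2, hn2⟩ := newtonLoop_tot (d := 4) hsz (by decide) h0
    hsc hF hp.γ_le hp.γ_pos.le hη v63 hs1 hn1
  have x2 : μ2.mat 1 n n = X :=
    Mem.mat_of_eq (by rw [hn2.frame 1 (by norm_num), f0 1 (by norm_num)]) rfl
  have z2 : μ2.mat 3 n n = S :=
    Mem.mat_of_eq (by rw [hn2.frame 3 (by norm_num), f0 3 (by norm_num)]) rfl
  obtain ⟨t3, s3, hex3, ht3, μ3, hs3, hg3⟩ :=
    (gsStart_sat h0 z2 hn2.mem_Y).tot (d := 4) hsz (by decide) (by decide) hs2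
  obtain ⟨t4, s4, hex4, ht4, μ4, ι4, hι4, hs4, hg4⟩ :=
    gsLoop_tot (d := 3) hsz (by decide) h0 (hYG.mul_S_posDef hsc) hs3 hg3
  have hT : μ4.mat 11 n n * (S * Y) * (μ4.mat 11 n n)ᵀ = 1 := by
    rw [hg4.T.orth]
    simp
  set T := μ4.mat 11 n n with hTd
  obtain ⟨hinv, hunit, hW⟩ := hYG.scaling hsc hPW hT
  refine ⟨T * (S * Y), T, hinv, hunit, hW, ?_⟩
  have hι0 : ι4 0 = n := (hι4 0 (by norm_num)).trans h0
  have hr := rhs_sat (c := centering n δ * nu X S) hι0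
    (Mem.mat_of_eq (hg4.frame 1 (by norm_num)) x2)
    (Mem.mat_of_eq (hg4.frame 3 (by norm_num)) z2) hg4.mem_G rfl
    (Mem.mat_of_eq (hg4.frame 40 (by norm_num)) hn2.mem_E)
    (Mem.sc_of_eq (hg4.frame 64 (by norm_num)) (Mem.sc_of_eq (hn2.frame 64 (by norm_num)) v64)) hinv
  obtain ⟨t5, s5, hex5, ht5, μ5, hs5, f5, f35, hm5, hR5⟩ := hr.tot (w := wt) (d := 4)
    ⟨hsz.1, fun v hv => by rw [hι4 v hv]; exact hsz.2 v hv⟩ (by decide) (by decide) hs4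
  refine ⟨_, s5, Exec.seq hex1 (Exec.seq hex2 (Exec.seq hex3 (Exec.seq hex4 hex5))), ?_,
    μ5, ι4, hι4, hs5, fun b hb => ?_, ?_, hm5, hR5⟩
  · have hz1 := hsz.one_le_pow 4
    have hnn : n * (gsPass.cf * n ^ 3 + 1) + 1 ≤ (gsPass.cf + 2) * n ^ 4 := by
      have : n ≤ n ^ 4 := Nat.le_self_pow (by norm_num) n
      calc n * (gsPass.cf * n ^ 3 + 1) + 1 = gsPass.cf * n ^ 4 + n + 1 := by ring
        _ ≤ gsPass.cf * n ^ 4 + n ^ 4 + n ^ 4 := by gcongr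
        _ = _ := by ring
    have hnw : newtonSteps η * (newtonPass.cf * n ^ 4 + 1) + 1 ≤
        (newtonSteps η * (newtonPass.cf + 1) + 1) * n ^ 4 := by
      calc newtonSteps η * (newtonPass.cf * n ^ 4 + 1) + 1
          ≤ newtonSteps η * (newtonPass.cf * n ^ 4 + n ^ 4) + n ^ 4 := by gcongr
        _ = _ := by ring
    unfold scaleCost
    calc t1 + (t2 + (t3 + (t4 + t5)))
        ≤ (parBlk ++ newtonStart).cf * n ^ 4 + ((newtonSteps η * (newtonPass.cf + 1) + 1) * n ^ 4 +
          (gsStart.cf * n ^ 4 + ((gsPass.cf + 2) * n ^ 4 + rhs.cf * n ^ 4))) :=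
          add_le_add ht1 (add_le_add (ht2.trans hnw) (add_le_add ht3
            (add_le_add (ht4.trans hnn) ht5)))
      _ = _ := by ring
  · rw [f5 b hb, hg4.frame b (by omega), hn2.frame b (by omega), f0 b (by omega)]
  · rw [Mem.sc, f35, hg4.frame 35 (by norm_num), hn2.frame 35 (by norm_num)]
    exact v35

theorem ev_gap {μ : Mem} {ι : ℕ → ℕ} (h0 : ι 0 = n) :
    gap.ev μ 6 (env ι 0 0) = inn (μ.mat 1 n n) (μ.mat 3 n n) :=
  ev_trace_mul h0 rfl rfl 0 0

theorem update_sat {ι : ℕ → ℕ} {μ : Mem} {X S : Matrix (Fin n) (Fin n) ℝ} {y : Fin m → ℝ}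
    {u : Fin p ⊕ Fin m → ℝ} (hn : 0 < n) (h0 : ι 0 = n) (h1 : ι 1 = m) (h2 : ι 2 = p)
    (hd : Data D Q ε γ δ β μ) (hw : μ.mat 13 n n = smatWeight n) (hX : μ.mat 1 n n = X)
    (hy : μ.vec 2 m = y) (hS : μ.mat 3 n n = S) (hu : μ.uvec 20 21 p m = u) :
    (update ++ nuBlk gap).Sat μ ι fun μ' => Data D Q ε γ δ β μ' ∧
      μ'.mat 1 n n = X + dirX Q u ∧ μ'.vec 2 m = (y + fun i => u (.inr i)) ∧
      μ'.mat 3 n n = S - D.dirS u ∧ μ' 0 4 0 0 = nu (X + dirX Q u) (S - D.dirS u) := by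
  unfold update
  rw [List.append_assoc]
  refine dirBlk_sat h0 h1 h2 (by norm_num) hd.A hd.Q hw hu fun μ1 f1 v50 v51 => ?_
  refine Blk.Sat.append ?_
  have x1 := Mem.mat_of_eq (f1 1 (by norm_num) (by norm_num)) hX
  refine Blk.Sat.setMat h0 (X + dirX Q u) rfl (fun i j => ?_) fun μ3 f3 v3 => ?_
  · rw [Tm.ev_add, ev_own x1, ev_own v50]; rfl
  refine Blk.Sat.setY h1 (y + fun i => u (.inr i)) rfl (fun i => ?_) fun μ4 f4 v4 => ?_
  · rw [Tm.ev_add]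
    simp only [Tm.ev, ixv, Function.update_self, Function.update_of_ne (show 4 ≠ 5 by norm_num)]
    rw [f3 2 (by norm_num), f3 21 (by norm_num), f1 2 (by norm_num) (by norm_num),
      f1 21 (by norm_num) (by norm_num), ← hu, ← hy]
    rfl
  have z4 : μ4.mat 3 n n = S := Mem.mat_of_eq (f4 3 (by norm_num))
    (Mem.mat_of_eq (f3 3 (by norm_num)) (Mem.mat_of_eq (f1 3 (by norm_num) (by norm_num)) hS))
  have d4 : μ4.mat 51 n n = D.dirS u :=
    Mem.mat_of_eq (f4 51 (by norm_num)) (Mem.mat_of_eq (f3 51 (by norm_num)) v51)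
  refine Blk.Sat.setMat h0 (S - D.dirS u) rfl (fun i j => ?_) fun μ5 f5 v5 => ?_
  · rw [Tm.ev_sub, ev_own z4, ev_own d4]; rfl
  refine Blk.Sat.nil (nuBlk_sat h0 hn rfl fun μ6 f6 g6 v6 => ?_)
  have g5 : ∀ b, b ≠ 1 → b ≠ 2 → b ≠ 3 → b < 10 → μ5 b = μ b := fun b hb1 hb2 hb3 hb => by
    rw [f5 b hb3, f4 b hb2, f3 b hb1, f1 b (by omega) (by omega)]
  have ex5 : μ5.mat 1 n n = X + dirX Q u :=
    Mem.mat_of_eq (f5 1 (by norm_num)) (Mem.mat_of_eq (f4 1 (by norm_num)) v3)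
  refine ⟨hd.congr (fun i hi => by rw [g6 i hi, g5 0 (by norm_num) (by norm_num) (by norm_num)
    (by norm_num)]) ?_ ?_, ?_, ?_, ?_, ?_⟩
  · rw [f6 4 (by norm_num) (by norm_num), g5 4 (by norm_num) (by norm_num) (by norm_num)
      (by norm_num)]
  · rw [f6 7 (by norm_num) (by norm_num), g5 7 (by norm_num) (by norm_num) (by norm_num)
      (by norm_num)]
  · exact Mem.mat_of_eq (f6 1 (by norm_num) (by norm_num)) ex5
  · rw [Mem.vec_congr (f6 2 (by norm_num) (by norm_num)), Mem.vec_congr (f5 2 (by norm_num)), v4]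
  · exact Mem.mat_of_eq (f6 3 (by norm_num) (by norm_num)) v5
  · rw [v6, ev_gap h0, ex5, v5, nu]

/-- The solver reaches `τ/2` for the system scaled by `P'`, and `SDO.stepFacts` converts this to `τ
≤ β` for the exact scaling. The same facts express the number of passes through the condition number
of the exact matrix. -/
theorem body_tot (hp : Params n γ δ) (hβ : 0 < β) (hβ1 : β < 1) (hQ : IsNullBasis D.As Q)
    {s : State} (hs : Good D Q ε γ δ β s) :
    ∃ (k : ℕ) (q : ℝ[X]), q.natDegree ≤ k ∧
      (∀ κ, 1 ≤ κ → condNumber (D.ntMatrix Q (s.mat 1 n n) (s.mat 3 n n)) ≤ κ →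
        (k : ℝ) ≤ cgFactor (tol γ δ β / 2) * κ) ∧
      Tot body s (cost (tol γ δ β ^ 2 / 100) * n ^ 4 * (k + 1)) fun s' => Good D Q ε γ δ β s' ∧
        D.InexactStep Q (centering n δ) β q (s.mat 1 n n) (s.vec 2 m) (s.mat 3 n n)
          (s'.mat 1 n n) (s'.vec 2 m) (s'.mat 3 n n) ∧
        s'.get nuRef ≤ (1 - (δ / 2) / Real.sqrt n) * s.get nuRef := by
  have hτ := tol_pos hp.γ_pos hp.δ_pos hβ
  obtain ⟨hτγ, hτδ, hτβ⟩ := tol_le hp hβ hβ1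
  have hτ1 : tol γ δ β ≤ 1 / 100 := by have := hp.γ_le; linarith
  obtain ⟨P', T, hinv, hunit, hW, t1, s1, hex1, ht1, μ1, ι, hι, hs1, hμ1, hθ1, hm1, hR1⟩ :=
    scale_tot hp hβ hQ hs
  obtain ⟨h0, h1, h2, hd, hgap, hN⟩ := hs
  set X := s.mat 1 n n with hXd
  set y := s.vec 2 m with hyd
  set S := s.mat 3 n n with hSd
  have hSt : Sᵀ = S := PosDef.transpose_eq hN.2.2.1
  have hf := SDO.stepFacts hp hQ hN hτ.le hτ1 hτγ hτδ hunit hW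
  replace h0 := (hι 0 (by norm_num)).trans h0
  replace h1 := (hι 1 (by norm_num)).trans h1
  replace h2 := (hι 2 (by norm_num)).trans h2
  have hsz := sized hQ hp.n_pos h0 h1 h2
  have hd1 : Data D Q ε γ δ β μ1 := hd.congr (fun i _ => by rw [hμ1 0 (by norm_num)])
    (hμ1 4 (by norm_num)) (hμ1 7 (by norm_num))
  have hmv := matvec h0 h1 h2 hd1 hm1 hSt hinv
  set R := (centering n δ * nu X S) • (1 : Matrix (Fin n) (Fin n) ℝ) - symmetrize P' (X * S) with hR
  have hRt : Rᵀ = R := by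
    rw [hR, symmetrize_eq, transpose_sub, symP_transpose, transpose_smul, transpose_one]
  obtain ⟨u₀, hu₀⟩ := hf.solvable R hRt
  obtain ⟨k, f, u, hk1, hu, hres, hk2, t2, s2, hex2, ht2, μ2, hs2, hμ2, hu2⟩ :=
    cgSolve_tot (N := D.ntMatrix Q X S) (d := 4)
    (ci := .var 0) (c := n) (mv := mv) (mvT := mvT) (M := D.fullMatrix Q P' X S)
    (R := vc R) (u := u₀) hsz h0 h1 h2 rfl h0 hmv
    (by decide) (by decide) (by decide) (by decide)
    (by rw [SDO.card_eq hQ]; exact card_sIdx_pos hp.n_pos) hf.nt_injective hf.lower hf.upper hu₀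
    (fun v => ⟨_, symP_transpose _, SDO.fullMatrix_mulVec hSt v⟩) (half_pos hτ)
    (fun h => hf.rhs_ne (vc_injective h)) hs1 hθ1 (by rw [rvec_eq, hR1])
  obtain ⟨hres', hN', hν'⟩ := hf.step u R hR hres
  rw [SDO.polySolve_fullMatrix f hRt] at hu
  have hpost := update_sat (u := u) (y := y) (S := S) hp.n_pos h0 h1 h2
    (hd1.congr (μ' := μ2) (fun i _ => by rw [hμ2 0 (by norm_num)]) (hμ2 4 (by norm_num))
      (hμ2 7 (by norm_num)))
    (hm1.congr hμ2).wt (hm1.congr hμ2).X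
    (Mem.vec_congr (by rw [hμ2 2 (by norm_num), hμ1 2 (by norm_num)])) (hm1.congr hμ2).S hu2
  obtain ⟨t3, s3, hex3, ht3, μ3, hs3, hd3, hx3, hy3, hz3, hν3⟩ :=
    hpost.tot (s := s2) (d := 4) hsz (by decide) (by decide) hs2
  have em : ∀ b ≠ 8, s3.mem b = μ3 b := hs3.2
  have vx : s3.mat 1 n n = X + dirX Q u := Mem.mat_of_eq (em 1 (by norm_num)) hx3
  have vy : s3.vec 2 m = (y + fun i => u (.inr i)) := by
    rw [← hy3]; exact Mem.vec_congr (em 2 (by norm_num))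
  have vz : s3.mat 3 n n = S - D.dirS u := Mem.mat_of_eq (em 3 (by norm_num)) hz3
  have vν : s3.mem 0 4 0 0 = nu (X + dirX Q u) (S - D.dirS u) := by
    rw [em 0 (by norm_num), hν3]
  refine ⟨k, f, hk1, hk2, _, s3, Exec.seq hex1 (Exec.seq hex2 hex3), ?_, ⟨?_, ?_, ?_, ?_, ?_, ?_⟩,
    ⟨P', u, hW.trans ?_, hu, hres'.trans (mul_le_mul_of_nonneg_right hτβ (vnorm_nonneg _)), vx, vy,
      vz⟩, ?_⟩
  · have hz1 := hsz.one_le_pow 4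
    unfold cost
    generalize scaleCost (tol γ δ β ^ 2 / 100) = a at *
    generalize (update ++ nuBlk gap).cf = b at *
    generalize (nuBlk gap).cf = c at *
    generalize cgCost (.var 0) mv mvT = e at *
    generalize n ^ 4 = N at *
    calc t1 + (t2 + t3) ≤ a * N + (e * N * (k + 1) + b * N) := by gcongr
      _ ≤ a * N * (k + 1) + (e * N * (k + 1) + b * N * (k + 1)) + c * N * (k + 1) := by
        have h3 : a * N ≤ a * N * (k + 1) := Nat.le_mul_of_pos_right _ (by omega)
        have h4 : b * N ≤ b * N * (k + 1) := Nat.le_mul_of_pos_right _ (by omega)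
        omega
      _ = _ := by ring
  · rw [hs3.1 0 (by norm_num), h0]
  · rw [hs3.1 1 (by norm_num), h1]
  · rw [hs3.1 2 (by norm_num), h2]
  · exact hd3.congr (fun i _ => by rw [em 0 (by norm_num)]) (em 4 (by norm_num)) (em 7 (by norm_num))
  · rw [vν, vx, vz]
  · rw [vx, vy, vz]; exact hN'
  · calc tol γ δ β ^ 2 / 100 ≤ tol γ δ β := by nlinarith
      _ ≤ β := hτβ
  · change s3.mem 0 4 0 0 ≤ _ * s.mem 0 4 0 0
    rw [vν, hgap]
    exact hν'

theorem data_input (X₀ : Matrix (Fin n) (Fin n) ℝ) (y₀ : Fin m → ℝ)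
    (S₀ : Matrix (Fin n) (Fin n) ℝ) : Data D Q ε γ δ β (D.input Q ε γ δ β X₀ y₀ S₀).mem := by
  refine ⟨rfl, rfl, rfl, rfl, fun k i j => ?_, fun i j l => ?_⟩
  · simp [SDO.input, put2]
  · simp [SDO.input, lowerQ]

theorem init_tot (hQ : IsNullBasis D.As Q) (hn : 0 < n) {X₀ S₀ : Matrix (Fin n) (Fin n) ℝ}
    {y₀ : Fin m → ℝ} (hN : D.Neighborhood γ X₀ y₀ S₀) (η : ℝ) :
    Tot init (D.input Q ε γ δ β X₀ y₀ S₀) (cost η * n ^ 4) fun s =>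
      (s.mat 1 n n = X₀ ∧ s.vec 2 m = y₀ ∧ s.mat 3 n n = S₀) ∧ Good D Q ε γ δ β s ∧
        s.get nuRef = nu X₀ S₀ := by
  set s := D.input Q ε γ δ β X₀ y₀ S₀ with hs
  have hsz : Sized wt n s.ix := sized hQ hn rfl rfl rfl
  have e1 : Mem.mat s.mem 1 n n = X₀ := by ext i j; simp [hs, SDO.input, Mem.mat, put2]
  have e2 : Mem.vec s.mem 2 m = y₀ := by funext i; simp [hs, SDO.input, Mem.vec, put1]
  have e3 : Mem.mat s.mem 3 n n = S₀ := by ext i j; simp [hs, SDO.input, Mem.mat, put2]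
  have h0 : s.ix 0 = n := rfl
  have hd : Data D Q ε γ δ β s.mem := data_input X₀ y₀ S₀
  have h : (nuBlk gap).Sat s.mem s.ix fun μ => Data D Q ε γ δ β μ ∧ μ.mat 1 n n = X₀ ∧
      μ.vec 2 m = y₀ ∧ μ.mat 3 n n = S₀ ∧ μ 0 4 0 0 = nu X₀ S₀ := by
    refine nuBlk_sat h0 hn rfl fun μ f g v => ⟨hd.congr g (f 4 (by norm_num) (by norm_num))
      (f 7 (by norm_num) (by norm_num)), ?_, ?_, ?_, ?_⟩
    · exact Mem.mat_of_eq (f 1 (by norm_num) (by norm_num)) e1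
    · rw [Mem.vec_congr (f 2 (by norm_num) (by norm_num)), e2]
    · exact Mem.mat_of_eq (f 3 (by norm_num) (by norm_num)) e3
    · rw [v, ev_gap h0, e1, e3, nu]
  refine (h.tot (d := 4) hsz (by decide) (by decide) ⟨fun _ _ => rfl, fun _ _ => rfl⟩).mono
    (Nat.mul_le_mul_right _ (Nat.le_add_left _ _)) ?_
  rintro s' ⟨μ, hμ, hd', hx, hy, hz, hν⟩
  have vx : s'.mat 1 n n = X₀ := Mem.mat_of_eq (hμ.2 1 (by norm_num)) hx
  have vy : s'.vec 2 m = y₀ := by rw [← hy]; exact Mem.vec_congr (hμ.2 2 (by norm_num))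
  have vz : s'.mat 3 n n = S₀ := Mem.mat_of_eq (hμ.2 3 (by norm_num)) hz
  have vν : s'.mem 0 4 0 0 = nu X₀ S₀ := by rw [hμ.2 0 (by norm_num), hν]
  refine ⟨⟨vx, vy, vz⟩, ⟨hμ.1 0 (by norm_num), hμ.1 1 (by norm_num), hμ.1 2 (by norm_num), ?_, ?_,
    ?_⟩, vν⟩
  · exact hd'.congr (fun i _ => by rw [hμ.2 0 (by norm_num)]) (hμ.2 4 (by norm_num))
      (hμ.2 7 (by norm_num))
  · rw [vν, vx, vz]
  · rw [vx, vy, vz]; exact hN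

end

end SDOProg

/-! ### The theorem for semidefinite optimization -/

theorem semidefinite_main :
    ∃ (init body : Cmd) (c : ℕ), ∀ γ δ β ν₀ : ℝ,
      0 < γ → γ < 1 → 0 < δ → δ < 1 → 0 < β → β < 1 → ∃ B : ℝ, 0 < B ∧
      ∀ (n m p : ℕ) (D : SDO n m) (Q : Matrix (SIdx n) (Fin p) ℝ) (ε : ℝ)
        (X₀ : Matrix (Fin n) (Fin n) ℝ) (y₀ : Fin m → ℝ) (S₀ : Matrix (Fin n) (Fin n) ℝ),
        0 < n → Admissible n γ δ β → IsNullBasis D.As Q → 0 < ε →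
        D.Neighborhood γ X₀ y₀ S₀ → nu X₀ S₀ ≤ ν₀ →
        ∃ (T K : ℕ) (st : ℕ → State) (q : ℕ → Polynomial ℝ),
          Exec (ipm init body) (D.input Q ε γ δ β X₀ y₀ S₀) T (st K) ∧
          Run init body (D.input Q ε γ δ β X₀ y₀ S₀) K st ∧
          (st 0).mat 1 n n = X₀ ∧ (st 0).vec 2 m = y₀ ∧ (st 0).mat 3 n n = S₀ ∧
          (∀ k ≤ K, (st k).scalar 0 = ε ∧
            (st k).scalar 4 = nu ((st k).mat 1 n n) ((st k).mat 3 n n) ∧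
            D.Neighborhood γ ((st k).mat 1 n n) ((st k).vec 2 m) ((st k).mat 3 n n)) ∧
          (∀ k < K, D.InexactStep Q (centering n δ) β (q k)
            ((st k).mat 1 n n) ((st k).vec 2 m) ((st k).mat 3 n n)
            ((st (k + 1)).mat 1 n n) ((st (k + 1)).vec 2 m) ((st (k + 1)).mat 3 n n)) ∧
          D.EpsOptimal ε ((st K).mat 1 n n) ((st K).vec 2 m) ((st K).mat 3 n n) ∧
          ∀ κ : ℝ, 1 ≤ κ →
            (∀ k < K, condNumber (D.ntMatrix Q ((st k).mat 1 n n) ((st k).mat 3 n n)) ≤ κ) →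
            (T : ℝ) ≤ B * (n : ℝ) ^ (9 / 2 : ℝ) * κ * polylog c κ ε ∧
            ∀ k < K, ((q k).natDegree : ℝ) ≤ B * κ * polylog c κ ε := by
  -- The number of Newton steps for the scaling is part of the cost constant, since its tolerance
  -- depends only on `γ, δ, β`; the remaining factor per inner pass is `n⁴`.
  refine ⟨SDOProg.init, SDOProg.body, 1, fun γ δ β ν₀ hγ hγ1 hδ hδ1 hβ hβ1 =>
    ⟨boundConst (δ / 2) ν₀ (cgFactor (tol γ δ β / 2)) (SDOProg.cost (tol γ δ β ^ 2 / 100)),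
      boundConst_pos (half_pos hδ) (cgFactor_nonneg _) (Nat.cast_nonneg _), ?_⟩⟩
  intro n m p D Q ε X₀ y₀ S₀ hn hadm hQ hε hN hν₀
  have hp := Params.of_admissible hn hγ hγ1 hδ hδ1 hβ hadm
  have hsn := hp.one_le_sqrt
  have hd0 : 0 < δ / 2 / Real.sqrt n := by positivity
  have hd1 : δ / 2 / Real.sqrt n ≤ 1 := by
    rw [div_le_one (by linarith)]; linarith
  obtain ⟨T, K, st, q, h1, h2, h3, h4, h5, h6, h7, h8⟩ := ipm_run
    (fun s => s.mat 1 n n = X₀ ∧ s.vec 2 m = y₀ ∧ s.mat 3 n n = S₀)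
    (SDOProg.Good D Q ε γ δ β)
    (fun q s s' => D.InexactStep Q (centering n δ) β q (s.mat 1 n n) (s.vec 2 m) (s.mat 3 n n)
          (s'.mat 1 n n) (s'.vec 2 m) (s'.mat 3 n n))
    (fun s => condNumber (D.ntMatrix Q (s.mat 1 n n) (s.mat 3 n n)))
    (ρ := 1 - δ / 2 / Real.sqrt n) (ν₀ := ν₀) (C₁ := cgFactor (tol γ δ β / 2))
    (C₂ := SDOProg.cost (tol γ δ β ^ 2 / 100) * n ^ 4)
    hε (by linarith) (by linarith) (fun s hs => hs.data.ε)
    ((SDOProg.init_tot (ε := ε) (δ := δ) (β := β) hQ hn hN _).mono le_rfl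
      fun s hs => ⟨hs.1, hs.2.1, hs.2.2.trans_le hν₀⟩)
    (fun s hs _ => SDOProg.body_tot hp hβ hβ1 hQ hs)
  refine ⟨T, K, st, q, h1, h2, h3.1, h3.2.1, h3.2.2, fun k hk => ?_, h5, ?_, ?_⟩
  · exact ⟨(h4 k hk).data.ε, (h4 k hk).gap, (h4 k hk).nbhd⟩
  · have hg := h4 K le_rfl
    refine ⟨hg.nbhd.1, hg.nbhd.2.1.posSemidef, hg.nbhd.2.2.1.posSemidef, ?_⟩
    rw [← hg.gap]
    exact h6
  · intro κ hκ hle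
    obtain ⟨h9, h10⟩ := h8 κ hκ hle
    push_cast at h9
    obtain ⟨h11, h12⟩ := complexity_bound (e := 4) hn (half_pos hδ) (by linarith) hε
      (cgFactor_nonneg _) (Nat.cast_nonneg (SDOProg.cost (tol γ δ β ^ 2 / 100))) hκ h7 h9
    refine ⟨?_, fun k hk => (h10 k hk).trans h12⟩
    have : (9 / 2 : ℝ) = ((4 : ℕ) : ℝ) + 1 / 2 := by norm_num
    rw [this]
    exact h11

end IFIPM

end

theorem mainTheorem6 :
    -- semidefinite optimization
    (∃ (init body : IFIPM.Cmd) (c : ℕ), ∀ γ δ β ν₀ : ℝ,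
      0 < γ → γ < 1 → 0 < δ → δ < 1 → 0 < β → β < 1 → ∃ B : ℝ, 0 < B ∧
      ∀ (n m p : ℕ) (D : IFIPM.SDO n m) (Q : Matrix (IFIPM.SIdx n) (Fin p) ℝ) (ε : ℝ)
        (X₀ : Matrix (Fin n) (Fin n) ℝ) (y₀ : Fin m → ℝ) (S₀ : Matrix (Fin n) (Fin n) ℝ),
        0 < n → IFIPM.Admissible n γ δ β → IFIPM.IsNullBasis D.As Q → 0 < ε →
        D.Neighborhood γ X₀ y₀ S₀ → IFIPM.nu X₀ S₀ ≤ ν₀ →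
        ∃ (T K : ℕ) (st : ℕ → IFIPM.State) (q : ℕ → Polynomial ℝ),
          IFIPM.Exec (IFIPM.ipm init body) (D.input Q ε γ δ β X₀ y₀ S₀) T (st K) ∧
          IFIPM.Run init body (D.input Q ε γ δ β X₀ y₀ S₀) K st ∧
          (st 0).mat 1 n n = X₀ ∧ (st 0).vec 2 m = y₀ ∧ (st 0).mat 3 n n = S₀ ∧
          (∀ k ≤ K, (st k).scalar 0 = ε ∧
            (st k).scalar 4 = IFIPM.nu ((st k).mat 1 n n) ((st k).mat 3 n n) ∧
            D.Neighborhood γ ((st k).mat 1 n n) ((st k).vec 2 m) ((st k).mat 3 n n)) ∧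
          (∀ k < K, D.InexactStep Q (IFIPM.centering n δ) β (q k)
            ((st k).mat 1 n n) ((st k).vec 2 m) ((st k).mat 3 n n)
            ((st (k + 1)).mat 1 n n) ((st (k + 1)).vec 2 m) ((st (k + 1)).mat 3 n n)) ∧
          D.EpsOptimal ε ((st K).mat 1 n n) ((st K).vec 2 m) ((st K).mat 3 n n) ∧
          ∀ κ : ℝ, 1 ≤ κ →
            (∀ k < K, IFIPM.condNumber (D.ntMatrix Q ((st k).mat 1 n n) ((st k).mat 3 n n)) ≤ κ) →
            (T : ℝ) ≤ B * (n : ℝ) ^ (9 / 2 : ℝ) * κ * IFIPM.polylog c κ ε ∧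
            ∀ k < K, ((q k).natDegree : ℝ) ≤ B * κ * IFIPM.polylog c κ ε) ∧
    -- linear optimization
    (∃ (init body : IFIPM.Cmd) (c : ℕ), ∀ γ δ β ν₀ : ℝ,
      0 < γ → γ < 1 → 0 < δ → δ < 1 → 0 < β → β < 1 → ∃ B : ℝ, 0 < B ∧
      ∀ (n m p : ℕ) (L : IFIPM.LO n m) (Q : Matrix (Fin n) (Fin p) ℝ) (ε : ℝ)
        (x₀ : Fin n → ℝ) (y₀ : Fin m → ℝ) (s₀ : Fin n → ℝ),
        0 < n → IFIPM.Admissible n γ δ β → IFIPM.IsNullBasis L.A Q → 0 < ε →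
        L.Neighborhood γ x₀ y₀ s₀ → IFIPM.nuLO x₀ s₀ ≤ ν₀ →
        ∃ (T K : ℕ) (st : ℕ → IFIPM.State) (q : ℕ → Polynomial ℝ),
          IFIPM.Exec (IFIPM.ipm init body) (L.input Q ε γ δ β x₀ y₀ s₀) T (st K) ∧
          IFIPM.Run init body (L.input Q ε γ δ β x₀ y₀ s₀) K st ∧
          (st 0).vec 1 n = x₀ ∧ (st 0).vec 2 m = y₀ ∧ (st 0).vec 3 n = s₀ ∧
          (∀ k ≤ K, (st k).scalar 0 = ε ∧
            (st k).scalar 4 = IFIPM.nuLO ((st k).vec 1 n) ((st k).vec 3 n) ∧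
            L.Neighborhood γ ((st k).vec 1 n) ((st k).vec 2 m) ((st k).vec 3 n)) ∧
          (∀ k < K, L.InexactStep Q (IFIPM.centering n δ) β (q k)
            ((st k).vec 1 n) ((st k).vec 2 m) ((st k).vec 3 n)
            ((st (k + 1)).vec 1 n) ((st (k + 1)).vec 2 m) ((st (k + 1)).vec 3 n)) ∧
          L.EpsOptimal ε ((st K).vec 1 n) ((st K).vec 2 m) ((st K).vec 3 n) ∧
          ∀ κ : ℝ, 1 ≤ κ →
            (∀ k < K, IFIPM.condNumber
              (L.newtonMatrix Q ((st k).vec 1 n) ((st k).vec 3 n)) ≤ κ) →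
            (T : ℝ) ≤ B * (n : ℝ) ^ (5 / 2 : ℝ) * κ * IFIPM.polylog c κ ε ∧
            ∀ k < K, ((q k).natDegree : ℝ) ≤ B * κ * IFIPM.polylog c κ ε) := by
  exact ⟨IFIPM.semidefinite_main, IFIPM.linear_main⟩
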